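/- Let $k$ be a field of characteristic zero and $A=\bigoplus_{n\le 0}A_n$ a non-positively graded, graded-commutative $k$-algebra. Modules are $\mathbb Z$-graded $A$-modules; $M$ is *flat* if $-\otimes_A M$ is exact on graded $A$-modules; $F$ is *finite* if it has a finite homogeneous $A$-basis, and then $F^*=\underline{\mathrm{Hom}}_A(F,A)$. If $M=\varinjlim_\alpha M_\alpha$ is a directed colimit of finite modules, $M^*=(M_\alpha^*)_\alpha$ is the dual pro-finite module and $\widehat{\mathrm{Sym}}_A(M^*)$ is the pro-algebra $\big(\mathrm{Sym}_A(M_\alpha^*)/\mathrm{Sym}_A^{>m}(M_\alpha^*)\big)_{(\alpha,m)}$. For a morphism $f:M\to N$ (of degree $0$), a *multiderivation over $f$ of weight $l\ge 0$* is a pair $(X,\sigma_X)$ of a degree $1$ $k$-linear map $X:\mathrm{Sym}_k^{l+1}(M)\to N$ and a degree $1$ graded $A$-linear map (the anchor) $\sigma_X:\mathrm{Sym}_A^l(M)\to \mathrm{Der}(A)$ such that, for homogeneous arguments, $$X(m_1\odot\dots\odot m_l\odot a m_{l+1})=\sigma_X(m_1\odot\dots\odot m_l)(a)\,f(m_{l+1})+(-1)^{|a|(1+\sum_{i\le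 l}|m_i|)}a\,X(m_1\odot\dots\odot m_{l+1}).$$ Let $\mathrm{mDer}_f(M,N)$ be the set of families $\mathbb X=(\mathbb X_l)_{l\ge 0}$ of multiderivations over $f$, one of each weight. Let $\mathrm{Der}^{\ge 0}_{f^*}(\widehat{\mathrm{Sym}}_AN^*,\widehat{\mathrm{Sym}}_AM^*)$ be the set of morphisms $d$ of pro-vector spaces which at each index $(\alpha,m)$ are represented by a degree $1$ derivation $\mathrm{Sym}_A(N_\beta^*)/\mathrm{Sym}_A^{>n}(N_\beta^*)\to\mathrm{Sym}_A(M_\alpha^*)/\mathrm{Sym}_A^{>m}(M_\alpha^*)$, not lowering weights, over the algebra map induced by the transpose of a component $M_\alpha\to N_\beta$ of $f$, where $n\ge m$. For $f:L\to M$, $g:M\to N$, $\mathbb X\in\mathrm{mDer}_f(L,M)$, $\mathbb Y\in\mathrm{mDer}_g(M,N)$, with anchors $\sigma_{X_j}$, $\sigma_{Y_i}$, write $\mathbb Y\circ\mathbb X=0$ if for every $w\ge0$ both $$\sum_{i+j=w}\ \sum_{\pi\in \mathrm{Sh}(j+1,i)}\pm\, Y_i\big(X_j(m_{\pi(1)}\odot\dots\odot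 m_{\pi(j+1)})\odot f m_{\pi(j+2)}\odot\dots\odot f m_{\pi(w+1)}\big)$$ and $$\sum_{i+j=w}\Big(\sum_{\pi\in \mathrm{Sh}(j+1,i-1)}\pm\,\sigma_{Y_i}\big(X_j(m_{\pi(1)}\odot\dots\odot m_{\pi(j+1)})\odot f m_{\pi(j+2)}\odot\dots\odot f m_{\pi(w)}\big)+\sum_{\pi\in \mathrm{Sh}(i,j)}\pm(-1)^{|m_{\pi(1)}|+\dots+|m_{\pi(i)}|}\sigma_{Y_i}(f m_{\pi(1)}\odot\dots\odot f m_{\pi(i)})\,\sigma_{X_j}(m_{\pi(i+1)}\odot\dots\odot m_{\pi(w)})\Big)$$ vanish identically, where $\mathrm{Sh}(p,q)$ is the set of $(p,q)$-unshuffles (empty for $q<0$) and $\pm$ is the Koszul sign of $\pi$. A multiderivation $\mathbb X$ over an identity *squares to zero* if $\mathbb X\circ\mathbb X=0$. **Theorem.** Let $M,N$ be flat graded $A$-modules and $f:M\to N$ a morphism. Then $M$ and $N$ are directed colimits of finite modules, and for all such presentations: 1. There is a bijection $$\mathrm{mDer}_f(M,N)\cong \mathrm{Der}^{\ge 0}_{f^*}(\widehat{\mathrm{Sym}}_AN^*,\widehat{\mathrm{Sym}}_AM^*),$$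 under which $\mathbb X=(X_l,\sigma_l)_l$ corresponds to $d$ exactly when, at each $(\alpha,m)$ and for a suitable representative of $d$ as above, for homogeneous $x_i\in M_\alpha$, $a\in A$, $\omega\in N_\beta^*$ (with $l\le m$ in the first formula and $l+1\le m$ in the second), $$(da)(x_1\odot\dots\odot x_l)=(-1)^{|a|\sum_i|x_i|}\sigma_l(x_1\odot\dots\odot x_l)(a),$$ $$(d\omega)(x_1\odot\dots\odot x_{l+1})=\sum_{i}(-1)^{|\omega|\sum_{t\ne i}|x_t|+|x_i|\sum_{t>i}|x_t|}\sigma_l(x_1\odot\dots\widehat{x_i}\dots\odot x_{l+1})(\omega(f x_i))-(-1)^{|\omega|}\omega(y),$$ where the left-hand sides are the evaluations of the weight $l$, respectively $l+1$, components, $fx_i\in N_\beta$ is the image under the component of $f$, the $x$'s are identified with their images in $M$ inside $\sigma_l$ and $X_l$, and $y\in N_\beta$ is some representative of $X_l(x_1\odot\dots\odot x_{l+1})\in N$. 2. A multiderivation over $\mathrm{id}_M$ squares to zero if and only if the corresponding derivation $d$ satisfies $d\circ d=0$. 3. More generally, let $g:N\to P$ be a morphism to another flat module, with any presentation of $P$,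 and let $\mathbb X\in\mathrm{mDer}_f(M,N)$, $\mathbb Y\in\mathrm{mDer}_g(N,P)$, with corresponding derivations $d_{\mathbb X}$, $d_{\mathbb Y}$, satisfy $g\circ\mathbb X=\mathbb Y\circ f$ (including anchors). Then $\mathbb Y\circ\mathbb X=0$ if and only if $d_{\mathbb X}\circ d_{\mathbb Y}=0$. -/

import Mathlib

universe u

open scoped TensorProduct DirectSum

noncomputable section

namespace SHLR

/-! ### Graded modules over a graded-commutative algebra -/

/-- Graded commutativity: `a b = (-1)^{|a||b|} b a` for homogeneous `a`, `b`. -/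
class IsGradedComm {k A : Type u} [Field k] [Ring A] [Algebra k A]
    (𝒜 : ℤ → Submodule k A) : Prop where
  comm : ∀ {i j : ℤ} {a b : A}, a ∈ 𝒜 i → b ∈ 𝒜 j → a * b = (i * j).negOnePow • (b * a)

/-- The grading is concentrated in non-positive degrees. -/
def IsNonpositivelyGraded {k A : Type u} [Field k] [Ring A] [Algebra k A]
    (𝒜 : ℤ → Submodule k A) : Prop :=
  ∀ n : ℤ, 0 < n → 𝒜 n = ⊥

/-- A `ℤ`-graded (left) module over the graded algebra `(A, 𝒜)`, with internal grading `gr`. -/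
structure GMod {k A : Type u} [Field k] [Ring A] [Algebra k A] (𝒜 : ℤ → Submodule k A) where
  carrier : Type u
  [instAddCommGroup : AddCommGroup carrier]
  [instModuleBase : Module k carrier]
  [instModule : Module A carrier]
  [instTower : IsScalarTower k A carrier]
  gr : ℤ → Submodule k carrier
  isInternal : DirectSum.IsInternal gr
  smul_mem : ∀ {i j : ℤ} {a : A} {x : carrier}, a ∈ 𝒜 i → x ∈ gr j → a • x ∈ gr (i + j)

attribute [instance] GMod.instAddCommGroup GMod.instModuleBase GMod.instModule GMod.instTower

variable {k A : Type u} [Field k] [Ring A] [Algebra k A] {𝒜 : ℤ → Submodule k A}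

instance : CoeSort (GMod 𝒜) (Type u) := ⟨GMod.carrier⟩

/-- Morphisms of graded `A`-modules: `A`-linear maps preserving degrees. -/
structure GHom (M N : GMod 𝒜) where
  toLin : M →ₗ[A] N
  map_mem : ∀ {n : ℤ} {x : M}, x ∈ M.gr n → toLin x ∈ N.gr n

instance (M N : GMod 𝒜) : CoeFun (GHom M N) (fun _ => M → N) := ⟨fun f => f.toLin⟩

/-- The underlying `k`-linear map. -/
def GHom.lin {M N : GMod 𝒜} (f : GHom M N) : M →ₗ[k] N := f.toLin.restrictScalars k

/-- The identity morphism. -/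
def GHom.id (M : GMod 𝒜) : GHom M M := ⟨LinearMap.id, fun h => h⟩

/-- Composition `g ∘ f`. -/
def GHom.comp {L M N : GMod 𝒜} (g : GHom M N) (f : GHom L M) : GHom L N :=
  ⟨g.toLin ∘ₗ f.toLin, fun h => g.map_mem (f.map_mem h)⟩

/-! ### Flatness -/

/-- The relations `(-1)^{|a||l|} (a l) ⊗ m = l ⊗ (a m)`; left modules over a graded-commutative
algebra are right modules through `l a = (-1)^{|a||l|} a l`. -/
def tensorRel (L M : GMod 𝒜) : Submodule k (L ⊗[k] M) :=
  Submodule.span k {t | ∃ (i j : ℤ) (a : A) (l : L) (m : M), a ∈ 𝒜 i ∧ l ∈ L.gr j ∧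
    t = (i * j).negOnePow • ((a • l) ⊗ₜ[k] m) - l ⊗ₜ[k] (a • m)}

/-- The (underlying vector space of the) graded tensor product `L ⊗_A M`. -/
abbrev GTensor (L M : GMod 𝒜) : Type u := (L ⊗[k] M) ⧸ tensorRel L M

lemma tensorRel_le {L L' : GMod 𝒜} (u : GHom L L') (M : GMod 𝒜) :
    tensorRel L M ≤ (tensorRel L' M).comap (LinearMap.rTensor M u.lin) := by
  refine Submodule.span_le.2 ?_
  rintro _ ⟨i, j, a, l, m, ha, hl, rfl⟩
  refine Submodule.subset_span ⟨i, j, a, u l, m, ha, u.map_mem hl, ?_⟩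
  simp [GHom.lin, Units.smul_def]

/-- The map `u ⊗_A M : L ⊗_A M → L' ⊗_A M`. -/
def tensorMap {L L' : GMod 𝒜} (u : GHom L L') (M : GMod 𝒜) : GTensor L M →ₗ[k] GTensor L' M :=
  Submodule.mapQ _ _ (LinearMap.rTensor M u.lin) (tensorRel_le u M)

/-- `M` is flat: the functor `- ⊗_A M` on graded `A`-modules is exact. -/
def GMod.Flat (M : GMod 𝒜) : Prop :=
  ∀ (L L' L'' : GMod 𝒜) (u : GHom L L') (v : GHom L' L''),
    Function.Exact u v → Function.Exact (tensorMap u M) (tensorMap v M)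

/-! ### Finite modules and presentations as directed colimits -/

/-- Free finite graded modules `A ⊗_k V` with `V` of finite total dimension: there is a finite
`A`-basis of homogeneous elements. -/
def GMod.IsFinite (F : GMod 𝒜) : Prop :=
  ∃ (n : ℕ) (b : Module.Basis (Fin n) A F) (e : Fin n → ℤ), ∀ i, b i ∈ F.gr (e i)

/-- A presentation of `M` as the colimit of a directed system of finite graded modules
(an ind-finite module with colimit `M`). Dualizing the system termwise gives the pro-finite
module `M^*`. -/
structure Presentation (M : GMod 𝒜) where
  ι : Type u
  [instPreorder : Preorder ι]
  [instDirected : IsDirectedOrder ι]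
  [instNonempty : Nonempty ι]
  F : ι → GMod 𝒜
  finite : ∀ i, (F i).IsFinite
  t : ∀ {i j : ι}, i ≤ j → GHom (F i) (F j)
  t_refl : ∀ (i : ι) (x : F i), t (le_refl i) x = x
  t_comp : ∀ {i j l : ι} (hij : i ≤ j) (hjl : j ≤ l) (x : F i),
    t hjl (t hij x) = t (hij.trans hjl) x
  incl : ∀ i, GHom (F i) M
  incl_t : ∀ {i j : ι} (h : i ≤ j) (x : F i), incl j (t h x) = incl i x
  incl_surj : ∀ m : M, ∃ i, ∃ x : F i, incl i x = m
  incl_eq_zero : ∀ (i : ι) (x : F i), incl i x = 0 → ∃ (j : ι) (h : i ≤ j), t h x = 0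

attribute [instance] Presentation.instPreorder Presentation.instDirected
  Presentation.instNonempty

/-! ### Duals -/

/-- Degree `n` elements of the internal `Hom_A(F, A)`: degree `n` maps `φ` with
`φ(a x) = (-1)^{n|a|} a φ(x)`. -/
def homDeg (F : GMod 𝒜) (n : ℤ) : Submodule k (F →ₗ[k] A) where
  carrier := {φ | (∀ (i : ℤ) (x : F), x ∈ F.gr i → φ x ∈ 𝒜 (n + i)) ∧
    ∀ (j : ℤ) (a : A) (x : F), a ∈ 𝒜 j → φ (a • x) = (n * j).negOnePow • (a * φ x)}
  zero_mem' := by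
    refine ⟨fun i x _ => by simp, fun j a x _ => by simp⟩
  add_mem' := by
    rintro φ ψ ⟨h1, h2⟩ ⟨h3, h4⟩
    refine ⟨fun i x hx => add_mem (h1 i x hx) (h3 i x hx), fun j a x ha => ?_⟩
    simp [h2 j a x ha, h4 j a x ha, mul_add]
  smul_mem' := by
    rintro c φ ⟨h1, h2⟩
    refine ⟨fun i x hx => Submodule.smul_mem _ c (h1 i x hx), fun j a x ha => ?_⟩
    simp only [LinearMap.smul_apply, h2 j a x ha, mul_smul_comm]
    rw [smul_comm]

lemma ext_homogeneous {F : GMod 𝒜} {φ ψ : F →ₗ[k] A}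
    (h : ∀ (i : ℤ) (x : F), x ∈ F.gr i → φ x = ψ x) : φ = ψ := by
  refine LinearMap.ext fun x => ?_
  have hx : x ∈ (⨆ i, F.gr i) := by
    rw [F.isInternal.submodule_iSup_eq_top]; trivial
  induction hx using Submodule.iSup_induction' with
  | zero => simp
  | add x y _ _ h1 h2 => rw [map_add, map_add, h1, h2]
  | mem n x hx => exact h n x hx

lemma comp_homDeg {F G : GMod 𝒜} (h : GHom F G) {n : ℤ} {φ : G →ₗ[k] A}
    (hφ : φ ∈ homDeg G n) : φ ∘ₗ h.lin ∈ homDeg F n := by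
  refine ⟨fun i x hx => hφ.1 i _ (h.map_mem hx), fun j a x ha => ?_⟩
  have := hφ.2 j a (h x) ha
  simpa [GHom.lin] using this

lemma comp_iSup_homDeg {F G : GMod 𝒜} (h : GHom F G) {φ : G →ₗ[k] A}
    (hφ : φ ∈ (⨆ n, homDeg G n : Submodule k (G →ₗ[k] A))) :
    φ ∘ₗ h.lin ∈ (⨆ n, homDeg F n : Submodule k (F →ₗ[k] A)) := by
  induction hφ using Submodule.iSup_induction' with
  | zero => simp
  | add φ ψ _ _ h1 h2 => rw [LinearMap.add_comp]; exact add_mem h1 h2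
  | mem n φ hφ => exact Submodule.mem_iSup_of_mem n (comp_homDeg h hφ)

section Dual

variable [GradedAlgebra 𝒜] [IsGradedComm 𝒜]

lemma smul_homDeg {F : GMod 𝒜} {i n : ℤ} {a : A} {φ : F →ₗ[k] A} (ha : a ∈ 𝒜 i)
    (hφ : φ ∈ homDeg F n) : a • φ ∈ homDeg F (i + n) := by
  refine ⟨fun j x hx => ?_, fun j b x hb => ?_⟩
  · rw [add_assoc]
    exact SetLike.mul_mem_graded ha (hφ.1 j x hx)
  · simp only [LinearMap.smul_apply, smul_eq_mul, hφ.2 j b x hb]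
    rw [mul_smul_comm, ← mul_assoc, IsGradedComm.comm ha hb, smul_mul_assoc, mul_assoc, smul_smul,
      ← Int.negOnePow_add]
    congr 2
    ring

/-- The underlying `A`-module of `F^* = Hom_A(F, A)`: finite sums of homogeneous elements, with
`(a φ)(x) = a φ(x)`. -/
def dualCarrier (F : GMod 𝒜) : Submodule A (F →ₗ[k] A) where
  carrier := (⨆ n, homDeg F n : Submodule k (F →ₗ[k] A))
  zero_mem' := zero_mem _
  add_mem' := add_mem
  smul_mem' := by
    intro a φ hφ
    induction hφ using Submodule.iSup_induction' with
    | zero => simp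
    | add φ ψ _ _ h1 h2 => rw [smul_add]; exact add_mem h1 h2
    | mem n φ hφ =>
      induction a using DirectSum.Decomposition.inductionOn 𝒜 with
      | zero => simp
      | homogeneous a => exact Submodule.mem_iSup_of_mem _ (smul_homDeg a.2 hφ)
      | add a b h1 h2 => rw [add_smul]; exact add_mem h1 h2

/-- The underlying type of `F^*`. -/
def DualType (F : GMod 𝒜) : Type u := dualCarrier F

namespace DualType

variable (F : GMod 𝒜)

instance : AddCommGroup (DualType F) := inferInstanceAs (AddCommGroup (dualCarrier F))
instance : Module A (DualType F) := inferInstanceAs (Module A (dualCarrier F))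
instance : Module k (DualType F) := inferInstanceAs (Module k (dualCarrier F))
instance : IsScalarTower k A (DualType F) := inferInstanceAs (IsScalarTower k A (dualCarrier F))

/-- An element of the dual, as a `k`-linear map. -/
def val : DualType F →ₗ[k] (F →ₗ[k] A) := (dualCarrier F).subtype.restrictScalars k

variable {F}

lemma val_injective : Function.Injective (val F) := Subtype.val_injective

lemma val_smul (a : A) (φ : DualType F) : val F (a • φ) = a • val F φ := rfl

lemma val_mem (φ : DualType F) : val F φ ∈ (⨆ n, homDeg F n : Submodule k (F →ₗ[k] A)) := φ.2

/-- Constructor. -/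
def mk (φ : F →ₗ[k] A) (h : φ ∈ (⨆ n, homDeg F n : Submodule k (F →ₗ[k] A))) : DualType F :=
  ⟨φ, h⟩

@[simp] lemma val_mk (φ : F →ₗ[k] A) (h) : val F (mk φ h) = φ := rfl

end DualType

/-- The degree `n` part of the dual. -/
def dualGr (F : GMod 𝒜) (n : ℤ) : Submodule k (DualType F) :=
  (homDeg F n).comap (DualType.val F)

lemma iSup_dualGr (F : GMod 𝒜) : (⨆ n, dualGr F n) = ⊤ := by
  rw [eq_top_iff]
  rintro φ -
  have key : (⨆ n, homDeg F n : Submodule k (F →ₗ[k] A)) ≤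
      (⨆ n, dualGr F n).map (DualType.val F) := by
    refine iSup_le fun n ψ hψ => ?_
    exact ⟨DualType.mk ψ (Submodule.mem_iSup_of_mem n hψ), Submodule.mem_iSup_of_mem n hψ, rfl⟩
  obtain ⟨ψ, hψ, h⟩ := key (DualType.val_mem φ)
  rwa [← DualType.val_injective h]

lemma dual_isInternal (F : GMod 𝒜) : DirectSum.IsInternal (dualGr F) := by
  refine DirectSum.isInternal_submodule_of_iSupIndep_of_iSup_eq_top ?_ (iSup_dualGr F)
  rw [iSupIndep_iff_finsetSum_eq_zero_imp_eq_zero]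
  intro s v h1 h2 n hn
  apply DualType.val_injective
  rw [map_zero]
  refine ext_homogeneous fun i x hx => ?_
  have h3 : ∑ j ∈ s, DualType.val F (v j) x = 0 := by
    have := congrArg (fun φ => DualType.val F φ x) h2
    simpa [map_sum, LinearMap.sum_apply] using this
  have h4 := congrArg (GradedRing.proj 𝒜 (n + i)) h3
  rw [map_sum, map_zero, Finset.sum_eq_single n] at h4
  · rw [GradedRing.proj_apply, DirectSum.decompose_of_mem_same _ ((h1 n hn).1 i x hx)] at h4
    simpa using h4
  · intro j hj hjn
    rw [GradedRing.proj_apply]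
    exact DirectSum.decompose_of_mem_ne _ ((h1 j hj).1 i x hx) (fun h => hjn (by lia))
  · exact fun h => absurd hn h

/-- The dual graded module `F^*`. -/
def GMod.dual (F : GMod 𝒜) : GMod 𝒜 where
  carrier := DualType F
  gr := dualGr F
  isInternal := dual_isInternal F
  smul_mem := fun {_ _ _ x} ha hx => smul_homDeg (φ := DualType.val F x) ha hx

/-- Evaluation of an element of the dual. -/
def evalDual {F : GMod 𝒜} (φ : F.dual) (x : F) : A := DualType.val F φ x

/-- The transpose `h^* : G^* → F^*`, `φ ↦ φ ∘ h`. -/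
def GHom.dual {F G : GMod 𝒜} (h : GHom F G) : GHom G.dual F.dual where
  toLin :=
    { toFun := fun φ => DualType.mk (DualType.val G φ ∘ₗ h.lin)
        (comp_iSup_homDeg h (DualType.val_mem (F := G) φ))
      map_add' := fun _ _ => rfl
      map_smul' := fun _ _ => rfl }
  map_mem := fun {_ φ} hφ => comp_homDeg (φ := DualType.val G φ) h hφ

lemma GHom.dual_eq_self {F : GMod 𝒜} (h : GHom F F) (hh : ∀ x, h x = x) (φ : F.dual) :
    h.dual φ = φ := by
  apply DualType.val_injective
  refine LinearMap.ext fun x => ?_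
  change DualType.val F φ (h x) = _
  rw [hh]

lemma GHom.dual_dual_eq {F G H : GMod 𝒜} (h : GHom F G) (h' : GHom G H) (h'' : GHom F H)
    (hh : ∀ x, h' (h x) = h'' x) (φ : H.dual) : h.dual (h'.dual φ) = h''.dual φ := by
  apply DualType.val_injective
  refine LinearMap.ext fun x => ?_
  change DualType.val H φ (h' (h x)) = DualType.val H φ (h'' x)
  rw [hh]

end Dual

/-! ### Graded symmetric algebras and their truncations -/

/-- The relations of `Sym_A V` on the generators `A ⊕ V`: the generators from `A` multiply as in
`A` and act on `V` as scalars, and homogeneous generators commute up to the Koszul sign. -/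
inductive SymRel (V : GMod 𝒜) : TensorAlgebra k (A × V) → TensorAlgebra k (A × V) → Prop
  | one : SymRel V (TensorAlgebra.ι k (1, 0)) 1
  | mul (a b : A) : SymRel V (TensorAlgebra.ι k (a, 0) * TensorAlgebra.ι k (b, 0))
      (TensorAlgebra.ι k (a * b, 0))
  | smul (a : A) (v : V) : SymRel V (TensorAlgebra.ι k (a, 0) * TensorAlgebra.ι k (0, v))
      (TensorAlgebra.ι k (0, a • v))
  | comm_coeff {i j : ℤ} {a : A} {v : V} (ha : a ∈ 𝒜 i) (hv : v ∈ V.gr j) :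
      SymRel V (TensorAlgebra.ι k (0, v) * TensorAlgebra.ι k (a, 0))
        ((i * j).negOnePow • (TensorAlgebra.ι k (a, 0) * TensorAlgebra.ι k (0, v)))
  | comm {i j : ℤ} {v w : V} (hv : v ∈ V.gr i) (hw : w ∈ V.gr j) :
      SymRel V (TensorAlgebra.ι k (0, v) * TensorAlgebra.ι k (0, w))
        ((i * j).negOnePow • (TensorAlgebra.ι k (0, w) * TensorAlgebra.ι k (0, v)))

/-- The free graded symmetric `A`-algebra `Sym_A V`. -/
def GSym (V : GMod 𝒜) : Type u := RingQuot (SymRel V)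

namespace GSym

instance (V : GMod 𝒜) : Ring (GSym V) := inferInstanceAs (Ring (RingQuot (SymRel V)))
instance (V : GMod 𝒜) : Algebra k (GSym V) := inferInstanceAs (Algebra k (RingQuot (SymRel V)))

/-- The projection from the tensor algebra. -/
def mk (V : GMod 𝒜) : TensorAlgebra k (A × V) →ₐ[k] GSym V := RingQuot.mkAlgHom k (SymRel V)

lemma mk_rel {V : GMod 𝒜} {x y : TensorAlgebra k (A × V)} (h : SymRel V x y) :
    mk V x = mk V y := RingQuot.mkAlgHom_rel k h

/-- The universal property of the quotient. -/
def lift {V : GMod 𝒜} {B : Type u} [Ring B] [Algebra k B] (φ : TensorAlgebra k (A × V) →ₐ[k] B)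
    (h : ∀ ⦃x y⦄, SymRel V x y → φ x = φ y) : GSym V →ₐ[k] B :=
  RingQuot.liftAlgHom k ⟨φ, h⟩

@[simp] lemma lift_mk {V : GMod 𝒜} {B : Type u} [Ring B] [Algebra k B]
    (φ : TensorAlgebra k (A × V) →ₐ[k] B) (h : ∀ ⦃x y⦄, SymRel V x y → φ x = φ y)
    (x : TensorAlgebra k (A × V)) : lift φ h (mk V x) = φ x :=
  RingQuot.liftAlgHom_mkAlgHom_apply k φ h x

/-- The inclusion of the coefficients `A → Sym_A V`. -/
def coeff (V : GMod 𝒜) : A →ₗ[k] GSym V :=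
  (mk V).toLinearMap ∘ₗ TensorAlgebra.ι k ∘ₗ LinearMap.inl k A V

/-- The inclusion of the generators `V → Sym_A V`. -/
def gen (V : GMod 𝒜) : V →ₗ[k] GSym V :=
  (mk V).toLinearMap ∘ₗ TensorAlgebra.ι k ∘ₗ LinearMap.inr k A V

/-- The monomial `a v₁ ⋯ vᵢ`. -/
def monomial (V : GMod 𝒜) {i : ℕ} (a : A) (v : Fin i → V) : GSym V :=
  coeff V a * (List.ofFn fun t => gen V (v t)).prod

/-- The weight `i` part `Sym^i_A V`. -/
def wt (V : GMod 𝒜) (i : ℕ) : Submodule k (GSym V) :=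
  Submodule.span k {s | ∃ (a : A) (v : Fin i → V), s = monomial V a v}

/-- The part of (cohomological) degree `p`. -/
def deg (V : GMod 𝒜) (p : ℤ) : Submodule k (GSym V) :=
  Submodule.span k {s | ∃ (i : ℕ) (c : ℤ) (e : Fin i → ℤ) (a : A) (v : Fin i → V),
    a ∈ 𝒜 c ∧ (∀ t, v t ∈ V.gr (e t)) ∧ c + ∑ t, e t = p ∧ s = monomial V a v}

variable {V W : GMod 𝒜}

lemma coeff_one : coeff V 1 = 1 := by
  simpa [coeff] using mk_rel (SymRel.one (V := V))

lemma coeff_mul (a b : A) : coeff V a * coeff V b = coeff V (a * b) := by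
  simpa [coeff] using mk_rel (SymRel.mul (V := V) a b)

lemma coeff_mul_gen (a : A) (v : V) : coeff V a * gen V v = gen V (a • v) := by
  simpa [coeff, gen] using mk_rel (SymRel.smul (V := V) a v)

lemma gen_mul_coeff {i j : ℤ} {a : A} {v : V} (ha : a ∈ 𝒜 i) (hv : v ∈ V.gr j) :
    gen V v * coeff V a = (i * j).negOnePow • (coeff V a * gen V v) := by
  simpa [coeff, gen, Units.smul_def] using mk_rel (SymRel.comm_coeff ha hv)

lemma gen_mul_gen {i j : ℤ} {v w : V} (hv : v ∈ V.gr i) (hw : w ∈ V.gr j) :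
    gen V v * gen V w = (i * j).negOnePow • (gen V w * gen V v) := by
  simpa [gen, Units.smul_def] using mk_rel (SymRel.comm hv hw)

/-- Algebra maps out of `Sym_A V` agree if they agree on coefficients and generators. -/
lemma hom_ext {B : Type u} [Ring B] [Algebra k B] {φ ψ : GSym V →ₐ[k] B}
    (h1 : ∀ a, φ (coeff V a) = ψ (coeff V a)) (h2 : ∀ v, φ (gen V v) = ψ (gen V v)) : φ = ψ := by
  apply RingQuot.ringQuot_ext'
  change φ.comp (mk V) = ψ.comp (mk V)
  ext x
  · simpa [coeff] using h1 x
  · simpa [gen] using h2 x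

/-- The map on generators inducing `Sym_A h`. -/
def preMap (h : GHom V W) : TensorAlgebra k (A × V) →ₐ[k] GSym W :=
  TensorAlgebra.lift k (LinearMap.coprod (coeff W) (gen W ∘ₗ h.lin))

lemma preMap_rel (h : GHom V W) ⦃x y : TensorAlgebra k (A × V)⦄ (hxy : SymRel V x y) :
    preMap h x = preMap h y := by
  induction hxy with
  | one => simp [preMap, coeff_one]
  | mul a b => simp [preMap, coeff_mul]
  | smul a v => simp [preMap, coeff_mul_gen, GHom.lin]
  | comm_coeff ha hv =>
    simpa [preMap, Units.smul_def, GHom.lin] using gen_mul_coeff ha (h.map_mem hv)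
  | comm hv hw =>
    simpa [preMap, Units.smul_def, GHom.lin] using gen_mul_gen (h.map_mem hv) (h.map_mem hw)

/-- The algebra map `Sym_A h : Sym_A V → Sym_A W`. -/
def map (h : GHom V W) : GSym V →ₐ[k] GSym W :=
  lift (preMap h) (preMap_rel h)

@[simp] lemma map_coeff (h : GHom V W) (a : A) : map h (coeff V a) = coeff W a := by
  simp [map, coeff, preMap]

@[simp] lemma map_gen (h : GHom V W) (v : V) : map h (gen V v) = gen W (h v) := by
  simp [map, gen, preMap, GHom.lin]

lemma map_monomial (h : GHom V W) {i : ℕ} (a : A) (v : Fin i → V) :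
    map h (monomial V a v) = monomial W a (fun t => h (v t)) := by
  simp [monomial, map_list_prod, List.map_ofFn, Function.comp_def]

lemma map_wt (h : GHom V W) {i : ℕ} {s : GSym V} (hs : s ∈ wt V i) : map h s ∈ wt W i := by
  have : wt V i ≤ (wt W i).comap (map h).toLinearMap := by
    refine Submodule.span_le.2 ?_
    rintro _ ⟨a, v, rfl⟩
    exact Submodule.subset_span ⟨a, fun t => h (v t), map_monomial h a v⟩
  exact this hs

end GSym

/-- The relations killing all weights `> n`. -/
def TruncRel (V : GMod 𝒜) (n : ℕ) (s t : GSym V) : Prop :=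
  t = 0 ∧ ∃ i, n < i ∧ s ∈ GSym.wt V i

/-- The nilpotent extension `Sym_A V / Sym_A^{>n} V` of `A`. -/
def TruncSym (V : GMod 𝒜) (n : ℕ) : Type u := RingQuot (TruncRel V n)

namespace TruncSym

instance (V : GMod 𝒜) (n : ℕ) : Ring (TruncSym V n) :=
  inferInstanceAs (Ring (RingQuot (TruncRel V n)))
instance (V : GMod 𝒜) (n : ℕ) : Algebra k (TruncSym V n) :=
  inferInstanceAs (Algebra k (RingQuot (TruncRel V n)))

/-- The projection `Sym_A V → Sym_A V / Sym_A^{>n} V`. -/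
def proj (V : GMod 𝒜) (n : ℕ) : GSym V →ₐ[k] TruncSym V n := RingQuot.mkAlgHom k (TruncRel V n)

/-- The image of a coefficient. -/
def coeff (V : GMod 𝒜) (n : ℕ) (a : A) : TruncSym V n := proj V n (GSym.coeff V a)

/-- The image of a generator. -/
def gen (V : GMod 𝒜) (n : ℕ) (v : V) : TruncSym V n := proj V n (GSym.gen V v)

/-- The image of a monomial. -/
def monomial (V : GMod 𝒜) (n : ℕ) {i : ℕ} (a : A) (v : Fin i → V) : TruncSym V n :=
  proj V n (GSym.monomial V a v)

/-- The weight `i` part. -/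
def wt (V : GMod 𝒜) (n i : ℕ) : Submodule k (TruncSym V n) :=
  (GSym.wt V i).map (proj V n).toLinearMap

/-- The degree `p` part. -/
def deg (V : GMod 𝒜) (n : ℕ) (p : ℤ) : Submodule k (TruncSym V n) :=
  (GSym.deg V p).map (proj V n).toLinearMap

lemma map_rel {V W : GMod 𝒜} (h : GHom V W) {n m : ℕ} (hmn : m ≤ n) ⦃s t : GSym V⦄
    (hst : TruncRel V n s t) :
    ((proj W m).comp (GSym.map h)) s = ((proj W m).comp (GSym.map h)) t := by
  obtain ⟨rfl, i, hi, hs⟩ := hst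
  have : proj W m (GSym.map h s) = proj W m 0 :=
    RingQuot.mkAlgHom_rel k (s := TruncRel W m)
      ⟨rfl, i, lt_of_le_of_lt hmn hi, GSym.map_wt h hs⟩
  simpa using this

/-- The map `Sym_A V / Sym_A^{>n} V → Sym_A W / Sym_A^{>m} W` induced by `h : V → W`, for
`m ≤ n`. -/
def map {V W : GMod 𝒜} (h : GHom V W) {n m : ℕ} (hmn : m ≤ n) : TruncSym V n →ₐ[k] TruncSym W m :=
  RingQuot.liftAlgHom k ⟨(proj W m).comp (GSym.map h), map_rel h hmn⟩

lemma map_proj {V W : GMod 𝒜} (h : GHom V W) {n m : ℕ} (hmn : m ≤ n) (s : GSym V) :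
    map h hmn (proj V n s) = proj W m (GSym.map h s) := by
  exact RingQuot.liftAlgHom_mkAlgHom_apply k _ _ s

lemma proj_surjective (V : GMod 𝒜) (n : ℕ) : Function.Surjective (proj V n) :=
  RingQuot.mkAlgHom_surjective k _

end TruncSym

/-! ### Pro-vector spaces -/

/-- An inverse system of `k`-vector spaces indexed by a nonempty directed set. -/
structure InvSys (k : Type u) [Field k] where
  ι : Type u
  [instPreorder : Preorder ι]
  [instDirected : IsDirectedOrder ι]
  [instNonempty : Nonempty ι]
  obj : ι → Type u
  [instAddCommGroup : ∀ i, AddCommGroup (obj i)]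
  [instModule : ∀ i, Module k (obj i)]
  p : ∀ {i j : ι}, i ≤ j → obj j →ₗ[k] obj i
  p_refl : ∀ (i : ι) (x : obj i), p (le_refl i) x = x
  p_comp : ∀ {i j l : ι} (hij : i ≤ j) (hjl : j ≤ l) (x : obj l),
    p hij (p hjl x) = p (hij.trans hjl) x

attribute [instance] InvSys.instPreorder InvSys.instDirected InvSys.instNonempty
  InvSys.instAddCommGroup InvSys.instModule

section Pro

open scoped Classical in
/-- `colim_a Hom_k(X_a, Z)`. -/
abbrev Germ (X : InvSys k) (Z : Type u) [AddCommGroup Z] [Module k Z] : Type u :=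
  Module.DirectLimit (fun a : X.ι => X.obj a →ₗ[k] Z)
    (fun _ _ h => LinearMap.lcomp k Z (X.p h))

namespace Germ

open scoped Classical in
/-- The class of a map `X_a → Z`. -/
def of (X : InvSys k) {Z : Type u} [AddCommGroup Z] [Module k Z] (a : X.ι) :
    (X.obj a →ₗ[k] Z) →ₗ[k] Germ X Z :=
  Module.DirectLimit.of k X.ι (fun a : X.ι => X.obj a →ₗ[k] Z)
    (fun _ _ h => LinearMap.lcomp k Z (X.p h)) a

lemma of_p {X : InvSys k} {Z : Type u} [AddCommGroup Z] [Module k Z] {a b : X.ι} (h : a ≤ b)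
    (φ : X.obj a →ₗ[k] Z) : of X b (φ ∘ₗ X.p h) = of X a φ := by
  classical
  exact Module.DirectLimit.of_f (f := fun _ _ h => LinearMap.lcomp k Z (X.p h)) (hij := h)

open scoped Classical in
/-- Composition with a map `Z → Z'`, linear in both arguments. -/
def post (X : InvSys k) {Z Z' : Type u} [AddCommGroup Z] [Module k Z] [AddCommGroup Z']
    [Module k Z'] (g : Z →ₗ[k] Z') : Germ X Z →ₗ[k] Germ X Z' :=
  Module.DirectLimit.lift k X.ι _ _
    (fun a => of X a ∘ₗ LinearMap.llcomp k (X.obj a) Z Z' g)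
    (fun _ _ h φ => of_p h (g ∘ₗ φ))

@[simp] lemma post_of {X : InvSys k} {Z Z' : Type u} [AddCommGroup Z] [Module k Z]
    [AddCommGroup Z'] [Module k Z'] (g : Z →ₗ[k] Z') (a : X.ι) (φ : X.obj a →ₗ[k] Z) :
    post X g (of X a φ) = of X a (g ∘ₗ φ) := by
  classical
  exact Module.DirectLimit.lift_of _ _ _

lemma exists_of {X : InvSys k} {Z : Type u} [AddCommGroup Z] [Module k Z] (x : Germ X Z) :
    ∃ (a : X.ι) (φ : X.obj a →ₗ[k] Z), of X a φ = x := by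
  classical
  exact Module.DirectLimit.exists_of x

lemma post_post {X : InvSys k} {Z Z' Z'' : Type u} [AddCommGroup Z] [Module k Z]
    [AddCommGroup Z'] [Module k Z'] [AddCommGroup Z''] [Module k Z''] (g' : Z' →ₗ[k] Z'')
    (g : Z →ₗ[k] Z') (x : Germ X Z) : post X g' (post X g x) = post X (g' ∘ₗ g) x := by
  obtain ⟨a, φ, rfl⟩ := exists_of x
  simp [LinearMap.comp_assoc]

end Germ

/-- Morphisms of pro-vector spaces: `lim_c colim_a Hom_k(X_a, Y_c)`. -/
structure ProHom (X Y : InvSys k) where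
  germ : ∀ c : Y.ι, Germ X (Y.obj c)
  compat : ∀ {c c' : Y.ι} (h : c ≤ c'), Germ.post X (Y.p h) (germ c') = germ c

namespace ProHom

open scoped Classical in
/-- Precomposition of a germ `Y ⇢ Z` with a morphism `X → Y` of pro-vector spaces. -/
def bind {X Y : InvSys k} (f : ProHom X Y) (Z : Type u) [AddCommGroup Z] [Module k Z] :
    Germ Y Z →ₗ[k] Germ X Z :=
  Module.DirectLimit.lift k Y.ι _ _
    (fun b =>
      { toFun := fun φ => Germ.post X φ (f.germ b)
        map_add' := fun φ ψ => by
          obtain ⟨a, θ, h⟩ := Germ.exists_of (f.germ b)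
          simp [← h, LinearMap.add_comp]
        map_smul' := fun c φ => by
          obtain ⟨a, θ, h⟩ := Germ.exists_of (f.germ b)
          simp [← h, LinearMap.smul_comp] })
    (fun b b' h φ => by
      have := Germ.post_post φ (Y.p h) (f.germ b')
      rw [f.compat h] at this
      exact this.symm)

lemma bind_of {X Y : InvSys k} (f : ProHom X Y) {Z : Type u} [AddCommGroup Z] [Module k Z]
    (b : Y.ι) (φ : Y.obj b →ₗ[k] Z) : f.bind Z (Germ.of Y b φ) = Germ.post X φ (f.germ b) := by
  classical
  exact Module.DirectLimit.lift_of _ _ _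

/-- The composite `g ∘ f` of morphisms of pro-vector spaces. -/
def comp {X Y Z : InvSys k} (g : ProHom Y Z) (f : ProHom X Y) : ProHom X Z where
  germ c := f.bind (Z.obj c) (g.germ c)
  compat {c c'} h := by
    rw [← g.compat h]
    obtain ⟨b, φ, hφ⟩ := Germ.exists_of (g.germ c')
    rw [← hφ, Germ.post_of, bind_of, bind_of, Germ.post_post]

instance (X Y : InvSys k) : Zero (ProHom X Y) := ⟨⟨fun _ => 0, fun _ => map_zero _⟩⟩

end ProHom

end Pro

/-! ### The completed symmetric algebra of the dual pro-finite module -/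

section Completed

variable [GradedAlgebra 𝒜] [IsGradedComm 𝒜]

/-- The pro-algebra `Sym^(M^*)`, for `M = colim_i F_i`: the inverse system of the
nilpotent extensions `Sym_A(F_i^*) / Sym_A^{>n}(F_i^*)` indexed by pairs `(i, n)`. -/
def Presentation.symSys {M : GMod 𝒜} (P : Presentation M) : InvSys k where
  ι := P.ι × ℕ
  instDirected := ⟨fun c c' => by
    obtain ⟨i, h1, h2⟩ := exists_ge_ge c.1 c'.1
    exact ⟨(i, max c.2 c'.2), ⟨h1, le_max_left _ _⟩, ⟨h2, le_max_right _ _⟩⟩⟩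
  obj := fun c => TruncSym (P.F c.1).dual c.2
  p := fun {c c'} h => (TruncSym.map (P.t (i := c.1) (j := c'.1) (And.left h)).dual
    (show c.2 ≤ c'.2 from And.right h)).toLinearMap
  p_refl := fun c x => by
    obtain ⟨s, rfl⟩ := TruncSym.proj_surjective _ _ x
    have : GSym.map (P.t (le_refl c.1)).dual = AlgHom.id k _ := by
      refine GSym.hom_ext (fun a => by simp) (fun v => ?_)
      rw [GSym.map_gen, GHom.dual_eq_self _ (P.t_refl c.1)]
      rfl
    simp [TruncSym.map_proj, this]
  p_comp := fun {c c' c''} h h' x => by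
    obtain ⟨s, rfl⟩ := TruncSym.proj_surjective _ _ x
    have h1 : c.1 ≤ c'.1 := And.left h
    have h1' : c'.1 ≤ c''.1 := And.left h'
    have : (GSym.map (P.t h1).dual).comp (GSym.map (P.t h1').dual) =
        GSym.map (P.t (h1.trans h1')).dual := by
      refine GSym.hom_ext (fun a => by simp) (fun v => ?_)
      rw [AlgHom.comp_apply, GSym.map_gen, GSym.map_gen, GSym.map_gen,
        GHom.dual_dual_eq _ _ _ (P.t_comp h1 h1')]
    have h2 := DFunLike.congr_fun this s
    simp only [AlgHom.comp_apply] at h2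
    simp [TruncSym.map_proj, h2]

/-- The index `(i, n)` of the system. -/
def Presentation.idx {M : GMod 𝒜} (P : Presentation M) (i : P.ι) (n : ℕ) : P.symSys.ι := (i, n)

end Completed

/-! ### Koszul signs, derivations, multiderivations -/

/-- The Koszul sign `ε` with `m_{π 0} ⊙ ⋯ ⊙ m_{π (n-1)} = ε • m_0 ⊙ ⋯ ⊙ m_{n-1}`, for `m_i` homogeneous of
degree `e i`. -/
def koszul {n : ℕ} (π : Equiv.Perm (Fin n)) (e : Fin n → ℤ) : ℤˣ :=
  ∏ s, ∏ t, if s < t ∧ π t < π s then (e (π s) * e (π t)).negOnePow else 1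

/-- `d` is a derivation of degree `n` over the algebra map `f`:
`d(x y) = d(x) f(y) + (-1)^{n|x|} f(x) d(y)`. -/
def IsDerOver {S T : Type u} [Ring S] [Algebra k S] [Ring T] [Algebra k T]
    (degS : ℤ → Submodule k S) (degT : ℤ → Submodule k T) (f : S →ₐ[k] T) (n : ℤ)
    (d : S →ₗ[k] T) : Prop :=
  (∀ (p : ℤ) (x : S), x ∈ degS p → d x ∈ degT (n + p)) ∧
    ∀ (p : ℤ) (x y : S), x ∈ degS p → d (x * y) = d x * f y + (n * p).negOnePow • (f x * d y)

/-- A multiderivation over `f` of weight `l`: a pair of a degree `1` graded symmetric `k`-multilinear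
map `X` (that is, a map of graded vector spaces `Sym_k^{l+1} M → N[-1]`, where `N[-1]` is graded
such that this means degree `1`) and an anchor, a degree `1` graded symmetric `A`-multilinear map
into the graded derivations of `A` (that is, a map of `A`-modules `Sym_A^l M → Der(A)[-1]`),
satisfying the Leibniz rule. -/
@[ext]
structure MultiDerW {M N : GMod 𝒜} (f : GHom M N) (l : ℕ) where
  X : MultilinearMap k (fun _ : Fin (l + 1) => M) N
  anchor : MultilinearMap k (fun _ : Fin l => M) (A →ₗ[k] A)
  X_mem : ∀ (e : Fin (l + 1) → ℤ) (m : Fin (l + 1) → M), (∀ t, m t ∈ M.gr (e t)) →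
    X m ∈ N.gr (1 + ∑ t, e t)
  X_symm : ∀ (e : Fin (l + 1) → ℤ) (m : Fin (l + 1) → M), (∀ t, m t ∈ M.gr (e t)) →
    ∀ π : Equiv.Perm (Fin (l + 1)), X (fun t => m (π t)) = koszul π e • X m
  anchor_der : ∀ (e : Fin l → ℤ) (m : Fin l → M), (∀ t, m t ∈ M.gr (e t)) →
    IsDerOver 𝒜 𝒜 (AlgHom.id k A) (1 + ∑ t, e t) (anchor m)
  anchor_symm : ∀ (e : Fin l → ℤ) (m : Fin l → M), (∀ t, m t ∈ M.gr (e t)) →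
    ∀ π : Equiv.Perm (Fin l), anchor (fun t => m (π t)) = koszul π e • anchor m
  anchor_smul : ∀ (e : Fin l → ℤ) (m : Fin l → M), (∀ t, m t ∈ M.gr (e t)) →
    ∀ (i : Fin l) (c : ℤ) (a : A), a ∈ 𝒜 c → ∀ b : A,
      anchor (Function.update m i (a • m i)) b =
        (c * (1 + ∑ t ∈ Finset.univ.filter (· < i), e t)).negOnePow • (a * anchor m b)
  leibniz : ∀ (e : Fin l → ℤ) (m : Fin l → M), (∀ t, m t ∈ M.gr (e t)) →
    ∀ (c : ℤ) (a : A), a ∈ 𝒜 c → ∀ x : M,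
      X (Fin.snoc (α := fun _ => M) m (a • x)) =
        anchor m a • f x +
          (c * (1 + ∑ t, e t)).negOnePow • (a • X (Fin.snoc (α := fun _ => M) m x))

/-- (Inhomogeneous) multiderivations over `f`: one of each weight `l ≥ 0`. -/
def MultiDer {M N : GMod 𝒜} (f : GHom M N) : Type u := ∀ l : ℕ, MultiDerW f l

/-! ### Composites of multiderivations -/

open scoped Classical in
/-- The `(p, q)`-unshuffles: permutations increasing on the first `p` and on the last `q`
positions. -/
def unshuffles (p q : ℕ) : Finset (Equiv.Perm (Fin (p + q))) :=
  Finset.univ.filter fun π =>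
    (∀ s t : Fin p, s < t → π (Fin.castAdd q s) < π (Fin.castAdd q t)) ∧
    ∀ s t : Fin q, s < t → π (Fin.natAdd p s) < π (Fin.natAdd p t)

section Composite

variable {L M N : GMod 𝒜} {f : GHom L M} {g : GHom M N}

/-- `∑ ± Y(X(m_{π 0} ⊙ ⋯ ⊙ m_{π j}) ⊙ f m_{π (j+1)} ⊙ ⋯ ⊙ f m_{π (j+i)})` over `π ∈ Sh(j+1, i)`, for `Y` of
weight `i` and `X` of weight `j`; only `m 0, …, m (i+j)` matter, and `e` lists their degrees. -/
def compX {i j : ℕ} (Y : MultiDerW g i) (X : MultiDerW f j) (e : ℕ → ℤ) (m : ℕ → L) : N :=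
  ∑ π ∈ unshuffles (j + 1) i, koszul π (fun t => e t) •
    Y.X (Fin.cons (α := fun _ => M) (X.X fun t => m (π (Fin.castAdd i t)))
      (fun t => f (m (π (Fin.natAdd (j + 1) t)))))

/-- `∑ ± σ_Y(X(m_{π 0} ⊙ ⋯ ⊙ m_{π j}) ⊙ f m_{π (j+1)} ⊙ ⋯ ⊙ f m_{π (j+i-1)})` over
`π ∈ Sh(j+1, i-1)`; it vanishes for `i = 0`. -/
def compAnchorX {j : ℕ} (X : MultiDerW f j) (e : ℕ → ℤ) (m : ℕ → L) :
    ∀ {i : ℕ}, MultiDerW g i → (A →ₗ[k] A)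
  | 0, _ => 0
  | i + 1, Y => ∑ π ∈ unshuffles (j + 1) i, koszul π (fun t => e t) •
      Y.anchor (Fin.cons (α := fun _ => M) (X.X fun t => m (π (Fin.castAdd i t)))
        (fun t => f (m (π (Fin.natAdd (j + 1) t)))))

/-- `∑ ± (-1)^{|m_{π 0}| + ⋯ + |m_{π (i-1)}|} σ_Y(f m_{π 0} ⊙ ⋯ ⊙ f m_{π (i-1)}) σ_X(m_{π i} ⊙ ⋯ ⊙ m_{π (i+j-1)})`
over `π ∈ Sh(i, j)`. -/
def compAnchors {i j : ℕ} (Y : MultiDerW g i) (X : MultiDerW f j) (e : ℕ → ℤ) (m : ℕ → L) :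
    A →ₗ[k] A :=
  ∑ π ∈ unshuffles i j, koszul π (fun t => e t) •
    (∑ t : Fin i, e (π (Fin.castAdd j t))).negOnePow •
      (Y.anchor (fun t => f (m (π (Fin.castAdd j t)))) ∘ₗ
        X.anchor (fun t => m (π (Fin.natAdd i t))))

/-- `𝕐 ∘ 𝕏 = 0`: in each total weight `w`, the sum over `i + j = w` of the composites
`𝕐_i ∘ 𝕏_j`, together with their anchors, vanishes. -/
def CompEqZero (Y : MultiDer g) (X : MultiDer f) : Prop :=
  ∀ (w : ℕ) (e : ℕ → ℤ) (m : ℕ → L), (∀ t, m t ∈ L.gr (e t)) →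
    ∑ ij ∈ Finset.HasAntidiagonal.antidiagonal w, compX (Y ij.1) (X ij.2) e m = 0 ∧
    ∑ ij ∈ Finset.HasAntidiagonal.antidiagonal w,
      (compAnchorX (X ij.2) e m (Y ij.1) + compAnchors (Y ij.1) (X ij.2) e m) = 0

/-- `g ∘ 𝕏 = 𝕐 ∘ f` as multiderivations over `g ∘ f`. -/
def Intertwined (Y : MultiDer g) (X : MultiDer f) : Prop :=
  ∀ l : ℕ, (∀ m : Fin (l + 1) → L, g ((X l).X m) = (Y l).X (fun t => f (m t))) ∧
    ∀ m : Fin l → L, (X l).anchor m = (Y l).anchor (fun t => f (m t))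

end Composite

/-- A multiderivation over the identity squares to zero. -/
def SquareZero {M : GMod 𝒜} (X : MultiDer (GHom.id M)) : Prop := CompEqZero X X

/-! ### Derivations of completed symmetric algebras -/

section Derivations

variable [GradedAlgebra 𝒜] [IsGradedComm 𝒜] {M N : GMod 𝒜}

/-- A representative, at the index `(α, m)` of the target, of a derivation
`Sym^(N^*) → Sym^(M^*)` over `f^*` of non-negative weight: a component `h : M_α → N_β` of `f` and a
degree `1` derivation `Sym(N_β^*)/Sym^{>n} → Sym(M_α^*)/Sym^{>m}` over `h^*` which does not
lower weights. -/
structure LocalDer (PM : Presentation M) (PN : Presentation N) (f : GHom M N)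
    (α : PM.ι) (m : ℕ) where
  β : PN.ι
  n : ℕ
  h : GHom (PM.F α) (PN.F β)
  incl_h : ∀ x, PN.incl β (h x) = f (PM.incl α x)
  le : m ≤ n
  d : TruncSym (PN.F β).dual n →ₗ[k] TruncSym (PM.F α).dual m
  isDer : IsDerOver (TruncSym.deg _ n) (TruncSym.deg _ m) (TruncSym.map h.dual le) 1 d
  nonneg : ∀ (i : ℕ) (s : TruncSym (PN.F β).dual n), s ∈ TruncSym.wt _ n i →
    d s ∈ ⨆ (j : ℕ) (_ : i ≤ j), TruncSym.wt (PM.F α).dual m j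

/-- The class of a representative in the colimit over `(β, n)`. -/
def LocalDer.germ {PM : Presentation M} {PN : Presentation N} {f : GHom M N} {α : PM.ι} {m : ℕ}
    (r : LocalDer PM PN f α m) : Germ PN.symSys (PM.symSys.obj (PM.idx α m)) :=
  Germ.of PN.symSys (PN.idx r.β r.n) r.d

/-- `Der^{≥0}_{f^*}(Sym^(N^*), Sym^(M^*))`, as a subset of the morphisms of pro-vector spaces. -/
@[ext]
structure NonnegDer (PM : Presentation M) (PN : Presentation N) (f : GHom M N) extends
    ProHom PN.symSys PM.symSys where
  isDer : ∀ (α : PM.ι) (m : ℕ), ∃ r : LocalDer PM PN f α m, r.germ = germ (PM.idx α m)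

/-! ### The duality between multiderivations and derivations -/

/-- `(φ_0 ⋯ φ_{j-1})(x_0 ⊙ ⋯ ⊙ x_{j-1})`: the sum over all permutations `π` of
`± φ_0(x_{π 0}) ⋯ φ_{j-1}(x_{π (j-1)})` with the Koszul sign of the rearrangement, for `φ_t` of degree `c t`
and `x_t` of degree `e t`. -/
def evalProd {F : GMod 𝒜} {j : ℕ} (c e : Fin j → ℤ) (φ : Fin j → F.dual) (x : Fin j → F) : A :=
  ∑ π : Equiv.Perm (Fin j),
    (koszul π e * ∏ s, ∏ t, if s < t then (c t * e (π s)).negOnePow else 1) •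
      (List.ofFn fun t => evalDual (φ t) (x (π t))).prod

/-- `Q` is evaluation of the weight `j` part at `x_0 ⊙ ⋯ ⊙ x_{j-1}`. As monomials in homogeneous
elements span, `Q` is unique. -/
structure IsEval {F : GMod 𝒜} (n : ℕ) {j : ℕ} (e : Fin j → ℤ) (x : Fin j → F)
    (Q : TruncSym F.dual n →ₗ[k] A) : Prop where
  same : ∀ (a : A) (c : Fin j → ℤ) (φ : Fin j → F.dual), (∀ t, φ t ∈ F.dual.gr (c t)) →
    Q (TruncSym.monomial F.dual n a φ) = a * evalProd c e φ x
  other : ∀ (i : ℕ) (a : A) (φ : Fin i → F.dual), i ≠ j → Q (TruncSym.monomial F.dual n a φ) = 0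

/-- The derivation `D` is dual to the multiderivation `𝕏 = (X, σ)`: at each index `(α, m)`, it has a
representative `d` such that, for homogeneous `x_t ∈ M_α`, `a ∈ A`, `ω ∈ N_β^*`,
`(d a)(x_0 ⊙ ⋯ ⊙ x_{l-1}) = (-1)^{|a| ∑ |x_t|} σ(x_0 ⊙ ⋯ ⊙ x_{l-1})(a)` and
`(d ω)(x_0 ⊙ ⋯ ⊙ x_l) = ∑_i ± σ(x_0 ⊙ ⋯ x̂_i ⋯ ⊙ x_l)(ω(f x_i)) - (-1)^{|ω|} ω(X(x_0 ⊙ ⋯ ⊙ x_l))`,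
where `X(x_0 ⊙ ⋯ ⊙ x_l) ∈ N` is represented by some `y ∈ N_β`. -/
def Dual (PM : Presentation M) (PN : Presentation N) (f : GHom M N) (X : MultiDer f)
    (D : NonnegDer PM PN f) : Prop :=
  ∀ (α : PM.ι) (m : ℕ), ∃ r : LocalDer PM PN f α m, r.germ = D.germ (PM.idx α m) ∧
    (∀ l : ℕ, l ≤ m → ∀ (e : Fin l → ℤ) (x : Fin l → PM.F α), (∀ t, x t ∈ (PM.F α).gr (e t)) →
      ∃ Q : TruncSym (PM.F α).dual m →ₗ[k] A, IsEval m e x Q ∧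
        ∀ (c : ℤ) (a : A), a ∈ 𝒜 c →
          Q (r.d (TruncSym.coeff _ r.n a)) =
            (c * ∑ t, e t).negOnePow • (X l).anchor (fun t => PM.incl α (x t)) a) ∧
    (∀ l : ℕ, l + 1 ≤ m → ∀ (e : Fin (l + 1) → ℤ) (x : Fin (l + 1) → PM.F α),
      (∀ t, x t ∈ (PM.F α).gr (e t)) →
      ∃ Q : TruncSym (PM.F α).dual m →ₗ[k] A, IsEval m e x Q ∧
        ∃ y : PN.F r.β, PN.incl r.β y = (X l).X (fun t => PM.incl α (x t)) ∧
          ∀ (c : ℤ) (ω : (PN.F r.β).dual), ω ∈ (PN.F r.β).dual.gr c →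
            Q (r.d (TruncSym.gen _ r.n ω)) =
              (∑ i : Fin (l + 1),
                (c * ∑ t : Fin l, e (i.succAbove t) +
                    e i * ∑ t ∈ Finset.univ.filter (i < ·), e t).negOnePow •
                  (X l).anchor (fun t => PM.incl α (x (i.succAbove t)))
                    (evalDual ω (r.h (x i)))) -
                c.negOnePow • evalDual ω y)

end Derivations

end SHLR

end

/-! Everything is first done for finite modules. Let h : F → G be a morphism of finite modules and d
a degree 1 derivation Sym(G^*) → Sym(F^*) over h^* that does not lower weights. Contraction by x in
F is a skew derivation of Sym(F^*), acting from the right, and the graded commutator P ↦ (dP)⌟x ∓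
d(P⌟hx) (`brStep`) is again a skew derivation over h^*. Iterating over x_1, …, x_l and then applying
the augmentation Sym(F^*) → A gives a skew derivation Sym(G^*) → A (`GDer.q`). Such a map amounts to
its restriction to A, which is the anchor σ_l(x) up to sign, and its restriction to G^*, which is ω
↦ ∓ω(X(x)) for a unique X(x) in G. Thus the multiderivation consists of the higher derived brackets
of d. Its graded symmetry holds because contractions commute up to sign (`brStep_brStep`), and its
Leibniz rule comes from contraction by a·x (`GDer.bra_leibniz`). Unwinding the commutators on A and
on generators yields the evaluation formulas of the statement (`GDer.q_coeff_eq`, `GDer.evF_gen`).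

Conversely, in characteristic zero Euler's formula shows that an element of Sym(F^*) is determined
modulo weights > m by its evaluations on words of length ≤ m in a basis (`HBasis.mem_fil_of_evW`),
and every graded symmetric function on words is realised (`HBasis.evW_elt`). So a multiderivation
whose values on words are lifted to G comes from a derivation (`GDer.exists_dual_words`), unique
modulo weights > m (`GDer.agree_of_words`).

For colimits, an index (α, m) involves finitely many words only: their values in N lift to some N_β,
and the finitely many relations needed hold after enlarging β (`exists_rep`, `Rep.exists_agree`). In
the other direction, a truncated representative lifts to the full symmetric algebras at the cost of
one weight (`LocalDer.exists_gder`), and the multiderivations obtained at finite level glue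
(`MultiDerW.exists_glue`).

For composites, the iterated commutators of d_X ∘ d_Y expand by the Leibniz rule into a sum over
unshuffles (`aug_brN_comp`). Evaluated on A this is the composite anchor; evaluated on a generator ω
it is -ω(composite bracket) plus two families of terms that are exchanged by swapping the blocks of
the unshuffle and cancel because g ∘ 𝕏 = 𝕐 ∘ f (`GDer.aug_comp_gen`). The same condition makes d_X ∘
d_Y a derivation modulo high weights (`GDer.Inter.skew`), so it vanishes as soon as it does on A and
on generators. Squares are the case where all maps are identities.

That flat modules are directed colimits of finite ones is Lazard's theorem in graded form, proved
through the equational criterion (`GMod.Flat.exists_eq_sum`). -/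

set_option linter.unusedSectionVars false

/-! ### Signs, parity twists and the graded structure of symmetric algebras. -/

noncomputable section
namespace SHLR

/-! ### Signs -/

section Signs

variable (k : Type u) [Field k]

/-- The sign `(-1)^n` as a scalar. -/
def sg (n : ℤ) : k := ((n.negOnePow : ℤ) : k)

variable {k}

lemma sg_add (m n : ℤ) : sg k (m + n) = sg k m * sg k n := by
  simp [sg, Int.negOnePow_add]

lemma sg_zero : sg k 0 = 1 := by simp [sg]

/-- All sign identities below are reduced by this to ring identities between exponents modulo 2. -/
lemma sg_congr {m n : ℤ} (h : (m : ZMod 2) = n) : sg k m = sg k n := by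
  have h1 : m.negOnePow = n.negOnePow := by
    rw [Int.negOnePow_eq_iff, ← ZMod.intCast_eq_zero_iff_even, Int.cast_sub, h, sub_self]
  rw [sg, sg, h1]

lemma sg_mul_self (n : ℤ) : sg k n * sg k n = 1 := by
  rw [← sg_add, ← sg_zero]
  exact sg_congr (by push_cast; grind)

lemma sg_one : sg k 1 = -1 := by simp [sg]

lemma sg_ne_zero (n : ℤ) : sg k n ≠ 0 := fun h => by simpa [h] using sg_mul_self (k := k) n

variable {X : Type u} [AddCommGroup X] [Module k X]

lemma units_smul (c : ℤˣ) (x : X) : c • x = ((c : ℤ) : k) • x := by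
  rw [Units.smul_def, Int.cast_smul_eq_zsmul]

lemma negOnePow_smul (n : ℤ) (x : X) : n.negOnePow • x = sg k n • x := units_smul _ x

lemma sg_smul_smul (n : ℤ) (x : X) : sg k n • sg k n • x = x := by
  rw [smul_smul, sg_mul_self, one_smul]

end Signs

/-! ### Internal gradings and parity twists -/

section Twist

variable {k : Type u} [Field k] {X : Type u} [AddCommGroup X] [Module k X]
  {gr : ℤ → Submodule k X}

lemma lin_ext_of_iSup {Y : Type u} [AddCommGroup Y] [Module k Y] (h : (⨆ p, gr p) = ⊤)
    {f g : X →ₗ[k] Y} (hfg : ∀ (p : ℤ) (x : X), x ∈ gr p → f x = g x) : f = g := by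
  refine LinearMap.ext fun x => ?_
  have hx : x ∈ (⨆ i, gr i) := by rw [h]; trivial
  induction hx using Submodule.iSup_induction' with
  | zero => simp
  | add x y _ _ h1 h2 => rw [map_add, map_add, h1, h2]
  | mem n x hx => exact hfg n x hx

lemma bijective_coeLinearMap (h : DirectSum.IsInternal gr) :
    Function.Bijective (DirectSum.coeLinearMap gr) := h

/-- The inclusion-of-components decomposition attached to an internal grading. -/
def decomp (h : DirectSum.IsInternal gr) : X ≃ₗ[k] ⨁ i, gr i :=
  (LinearEquiv.ofBijective (DirectSum.coeLinearMap gr) (bijective_coeLinearMap h)).symm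

lemma decomp_of_mem (h : DirectSum.IsInternal gr) {p : ℤ} {x : X} (hx : x ∈ gr p) :
    decomp h x = DirectSum.lof k ℤ (fun i => gr i) p ⟨x, hx⟩ := by
  rw [decomp, LinearEquiv.symm_apply_eq, LinearEquiv.ofBijective_apply, DirectSum.coeLinearMap_lof]

/-- The projection onto the degree `p` component. -/
def component (h : DirectSum.IsInternal gr) (p : ℤ) : X →ₗ[k] X :=
  (gr p).subtype ∘ₗ DirectSum.component k ℤ (fun i => gr i) p ∘ₗ (decomp h).toLinearMap

lemma component_mem (h : DirectSum.IsInternal gr) (p : ℤ) (x : X) : component h p x ∈ gr p :=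
  Subtype.coe_prop _

lemma component_of_mem (h : DirectSum.IsInternal gr) {p : ℤ} {x : X} (hx : x ∈ gr p) (q : ℤ) :
    component h q x = if q = p then x else 0 := by
  simp only [component, LinearMap.comp_apply, LinearEquiv.coe_coe, decomp_of_mem h hx]
  split_ifs with hq
  · subst hq
    rw [DirectSum.component.lof_self]; rfl
  · rw [DirectSum.component.of, dif_neg (fun h' => hq h'.symm)]; rfl

/-- The quantification over all larger finite sets lets two elements be expanded over a common set
of degrees. -/
lemma exists_sum_component (h : DirectSum.IsInternal gr) (x : X) :
    ∃ s : Finset ℤ, ∀ t, s ⊆ t → ∑ p ∈ t, component h p x = x := by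
  have hx : x ∈ (⨆ i, gr i) := by rw [h.submodule_iSup_eq_top]; trivial
  classical
  induction hx using Submodule.iSup_induction' with
  | zero => exact ⟨∅, fun t _ => by simp⟩
  | add x y _ _ h1 h2 =>
    obtain ⟨s, hs⟩ := h1
    obtain ⟨t, ht⟩ := h2
    refine ⟨s ∪ t, fun w hw => ?_⟩
    simp only [map_add, Finset.sum_add_distrib]
    rw [hs w (Finset.union_subset_left hw), ht w (Finset.union_subset_right hw)]
  | mem n x hx =>
    refine ⟨{n}, fun w hw => ?_⟩
    simp only [component_of_mem h hx]
    simp [hw (Finset.mem_singleton_self n)]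

/-- The parity twist `x ↦ (-1)^{n|x|} x`. -/
def twist (h : DirectSum.IsInternal gr) (n : ℤ) : X →ₗ[k] X :=
  DirectSum.toModule k ℤ X (fun p => sg k (n * p) • (gr p).subtype) ∘ₗ (decomp h).toLinearMap

lemma twist_of_mem (h : DirectSum.IsInternal gr) (n : ℤ) {p : ℤ} {x : X} (hx : x ∈ gr p) :
    twist h n x = sg k (n * p) • x := by
  simp [twist, decomp_of_mem h hx]

end Twist

variable {k A : Type u} [Field k] [Ring A] [Algebra k A] {𝒜 : ℤ → Submodule k A}

/-- The parity twist of a graded module. -/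
def GMod.tw (M : GMod 𝒜) (n : ℤ) : M →ₗ[k] M := twist M.isInternal n

lemma GMod.tw_of_mem (M : GMod 𝒜) (n : ℤ) {p : ℤ} {x : M} (hx : x ∈ M.gr p) :
    M.tw n x = sg k (n * p) • x := twist_of_mem _ n hx

lemma GMod.lin_ext {M : GMod 𝒜} {Y : Type u} [AddCommGroup Y] [Module k Y] {f g : M →ₗ[k] Y}
    (h : ∀ (p : ℤ) (x : M), x ∈ M.gr p → f x = g x) : f = g :=
  lin_ext_of_iSup M.isInternal.submodule_iSup_eq_top h

variable [GradedAlgebra 𝒜]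

lemma isInternal_alg (𝒜 : ℤ → Submodule k A) [GradedAlgebra 𝒜] : DirectSum.IsInternal 𝒜 :=
  DirectSum.Decomposition.isInternal 𝒜

lemma lin_ext_alg (𝒜 : ℤ → Submodule k A) [GradedAlgebra 𝒜] {Y : Type u} [AddCommGroup Y]
    [Module k Y] {f g : A →ₗ[k] Y} (h : ∀ (p : ℤ) (x : A), x ∈ 𝒜 p → f x = g x) : f = g :=
  lin_ext_of_iSup (isInternal_alg 𝒜).submodule_iSup_eq_top h

/-- The parity twist of the base algebra, as an algebra map. -/
def twA (𝒜 : ℤ → Submodule k A) [GradedAlgebra 𝒜] (n : ℤ) : A →ₐ[k] A :=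
  AlgHom.ofLinearMap (twist (isInternal_alg 𝒜) n)
    (by rw [twist_of_mem _ n (SetLike.one_mem_graded 𝒜), mul_zero, sg_zero, one_smul])
    (by
      have : (LinearMap.mul k A).compr₂ (twist (isInternal_alg 𝒜) n) =
          (LinearMap.mul k A).compl₁₂ (twist (isInternal_alg 𝒜) n) (twist (isInternal_alg 𝒜) n) := by
        refine lin_ext_alg 𝒜 fun p x hx => lin_ext_alg 𝒜 fun q y hy => ?_
        simp only [LinearMap.compr₂_apply, LinearMap.compl₁₂_apply, LinearMap.mul_apply_apply]
        rw [twist_of_mem _ n hx, twist_of_mem _ n hy, twist_of_mem _ n (SetLike.mul_mem_graded hx hy),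
          smul_mul_smul_comm, ← sg_add, mul_add]
      intro x y
      exact LinearMap.congr_fun₂ this x y)

lemma twA_of_mem (n : ℤ) {p : ℤ} {x : A} (hx : x ∈ 𝒜 p) : twA 𝒜 n x = sg k (n * p) • x :=
  twist_of_mem _ n hx

lemma twA_mem (n : ℤ) {p : ℤ} {x : A} (hx : x ∈ 𝒜 p) : twA 𝒜 n x ∈ 𝒜 p := by
  rw [twA_of_mem n hx]; exact Submodule.smul_mem _ _ hx

lemma twA_twA (m n : ℤ) (a : A) : twA 𝒜 m (twA 𝒜 n a) = twA 𝒜 (m + n) a := by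
  have : (twA 𝒜 m).toLinearMap ∘ₗ (twA 𝒜 n).toLinearMap = (twA 𝒜 (m + n)).toLinearMap :=
    lin_ext_alg 𝒜 fun p x hx => by
      simp [twA_of_mem n hx, twA_of_mem m hx, twA_of_mem (m + n) hx, smul_smul, ← sg_add, add_mul,
        add_comm]
  exact LinearMap.congr_fun this a

lemma twA_congr {m n : ℤ} (h : (m : ZMod 2) = n) (a : A) : twA 𝒜 m a = twA 𝒜 n a := by
  have : (twA 𝒜 m).toLinearMap = (twA 𝒜 n).toLinearMap :=
    lin_ext_alg 𝒜 fun p x hx => by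
      simp only [AlgHom.toLinearMap_apply, twA_of_mem m hx, twA_of_mem n hx]
      rw [sg_congr (n := n * p) (by push_cast; rw [h])]
  exact LinearMap.congr_fun this a

lemma twA_zero (a : A) : twA 𝒜 0 a = a := by
  have : (twA 𝒜 0).toLinearMap = LinearMap.id :=
    lin_ext_alg 𝒜 fun p x hx => by simp [twA_of_mem 0 hx, sg_zero]
  exact LinearMap.congr_fun this a

lemma twA_self (n : ℤ) (a : A) : twA 𝒜 n (twA 𝒜 n a) = a := by
  rw [twA_twA, twA_congr (n := 0) (by push_cast; grind), twA_zero]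

lemma GMod.tw_smul (M : GMod 𝒜) (n : ℤ) (a : A) (x : M) :
    M.tw n (a • x) = twA 𝒜 n a • M.tw n x := by
  have key : ∀ x : M, (M.tw n) ∘ₗ (LinearMap.toSpanSingleton A M x).restrictScalars k =
      (LinearMap.toSpanSingleton A M (M.tw n x)).restrictScalars k ∘ₗ (twA 𝒜 n).toLinearMap := by
    intro x
    refine lin_ext_alg 𝒜 fun p a ha => ?_
    have : (M.tw n) ∘ₗ Algebra.lsmul k k M a = Algebra.lsmul k k M (twA 𝒜 n a) ∘ₗ M.tw n := by
      refine GMod.lin_ext fun q x hx => ?_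
      simp [M.tw_of_mem n (M.smul_mem ha hx), M.tw_of_mem n hx, twA_of_mem n ha, mul_add, sg_add,
        smul_smul, smul_comm a]
    simpa using LinearMap.congr_fun this x
  simpa using LinearMap.congr_fun (key x) a

/-! ### The structure of graded symmetric algebras -/

namespace GSym

variable {V W : GMod 𝒜}

lemma induct {C : GSym V → Prop} (hc : ∀ a, C (coeff V a)) (hg : ∀ v, C (gen V v))
    (hm : ∀ x y, C x → C y → C (x * y)) (ha : ∀ x y, C x → C y → C (x + y)) (x : GSym V) : C x := by
  obtain ⟨t, rfl⟩ : ∃ t, mk V t = x := RingQuot.mkAlgHom_surjective k _ x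
  induction t using TensorAlgebra.induction with
  | algebraMap r =>
    have : mk V (algebraMap k _ r) = coeff V (r • 1) := by
      rw [AlgHom.commutes, map_smul, coeff_one, Algebra.algebraMap_eq_smul_one]
    rw [this]; exact hc _
  | ι x =>
    obtain ⟨a, v⟩ := x
    have : mk V (TensorAlgebra.ι k (a, v)) = coeff V a + gen V v := by
      simp [coeff, gen, ← map_add]
    rw [this]; exact ha _ _ (hc _) (hg _)
  | mul x y h1 h2 => rw [map_mul]; exact hm _ _ h1 h2
  | add x y h1 h2 => rw [map_add]; exact ha _ _ h1 h2

lemma monomial_snoc {i : ℕ} (a : A) (v : Fin i → V) (w : V) :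
    monomial V a (Fin.snoc (α := fun _ => V) v w) = monomial V a v * gen V w := by
  rw [monomial, List.ofFn_succ', List.concat_eq_append, List.prod_append, ← mul_assoc]
  simp [monomial]

lemma monomial_zero (a : A) (v : Fin 0 → V) : monomial V a v = coeff V a := by
  simp [monomial]

lemma monomial_succ {i : ℕ} (a : A) (v : Fin (i + 1) → V) :
    monomial V a v = monomial V a (Fin.init v) * gen V (v (Fin.last i)) := by
  rw [← monomial_snoc, Fin.snoc_init_self]

lemma coeff_mem_deg {p : ℤ} {a : A} (ha : a ∈ 𝒜 p) : coeff V a ∈ deg V p :=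
  Submodule.subset_span ⟨0, p, Fin.elim0, a, Fin.elim0, ha, fun t => t.elim0, by simp,
    (monomial_zero a _).symm⟩

lemma deg_mul_gen {p q : ℤ} {P : GSym V} {v : V} (hP : P ∈ deg V p) (hv : v ∈ V.gr q) :
    P * gen V v ∈ deg V (p + q) := by
  induction hP using Submodule.span_induction with
  | zero => simp
  | add x y _ _ h1 h2 => rw [add_mul]; exact add_mem h1 h2
  | smul c x _ h => rw [smul_mul_assoc]; exact Submodule.smul_mem _ c h
  | mem x hx =>
    obtain ⟨i, c, e, a, w, ha, hw, hs, rfl⟩ := hx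
    refine Submodule.subset_span ⟨i + 1, c, Fin.snoc (α := fun _ => ℤ) e q, a,
      Fin.snoc (α := fun _ => V) w v, ha, fun t => ?_, ?_, (monomial_snoc a w v).symm⟩
    · induction t using Fin.lastCases with
      | last => simpa using hv
      | cast t => simpa using hw t
    · rw [Fin.sum_snoc]; lia

/-- Monomials grow by right multiplication with a homogeneous generator. A property tracking the
degree therefore needs checking only on coefficients, under such a multiplication and under linear
combinations. -/
lemma deg_induction {C : ℤ → GSym V → Prop} (hc : ∀ p a, a ∈ 𝒜 p → C p (coeff V a))
    (hg : ∀ p q P v, P ∈ deg V p → C p P → v ∈ V.gr q → C (p + q) (P * gen V v))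
    (h0 : ∀ p, C p 0) (ha : ∀ p P Q, C p P → C p Q → C p (P + Q))
    (hs : ∀ p (r : k) P, C p P → C p (r • P)) {p : ℤ} {P : GSym V} (hP : P ∈ deg V p) : C p P := by
  induction hP using Submodule.span_induction with
  | zero => exact h0 p
  | add x y _ _ h1 h2 => exact ha _ _ _ h1 h2
  | smul c x _ h => exact hs _ _ _ h
  | mem x hx =>
    obtain ⟨i, c, e, a, w, haa, hw, rfl, rfl⟩ := hx
    induction i with
    | zero => rw [monomial_zero]; simpa using hc c a haa
    | succ i ih =>
      rw [monomial_succ, Fin.sum_univ_castSucc, ← add_assoc]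
      exact hg _ _ _ _ (Submodule.subset_span ⟨i, c, _, a, _, haa, fun t => hw t.castSucc, rfl, rfl⟩)
        (ih (fun t => e t.castSucc) (Fin.init w) (fun t => hw t.castSucc)) (hw _)

lemma gen_mem_deg {p : ℤ} {v : V} (hv : v ∈ V.gr p) : gen V v ∈ deg V p := by
  have := deg_mul_gen (coeff_mem_deg (V := V) (SetLike.one_mem_graded 𝒜)) hv
  rwa [coeff_one, one_mul, zero_add] at this

lemma deg_mul_coeff {p q : ℤ} {P : GSym V} {a : A} (hP : P ∈ deg V p) (ha : a ∈ 𝒜 q) :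
    P * coeff V a ∈ deg V (p + q) := by
  refine deg_induction (C := fun p P => P * coeff V a ∈ deg V (p + q)) (fun p b hb => ?_)
    (fun p r P v _ hP hv => ?_) (fun p => by simp) (fun p P Q h1 h2 => by
      rw [add_mul]; exact add_mem h1 h2)
    (fun p c P h => by rw [smul_mul_assoc]; exact Submodule.smul_mem _ c h) hP
  · rw [coeff_mul]; exact coeff_mem_deg (SetLike.mul_mem_graded hb ha)
  · rw [mul_assoc, gen_mul_coeff ha hv, negOnePow_smul (k := k), mul_smul_comm, ← mul_assoc,
      add_right_comm]
    exact Submodule.smul_mem _ _ (deg_mul_gen hP hv)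

lemma deg_mul {p q : ℤ} {P Q : GSym V} (hP : P ∈ deg V p) (hQ : Q ∈ deg V q) :
    P * Q ∈ deg V (p + q) := by
  refine deg_induction (C := fun q Q => P * Q ∈ deg V (p + q)) (fun q b hb => deg_mul_coeff hP hb)
    (fun p r Q v _ hQ hv => ?_) (fun p => by simp) (fun p P Q h1 h2 => by
      rw [mul_add]; exact add_mem h1 h2)
    (fun p c P h => by rw [mul_smul_comm]; exact Submodule.smul_mem _ c h) hQ
  rw [← mul_assoc, ← add_assoc]
  exact deg_mul_gen hQ hv

lemma iSup_deg (V : GMod 𝒜) : (⨆ p, deg V p) = ⊤ := by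
  rw [eq_top_iff]
  rintro x -
  induction x using induct with
  | hc a =>
    induction a using DirectSum.Decomposition.inductionOn 𝒜 with
    | zero => simp
    | homogeneous a => exact Submodule.mem_iSup_of_mem _ (coeff_mem_deg a.2)
    | add a b h1 h2 => rw [map_add]; exact add_mem h1 h2
  | hg v =>
    have hx : v ∈ (⨆ i, V.gr i) := by rw [V.isInternal.submodule_iSup_eq_top]; trivial
    induction hx using Submodule.iSup_induction' with
    | zero => simp
    | add x y _ _ h1 h2 => rw [map_add]; exact add_mem h1 h2
    | mem n x hx => exact Submodule.mem_iSup_of_mem _ (gen_mem_deg hx)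
  | ha x y h1 h2 => exact add_mem h1 h2
  | hm x y h1 h2 =>
    induction h1 using Submodule.iSup_induction' with
    | zero => simp
    | add x z _ _ h1 h2 => rw [add_mul]; exact add_mem h1 h2
    | mem n x hx =>
      induction h2 using Submodule.iSup_induction' with
      | zero => simp
      | add x z _ _ h1 h2 => rw [mul_add]; exact add_mem h1 h2
      | mem m y hy => exact Submodule.mem_iSup_of_mem _ (deg_mul hx hy)

lemma lin_ext {Y : Type u} [AddCommGroup Y] [Module k Y] {f g : GSym V →ₗ[k] Y}
    (h : ∀ (p : ℤ) (x : GSym V), x ∈ deg V p → f x = g x) : f = g :=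
  lin_ext_of_iSup (iSup_deg V) h

lemma coeff_mul_comm_of_mem [IsGradedComm 𝒜] {p q : ℤ} {a : A} {P : GSym V} (ha : a ∈ 𝒜 p)
    (hP : P ∈ deg V q) : coeff V a * P = sg k (p * q) • (P * coeff V a) := by
  refine deg_induction (C := fun q P => coeff V a * P = sg k (p * q) • (P * coeff V a))
    (fun q b hb => ?_) (fun q r P v _ hP hv => ?_) (fun p => by simp) (fun p P Q h1 h2 => by
      rw [mul_add, add_mul, smul_add, h1, h2])
    (fun p c P h => by rw [smul_mul_assoc, mul_smul_comm, h, smul_comm]) hP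
  · rw [coeff_mul, coeff_mul, IsGradedComm.comm ha hb, negOnePow_smul (k := k), map_smul]
  · rw [mul_assoc P, gen_mul_coeff ha hv, negOnePow_smul (k := k), ← mul_assoc, hP, mul_smul_comm,
      smul_smul, mul_add, smul_mul_assoc, mul_assoc, sg_add, mul_assoc, sg_mul_self, mul_one]

/-- The defining relations commute only generators and coefficients. An induction on `Q` commutes a
single generator past `Q`, and an induction on `P` does the rest. -/
lemma gcomm [IsGradedComm 𝒜] {p q : ℤ} {P Q : GSym V} (hP : P ∈ deg V p)
    (hQ : Q ∈ deg V q) : P * Q = sg k (p * q) • (Q * P) := by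
  refine deg_induction (C := fun p P => P * Q = sg k (p * q) • (Q * P))
    (fun q b hb => coeff_mul_comm_of_mem hb hQ) (fun p r P v hP' hP hv => ?_) (fun p => by simp)
    (fun p P Q h1 h2 => by rw [mul_add, add_mul, smul_add, h1, h2])
    (fun p c P h => by rw [smul_mul_assoc, mul_smul_comm, h, smul_comm]) hP
  have key : gen V v * Q = sg k (r * q) • (Q * gen V v) := by
    refine deg_induction (C := fun q Q => gen V v * Q = sg k (r * q) • (Q * gen V v))
      (fun q b hb => ?_) (fun p s P w _ hP hw => ?_) (fun p => by simp) (fun p P Q h1 h2 => by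
        rw [mul_add, add_mul, smul_add, h1, h2])
      (fun p c P h => by rw [smul_mul_assoc, mul_smul_comm, h, smul_comm]) hQ
    · rw [gen_mul_coeff hb hv, negOnePow_smul (k := k), mul_comm q]
    · rw [← mul_assoc, hP, smul_mul_assoc, mul_assoc, gen_mul_gen hv hw, negOnePow_smul (k := k),
        mul_smul_comm, smul_smul, ← sg_add, mul_add, mul_assoc]
  rw [mul_assoc, key, mul_smul_comm, ← mul_assoc, hP, smul_mul_assoc, smul_smul, ← sg_add, mul_assoc,
    add_mul, add_comm (r * q)]

/-- The parity twist, as an algebra map. -/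
def tw (V : GMod 𝒜) (n : ℤ) : GSym V →ₐ[k] GSym V :=
  lift (TensorAlgebra.lift k (LinearMap.coprod (coeff V ∘ₗ (twA 𝒜 n).toLinearMap)
      (gen V ∘ₗ V.tw n))) (by
    intro x y hxy
    induction hxy with
    | one => simp [coeff_one]
    | mul a b => simp [coeff_mul]
    | smul a v => simp [coeff_mul_gen, GMod.tw_smul]
    | comm_coeff ha hv =>
      simp only [map_mul, Units.smul_def, map_zsmul, TensorAlgebra.lift_ι_apply,
        LinearMap.coprod_apply, LinearMap.comp_apply, map_zero, add_zero, zero_add,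
        AlgHom.toLinearMap_apply, twA_of_mem n ha, V.tw_of_mem n hv, map_smul, smul_mul_smul_comm,
        gen_mul_coeff ha hv]
      rw [smul_comm, mul_comm (sg k _) (sg k _)]
    | comm hv hw =>
      simp only [map_mul, Units.smul_def, map_zsmul, TensorAlgebra.lift_ι_apply,
        LinearMap.coprod_apply, LinearMap.comp_apply, map_zero, add_zero, zero_add,
        V.tw_of_mem n hv, V.tw_of_mem n hw, map_smul, smul_mul_smul_comm,
        gen_mul_gen hv hw]
      rw [smul_comm, mul_comm (sg k _) (sg k _)])

@[simp] lemma tw_coeff (n : ℤ) (a : A) : tw V n (coeff V a) = coeff V (twA 𝒜 n a) := by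
  simp [tw, coeff]

@[simp] lemma tw_gen (n : ℤ) (v : V) : tw V n (gen V v) = gen V (V.tw n v) := by
  simp [tw, gen]

lemma tw_of_mem (n : ℤ) {p : ℤ} {P : GSym V} (hP : P ∈ deg V p) : tw V n P = sg k (n * p) • P := by
  refine deg_induction (C := fun p P => tw V n P = sg k (n * p) • P)
    (fun p a ha => by rw [tw_coeff, twA_of_mem n ha, map_smul])
    (fun p q P v _ hP hv => ?_) (fun p => by simp) (fun p P Q h1 h2 => by
      rw [map_add, h1, h2, smul_add]) (fun p c P h => by rw [map_smul, h, smul_comm]) hP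
  rw [map_mul, hP, tw_gen, V.tw_of_mem n hv, map_smul, smul_mul_smul_comm, ← sg_add, mul_add]

lemma tw_tw (m n : ℤ) (P : GSym V) : tw V m (tw V n P) = tw V (m + n) P := by
  have : (tw V m).toLinearMap ∘ₗ (tw V n).toLinearMap = (tw V (m + n)).toLinearMap :=
    lin_ext fun p x hx => by
      simp [tw_of_mem n hx, tw_of_mem m hx, tw_of_mem (m + n) hx, smul_smul, ← sg_add, add_mul,
        add_comm]
  exact LinearMap.congr_fun this P

lemma tw_congr {m n : ℤ} (h : (m : ZMod 2) = n) (P : GSym V) : tw V m P = tw V n P := by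
  have : (tw V m).toLinearMap = (tw V n).toLinearMap :=
    lin_ext fun p x hx => by
      simp only [AlgHom.toLinearMap_apply, tw_of_mem m hx, tw_of_mem n hx]
      rw [sg_congr (n := n * p) (by push_cast; rw [h])]
  exact LinearMap.congr_fun this P

lemma tw_zero (P : GSym V) : tw V 0 P = P := by
  have : (tw V 0).toLinearMap = LinearMap.id :=
    lin_ext fun p x hx => by simp [tw_of_mem 0 hx, sg_zero]
  exact LinearMap.congr_fun this P

lemma map_deg (h : GHom V W) {p : ℤ} {P : GSym V} (hP : P ∈ deg V p) : map h P ∈ deg W p :=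
  deg_induction (C := fun p P => map h P ∈ deg W p)
    (fun p a ha => by rw [map_coeff]; exact coeff_mem_deg ha)
    (fun p q P v _ hP hv => by
      rw [_root_.map_mul, map_gen]; exact deg_mul_gen hP (h.map_mem hv))
    (fun p => by simp) (fun p P Q h1 h2 => by rw [map_add]; exact add_mem h1 h2)
    (fun p c P h => by rw [map_smul]; exact Submodule.smul_mem _ c h) hP

lemma map_tw (h : GHom V W) (n : ℤ) (P : GSym V) : map h (tw V n P) = tw W n (map h P) := by
  have : (map h).toLinearMap ∘ₗ (tw V n).toLinearMap = (tw W n).toLinearMap ∘ₗ (map h).toLinearMap :=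
    lin_ext fun p x hx => by
      simp [tw_of_mem n hx, tw_of_mem n (map_deg h hx)]
  exact LinearMap.congr_fun this P

/-! The augmentation -/

/-- The relations of the graded symmetric algebra hold for the augmentation. -/
lemma aug_rel [IsGradedComm 𝒜] ⦃x y : TensorAlgebra k (A × V)⦄ (hxy : SymRel V x y) :
    TensorAlgebra.lift k (LinearMap.fst k A V) x = TensorAlgebra.lift k (LinearMap.fst k A V) y := by
  induction hxy <;> simp [Units.smul_def]

/-- The augmentation `Sym_A V → A`. -/
def aug (V : GMod 𝒜) [IsGradedComm 𝒜] : GSym V →ₐ[k] A :=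
  lift (TensorAlgebra.lift k (LinearMap.fst k A V)) aug_rel

variable [IsGradedComm 𝒜]

@[simp] lemma aug_coeff (a : A) : aug V (coeff V a) = a := by
  rw [aug, coeff, LinearMap.comp_apply, AlgHom.toLinearMap_apply, lift_mk]; simp

@[simp] lemma aug_gen (v : V) : aug V (gen V v) = 0 := by
  rw [aug, gen, LinearMap.comp_apply, AlgHom.toLinearMap_apply, lift_mk]; simp

lemma aug_mem {p : ℤ} {P : GSym V} (hP : P ∈ deg V p) : aug V P ∈ 𝒜 p :=
  deg_induction (C := fun p P => aug V P ∈ 𝒜 p) (fun p a ha => by rwa [aug_coeff])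
    (fun p q P v _ _ _ => by simp) (fun p => by simp)
    (fun p P Q h1 h2 => by rw [map_add]; exact add_mem h1 h2)
    (fun p c P h => by rw [map_smul]; exact Submodule.smul_mem _ c h) hP

lemma aug_tw (n : ℤ) (P : GSym V) : aug V (tw V n P) = twA 𝒜 n (aug V P) := by
  have : (aug V).toLinearMap ∘ₗ (tw V n).toLinearMap = (twA 𝒜 n).toLinearMap ∘ₗ (aug V).toLinearMap :=
    lin_ext fun p x hx => by simp [tw_of_mem n hx, twA_of_mem n (aug_mem hx)]
  exact LinearMap.congr_fun this P

lemma aug_map (h : GHom V W) (P : GSym V) : aug W (map h P) = aug V P := by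
  have : (aug W).comp (map h) = aug V := hom_ext (fun a => by simp) (fun v => by simp)
  exact DFunLike.congr_fun this P

end GSym

end SHLR
end

/-! ### Skew derivations, the weight grading and truncations. -/

noncomputable section
namespace SHLR

variable {k A : Type u} [Field k] [Ring A] [Algebra k A] {𝒜 : ℤ → Submodule k A}
  [GradedAlgebra 𝒜]

/-! ### Skew derivations -/

/-- `D (P Q) = ρ₁(P) D(Q) + D(P) ρ₂(Q)`. -/
def IsSkewDer {S B : Type u} [Ring S] [Algebra k S] [Ring B] [Algebra k B] (ρ₁ ρ₂ : S →ₐ[k] B)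
    (D : S →ₗ[k] B) : Prop :=
  ∀ P Q, D (P * Q) = ρ₁ P * D Q + D P * ρ₂ Q

namespace GSym

variable {V W : GMod 𝒜}

/-- The standard way of proving operator identities below: both sides are skew over the same pair of
algebra maps, so only coefficients and generators have to be compared. -/
lemma skewDer_ext {B : Type u} [Ring B] [Algebra k B] {ρ₁ ρ₂ : GSym V →ₐ[k] B}
    {D D' : GSym V →ₗ[k] B} (hD : IsSkewDer ρ₁ ρ₂ D) (hD' : IsSkewDer ρ₁ ρ₂ D')
    (h1 : ∀ a, D (coeff V a) = D' (coeff V a)) (h2 : ∀ v, D (gen V v) = D' (gen V v)) : D = D' := by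
  refine LinearMap.ext fun P => ?_
  induction P using induct with
  | hc a => exact h1 a
  | hg v => exact h2 v
  | hm x y hx hy => rw [hD, hD', hx, hy]
  | ha x y hx hy => rw [map_add, map_add, hx, hy]

/-- The generator data of the block triangular representation attached to a skew derivation. -/
def skewMatrix {B : Type u} [Ring B] [Algebra k B] (ρ₁ ρ₂ : GSym V →ₐ[k] B)
    (δ₀ : A →ₗ[k] B) (δ₁ : V →ₗ[k] B) : A × V →ₗ[k] Matrix (Fin 2) (Fin 2) B where
  toFun x := !![ρ₁ (coeff V x.1 + gen V x.2), δ₀ x.1 + δ₁ x.2; 0, ρ₂ (coeff V x.1 + gen V x.2)]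
  map_add' x y := by
    ext i j
    fin_cases i <;> fin_cases j <;> simp <;> abel
  map_smul' c x := by
    ext i j
    fin_cases i <;> fin_cases j <;> simp

/-- `D` is skew over `ρ₁`, `ρ₂` exactly when P ↦ (ρ₁ P, D P; 0, ρ₂ P) is multiplicative into upper
triangular 2×2 matrices. The universal property of Sym therefore produces `D`, and the four
hypotheses are the defining relations of Sym read in the upper right corner. -/
lemma exists_skewDer {B : Type u} [Ring B] [Algebra k B] (ρ₁ ρ₂ : GSym V →ₐ[k] B)
    (δ₀ : A →ₗ[k] B) (δ₁ : V →ₗ[k] B)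
    (hmul : ∀ a b, δ₀ (a * b) = ρ₁ (coeff V a) * δ₀ b + δ₀ a * ρ₂ (coeff V b))
    (hsmul : ∀ (a : A) (v : V), δ₁ (a • v) = ρ₁ (coeff V a) * δ₁ v + δ₀ a * ρ₂ (gen V v))
    (hcc : ∀ (i j : ℤ) (a : A) (v : V), a ∈ 𝒜 i → v ∈ V.gr j →
      ρ₁ (gen V v) * δ₀ a + δ₁ v * ρ₂ (coeff V a) =
        sg k (i * j) • (ρ₁ (coeff V a) * δ₁ v + δ₀ a * ρ₂ (gen V v)))
    (hc : ∀ (i j : ℤ) (v w : V), v ∈ V.gr i → w ∈ V.gr j →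
      ρ₁ (gen V v) * δ₁ w + δ₁ v * ρ₂ (gen V w) =
        sg k (i * j) • (ρ₁ (gen V w) * δ₁ v + δ₁ w * ρ₂ (gen V v))) :
    ∃ D : GSym V →ₗ[k] B, IsSkewDer ρ₁ ρ₂ D ∧ (∀ a, D (coeff V a) = δ₀ a) ∧
      ∀ v, D (gen V v) = δ₁ v := by
  have h1 : δ₀ 1 = 0 := by
    have := hmul 1 1
    simpa [coeff_one] using this
  -- The relation identifying the coefficient 1 with the unit asks for δ₀(1) = 0, which the product
  -- rule for 1·1 has just supplied.
  have hM0 (a : A) : skewMatrix ρ₁ ρ₂ δ₀ δ₁ (a, 0) =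
      !![ρ₁ (coeff V a), δ₀ a; 0, ρ₂ (coeff V a)] := by simp [skewMatrix]
  have hM1 (v : V) : skewMatrix ρ₁ ρ₂ δ₀ δ₁ (0, v) =
      !![ρ₁ (gen V v), δ₁ v; 0, ρ₂ (gen V v)] := by simp [skewMatrix]
  let Φ : GSym V →ₐ[k] Matrix (Fin 2) (Fin 2) B :=
    lift (TensorAlgebra.lift k (skewMatrix ρ₁ ρ₂ δ₀ δ₁)) (by
      intro x y hxy
      induction hxy with
      | one => rw [TensorAlgebra.lift_ι_apply, map_one, hM0, coeff_one, h1, map_one, map_one]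
               ext i j; fin_cases i <;> fin_cases j <;> rfl
      | mul a b =>
        simp only [map_mul, TensorAlgebra.lift_ι_apply, hM0, Matrix.mul_fin_two, hmul, ← coeff_mul]
        simp
      | smul a v =>
        simp only [map_mul, TensorAlgebra.lift_ι_apply, hM0, hM1, Matrix.mul_fin_two, hsmul,
          ← coeff_mul_gen]
        simp
      | comm_coeff ha hv =>
        rw [negOnePow_smul (k := k)]
        simp only [map_mul, map_smul, TensorAlgebra.lift_ι_apply, hM0, hM1, Matrix.mul_fin_two,
          mul_zero, zero_mul, add_zero, zero_add, hcc _ _ _ _ ha hv]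
        simp only [← map_mul, gen_mul_coeff ha hv, negOnePow_smul (k := k), map_smul]
        simp
      | comm hv hw =>
        rw [negOnePow_smul (k := k)]
        simp only [map_mul, map_smul, TensorAlgebra.lift_ι_apply, hM1, Matrix.mul_fin_two,
          mul_zero, zero_mul, add_zero, zero_add, hc _ _ _ _ hv hw]
        simp only [← map_mul, gen_mul_gen hv hw, negOnePow_smul (k := k), map_smul]
        simp)
  have hΦc (a : A) : Φ (coeff V a) = skewMatrix ρ₁ ρ₂ δ₀ δ₁ (a, 0) := by simp [Φ, coeff]
  have hΦg (v : V) : Φ (gen V v) = skewMatrix ρ₁ ρ₂ δ₀ δ₁ (0, v) := by simp [Φ, gen]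
  -- The other three entries are known on all of Sym, so multiplicativity of `Φ` becomes the skew
  -- Leibniz rule for the upper right entry.
  have key (P : GSym V) : Φ P 0 0 = ρ₁ P ∧ Φ P 1 0 = 0 ∧ Φ P 1 1 = ρ₂ P := by
    induction P using induct with
    | hc a => rw [hΦc]; simp [skewMatrix]
    | hg v => rw [hΦg]; simp [skewMatrix]
    | hm x y hx hy => simp [Matrix.mul_apply, Fin.sum_univ_two, hx, hy]
    | ha x y hx hy => simp [hx, hy]
  refine ⟨{ toFun := fun P => Φ P 0 1, map_add' := fun P Q => by simp, map_smul' := fun c P => by simp },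
    fun P Q => ?_, fun a => ?_, fun v => ?_⟩
  · simp [Matrix.mul_apply, Fin.sum_univ_two, key]
  · simp [hΦc, skewMatrix]
  · simp [hΦg, skewMatrix]

/-! ### Weights -/

/-- The algebra map `P ↦ ∑ P_j X^j` recording weights. -/
def wtPoly (V : GMod 𝒜) : GSym V →ₐ[k] Polynomial (GSym V) :=
  lift (TensorAlgebra.lift k (LinearMap.coprod
      ((Polynomial.CAlgHom (R := k) (A := GSym V)).toLinearMap ∘ₗ coeff V)
      (LinearMap.mulRight k Polynomial.X ∘ₗ
        (Polynomial.CAlgHom (R := k) (A := GSym V)).toLinearMap ∘ₗ gen V))) (by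
    intro x y hxy
    induction hxy with
    | one => simp [coeff_one]
    | mul a b => simp [← Polynomial.C_mul, coeff_mul]
    | smul a v => simp [← mul_assoc, ← Polynomial.C_mul, coeff_mul_gen]
    | comm_coeff ha hv =>
      simp only [negOnePow_smul (k := k)]
      simp only [map_mul, TensorAlgebra.lift_ι_apply, LinearMap.coprod_apply,
        LinearMap.comp_apply, map_zero, add_zero, zero_add, AlgHom.toLinearMap_apply, map_smul,
        Polynomial.CAlgHom_apply, LinearMap.mulRight_apply]
      rw [mul_assoc, Polynomial.X_mul_C, ← mul_assoc, ← Polynomial.C_mul, gen_mul_coeff ha hv,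
        negOnePow_smul (k := k), ← mul_assoc, ← Polynomial.C_mul, ← Polynomial.smul_C, smul_mul_assoc]
    | comm hv hw =>
      simp only [negOnePow_smul (k := k)]
      simp only [map_mul, TensorAlgebra.lift_ι_apply, LinearMap.coprod_apply,
        LinearMap.comp_apply, map_zero, zero_add, AlgHom.toLinearMap_apply, map_smul,
        Polynomial.CAlgHom_apply, LinearMap.mulRight_apply]
      have h (P Q : GSym V) : Polynomial.C P * Polynomial.X * (Polynomial.C Q * Polynomial.X) =
          Polynomial.C (P * Q) * Polynomial.X ^ 2 := by
        rw [mul_assoc, ← mul_assoc Polynomial.X, Polynomial.X_mul_C, Polynomial.C_mul, pow_two]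
        simp only [mul_assoc]
      rw [h, h, gen_mul_gen hv hw, negOnePow_smul (k := k), ← Polynomial.smul_C, smul_mul_assoc])

lemma wtPoly_coeff (a : A) : wtPoly V (coeff V a) = Polynomial.C (coeff V a) := by
  have h : coeff V a = mk V (TensorAlgebra.ι k (a, 0)) := rfl
  rw [h, wtPoly, lift_mk]; simp [h]

lemma wtPoly_gen (v : V) : wtPoly V (gen V v) = Polynomial.C (gen V v) * Polynomial.X := by
  have h : gen V v = mk V (TensorAlgebra.ι k (0, v)) := rfl
  rw [h, wtPoly, lift_mk]; simp [h]

/-- The weight `j` component. -/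
def pr (V : GMod 𝒜) (j : ℕ) : GSym V →ₗ[k] GSym V where
  toFun P := (wtPoly V P).coeff j
  map_add' P Q := by simp
  map_smul' c P := by simp

lemma pr_apply (j : ℕ) (P : GSym V) : pr V j P = (wtPoly V P).coeff j := rfl

lemma pr_coeff (j : ℕ) (a : A) : pr V j (coeff V a) = if j = 0 then coeff V a else 0 := by
  rw [pr_apply, wtPoly_coeff, Polynomial.coeff_C]

lemma pr_mul (n : ℕ) (P Q : GSym V) :
    pr V n (P * Q) = ∑ ij ∈ Finset.HasAntidiagonal.antidiagonal n, pr V ij.1 P * pr V ij.2 Q := by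
  simp only [pr_apply, map_mul, Polynomial.coeff_mul]

lemma pr_coeff_mul (n : ℕ) (a : A) (Q : GSym V) : pr V n (coeff V a * Q) = coeff V a * pr V n Q := by
  rw [pr_apply, map_mul, wtPoly_coeff, Polynomial.coeff_C_mul, pr_apply]

lemma pr_mul_coeff (n : ℕ) (a : A) (Q : GSym V) : pr V n (Q * coeff V a) = pr V n Q * coeff V a := by
  rw [pr_apply, map_mul, wtPoly_coeff, Polynomial.coeff_mul_C, pr_apply]

lemma pr_succ_mul_gen (n : ℕ) (v : V) (Q : GSym V) :
    pr V (n + 1) (Q * gen V v) = pr V n Q * gen V v := by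
  rw [pr_apply, map_mul, wtPoly_gen, ← mul_assoc, Polynomial.coeff_mul_X, Polynomial.coeff_mul_C,
    pr_apply]

lemma pr_zero_mul_gen (v : V) (Q : GSym V) : pr V 0 (Q * gen V v) = 0 := by
  rw [pr_apply, map_mul, wtPoly_gen, ← mul_assoc, Polynomial.coeff_mul_X_zero]

lemma wtPoly_of_wt {i : ℕ} {P : GSym V} (hP : P ∈ wt V i) :
    wtPoly V P = Polynomial.C P * Polynomial.X ^ i := by
  induction hP using Submodule.span_induction with
  | zero => simp
  | add x y _ _ h1 h2 => rw [map_add, h1, h2, map_add, add_mul]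
  | smul c x _ h => rw [map_smul, h, ← smul_mul_assoc, Polynomial.smul_C]
  | mem x hx =>
    obtain ⟨a, v, rfl⟩ := hx
    induction i with
    | zero => simp [monomial_zero, wtPoly_coeff]
    | succ i ih =>
      rw [monomial_succ, map_mul, ih, wtPoly_gen, mul_assoc, ← mul_assoc (Polynomial.X ^ i),
        Polynomial.X_pow_mul_C, mul_assoc, ← pow_succ, ← mul_assoc, ← Polynomial.C_mul]

lemma pr_of_wt {i : ℕ} {P : GSym V} (hP : P ∈ wt V i) (j : ℕ) :
    pr V j P = if j = i then P else 0 := by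
  rw [pr_apply, wtPoly_of_wt hP, Polynomial.coeff_C_mul_X_pow]

lemma coeff_mem_wt (a : A) : coeff V a ∈ wt V 0 :=
  Submodule.subset_span ⟨a, Fin.elim0, (monomial_zero a _).symm⟩

lemma wt_mul_gen {i : ℕ} {P : GSym V} (hP : P ∈ wt V i) (v : V) : P * gen V v ∈ wt V (i + 1) := by
  induction hP using Submodule.span_induction with
  | zero => simp
  | add x y _ _ h1 h2 => rw [add_mul]; exact add_mem h1 h2
  | smul c x _ h => rw [smul_mul_assoc]; exact Submodule.smul_mem _ c h
  | mem x hx =>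
    obtain ⟨a, w, rfl⟩ := hx
    exact Submodule.subset_span ⟨a, _, (monomial_snoc a w v).symm⟩

lemma gen_mem_wt (v : V) : gen V v ∈ wt V 1 := by
  simpa [coeff_one] using wt_mul_gen (coeff_mem_wt (V := V) 1) v

lemma pr_mem_deg_wt {p : ℤ} {P : GSym V} (hP : P ∈ deg V p) (j : ℕ) :
    pr V j P ∈ deg V p ⊓ wt V j := by
  refine deg_induction (C := fun p P => ∀ j, pr V j P ∈ deg V p ⊓ wt V j) (fun p a ha j => ?_)
    (fun p q P v _ hP hv j => ?_) (fun p j => by simp)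
    (fun p P Q h1 h2 j => by rw [map_add]; exact add_mem (h1 j) (h2 j))
    (fun p c P h j => by rw [map_smul]; exact Submodule.smul_mem _ c (h j)) hP j
  · rw [pr_coeff]
    split_ifs with h
    · subst h; exact ⟨coeff_mem_deg ha, coeff_mem_wt a⟩
    · exact zero_mem _
  · cases j with
    | zero => rw [pr_zero_mul_gen]; exact zero_mem _
    | succ j => rw [pr_succ_mul_gen]; exact ⟨deg_mul_gen (hP j).1 hv, wt_mul_gen (hP j).2 v⟩

lemma pr_mem_deg {p : ℤ} {P : GSym V} (hP : P ∈ deg V p) (j : ℕ) : pr V j P ∈ deg V p :=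
  (pr_mem_deg_wt hP j).1

lemma mem_of_deg {N : Submodule k (GSym V)} (h : ∀ p P, P ∈ deg V p → P ∈ N) (P : GSym V) :
    P ∈ N := by
  have : (⊤ : Submodule k (GSym V)) ≤ N := by
    rw [← iSup_deg V]; exact iSup_le fun p P hP => h p P hP
  exact this trivial

lemma pr_mem_wt (P : GSym V) (j : ℕ) : pr V j P ∈ wt V j :=
  mem_of_deg (N := (wt V j).comap (pr V j)) (fun _ _ hP => (pr_mem_deg_wt hP j).2) P

lemma pr_pr (i j : ℕ) (P : GSym V) : pr V i (pr V j P) = if i = j then pr V j P else 0 :=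
  pr_of_wt (pr_mem_wt P j) i

/-- Weights are bounded on each element, so `pr` decomposes it; as with degrees, the bound is stated
for all larger `n` so as to be stable under sums. -/
lemma exists_sum_pr (P : GSym V) : ∃ N, ∀ n, N ≤ n → P = ∑ j ∈ Finset.range n, pr V j P := by
  refine mem_of_deg (N := ⟨⟨⟨{P | ∃ N, ∀ n, N ≤ n → P = ∑ j ∈ Finset.range n, pr V j P}, ?_⟩, ?_⟩, ?_⟩)
    (fun p P hP => ?_) P
  · rintro P Q ⟨N, hN⟩ ⟨N', hN'⟩
    refine ⟨max N N', fun n hn => ?_⟩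
    simp only [map_add, Finset.sum_add_distrib]
    rw [← hN n (by omega), ← hN' n (by omega)]
  · exact ⟨0, by simp⟩
  · rintro c P ⟨N, hN⟩
    refine ⟨N, fun n hn => ?_⟩
    simp only [map_smul, ← Finset.smul_sum]
    rw [← hN n hn]
  · refine deg_induction (C := fun _ P => ∃ N, ∀ n, N ≤ n → P = ∑ j ∈ Finset.range n, pr V j P)
      (fun p a ha => ⟨1, fun n hn => ?_⟩) (fun p q P v _ hP hv => ?_) (fun p => ⟨0, by simp⟩)
      ?_ ?_ hP
    · simp only [pr_coeff]
      simp; omega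
    · obtain ⟨N, hN⟩ := hP
      refine ⟨N + 1, fun n hn => ?_⟩
      obtain ⟨n, rfl⟩ : ∃ n', n = n' + 1 := ⟨n - 1, by omega⟩
      rw [Finset.sum_range_succ', pr_zero_mul_gen, add_zero]
      simp only [pr_succ_mul_gen, ← Finset.sum_mul]
      rw [← hN n (by omega)]
    · rintro p P Q ⟨N, hN⟩ ⟨N', hN'⟩
      refine ⟨max N N', fun n hn => ?_⟩
      simp only [map_add, Finset.sum_add_distrib]
      rw [← hN n (by omega), ← hN' n (by omega)]
    · rintro p c P ⟨N, hN⟩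
      refine ⟨N, fun n hn => ?_⟩
      simp only [map_smul, ← Finset.smul_sum]
      rw [← hN n hn]

lemma pr_zero_eq [IsGradedComm 𝒜] (P : GSym V) : pr V 0 P = coeff V (aug V P) := by
  have : pr V 0 = coeff V ∘ₗ (aug V).toLinearMap := lin_ext fun p P hP =>
    deg_induction (C := fun _ P => pr V 0 P = (coeff V ∘ₗ (aug V).toLinearMap) P)
      (fun p a _ => by simp [pr_coeff]) (fun p q P v _ _ _ => by simp [pr_zero_mul_gen])
      (fun p => by simp) (fun p P Q h1 h2 => by rw [map_add, map_add, h1, h2])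
      (fun p c P h => by rw [map_smul, map_smul, h]) hP
  exact LinearMap.congr_fun this P

lemma aug_of_wt [IsGradedComm 𝒜] {i : ℕ} (hi : i ≠ 0) {P : GSym V} (hP : P ∈ wt V i) :
    aug V P = 0 := by
  have := pr_zero_eq P
  rw [pr_of_wt hP, if_neg hi.symm] at this
  have := congrArg (aug V) this
  simpa using this.symm

lemma wtPoly_map (h : GHom V W) (P : GSym V) (j : ℕ) : pr W j (map h P) = map h (pr V j P) := by
  have : pr W j ∘ₗ (map h).toLinearMap = (map h).toLinearMap ∘ₗ pr V j := lin_ext fun p P hP =>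
    deg_induction (C := fun _ P => ∀ j, (pr W j ∘ₗ (map h).toLinearMap) P =
        ((map h).toLinearMap ∘ₗ pr V j) P)
      (fun p a _ j => by by_cases hj : j = 0 <;> simp [pr_coeff, hj])
      (fun p q P v _ hP _ j => by
        simp only [LinearMap.comp_apply, AlgHom.toLinearMap_apply] at hP ⊢
        cases j with
        | zero => simp [pr_zero_mul_gen]
        | succ j => simp [pr_succ_mul_gen, hP])
      (fun p j => by simp) (fun p P Q h1 h2 j => by rw [map_add, map_add, h1, h2])
      (fun p c P h j => by rw [map_smul, map_smul, h]) hP j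
  exact LinearMap.congr_fun this P

lemma pr_tw (n : ℤ) (P : GSym V) (j : ℕ) : pr V j (tw V n P) = tw V n (pr V j P) := by
  have : pr V j ∘ₗ (tw V n).toLinearMap = (tw V n).toLinearMap ∘ₗ pr V j := lin_ext fun p P hP => by
    simp [tw_of_mem n hP, tw_of_mem n (pr_mem_deg hP j)]
  exact LinearMap.congr_fun this P

/-- Elements of weight at least `i`. -/
def fil (V : GMod 𝒜) (i : ℕ) : Submodule k (GSym V) := ⨅ j : Fin i, LinearMap.ker (pr V j)

lemma mem_fil {i : ℕ} {P : GSym V} : P ∈ fil V i ↔ ∀ j < i, pr V j P = 0 := by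
  simp [fil, Fin.forall_iff]

lemma fil_mul {i j : ℕ} {P Q : GSym V} (hP : P ∈ fil V i) (hQ : Q ∈ fil V j) :
    P * Q ∈ fil V (i + j) := by
  rw [mem_fil] at *
  intro n hn
  rw [pr_mul]
  refine Finset.sum_eq_zero fun ab hab => ?_
  rw [Finset.HasAntidiagonal.mem_antidiagonal] at hab
  rcases lt_or_ge ab.1 i with h | h
  · rw [hP _ h, zero_mul]
  · rw [hQ ab.2 (by omega), mul_zero]

lemma fil_zero (P : GSym V) : P ∈ fil V 0 := by simp [mem_fil]

lemma fil_anti {i j : ℕ} (h : i ≤ j) : fil V j ≤ fil V i := fun P hP => by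
  rw [mem_fil] at *; exact fun l hl => hP l (by omega)

lemma wt_le_fil {i j : ℕ} (h : j ≤ i) : wt V i ≤ fil V j := fun P hP => by
  rw [mem_fil]; intro l hl; rw [pr_of_wt hP, if_neg (by omega)]

lemma map_fil (h : GHom V W) {i : ℕ} {P : GSym V} (hP : P ∈ fil V i) : map h P ∈ fil W i := by
  rw [mem_fil] at *; intro j hj; rw [wtPoly_map, hP j hj, map_zero]

lemma tw_fil (n : ℤ) {i : ℕ} {P : GSym V} (hP : P ∈ fil V i) : tw V n P ∈ fil V i := by
  rw [mem_fil] at *; intro j hj; rw [pr_tw, hP j hj, map_zero]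

end GSym

namespace TruncSym

open GSym

variable {V : GMod 𝒜}

/-- The congruence of elements agreeing in weights `≤ m`. -/
def truncCon (V : GMod 𝒜) (m : ℕ) : RingCon (GSym V) where
  r P Q := ∀ j ≤ m, pr V j P = pr V j Q
  iseqv := ⟨fun _ _ _ => rfl, fun h j hj => (h j hj).symm, fun h h' j hj => (h j hj).trans (h' j hj)⟩
  mul' {P P' Q Q'} h h' j hj := by
    rw [pr_mul, pr_mul]
    refine Finset.sum_congr rfl fun ab hab => ?_
    rw [Finset.HasAntidiagonal.mem_antidiagonal] at hab
    rw [h _ (by omega), h' _ (by omega)]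
  add' h h' j hj := by rw [map_add, map_add, h j hj, h' j hj]

/-- The truncation is defined by generators and relations, so it might a priori collapse low
weights. It maps onto the quotient by `truncCon`, where the components of weight ≤ `m` are still
visible. -/
lemma pr_eq_of_proj_eq {m : ℕ} {P Q : GSym V} (h : proj V m P = proj V m Q) {j : ℕ} (hj : j ≤ m) :
    pr V j P = pr V j Q := by
  let φ : TruncSym V m →ₐ[k] (truncCon V m).Quotient :=
    RingQuot.liftAlgHom k ⟨(truncCon V m).mkₐ k, by
      rintro s t ⟨rfl, i, hi, hs⟩
      refine (RingCon.eq (truncCon V m)).2 fun j hj => ?_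
      rw [pr_of_wt hs, if_neg (by omega), map_zero]⟩
  have hφ (P) : φ (proj V m P) = (truncCon V m).mkₐ k P :=
    RingQuot.liftAlgHom_mkAlgHom_apply k _ _ P
  have h1 := congrArg φ h
  rw [hφ, hφ] at h1
  exact (RingCon.eq (truncCon V m)).1 h1 j hj

lemma proj_of_wt {m i : ℕ} (hi : m < i) {P : GSym V} (hP : P ∈ GSym.wt V i) : proj V m P = 0 := by
  have : proj V m P = proj V m 0 := RingQuot.mkAlgHom_rel k (s := TruncRel V m) ⟨rfl, i, hi, hP⟩
  rwa [map_zero] at this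

/-- From here on equality in the truncated algebra is handled as membership of a difference in
`fil`, and computations stay in the full symmetric algebra. -/
lemma proj_eq_zero_iff {m : ℕ} {P : GSym V} : proj V m P = 0 ↔ P ∈ fil V (m + 1) := by
  rw [mem_fil]
  constructor
  · intro h j hj
    have := pr_eq_of_proj_eq (Q := 0) (by rw [h, map_zero]) (show j ≤ m by omega)
    rwa [map_zero] at this
  · intro h
    obtain ⟨N, hN⟩ := exists_sum_pr P
    rw [hN N le_rfl, map_sum]
    refine Finset.sum_eq_zero fun j _ => ?_
    rcases Nat.lt_or_ge j (m + 1) with hj | hj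
    · rw [h j hj, map_zero]
    · exact proj_of_wt (by omega) (pr_mem_wt P j)

lemma proj_eq_iff {m : ℕ} {P Q : GSym V} : proj V m P = proj V m Q ↔ P - Q ∈ fil V (m + 1) := by
  rw [← proj_eq_zero_iff, map_sub, sub_eq_zero]

end TruncSym

end SHLR
end

/-! ### Evaluation of duals and contraction of Sym(F^*) by elements of F. -/

noncomputable section
namespace SHLR

variable {k A : Type u} [Field k] [Ring A] [Algebra k A] {𝒜 : ℤ → Submodule k A}
  [GradedAlgebra 𝒜] [IsGradedComm 𝒜]

/-! ### Evaluation of duals -/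

section Eval

variable {F G : GMod 𝒜}

/-- Evaluation at `x`, as a linear map on the dual. -/
def evalAt (x : F) : F.dual →ₗ[k] A := LinearMap.applyₗ x ∘ₗ DualType.val F

@[simp] lemma evalAt_apply (x : F) (φ : F.dual) : evalAt x φ = evalDual φ x := rfl

lemma evalDual_add (φ : F.dual) (x y : F) : evalDual φ (x + y) = evalDual φ x + evalDual φ y :=
  map_add (DualType.val F φ) x y

lemma evalDual_ksmul (φ : F.dual) (c : k) (x : F) : evalDual φ (c • x) = c • evalDual φ x :=
  map_smul (DualType.val F φ) c x

@[simp] lemma evalDual_zero (φ : F.dual) : evalDual φ (0 : F) = 0 := map_zero (DualType.val F φ)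

lemma evalDual_sum {ι : Type*} (φ : F.dual) (s : Finset ι) (x : ι → F) :
    evalDual φ (∑ i ∈ s, x i) = ∑ i ∈ s, evalDual φ (x i) := map_sum (DualType.val F φ) _ _

lemma evalDual_smul_left (a : A) (φ : F.dual) (x : F) : evalDual (a • φ) x = a * evalDual φ x := rfl

lemma evalDual_mem {n i : ℤ} {φ : F.dual} {x : F} (hφ : φ ∈ F.dual.gr n) (hx : x ∈ F.gr i) :
    evalDual φ x ∈ 𝒜 (n + i) := hφ.1 i x hx

lemma evalDual_smul_right {n j : ℤ} {φ : F.dual} (hφ : φ ∈ F.dual.gr n) {a : A} (ha : a ∈ 𝒜 j)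
    (x : F) : evalDual φ (a • x) = sg k (n * j) • (a * evalDual φ x) := by
  rw [← negOnePow_smul]; exact hφ.2 j a x ha

@[simp] lemma evalDual_dual (h : GHom F G) (φ : G.dual) (x : F) :
    evalDual (h.dual φ) x = evalDual φ (h x) := rfl

lemma dual_ext {φ ψ : F.dual} (h : ∀ x, evalDual φ x = evalDual ψ x) : φ = ψ :=
  DualType.val_injective (LinearMap.ext h)

end Eval

/-! ### Contractions -/

section Contraction

variable {F G : GMod 𝒜}

open GSym

/-- Contraction is the skew derivation that kills A and sends φ to φ(x). The twist sits on the
right-hand factor because x acts from the right; compatibility with the relations of Sym reduces to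
graded commutativity of A. -/
lemma exists_ctr {e : ℤ} {x : F} (hx : x ∈ F.gr e) :
    ∃ D : GSym F.dual →ₗ[k] GSym F.dual, IsSkewDer (AlgHom.id k _) (tw F.dual e) D ∧
      (∀ a, D (coeff _ a) = 0) ∧ ∀ φ, D (gen _ φ) = coeff _ (evalDual φ x) := by
  refine exists_skewDer (AlgHom.id k _) (tw F.dual e) 0 (coeff _ ∘ₗ evalAt x)
    (fun a b => by simp) (fun a φ => by simp [evalDual_smul_left, coeff_mul])
    (fun i j a φ ha hφ => ?_) (fun i j φ ψ hφ hψ => ?_)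
  · simp only [AlgHom.coe_id, id_eq, LinearMap.zero_apply, mul_zero, LinearMap.comp_apply,
      evalAt_apply, tw_coeff, zero_mul, add_zero, zero_add, coeff_mul, twA_of_mem e ha,
      mul_smul_comm, map_smul]
    rw [IsGradedComm.comm (evalDual_mem hφ hx) ha, negOnePow_smul (k := k), map_smul, smul_smul,
      ← sg_add]
    congr 1
    exact sg_congr (by push_cast; grind)
  · simp only [AlgHom.coe_id, id_eq, LinearMap.comp_apply,
      evalAt_apply, tw_gen, F.dual.tw_of_mem e hφ, F.dual.tw_of_mem e hψ,
      mul_smul_comm, map_smul]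
    rw [gen_mul_coeff (evalDual_mem hψ hx) hφ, gen_mul_coeff (evalDual_mem hφ hx) hψ,
      negOnePow_smul (k := k), negOnePow_smul (k := k), smul_add, smul_smul, smul_smul, ← sg_add,
      ← sg_add, add_comm]
    congr 2
    · exact sg_congr (by push_cast; grind)
    · exact sg_congr (by push_cast; grind)

/-- Contraction with a homogeneous element. -/
def ctrHom (F : GMod 𝒜) (e : ℤ) : F.gr e →ₗ[k] (GSym F.dual →ₗ[k] GSym F.dual) where
  toFun x := (exists_ctr x.2).choose
  map_add' x y := by
    have hx := (exists_ctr x.2).choose_spec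
    have hy := (exists_ctr y.2).choose_spec
    have hxy := (exists_ctr (x + y).2).choose_spec
    refine skewDer_ext hxy.1 (fun P Q => ?_) (fun a => ?_) (fun φ => ?_)
    · simp only [LinearMap.add_apply, hx.1 P Q, hy.1 P Q]
      rw [mul_add, add_mul]; abel
    · simp only [LinearMap.add_apply, hx.2.1, hy.2.1, hxy.2.1, add_zero]
    · refine (hxy.2.2 φ).trans ?_
      simp only [LinearMap.add_apply, hx.2.2, hy.2.2, Submodule.coe_add, evalDual_add, map_add]
  map_smul' c x := by
    have hx := (exists_ctr x.2).choose_spec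
    have hcx := (exists_ctr (c • x).2).choose_spec
    refine skewDer_ext hcx.1 (fun P Q => ?_) (fun a => ?_) (fun φ => ?_)
    · simp only [RingHom.id_apply, LinearMap.smul_apply, hx.1 P Q]
      rw [mul_smul_comm, smul_mul_assoc, smul_add]
    · simp only [RingHom.id_apply, LinearMap.smul_apply, hx.2.1, hcx.2.1, smul_zero]
    · refine (hcx.2.2 φ).trans ?_
      simp only [RingHom.id_apply, LinearMap.smul_apply, hx.2.2, Submodule.coe_smul,
        evalDual_ksmul, map_smul]

/-- Contraction `P ↦ P ⌟ x`, acting from the right. -/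
def ctr (F : GMod 𝒜) : F →ₗ[k] (GSym F.dual →ₗ[k] GSym F.dual) :=
  DirectSum.toModule k ℤ _ (ctrHom F) ∘ₗ (decomp F.isInternal).toLinearMap

lemma ctr_of_mem {e : ℤ} {x : F} (hx : x ∈ F.gr e) : ctr F x = ctrHom F e ⟨x, hx⟩ := by
  simp [ctr, decomp_of_mem F.isInternal hx]

lemma ctr_mul {e : ℤ} {x : F} (hx : x ∈ F.gr e) (P Q : GSym F.dual) :
    ctr F x (P * Q) = P * ctr F x Q + ctr F x P * tw _ e Q := by
  rw [ctr_of_mem hx]; exact (exists_ctr hx).choose_spec.1 P Q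

lemma ctr_skew {e : ℤ} {x : F} (hx : x ∈ F.gr e) :
    IsSkewDer (AlgHom.id k _) (tw F.dual e) (ctr F x) := ctr_mul hx

@[simp] lemma ctr_coeff (x : F) (a : A) : ctr F x (coeff _ a) = 0 := by
  have : (LinearMap.applyₗ (coeff F.dual a)) ∘ₗ ctr F = 0 := GMod.lin_ext fun p x hx => by
    rw [LinearMap.comp_apply, ctr_of_mem hx]; exact (exists_ctr hx).choose_spec.2.1 a
  exact LinearMap.congr_fun this x

@[simp] lemma ctr_gen (x : F) (φ : F.dual) : ctr F x (gen _ φ) = coeff _ (evalDual φ x) := by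
  have : (LinearMap.applyₗ (gen F.dual φ)) ∘ₗ ctr F = coeff _ ∘ₗ DualType.val F φ :=
    GMod.lin_ext fun p x hx => by
      rw [LinearMap.comp_apply, ctr_of_mem hx]; exact (exists_ctr hx).choose_spec.2.2 φ
  exact LinearMap.congr_fun this x

lemma ctr_mul_gen {e c : ℤ} {x : F} (hx : x ∈ F.gr e) {φ : F.dual} (hφ : φ ∈ F.dual.gr c)
    (P : GSym F.dual) : ctr F x (P * gen _ φ) =
      P * coeff _ (evalDual φ x) + sg k (e * c) • (ctr F x P * gen _ φ) := by
  rw [ctr_mul hx, ctr_gen, tw_gen, F.dual.tw_of_mem e hφ, map_smul, mul_smul_comm]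

lemma ctr_coeff_mul (x : F) (a : A) (P : GSym F.dual) :
    ctr F x (coeff _ a * P) = coeff _ a * ctr F x P := by
  have : (LinearMap.applyₗ (coeff F.dual a * P)) ∘ₗ ctr F =
      LinearMap.mulLeft k (coeff F.dual a) ∘ₗ (LinearMap.applyₗ P) ∘ₗ ctr F :=
    GMod.lin_ext fun p x hx => by simp [ctr_mul hx]
  exact LinearMap.congr_fun this x

lemma ctr_mul_coeff {e : ℤ} {x : F} (hx : x ∈ F.gr e) (P : GSym F.dual) (a : A) :
    ctr F x (P * coeff _ a) = ctr F x P * coeff _ (twA 𝒜 e a) := by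
  rw [ctr_mul hx, ctr_coeff, mul_zero, zero_add, tw_coeff]

lemma ctr_mem_deg {e : ℤ} {x : F} (hx : x ∈ F.gr e) {p : ℤ} {P : GSym F.dual}
    (hP : P ∈ deg _ p) : ctr F x P ∈ deg _ (p + e) := by
  refine deg_induction (C := fun p P => P ∈ deg _ p ∧ ctr F x P ∈ deg _ (p + e))
    (fun p a ha => ⟨coeff_mem_deg ha, by simp⟩)
    (fun p q P φ _ hP hφ => ⟨deg_mul_gen hP.1 hφ, ?_⟩) (fun p => by simp)
    (fun p P Q h1 h2 => ⟨add_mem h1.1 h2.1, by rw [map_add]; exact add_mem h1.2 h2.2⟩)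
    (fun p c P h => ⟨Submodule.smul_mem _ c h.1, by rw [map_smul]; exact Submodule.smul_mem _ c h.2⟩)
    hP |>.2
  rw [ctr_mul_gen hx hφ]
  refine add_mem ?_ (Submodule.smul_mem _ _ ?_)
  · rw [add_assoc]; exact deg_mul_coeff hP.1 (evalDual_mem hφ hx)
  · rw [add_right_comm]; exact deg_mul_gen hP.2 hφ

lemma ctr_tw {e : ℤ} {x : F} (hx : x ∈ F.gr e) (n : ℤ) (P : GSym F.dual) :
    tw _ n (ctr F x P) = sg k (n * e) • ctr F x (tw _ n P) := by
  have : (tw _ n).toLinearMap ∘ₗ ctr F x = sg k (n * e) • (ctr F x ∘ₗ (tw _ n).toLinearMap) :=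
    lin_ext fun p P hP => by
      simp only [LinearMap.comp_apply, AlgHom.toLinearMap_apply, LinearMap.smul_apply,
        tw_of_mem n hP, tw_of_mem n (ctr_mem_deg hx hP), map_smul, smul_smul]
      rw [← sg_add]; congr 2; ring
  exact LinearMap.congr_fun this P

/-- The graded commutator of two contractions is skew with twist `e + e'` and kills coefficients and
generators, hence is zero. -/
lemma ctr_ctr {e e' : ℤ} {x y : F} (hx : x ∈ F.gr e) (hy : y ∈ F.gr e') (P : GSym F.dual) :
    ctr F y (ctr F x P) = sg k (e * e') • ctr F x (ctr F y P) := by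
  have : ctr F y ∘ₗ ctr F x - sg k (e * e') • (ctr F x ∘ₗ ctr F y) = 0 := by
    refine skewDer_ext (ρ₁ := AlgHom.id k _) (ρ₂ := tw F.dual (e + e')) (fun P Q => ?_)
      (fun P Q => by simp) (fun a => by simp) (fun φ => by simp)
    simp only [LinearMap.sub_apply, LinearMap.comp_apply, LinearMap.smul_apply, ctr_mul hx,
      ctr_mul hy, map_add, AlgHom.id_apply, ctr_tw hx, ctr_tw hy, tw_tw, mul_smul_comm,
      mul_comm e' e, add_comm e' e, smul_add, smul_smul, sg_mul_self, mul_sub, sub_mul,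
      smul_mul_assoc]
    module
  have := LinearMap.congr_fun this P
  simpa [sub_eq_zero] using this

/-- The A-linearity of anchors and the Leibniz rule both originate here. The right-hand side is a
skew derivation for the same twist, since the sign for moving `a` past P is absorbed by the twist of
P; so generators suffice. -/
lemma ctr_smul {c e : ℤ} {a : A} {x : F} (ha : a ∈ 𝒜 c) (hx : x ∈ F.gr e) (P : GSym F.dual) :
    ctr F (a • x) P = coeff _ a * ctr F x (tw _ c P) := by
  have hax := F.smul_mem ha hx
  have : ctr F (a • x) = LinearMap.mulLeft k (coeff F.dual a) ∘ₗ ctr F x ∘ₗ (tw _ c).toLinearMap := by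
    refine skewDer_ext (ctr_skew hax) ?_ (fun a => by simp) (fun φ => ?_)
    · have key : (LinearMap.mul k _).compr₂
          (LinearMap.mulLeft k (coeff F.dual a) ∘ₗ ctr F x ∘ₗ (tw _ c).toLinearMap) =
          (LinearMap.mul k _).compl₂ (LinearMap.mulLeft k (coeff F.dual a) ∘ₗ ctr F x ∘ₗ (tw _ c).toLinearMap) +
          (LinearMap.mul k _).compl₁₂ (LinearMap.mulLeft k (coeff F.dual a) ∘ₗ ctr F x ∘ₗ (tw _ c).toLinearMap) (tw F.dual (c + e)).toLinearMap := by
        refine lin_ext fun p P hP => LinearMap.ext fun Q => ?_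
        simp only [LinearMap.compr₂_apply, LinearMap.compl₁₂_apply, LinearMap.compl₂_apply,
          LinearMap.mul_apply_apply, LinearMap.add_apply, LinearMap.comp_apply,
          LinearMap.mulLeft_apply, AlgHom.toLinearMap_apply, map_mul, ctr_mul hx, tw_tw, mul_add,
          tw_of_mem c hP, smul_mul_assoc, mul_smul_comm, map_smul, add_comm e c]
        rw [← mul_assoc, coeff_mul_comm_of_mem ha hP, smul_mul_assoc, smul_add, smul_smul, sg_mul_self,
          one_smul, mul_assoc, LinearMap.smul_apply, LinearMap.mul_apply_apply, mul_assoc]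
      intro P Q
      exact LinearMap.congr_fun₂ key P Q
    -- The comparison is linear in φ, so φ may be taken homogeneous.
    · have : gen F.dual φ ∈ LinearMap.ker ((ctr F (a • x)) -
          LinearMap.mulLeft k (coeff F.dual a) ∘ₗ ctr F x ∘ₗ (tw _ c).toLinearMap) := by
        have key : ((ctr F (a • x)) - LinearMap.mulLeft k (coeff F.dual a) ∘ₗ ctr F x ∘ₗ
            (tw _ c).toLinearMap) ∘ₗ gen F.dual = 0 := GMod.lin_ext fun p φ hφ => by
          simp [F.dual.tw_of_mem c hφ, evalDual_smul_right hφ ha, coeff_mul, mul_comm]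
        exact LinearMap.congr_fun key φ
      simpa [sub_eq_zero] using this
  rw [this]; simp

/-- Both sides are skew over the map induced by `h` and agree on generators by definition of the
transpose. -/
lemma ctr_map {e : ℤ} {x : F} (hx : x ∈ F.gr e) (h : GHom F G) (P : GSym G.dual) :
    ctr F x (GSym.map h.dual P) = GSym.map h.dual (ctr G (h x) P) := by
  have : ctr F x ∘ₗ (GSym.map h.dual).toLinearMap =
      (GSym.map h.dual).toLinearMap ∘ₗ ctr G (h x) := by
    refine skewDer_ext (ρ₁ := GSym.map h.dual) (ρ₂ := (GSym.map h.dual).comp (tw G.dual e))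
      (fun P Q => ?_) (fun P Q => ?_) (fun a => by simp) (fun φ => by simp)
    · simp [ctr_mul hx, map_tw]
    · simp [ctr_mul (h.map_mem hx)]
  exact LinearMap.congr_fun this P

lemma pr_ctr {e : ℤ} {x : F} (hx : x ∈ F.gr e) (j : ℕ) (P : GSym F.dual) :
    pr _ j (ctr F x P) = ctr F x (pr _ (j + 1) P) := by
  have : pr _ j ∘ₗ ctr F x = ctr F x ∘ₗ pr _ (j + 1) := lin_ext fun p P hP =>
    deg_induction (C := fun _ P => ∀ j, (pr _ j ∘ₗ ctr F x) P = (ctr F x ∘ₗ pr _ (j + 1)) P)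
      (fun p a _ j => by simp [pr_coeff])
      (fun p q P v _ hP hv j => by
        simp only [LinearMap.comp_apply] at hP ⊢
        rw [ctr_mul_gen hx hv, pr_succ_mul_gen, map_add, pr_mul_coeff, map_smul, ctr_mul_gen hx hv]
        cases j with
        | zero =>
          have : ctr F x (pr _ 0 P) = 0 := by rw [pr_zero_eq, ctr_coeff]
          simp [pr_zero_mul_gen, this]
        | succ j => rw [pr_succ_mul_gen, hP])
      (fun p j => by simp) (fun p P Q h1 h2 j => by rw [map_add, map_add, h1, h2])
      (fun p c P h j => by rw [map_smul, map_smul, h]) hP j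
  exact LinearMap.congr_fun this P

lemma ctr_fil {e : ℤ} {x : F} (hx : x ∈ F.gr e) {j : ℕ} {P : GSym F.dual}
    (hP : P ∈ fil F.dual (j + 1)) : ctr F x P ∈ fil F.dual j := by
  rw [mem_fil] at *
  intro i hi
  rw [pr_ctr hx, hP _ (by omega), map_zero]

end Contraction

end SHLR
end

/-! ### Iterated contractions and iterated graded commutators. -/

noncomputable section
namespace SHLR

variable {k A : Type u} [Field k] [Ring A] [Algebra k A] {𝒜 : ℤ → Submodule k A}
  [GradedAlgebra 𝒜] [IsGradedComm 𝒜]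

/-! ### Folding bilinear steps over increasing subsets -/

section Fold

variable {F Ω : Type u} [AddCommGroup F] [Module k F] [AddCommGroup Ω] [Module k Ω]

/-- Apply `st (e t) (∑_{s < t, s ∈ T} e s) (x t)` to `ω`, for `t ∈ T` with `t < r`, in increasing order. -/
def foldN (st : ℤ → ℤ → F →ₗ[k] Ω →ₗ[k] Ω) (x : ℕ → F) (e : ℕ → ℤ) (ω : Ω) : ℕ → Finset ℕ → Ω
  | 0, _ => ω
  | r + 1, T => if r ∈ T then st (e r) (∑ t ∈ T with t < r, e t) (x r) (foldN st x e ω r T)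
      else foldN st x e ω r T

variable {st : ℤ → ℤ → F →ₗ[k] Ω →ₗ[k] Ω} {x y z : ℕ → F} {e e' : ℕ → ℤ} {ω ω' : Ω}

@[simp] lemma foldN_zero (T : Finset ℕ) : foldN st x e ω 0 T = ω := rfl

lemma foldN_succ_mem {r : ℕ} {T : Finset ℕ} (h : r ∈ T) : foldN st x e ω (r + 1) T =
    st (e r) (∑ t ∈ T with t < r, e t) (x r) (foldN st x e ω r T) := by
  rw [foldN, if_pos h]

lemma foldN_succ_not_mem {r : ℕ} {T : Finset ℕ} (h : r ∉ T) : foldN st x e ω (r + 1) T =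
    foldN st x e ω r T := by
  rw [foldN, if_neg h]

lemma foldN_congr {r : ℕ} {T : Finset ℕ} (hx : ∀ t ∈ T, t < r → x t = y t)
    (he : ∀ t ∈ T, t < r → e t = e' t) : foldN st x e ω r T = foldN st y e' ω r T := by
  induction r with
  | zero => rfl
  | succ r ih =>
    have ih := ih (fun t h h' => hx t h (by omega)) (fun t h h' => he t h (by omega))
    by_cases h : r ∈ T
    · rw [foldN_succ_mem h, foldN_succ_mem h, ih, hx r h (by omega), he r h (by omega)]
      congr 3
      refine Finset.sum_congr rfl fun t ht => ?_
      rw [Finset.mem_filter] at ht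
      exact he t ht.1 (by omega)
    · rw [foldN_succ_not_mem h, foldN_succ_not_mem h, ih]

/-- Folding over `T` is folding over an initial segment along an increasing enumeration of `T`. -/
lemma foldN_enum (f : ℕ → ℕ) {r p : ℕ} {T : Finset ℕ} (hf : ∀ s t, s < t → t < p → f s < f t)
    (hT : ∀ t, t ∈ T ∧ t < r ↔ ∃ s < p, f s = t) :
    foldN st x e ω r T = foldN st (fun t => x (f t)) (fun t => e (f t)) ω p (Finset.range p) := by
  induction r generalizing p with
  | zero =>
    cases p with
    | zero => rfl
    | succ p => exact absurd ((hT (f 0)).2 ⟨0, by omega, rfl⟩).2 (by omega)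
  | succ r ih =>
    by_cases h : r ∈ T
    · obtain ⟨s, hs, hsr⟩ := (hT r).1 ⟨h, by omega⟩
      obtain ⟨p, rfl⟩ : ∃ p', p = p' + 1 := ⟨p - 1, by omega⟩
      -- `r` is the largest element of `T` in range, so in an increasing enumeration it can only be
      -- the last one.
      have hsp : s = p := by
        by_contra hne
        have h1 := hf s p (by omega) (by omega)
        have h2 := (hT (f p)).2 ⟨p, by omega, rfl⟩
        omega
      subst hsp
      have hT' : ∀ t, t ∈ T ∧ t < r ↔ ∃ s' < s, f s' = t := by
        intro t
        constructor
        · rintro ⟨h1, h2⟩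
          obtain ⟨s', hs', rfl⟩ := (hT t).1 ⟨h1, by omega⟩
          refine ⟨s', ?_, rfl⟩
          rcases Nat.lt_or_ge s' s with h | h
          · exact h
          · obtain rfl : s' = s := by omega
            omega
        · rintro ⟨s', hs', rfl⟩
          exact ⟨((hT (f s')).2 ⟨s', by omega, rfl⟩).1, by rw [← hsr]; exact hf _ _ hs' (by omega)⟩
      have ih' := ih (p := s) (fun a b hab hb => hf a b hab (by omega)) hT'
      rw [foldN_succ_mem h, foldN_succ_mem (Finset.mem_range.2 (by omega)), hsr, ih']
      have h3 : foldN st (fun t => x (f t)) (fun t => e (f t)) ω s (Finset.range (s + 1)) =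
          foldN st (fun t => x (f t)) (fun t => e (f t)) ω s (Finset.range s) := by
        clear ih ih' hT' hsr hT hf
        have : ∀ (q : ℕ) (T T' : Finset ℕ), (∀ t < q, t ∈ T ↔ t ∈ T') →
            foldN st (fun t => x (f t)) (fun t => e (f t)) ω q T =
            foldN st (fun t => x (f t)) (fun t => e (f t)) ω q T' := by
          intro q T T' hTT
          induction q with
          | zero => rfl
          | succ q ih =>
            have ih := ih (fun t ht => hTT t (by omega))
            have hfil : T.filter (· < q) = T'.filter (· < q) := by
              ext t
              simp only [Finset.mem_filter]
              exact ⟨fun h => ⟨(hTT t (by omega)).1 h.1, h.2⟩, fun h => ⟨(hTT t (by omega)).2 h.1, h.2⟩⟩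
            by_cases hq : q ∈ T
            · rw [foldN_succ_mem hq, foldN_succ_mem ((hTT q (by omega)).1 hq), ih, hfil]
            · rw [foldN_succ_not_mem hq, foldN_succ_not_mem (fun h => hq ((hTT q (by omega)).2 h)), ih]
        exact this _ _ _ (fun t ht => by simp; omega)
      rw [h3]
      congr 3
      have himg : T.filter (· < r) = (Finset.range s).image f := by
        ext t
        simp only [Finset.mem_filter, Finset.mem_image, Finset.mem_range]
        exact hT' t
      rw [himg, Finset.sum_image]
      · refine Finset.sum_congr ?_ fun _ _ => rfl
        ext t; simp; omega
      · intro a ha b hb hab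
        simp only [Finset.coe_range, Set.mem_Iio] at ha hb
        rcases lt_trichotomy a b with h | h | h
        · exact absurd (hf a b h (by omega)) (by omega)
        · exact h
        · exact absurd (hf b a h (by omega)) (by omega)
    · rw [foldN_succ_not_mem h]
      refine ih hf fun t => ?_
      rw [← hT t]
      constructor
      · rintro ⟨h1, h2⟩; exact ⟨h1, by omega⟩
      · rintro ⟨h1, h2⟩
        refine ⟨h1, ?_⟩
        rcases Nat.lt_or_ge t r with h' | h'
        · exact h'
        · obtain rfl : t = r := by omega
          exact absurd h1 h

lemma foldN_congr_set {r : ℕ} {T T' : Finset ℕ} (hT : ∀ t < r, t ∈ T ↔ t ∈ T') :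
    foldN st x e ω r T = foldN st x e ω r T' := by
  induction r with
  | zero => rfl
  | succ q ih =>
    have ih := ih (fun t ht => hT t (by omega))
    have hfil : T.filter (· < q) = T'.filter (· < q) := by
      ext t
      simp only [Finset.mem_filter]
      exact ⟨fun h => ⟨(hT t (by omega)).1 h.1, h.2⟩, fun h => ⟨(hT t (by omega)).2 h.1, h.2⟩⟩
    by_cases hq : q ∈ T
    · rw [foldN_succ_mem hq, foldN_succ_mem ((hT q (by omega)).1 hq), ih, hfil]
    · rw [foldN_succ_not_mem hq, foldN_succ_not_mem (fun h => hq ((hT q (by omega)).2 h)), ih]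

lemma foldN_range_succ (r : ℕ) : foldN st x e ω (r + 1) (Finset.range (r + 1)) =
    st (e r) (∑ t ∈ Finset.range r, e t) (x r) (foldN st x e ω r (Finset.range r)) := by
  rw [foldN_succ_mem (Finset.mem_range.2 (by omega)),
    foldN_congr_set (T' := Finset.range r) (fun t ht => by simp; omega)]
  have : (Finset.range (r + 1)).filter (· < r) = Finset.range r := by
    ext t; simp only [Finset.mem_filter, Finset.mem_range]; omega
  rw [this]

lemma foldN_add (r : ℕ) (T : Finset ℕ) :
    foldN st x e (ω + ω') r T = foldN st x e ω r T + foldN st x e ω' r T := by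
  induction r with
  | zero => rfl
  | succ r ih => rw [foldN, foldN, foldN, ih]; split_ifs <;> simp

lemma foldN_smul (c : k) (r : ℕ) (T : Finset ℕ) :
    foldN st x e (c • ω) r T = c • foldN st x e ω r T := by
  induction r with
  | zero => rfl
  | succ r ih => rw [foldN, foldN, ih]; split_ifs <;> simp

lemma foldN_sub (r : ℕ) (T : Finset ℕ) :
    foldN st x e (ω - ω') r T = foldN st x e ω r T - foldN st x e ω' r T := by
  rw [sub_eq_add_neg, ← neg_one_smul k ω', foldN_add, foldN_smul, neg_one_smul, sub_eq_add_neg]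

lemma foldN_slot_add {r i : ℕ} {T : Finset ℕ} (hi : i ∈ T) (hir : i < r) (h : x i = y i + z i)
    (hy : ∀ t, t ≠ i → x t = y t) (hz : ∀ t, t ≠ i → x t = z t) :
    foldN st x e ω r T = foldN st y e ω r T + foldN st z e ω r T := by
  induction r with
  | zero => omega
  | succ r ih =>
    rcases eq_or_ne i r with rfl | hne
    · rw [foldN_succ_mem hi, foldN_succ_mem hi, foldN_succ_mem hi, h,
        ← foldN_congr (x := x) (y := y) (fun t _ ht => hy t (by omega)) (fun _ _ _ => rfl),
        ← foldN_congr (x := x) (y := z) (fun t _ ht => hz t (by omega)) (fun _ _ _ => rfl)]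
      simp
    · have ih := ih (by omega)
      by_cases hr : r ∈ T
      · rw [foldN_succ_mem hr, foldN_succ_mem hr, foldN_succ_mem hr, ih, ← hy r hne.symm,
          ← hz r hne.symm, map_add]
      · rw [foldN_succ_not_mem hr, foldN_succ_not_mem hr, foldN_succ_not_mem hr, ih]

lemma foldN_slot_smul {r i : ℕ} {T : Finset ℕ} (hi : i ∈ T) (hir : i < r) {c : k} (h : x i = c • y i)
    (hy : ∀ t, t ≠ i → x t = y t) :
    foldN st x e ω r T = c • foldN st y e ω r T := by
  induction r with
  | zero => omega
  | succ r ih =>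
    rcases eq_or_ne i r with rfl | hne
    · rw [foldN_succ_mem hi, foldN_succ_mem hi, h,
        ← foldN_congr (x := x) (y := y) (fun t _ ht => hy t (by omega)) (fun _ _ _ => rfl)]
      simp
    · have ih := ih (by omega)
      by_cases hr : r ∈ T
      · rw [foldN_succ_mem hr, foldN_succ_mem hr, ih, ← hy r hne.symm, map_smul]
      · rw [foldN_succ_not_mem hr, foldN_succ_not_mem hr, ih]

/-- Extend a finite family by zero. -/
def extz {X : Type*} [Zero X] {l : ℕ} (x : Fin l → X) (t : ℕ) : X := if h : t < l then x ⟨t, h⟩ else 0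

@[simp] lemma extz_coe {X : Type*} [Zero X] {l : ℕ} (x : Fin l → X) (t : Fin l) :
    extz x (t : ℕ) = x t := by simp [extz]

lemma extz_of_lt {X : Type*} [Zero X] {l : ℕ} (x : Fin l → X) {t : ℕ} (h : t < l) :
    extz x t = x ⟨t, h⟩ := by simp [extz, h]

/-- The full fold, as a multilinear map. -/
def foldMul (st : ℤ → ℤ → F →ₗ[k] Ω →ₗ[k] Ω) {l : ℕ} (e : Fin l → ℤ) (ω : Ω) :
    MultilinearMap k (fun _ : Fin l => F) Ω where
  toFun x := foldN st (extz x) (extz e) ω l (Finset.range l)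
  map_update_add' {inst} x i a b := by
    obtain rfl : inst = instDecidableEqFin l := Subsingleton.elim _ _
    have h (c : F) (t : ℕ) (ht : t ≠ i) : extz (Function.update x i c) t = extz x t := by
      by_cases htl : t < l
      · rw [extz_of_lt _ htl, extz_of_lt _ htl, Function.update_of_ne]
        exact fun h => ht (by rw [← h])
      · simp [extz, htl]
    refine foldN_slot_add (i := i) (by simp) i.2 (by simp) (fun t ht => ?_) (fun t ht => ?_)
    · rw [h _ t ht, h _ t ht]
    · rw [h _ t ht, h _ t ht]
  map_update_smul' {inst} x i c a := by
    obtain rfl : inst = instDecidableEqFin l := Subsingleton.elim _ _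
    have h (c : F) (t : ℕ) (ht : t ≠ i) : extz (Function.update x i c) t = extz x t := by
      by_cases htl : t < l
      · rw [extz_of_lt _ htl, extz_of_lt _ htl, Function.update_of_ne]
        exact fun h => ht (by rw [← h])
      · simp [extz, htl]
    refine foldN_slot_smul (i := i) (by simp) i.2 (by simp) (fun t ht => ?_)
    rw [h _ t ht, h _ t ht]

lemma foldMul_apply {l : ℕ} (e : Fin l → ℤ) (x : Fin l → F) :
    foldMul st e ω x = foldN st (extz x) (extz e) ω l (Finset.range l) := rfl

lemma foldMul_eq {l : ℕ} (x : ℕ → F) (e : ℕ → ℤ) :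
    foldMul st (fun t : Fin l => e t) ω (fun t : Fin l => x t) = foldN st x e ω l (Finset.range l) := by
  rw [foldMul_apply]
  exact foldN_congr (fun t _ h => extz_of_lt _ h) (fun t _ h => extz_of_lt _ h)

end Fold

/-! ### Multilinear maps from their values on homogeneous tuples -/

/-- A multilinear map with prescribed values on homogeneous tuples. -/
def homMul {F : GMod 𝒜} {Y : Type u} [AddCommGroup Y] [Module k Y] {l : ℕ}
    (Ψ : (Fin l → ℤ) → MultilinearMap k (fun _ : Fin l => F) Y) :
    MultilinearMap k (fun _ : Fin l => F) Y :=
  (MultilinearMap.fromDFinsuppEquiv (ι := Fin l) (fun _ => ℤ) k (M := fun _ j => F.gr j)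
    (fun e => (Ψ e).compLinearMap (fun t => (F.gr (e t)).subtype))).compLinearMap
      (fun _ => (decomp F.isInternal).toLinearMap)

/-- The signs in iterated commutators depend on the degrees of the arguments. They are therefore
defined by one multilinear map per tuple of degrees, and `homMul` assembles these over homogeneous
components into a genuine multilinear map. -/
lemma homMul_apply {F : GMod 𝒜} {Y : Type u} [AddCommGroup Y] [Module k Y] {l : ℕ}
    (Ψ : (Fin l → ℤ) → MultilinearMap k (fun _ : Fin l => F) Y) (e : Fin l → ℤ) (x : Fin l → F)
    (hx : ∀ t, x t ∈ F.gr (e t)) : homMul Ψ x = Ψ e x := by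
  rw [homMul, MultilinearMap.compLinearMap_apply]
  have : (fun t => (decomp F.isInternal).toLinearMap (x t)) =
      fun t => DFinsupp.single (β := fun j => F.gr j) (e t) ⟨x t, hx t⟩ :=
    funext fun t => decomp_of_mem F.isInternal (hx t)
  rw [this]
  erw [MultilinearMap.fromDFinsuppEquiv_single]
  rfl

/-! ### Iterated contractions and iterated brackets -/

section Brackets

variable {F G : GMod 𝒜}

open GSym

/-- One contraction step on operators with values in `Sym F^*`. -/
def ctrStep (F : GMod 𝒜) (S : Type u) [AddCommGroup S] [Module k S] (_ _ : ℤ) :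
    F →ₗ[k] (S →ₗ[k] GSym F.dual) →ₗ[k] (S →ₗ[k] GSym F.dual) :=
  LinearMap.llcomp k S (GSym F.dual) (GSym F.dual) ∘ₗ ctr F

@[simp] lemma ctrStep_apply {S : Type u} [AddCommGroup S] [Module k S] (e E : ℤ) (x : F)
    (δ : S →ₗ[k] GSym F.dual) (P : S) : ctrStep F S e E x δ P = ctr F x (δ P) := rfl

/-- One bracket step: `P ↦ (δ P) ⌟ x - (-1)^{eE} δ (P ⌟ h x)`. -/
def brStep (h : GHom F G) (e E : ℤ) :
    F →ₗ[k] (GSym G.dual →ₗ[k] GSym F.dual) →ₗ[k] (GSym G.dual →ₗ[k] GSym F.dual) :=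
  LinearMap.mk₂ k (fun x δ => ctr F x ∘ₗ δ - sg k (e * E) • (δ ∘ₗ ctr G (h.lin x)))
    (fun x y δ => by simp only [map_add, LinearMap.add_comp, LinearMap.comp_add]; module)
    (fun c x δ => by simp only [map_smul, LinearMap.smul_comp, LinearMap.comp_smul]; module)
    (fun x δ δ' => by simp only [LinearMap.add_comp, LinearMap.comp_add]; module)
    (fun c x δ => by simp only [LinearMap.smul_comp, LinearMap.comp_smul]; module)

@[simp] lemma brStep_apply (h : GHom F G) (e E : ℤ) (x : F) (δ : GSym G.dual →ₗ[k] GSym F.dual)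
    (P : GSym G.dual) :
    brStep h e E x δ P = ctr F x (δ P) - sg k (e * E) • δ (ctr G (h x) P) := rfl

/-- `δ` is a degree `n + E` skew derivation over `h^*`: `δ(PQ) = ± P δ(Q) + δ(P) (± Q)`, where the first sign is
that of an operator of degree `n` on the left, the second that of an operator of degree `E` on the
right. -/
structure IsBr (h : GHom F G) (n E : ℤ) (δ : GSym G.dual →ₗ[k] GSym F.dual) : Prop where
  skew : IsSkewDer ((tw F.dual n).comp (GSym.map h.dual)) ((tw F.dual E).comp (GSym.map h.dual)) δ
  mem_deg : ∀ {p : ℤ} {P : GSym G.dual}, P ∈ deg _ p → δ P ∈ deg _ (p + n + E)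

lemma IsBr.mul {h : GHom F G} {n E : ℤ} {δ : GSym G.dual →ₗ[k] GSym F.dual} (hδ : IsBr h n E δ)
    (P Q : GSym G.dual) : δ (P * Q) = tw _ n (GSym.map h.dual P) * δ Q +
      δ P * tw _ E (GSym.map h.dual Q) := hδ.skew P Q

lemma IsBr.tw_comm {h : GHom F G} {n E : ℤ} {δ : GSym G.dual →ₗ[k] GSym F.dual} (hδ : IsBr h n E δ)
    (m : ℤ) (P : GSym G.dual) : tw _ m (δ P) = sg k (m * (n + E)) • δ (tw _ m P) := by
  have : (tw _ m).toLinearMap ∘ₗ δ = sg k (m * (n + E)) • (δ ∘ₗ (tw _ m).toLinearMap) :=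
    lin_ext fun p P hP => by
      simp only [LinearMap.comp_apply, AlgHom.toLinearMap_apply, LinearMap.smul_apply,
        tw_of_mem m hP, tw_of_mem m (hδ.mem_deg hP), map_smul, smul_smul]
      rw [← sg_add]; congr 2; ring
  exact LinearMap.congr_fun this P

/-- In the commutator the products in which the contraction hits one factor and δ the other occur
twice and cancel, because contraction is compatible with h^* (`ctr_map`). Only the right-hand twist
grows, since contraction acts from the right. -/
lemma IsBr.brStep {h : GHom F G} {n E : ℤ} {δ : GSym G.dual →ₗ[k] GSym F.dual} (hδ : IsBr h n E δ)
    {e : ℤ} {x : F} (hx : x ∈ F.gr e) : IsBr h n (E + e) (brStep h e E x δ) where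
  skew P Q := by
    have h1 := hδ.tw_comm e Q
    have h2 : sg k (e * (n + E)) = sg k (n * e) * sg k (e * E) := by
      rw [← sg_add]; congr 1; ring
    have h3 : sg k (E * e) = sg k (e * E) := by rw [mul_comm]
    have h4 (a b : k) (X : GSym F.dual) : sg k (n * e) • a • b • X = (sg k (n * e) * a * b) • X := by
      rw [smul_smul, smul_smul, mul_assoc]
    have key : ctr F x (tw _ n (GSym.map h.dual P)) = sg k (n * e) • tw _ n (GSym.map h.dual (ctr G (h x) P)) := by
      rw [← ctr_map hx, ctr_tw hx, sg_smul_smul]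
    have key' : ctr F x (tw _ E (GSym.map h.dual Q)) = sg k (E * e) • tw _ E (GSym.map h.dual (ctr G (h x) Q)) := by
      rw [← ctr_map hx, ctr_tw hx, sg_smul_smul]
    simp only [brStep_apply, hδ.mul, ctr_mul hx, ctr_mul (h.map_mem hx), map_add, AlgHom.comp_apply,
      h1, key, key', map_tw, tw_tw, mul_smul_comm, smul_mul_assoc, h2, h3, mul_sub, sub_mul,
      add_comm e E]
    have h5 := sg_mul_self (k := k) (n * e)
    have h6 : sg k (n * e) • (sg k (n * e) * sg k (e * E)) •
      (tw _ n (GSym.map h.dual (ctr G (h x) P)) * δ (tw _ e Q)) =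
        sg k (e * E) • (tw _ n (GSym.map h.dual (ctr G (h x) P)) * δ (tw _ e Q)) := by
      rw [smul_smul, ← mul_assoc, h5, one_mul]
    rw [smul_comm, h6]
    module
  mem_deg {p P} hP := by
    rw [brStep_apply]
    refine sub_mem ?_ (Submodule.smul_mem _ _ ?_)
    · rw [← add_assoc]; exact ctr_mem_deg hx (hδ.mem_deg hP)
    · have := hδ.mem_deg (ctr_mem_deg (h.map_mem hx) hP)
      convert this using 1; ring

/-- Iterated brackets. -/
abbrev brN (h : GHom F G) (x : ℕ → F) (e : ℕ → ℤ) (δ : GSym G.dual →ₗ[k] GSym F.dual) (r : ℕ)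
    (T : Finset ℕ) : GSym G.dual →ₗ[k] GSym F.dual := foldN (brStep h) x e δ r T

/-- Iterated contractions. -/
abbrev ctrN {S : Type u} [AddCommGroup S] [Module k S] (x : ℕ → F) (e : ℕ → ℤ)
    (δ : S →ₗ[k] GSym F.dual) (r : ℕ) (T : Finset ℕ) : S →ₗ[k] GSym F.dual :=
  foldN (ctrStep F S) x e δ r T

lemma sum_filter_lt_succ_mem {r : ℕ} {T : Finset ℕ} (h : r ∈ T) (e : ℕ → ℤ) :
    ∑ t ∈ T with t < r + 1, e t = ∑ t ∈ T with t < r, e t + e r := by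
  have : T.filter (· < r + 1) = insert r (T.filter (· < r)) := by
    ext t; simp only [Finset.mem_filter, Finset.mem_insert]
    constructor
    · rintro ⟨h1, h2⟩
      rcases Nat.lt_or_ge t r with h | h
      · exact Or.inr ⟨h1, h⟩
      · exact Or.inl (by omega)
    · rintro (rfl | ⟨h1, h2⟩)
      · exact ⟨h, by omega⟩
      · exact ⟨h1, by omega⟩
  rw [this, Finset.sum_insert (by simp), add_comm]

lemma filter_lt_succ_not_mem {r : ℕ} {T : Finset ℕ} (h : r ∉ T) :
    T.filter (· < r + 1) = T.filter (· < r) := by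
  ext t; simp only [Finset.mem_filter]
  constructor
  · rintro ⟨h1, h2⟩
    refine ⟨h1, ?_⟩
    rcases Nat.lt_or_ge t r with h' | h'
    · exact h'
    · obtain rfl : t = r := by omega
      exact absurd h1 h
  · rintro ⟨h1, h2⟩; exact ⟨h1, by omega⟩

lemma IsBr.brN {h : GHom F G} {n : ℤ} {δ : GSym G.dual →ₗ[k] GSym F.dual} (hδ : IsBr h n 0 δ)
    {x : ℕ → F} {e : ℕ → ℤ} (hx : ∀ t, x t ∈ F.gr (e t)) (r : ℕ) (T : Finset ℕ) :
    IsBr h n (∑ t ∈ T with t < r, e t) (brN h x e δ r T) := by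
  induction r with
  | zero => simpa using hδ
  | succ r ih =>
    by_cases hr : r ∈ T
    · rw [SHLR.brN, foldN_succ_mem hr, sum_filter_lt_succ_mem hr]
      exact ih.brStep (hx r)
    · rw [SHLR.brN, foldN_succ_not_mem hr, filter_lt_succ_not_mem hr]
      exact ih

/-- Graded Jacobi identity for δ and two contractions: as contractions commute up to sign, so do the
commutators with them. The graded symmetry of anchors and brackets rests on this. -/
lemma brStep_brStep {x y : F} {e e' : ℤ} (hx : x ∈ F.gr e) (hy : y ∈ F.gr e') (h : GHom F G) (E : ℤ)
    (δ : GSym G.dual →ₗ[k] GSym F.dual) :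
    brStep h e' (E + e) y (brStep h e E x δ) =
      sg k (e * e') • brStep h e (E + e') x (brStep h e' E y δ) := by
  refine LinearMap.ext fun P => ?_
  simp only [brStep_apply, LinearMap.smul_apply, map_sub, map_smul,
    ctr_ctr hx hy, ctr_ctr (h.map_mem hx) (h.map_mem hy), mul_add, sg_add]
  have h1 := sg_mul_self (k := k) (e * e')
  rw [mul_comm e' e]
  simp only [smul_sub, smul_smul]
  have h2 : sg k (e * e') * (sg k (e * E) * sg k (e * e')) = sg k (e * E) := by
    rw [mul_left_comm, h1, mul_one]
  have h3 : sg k (e' * E) * sg k (e * e') * sg k (e * E) * sg k (e * e') = sg k (e' * E) * sg k (e * E) := by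
    linear_combination (sg k (e' * E) * sg k (e * E)) * h1
  simp only [h2, ← mul_assoc, h1, one_mul]
  simp only [mul_assoc, mul_left_comm _ (sg k (e * e')), h1, mul_one]
  simp only [mul_comm (sg k (e * e')), mul_assoc, h1, mul_one]
  module

/-- Contractions kill coefficients, so the subtracted half of each commutator vanishes. -/
lemma brN_coeff {h : GHom F G} {δ : GSym G.dual →ₗ[k] GSym F.dual} (x : ℕ → F) (e : ℕ → ℤ) (r : ℕ)
    (T : Finset ℕ) (a : A) :
    brN h x e δ r T (coeff _ a) = ctrN x e δ r T (coeff _ a) := by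
  induction r with
  | zero => rfl
  | succ r ih =>
    by_cases hr : r ∈ T
    · rw [brN, foldN_succ_mem hr, ctrN, foldN_succ_mem hr, brStep_apply, ctrStep_apply, ih, ctr_coeff,
        map_zero, smul_zero, sub_zero]
    · rw [brN, foldN_succ_not_mem hr, ctrN, foldN_succ_not_mem hr, ih]

lemma ctrN_apply {S : Type u} [AddCommGroup S] [Module k S] (x : ℕ → F) (e : ℕ → ℤ)
    (δ : S →ₗ[k] GSym F.dual) (r : ℕ) (T : Finset ℕ) (s : S) :
    ctrN x e δ r T s = ctrN x e LinearMap.id r T (δ s) := by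
  induction r with
  | zero => rfl
  | succ r ih =>
    by_cases hr : r ∈ T
    · rw [ctrN, foldN_succ_mem hr, ctrN, foldN_succ_mem hr, ctrStep_apply, ctrStep_apply, ih]
    · rw [ctrN, foldN_succ_not_mem hr, ctrN, foldN_succ_not_mem hr, ih]

/-- Iterated contractions of `δ ω`, in terms of iterated brackets. -/
lemma ctrN_gen {h : GHom F G} {δ : GSym G.dual →ₗ[k] GSym F.dual} (x : ℕ → F) (e : ℕ → ℤ) (r : ℕ)
    (T : Finset ℕ) (ω : G.dual) :
    ctrN x e δ r T (gen _ ω) = brN h x e δ r T (gen _ ω) +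
      ∑ i ∈ T with i < r, sg k (e i * ∑ t ∈ T with t < i, e t) •
        ctrN x e δ r (T.erase i) (coeff _ (evalDual ω (h (x i)))) := by
  induction r with
  | zero => simp
  | succ r ih =>
    by_cases hr : r ∈ T
    · have h1 : T.filter (· < r + 1) = insert r (T.filter (· < r)) := by
        ext t; simp only [Finset.mem_filter, Finset.mem_insert]
        constructor
        · rintro ⟨h1, h2⟩
          rcases Nat.lt_or_ge t r with h | h
          · exact Or.inr ⟨h1, h⟩
          · exact Or.inl (by omega)
        · rintro (rfl | ⟨h1, h2⟩)
          · exact ⟨hr, by omega⟩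
          · exact ⟨h1, by omega⟩
      -- The last commutator subtracts the value of the previous bracket at ω⌟h x_r, which is the
      -- coefficient ω(h x_r). Adding it back is the new summand `i = r`; the older summands merely
      -- receive one more contraction.
      rw [ctrN, foldN_succ_mem hr, brN, foldN_succ_mem hr, h1, Finset.sum_insert (by simp),
        ctrStep_apply, brStep_apply, ih, map_add, map_sum, ctr_gen, brN_coeff]
      have h3 : ctrN x e δ (r + 1) (T.erase r) = ctrN x e δ r T := by
        rw [ctrN, foldN_succ_not_mem (by simp : r ∉ T.erase r)]
        exact foldN_congr_set (fun t ht => by simp; omega)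
      rw [h3]
      have h2 : ∀ i ∈ T.filter (· < r), ctr F (x r) (sg k (e i * ∑ t ∈ T with t < i, e t) •
          ctrN x e δ r (T.erase i) (coeff _ (evalDual ω (h (x i))))) =
          sg k (e i * ∑ t ∈ T with t < i, e t) •
          ctrN x e δ (r + 1) (T.erase i) (coeff _ (evalDual ω (h (x i)))) := by
        intro i hi
        rw [Finset.mem_filter] at hi
        rw [map_smul, ctrN, ctrN, foldN_succ_mem (T := T.erase i), ctrStep_apply]
        exact Finset.mem_erase.2 ⟨by omega, hr⟩
      rw [Finset.sum_congr rfl h2]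
      abel
    · rw [ctrN, foldN_succ_not_mem hr, brN, foldN_succ_not_mem hr, filter_lt_succ_not_mem hr, ih]
      congr 1
      refine Finset.sum_congr rfl fun i _ => ?_
      rw [ctrN, ctrN, foldN_succ_not_mem (T := T.erase i)]
      exact fun h => hr (Finset.mem_of_mem_erase h)

/-- Each commutator costs one weight, through the contraction applied after δ. -/
lemma brN_fil {h : GHom F G} {x : ℕ → F} {e : ℕ → ℤ}
    (hx : ∀ t, x t ∈ F.gr (e t)) {δ : GSym G.dual →ₗ[k] GSym F.dual} {m : ℕ} {r : ℕ}
    (hδ : ∀ P, δ P ∈ fil F.dual (m + r)) (T : Finset ℕ) (P : GSym G.dual) :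
    brN h x e δ r T P ∈ fil F.dual m := by
  induction r generalizing m P with
  | zero => exact hδ P
  | succ r ih =>
    have := ih (m := m + 1) (by rwa [add_assoc, add_comm 1 r])
    by_cases hr : r ∈ T
    · rw [brN, foldN_succ_mem hr, brStep_apply]
      exact sub_mem (ctr_fil (hx r) (this _))
        (Submodule.smul_mem _ _ (fil_anti (by omega) (this _)))
    · rw [brN, foldN_succ_not_mem hr]
      exact fil_anti (by omega) (this _)

end Brackets

end SHLR
end

/-! ### Dual bases, and reconstruction of elements of Sym(F^*) from their evaluations. -/

noncomputable section
namespace SHLR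

variable {k A : Type u} [Field k] [Ring A] [Algebra k A] {𝒜 : ℤ → Submodule k A}
  [GradedAlgebra 𝒜] [IsGradedComm 𝒜]

/-! ### Homogeneous bases and dual bases -/

lemma mul_eq_twA_mul {p : ℤ} {a : A} (ha : a ∈ 𝒜 p) (c : A) : a * c = twA 𝒜 p c * a := by
  have : LinearMap.mulLeft k a = LinearMap.mulRight k a ∘ₗ (twA 𝒜 p).toLinearMap :=
    lin_ext_alg 𝒜 fun q c hc => by
      simp [twA_of_mem p hc, IsGradedComm.comm ha hc, negOnePow_smul (k := k)]
  exact LinearMap.congr_fun this c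

lemma evalDual_smul_tw {F : GMod 𝒜} {n : ℤ} {φ : F.dual} (hφ : φ ∈ F.dual.gr n) (a : A) (x : F) :
    evalDual φ (a • x) = twA 𝒜 n a * evalDual φ x := by
  have : DualType.val F φ ∘ₗ (LinearMap.toSpanSingleton A F x).restrictScalars k =
      LinearMap.mulRight k (evalDual φ x) ∘ₗ (twA 𝒜 n).toLinearMap := lin_ext_alg 𝒜 fun q c hc => by
    have := evalDual_smul_right hφ hc x
    simp only [LinearMap.comp_apply, LinearMap.mulRight_apply, AlgHom.toLinearMap_apply,
      twA_of_mem n hc, smul_mul_assoc]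
    exact this
  exact LinearMap.congr_fun this a

/-- A finite homogeneous basis together with its dual basis. -/
structure HBasis (F : GMod 𝒜) where
  n : ℕ
  b : Fin n → F
  d : Fin n → ℤ
  β : Fin n → F.dual
  b_mem : ∀ r, b r ∈ F.gr (d r)
  β_mem : ∀ r, β r ∈ F.dual.gr (-d r)
  eval : ∀ r s, evalDual (β r) (b s) = if r = s then 1 else 0
  expand_dual : ∀ φ : F.dual, φ = ∑ r, evalDual φ (b r) • β r
  expand : ∀ x : F, x = ∑ r, twA 𝒜 (d r) (evalDual (β r) x) • b r

/-- Projecting the expansion of `x` to degree `i` replaces each coordinate by its component of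
degree `i - e s`; uniqueness of coordinates shows that nothing has changed. -/
lemma repr_mem {F : GMod 𝒜} {n : ℕ} (b : Module.Basis (Fin n) A F) {e : Fin n → ℤ}
    (hb : ∀ i, b i ∈ F.gr (e i)) {i : ℤ} {x : F} (hx : x ∈ F.gr i) (s : Fin n) :
    b.repr x s ∈ 𝒜 (i - e s) := by
  have key (s : Fin n) : component F.isInternal i ∘ₗ
      (LinearMap.toSpanSingleton A F (b s)).restrictScalars k =
      (LinearMap.toSpanSingleton A F (b s)).restrictScalars k ∘ₗ
        component (isInternal_alg 𝒜) (i - e s) := lin_ext_alg 𝒜 fun p a ha => by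
    simp only [LinearMap.comp_apply, LinearMap.restrictScalars_apply,
      LinearMap.toSpanSingleton_apply, component_of_mem F.isInternal (F.smul_mem ha (hb s)),
      component_of_mem (isInternal_alg 𝒜) ha]
    by_cases h : i = p + e s
    · rw [if_pos h, if_pos (by lia)]
    · rw [if_neg h, if_neg (by lia), zero_smul]
  have h1 : x = ∑ s, component (isInternal_alg 𝒜) (i - e s) (b.repr x s) • b s := by
    conv_lhs => rw [← if_pos (c := i = i) (t := x) (e := 0) rfl, ← component_of_mem F.isInternal hx,
      ← b.sum_repr x, map_sum]
    exact Finset.sum_congr rfl fun s _ => LinearMap.congr_fun (key s) (b.repr x s)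
  rw [h1, b.repr_sum_self]
  exact component_mem _ _ _

/-- A coordinate function commutes with scalars without sign, whereas an element of F^* of degree -d
must produce the sign (-1)^{d|a|}. Twisting the coordinate by the parity of d repairs this, which is
why `twA` enters `HBasis.expand`. -/
lemma exists_hbasis {F : GMod 𝒜} (hF : F.IsFinite) : Nonempty (HBasis F) := by
  obtain ⟨n, b, e, hb⟩ := hF
  have hmem (r : Fin n) : (twA 𝒜 (e r)).toLinearMap ∘ₗ (b.coord r).restrictScalars k ∈
      homDeg F (-e r) := by
    refine ⟨fun i x hx => ?_, fun j a x ha => ?_⟩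
    · have := twA_mem (e r) (repr_mem b hb hx r)
      rw [neg_add_eq_sub]
      exact this
    · simp only [LinearMap.comp_apply, LinearMap.restrictScalars_apply, map_smul, smul_eq_mul,
        AlgHom.toLinearMap_apply, map_mul, twA_of_mem (e r) ha, smul_mul_assoc]
      rw [negOnePow_smul (k := k)]
      congr 1
      exact sg_congr (by push_cast; grind)
  let β (r : Fin n) : F.dual := DualType.mk _ (Submodule.mem_iSup_of_mem (-e r) (hmem r))
  have hβ (r : Fin n) (x : F) : evalDual (β r) x = twA 𝒜 (e r) (b.repr x r) := rfl
  have expand (x : F) : x = ∑ r, twA 𝒜 (e r) (evalDual (β r) x) • b r := by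
    simp only [hβ, twA_self, b.sum_repr]
  refine ⟨n, b, e, β, hb, hmem, fun r s => ?_, fun φ => ?_, expand⟩
  · rw [hβ, b.repr_self, Finsupp.single_apply]
    split_ifs with h1 h2 h2
    · simp
    · exact absurd h1.symm h2
    · exact absurd h2.symm h1
    · simp
  · refine dual_ext fun x => ?_
    have : evalAt x = ∑ r, LinearMap.mulRight k (evalDual (β r) x) ∘ₗ evalAt (b r) := by
      refine GMod.lin_ext fun p φ hφ => ?_
      simp only [evalAt_apply, LinearMap.coe_sum, Finset.sum_apply, LinearMap.comp_apply,
        LinearMap.mulRight_apply]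
      conv_lhs => rw [← b.sum_repr x]
      rw [evalDual_sum]
      refine Finset.sum_congr rfl fun r _ => ?_
      rw [evalDual_smul_tw hφ, hβ, mul_eq_twA_mul (evalDual_mem hφ (hb r)), twA_twA,
        twA_congr (m := p + e r + e r) (n := p) (by push_cast; grind)]
    have h2 := LinearMap.congr_fun this φ
    simp only [LinearMap.coe_sum, Finset.sum_apply, LinearMap.comp_apply, evalAt_apply,
      LinearMap.mulRight_apply] at h2
    rw [h2, ← evalAt_apply x (∑ r, _), map_sum]
    rfl

namespace HBasis

open GSym

variable {F : GMod 𝒜} (B : HBasis F)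

/-- Evaluation of (the appropriate weight component of) `P` on a word in the basis. -/
def evW : List (Fin B.n) → GSym F.dual →ₗ[k] A
  | [] => (aug F.dual).toLinearMap
  | r :: w => evW w ∘ₗ ctr F (B.b r)

/-- Euler's formula: contracting with b_r and multiplying back by β_r, summed over r, acts on weight
j as multiplication by j. Under right multiplication by φ the operator gains one copy of Pφ from
contracting φ itself; in the other term the sign of the contraction cancels that of moving φ past
β_r. -/
lemma pr_succ_euler (j : ℕ) (P : GSym F.dual) :
    pr _ j (∑ r, ctr F (B.b r) P * gen _ (B.β r)) = (j : k) • pr _ j P := by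
  let E : GSym F.dual →ₗ[k] GSym F.dual :=
    ∑ r, LinearMap.mulRight k (gen _ (B.β r)) ∘ₗ ctr F (B.b r)
  have hE (P) : E P = ∑ r, ctr F (B.b r) P * gen _ (B.β r) := by simp [E]
  have : pr _ j ∘ₗ E = (j : k) • pr _ j := lin_ext fun p P hP =>
    deg_induction (C := fun _ P => ∀ j, pr _ j (E P) = (j : k) • pr _ j P)
      (fun p a _ j => by rw [hE]; by_cases hj : j = 0 <;> simp [pr_coeff, hj])
      (fun p q P v _ hP hv j => by
        have h1 : E (P * gen _ v) = P * gen _ v + E P * gen _ v := by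
          rw [hE, hE, Finset.sum_mul]
          have h0 : P * gen _ v = ∑ r, P * gen _ (evalDual v (B.b r) • B.β r) := by
            conv_lhs => rw [B.expand_dual v]
            rw [map_sum, Finset.mul_sum]
          conv_rhs => rw [h0]
          rw [← Finset.sum_add_distrib]
          refine Finset.sum_congr rfl fun r _ => ?_
          rw [ctr_mul_gen (B.b_mem r) hv, add_mul, mul_assoc, coeff_mul_gen,
            smul_mul_assoc, mul_assoc, gen_mul_gen hv (B.β_mem r), negOnePow_smul (k := k),
            mul_smul_comm, smul_smul, ← sg_add, sg_congr (n := 0) (by push_cast; grind), sg_zero,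
            one_smul, mul_assoc]
        rw [h1, map_add]
        cases j with
        | zero => simp [pr_zero_mul_gen]
        | succ j => rw [pr_succ_mul_gen, pr_succ_mul_gen, hP]; simp [add_smul]; abel)
      (fun p j => by simp) (fun p P Q h1 h2 j => by simp only [map_add, h1, h2, smul_add])
      (fun p c P h j => by rw [map_smul, map_smul, map_smul, h, smul_comm]) hP j
  have := LinearMap.congr_fun this P
  simpa [hE] using this

/-- By induction the contractions P⌟b_r have high weight. Euler's formula expresses (j+1) times the
component of weight j+1 through them, and j+1 is invertible in characteristic zero. -/
lemma mem_fil_of_evW [CharZero k] {m : ℕ} {P : GSym F.dual}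
    (h : ∀ w : List (Fin B.n), w.length < m → B.evW w P = 0) : P ∈ fil F.dual m := by
  induction m generalizing P with
  | zero => exact fil_zero P
  | succ m ih =>
    have h1 (r) : ctr F (B.b r) P ∈ fil F.dual m := ih fun w hw => h (r :: w) (by simpa using hw)
    rw [mem_fil]
    intro j hj
    cases j with
    | zero =>
      have := h [] (by simp)
      rw [pr_zero_eq]
      simp only [evW, AlgHom.toLinearMap_apply] at this
      rw [this, map_zero]
    | succ j =>
      have h2 : pr _ (j + 1) (∑ r, ctr F (B.b r) P * gen _ (B.β r)) = 0 := by
        rw [map_sum]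
        refine Finset.sum_eq_zero fun r _ => ?_
        rw [pr_succ_mul_gen, mem_fil.1 (h1 r) j (by omega), zero_mul]
      rw [pr_succ_euler] at h2
      exact (smul_eq_zero.1 h2).resolve_left (by exact_mod_cast Nat.succ_ne_zero j)

/-- Total degree of a word. -/
def wdeg (w : List (Fin B.n)) : ℤ := (w.map B.d).sum

@[simp] lemma wdeg_cons (r : Fin B.n) (w : List (Fin B.n)) : B.wdeg (r :: w) = B.d r + B.wdeg w := by
  simp [wdeg]

@[simp] lemma wdeg_nil : B.wdeg [] = 0 := rfl

/-- Graded symmetry of a function on words. -/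
def SymW (T : List (Fin B.n) → A) (j : ℕ) : Prop :=
  ∀ l r s l', (l ++ r :: s :: l').length = j →
    T (l ++ r :: s :: l') = sg k (B.d r * B.d s) • T (l ++ s :: r :: l')

lemma SymW.cons {T : List (Fin B.n) → A} {j : ℕ} (h : B.SymW T (j + 1)) (r : Fin B.n) :
    B.SymW (fun w => T (r :: w)) j := fun l s t l' hl => h (r :: l) s t l' (by simpa using hl)

/-- The element of `Sym^j F^*` with prescribed evaluations on words of length `j`. -/
def elt : ℕ → (List (Fin B.n) → A) → GSym F.dual
  | 0, T => coeff _ (T [])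
  | j + 1, T => ((j + 1 : ℕ) : k)⁻¹ • ∑ r, elt j (fun w => T (r :: w)) * gen _ (B.β r)

lemma elt_congr {j : ℕ} {T T' : List (Fin B.n) → A} (h : ∀ w, w.length = j → T w = T' w) :
    B.elt j T = B.elt j T' := by
  induction j generalizing T T' with
  | zero => rw [elt, elt, h [] rfl]
  | succ j ih =>
    rw [elt, elt]
    congr 1
    refine Finset.sum_congr rfl fun r _ => ?_
    rw [ih fun w hw => h (r :: w) (by simpa using hw)]

lemma elt_smul (c : k) (j : ℕ) (T : List (Fin B.n) → A) :
    B.elt j (fun w => c • T w) = c • B.elt j T := by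
  induction j generalizing T with
  | zero => rw [elt, elt, map_smul]
  | succ j ih => simp only [elt, ih, smul_mul_assoc, ← Finset.smul_sum]; rw [smul_comm]

lemma elt_add (j : ℕ) (T T' : List (Fin B.n) → A) :
    B.elt j (fun w => T w + T' w) = B.elt j T + B.elt j T' := by
  induction j generalizing T T' with
  | zero => rw [elt, elt, elt, map_add]
  | succ j ih => simp only [elt, ih, add_mul, Finset.sum_add_distrib, smul_add]

lemma elt_mul_left (j : ℕ) (a : A) (T : List (Fin B.n) → A) :
    B.elt j (fun w => a * T w) = coeff _ a * B.elt j T := by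
  induction j generalizing T with
  | zero => rw [elt, elt, coeff_mul]
  | succ j ih => simp only [elt, ih, mul_assoc, ← Finset.mul_sum, mul_smul_comm]

/-- Moving `a` to the left past the dual basis elements of a word costs the parity of the degree of
that word. -/
lemma elt_mul_right (j : ℕ) (a : A) (T : List (Fin B.n) → A) :
    B.elt j (fun w => T w * twA 𝒜 (B.wdeg w) a) = B.elt j T * coeff _ a := by
  induction j generalizing T a with
  | zero => rw [elt, elt, coeff_mul, wdeg_nil, twA_zero]
  | succ j ih =>
    simp only [elt, smul_mul_assoc, Finset.sum_mul]
    congr 1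
    refine Finset.sum_congr rfl fun r _ => ?_
    have h1 : gen F.dual (B.β r) * coeff _ a = coeff _ (twA 𝒜 (B.d r) a) * gen _ (B.β r) := by
      have : LinearMap.mulLeft k (gen F.dual (B.β r)) ∘ₗ coeff _ =
          LinearMap.mulRight k (gen F.dual (B.β r)) ∘ₗ coeff _ ∘ₗ (twA 𝒜 (B.d r)).toLinearMap :=
        lin_ext_alg 𝒜 fun p a ha => by
          simp only [LinearMap.comp_apply, LinearMap.mulLeft_apply, LinearMap.mulRight_apply,
            AlgHom.toLinearMap_apply, twA_of_mem _ ha, gen_mul_coeff ha (B.β_mem r), map_smul,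
            smul_mul_assoc, negOnePow_smul (k := k)]
          rw [sg_congr (n := B.d r * p) (by push_cast; grind)]
      exact LinearMap.congr_fun this a
    rw [mul_assoc, h1, ← mul_assoc, ← ih]
    congr 2
    funext w
    rw [wdeg_cons, twA_twA, add_comm]

lemma elt_mem_wt (j : ℕ) (T : List (Fin B.n) → A) : B.elt j T ∈ wt F.dual j := by
  induction j generalizing T with
  | zero => exact coeff_mem_wt _
  | succ j ih =>
    exact Submodule.smul_mem _ _ (Submodule.sum_mem _ fun r _ => wt_mul_gen (ih _) _)

lemma elt_mem_deg {j : ℕ} {T : List (Fin B.n) → A} {p : ℤ}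
    (hT : ∀ w, w.length = j → T w ∈ 𝒜 (p + B.wdeg w)) : B.elt j T ∈ deg F.dual p := by
  induction j generalizing T p with
  | zero => exact coeff_mem_deg (by simpa using hT [] rfl)
  | succ j ih =>
    refine Submodule.smul_mem _ _ (Submodule.sum_mem _ fun r _ => ?_)
    have := deg_mul_gen (ih (T := fun w => T (r :: w)) (p := p + B.d r) fun w hw => by
      have := hT (r :: w) (by simpa using hw)
      rwa [wdeg_cons, ← add_assoc] at this) (B.β_mem r)
    simpa using this

/-- For j ≥ 1, contracting the last factor of the defining sum gives one copy of the answer, and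
contracting the earlier ones gives j more, because graded symmetry brings the letter `c` to the
front of each word. The total of j+1 copies cancels the normalising factor of `elt`. -/
lemma ctr_elt [CharZero k] {j : ℕ} {T : List (Fin B.n) → A} (hT : B.SymW T (j + 1)) (c : Fin B.n) :
    ctr F (B.b c) (B.elt (j + 1) T) = B.elt j (fun w => T (c :: w)) := by
  induction j generalizing T c with
  | zero =>
    simp only [elt, map_smul, map_sum, ctr_mul_gen (B.b_mem c) (B.β_mem _), ctr_coeff, zero_mul,
      smul_zero, add_zero, B.eval, coeff_mul, mul_ite, mul_one, mul_zero, apply_ite (coeff F.dual),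
      map_zero, Finset.sum_ite_eq', Finset.mem_univ, if_true]
    simp
  | succ j ih =>
    have h1 (r : Fin B.n) : ctr F (B.b c) (B.elt (j + 1) (fun w => T (r :: w))) =
        sg k (B.d r * B.d c) • B.elt j (fun w => T (c :: r :: w)) := by
      rw [ih (hT.cons B r), ← elt_smul]
      exact B.elt_congr fun w hw => hT [] r c w (by simp [hw])
    have h2 : ((j + 1 + 1 : ℕ) : k) ≠ 0 := by exact_mod_cast Nat.succ_ne_zero (j + 1)
    have h3 : ((j + 1 : ℕ) : k) ≠ 0 := by exact_mod_cast Nat.succ_ne_zero j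
    rw [elt, map_smul, inv_smul_eq_iff₀ h2, map_sum]
    simp only [ctr_mul_gen (B.b_mem c) (B.β_mem _), Finset.sum_add_distrib, h1, B.eval]
    have h4 : ∀ r, sg k (B.d c * -B.d r) • (sg k (B.d r * B.d c) •
        B.elt j (fun w => T (c :: r :: w)) * gen F.dual (B.β r)) =
        B.elt j (fun w => T (c :: r :: w)) * gen F.dual (B.β r) := by
      intro r
      rw [smul_mul_assoc, smul_smul, ← sg_add, sg_congr (n := 0) (by push_cast; grind), sg_zero,
        one_smul]
    simp only [h4]
    have h5 : ∑ r, B.elt j (fun w => T (c :: r :: w)) * gen F.dual (B.β r) =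
        ((j + 1 : ℕ) : k) • B.elt (j + 1) (fun w => T (c :: w)) := by
      rw [elt, smul_inv_smul₀ h3]
    rw [h5]
    simp only [apply_ite (coeff F.dual), coeff_one, map_zero, mul_ite, mul_one, mul_zero,
      Finset.sum_ite_eq', Finset.mem_univ, if_true]
    push_cast
    module

lemma evW_coeff_cons (r : Fin B.n) (w : List (Fin B.n)) (a : A) : B.evW (r :: w) (coeff _ a) = 0 := by
  simp [evW]

lemma evW_elt [CharZero k] {j : ℕ} {T : List (Fin B.n) → A} (hT : B.SymW T j) (w : List (Fin B.n)) :
    B.evW w (B.elt j T) = if w.length = j then T w else 0 := by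
  induction w generalizing j T with
  | nil =>
    rw [evW, AlgHom.toLinearMap_apply]
    cases j with
    | zero => simp [elt]
    | succ j => rw [aug_of_wt (by omega) (B.elt_mem_wt _ T)]; simp
  | cons r w ih =>
    cases j with
    | zero => rw [elt, evW_coeff_cons]; simp
    | succ j =>
      rw [evW, LinearMap.comp_apply, B.ctr_elt hT, ih (hT.cons B r)]
      simp

end HBasis

section Front

variable {F : GMod 𝒜} {S : Type u} [AddCommGroup S] [Module k S]

/-- Contraction steps ignore the recorded degrees, hence the arbitrary `e'`; peeling off the first
letter matches the recursion of `evW`. -/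
lemma ctrN_front (x : ℕ → F) (e e' : ℕ → ℤ) (δ : S →ₗ[k] GSym F.dual) (r : ℕ) :
    ctrN x e δ (r + 1) (Finset.range (r + 1)) =
      ctrN (fun t => x (t + 1)) e' (ctr F (x 0) ∘ₗ δ) r (Finset.range r) := by
  induction r with
  | zero => rw [ctrN, foldN_range_succ]; rfl
  | succ r ih =>
    have h (x : ℕ → F) (e : ℕ → ℤ) (δ : S →ₗ[k] GSym F.dual) (r : ℕ) :
        ctrN x e δ (r + 1) (Finset.range (r + 1)) = ctr F (x r) ∘ₗ ctrN x e δ r (Finset.range r) :=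
      foldN_range_succ r
    rw [h, ih, h (fun t => x (t + 1))]

lemma HBasis.evW_eq (B : HBasis F) (w : List (Fin B.n)) (e : ℕ → ℤ) (P : GSym F.dual) :
    B.evW w P = GSym.aug _ (ctrN (fun t => (w.map B.b).getD t 0) e LinearMap.id w.length
      (Finset.range w.length) P) := by
  induction w generalizing P with
  | nil => rfl
  | cons r w ih =>
    rw [HBasis.evW, LinearMap.comp_apply, ih, List.length_cons, ctrN_front _ e e, ctrN_apply]
    conv_rhs => rw [ctrN_apply]
    rfl

end Front

end SHLR
end

/-! ### Koszul signs, and evaluation functionals as iterated contractions. -/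

noncomputable section
namespace SHLR

/-! ### Koszul signs -/

section Koszul

/-- Collects the factors of an unordered pair, so that identities between Koszul signs can be
checked one pair at a time. -/
lemma prod_prod_eq_prod_lt {n : ℕ} {H : Type*} [CommMonoid H] (g : Fin n → Fin n → H)
    (hg : ∀ s, g s s = 1) :
    ∏ s, ∏ t, g s t = ∏ s, ∏ t, if s < t then g s t * g t s else 1 := by
  have h1 : ∀ s t, g s t = (if s < t then g s t else 1) * (if t < s then g s t else 1) := by
    intro s t
    rcases lt_trichotomy s t with h | h | h
    · simp [h, h.le, not_lt_of_gt h]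
    · subst h; simp [hg]
    · simp [h, not_lt_of_gt h]
  have h2 : ∀ s t, (if s < t then g s t * g t s else 1) =
      (if s < t then g s t else 1) * (if s < t then g t s else 1) := by
    intro s t; split_ifs <;> simp
  simp_rw [h2, Finset.prod_mul_distrib]
  conv_lhs => enter [2, s, 2, t]; rw [h1]
  simp_rw [Finset.prod_mul_distrib]
  congr 1
  rw [Finset.prod_comm]

/-- A pair is inverted by the composite exactly when one but not both of the two permutations invert
it; if both do, two equal signs cancel. -/
lemma koszul_mul {n : ℕ} (π ρ : Equiv.Perm (Fin n)) (e : Fin n → ℤ) :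
    koszul (π * ρ) e = koszul π e * koszul ρ (fun t => e (π t)) := by
  have h1 : koszul π e = ∏ s, ∏ t, if ρ s < ρ t ∧ π (ρ t) < π (ρ s) then
      (e (π (ρ s)) * e (π (ρ t))).negOnePow else 1 := by
    rw [koszul, ← Equiv.prod_comp ρ]
    exact Finset.prod_congr rfl fun s _ => by rw [← Equiv.prod_comp ρ]
  rw [h1, koszul, koszul, prod_prod_eq_prod_lt, prod_prod_eq_prod_lt (fun s t => if ρ s < ρ t ∧ _ then _ else _),
    prod_prod_eq_prod_lt (fun s t => if s < t ∧ ρ t < ρ s then _ else _), ← Finset.prod_mul_distrib]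
  · refine Finset.prod_congr rfl fun s _ => ?_
    rw [← Finset.prod_mul_distrib]
    refine Finset.prod_congr rfl fun t _ => ?_
    by_cases hst : s < t
    · have h2 : ¬ t < s := not_lt_of_gt hst
      have h3 : ρ s ≠ ρ t := fun h => hst.ne (ρ.injective h)
      have h4 : π (ρ s) ≠ π (ρ t) := fun h => h3 (π.injective h)
      simp only [hst, h2, true_and, false_and, if_true, if_false, mul_one, Equiv.Perm.mul_apply]
      rcases lt_or_gt_of_ne h3 with h5 | h5 <;> rcases lt_or_gt_of_ne h4 with h6 | h6 <;>
        simp [h5, h6, not_lt_of_gt h5, not_lt_of_gt h6, mul_comm (e (π (ρ t)))]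
    · simp [hst]
  · intro s; simp
  · intro s; simp
  · intro s; simp

lemma koszul_one {n : ℕ} (e : Fin n → ℤ) : koszul 1 e = 1 := by
  rw [koszul]
  refine Finset.prod_eq_one fun s _ => Finset.prod_eq_one fun t _ => ?_
  rw [if_neg]
  rintro ⟨h1, h2⟩
  exact absurd h2 (not_lt_of_gt h1)

lemma koszul_swap {n : ℕ} (i : Fin n) (e : Fin (n + 1) → ℤ) :
    koszul (Equiv.swap i.castSucc i.succ) e = (e i.castSucc * e i.succ).negOnePow := by
  have hlt : i.castSucc < i.succ := Fin.castSucc_lt_succ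
  rw [koszul, Finset.prod_eq_single i.castSucc, Finset.prod_eq_single i.succ]
  · simp [mul_comm]
  · intro t _ ht
    rw [if_neg]
    rintro ⟨h1, h2⟩
    rw [Equiv.swap_apply_left, Equiv.swap_apply_of_ne_of_ne h1.ne' ht] at h2
    rw [Fin.lt_def] at h1 h2
    simp only [Fin.val_castSucc, Fin.val_succ] at h1 h2
    exact ht (Fin.ext (by simp; omega))
  · simp
  · intro s _ hs
    refine Finset.prod_eq_one fun t _ => if_neg ?_
    rintro ⟨h1, h2⟩
    by_cases hs' : s = i.succ
    · subst hs'
      rw [Equiv.swap_apply_right, Equiv.swap_apply_of_ne_of_ne (hlt.trans h1).ne' h1.ne'] at h2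
      exact absurd h2 (not_lt_of_gt (hlt.trans h1))
    · rw [Equiv.swap_apply_of_ne_of_ne hs hs'] at h2
      rcases eq_or_ne t i.castSucc with rfl | ht
      · rw [Equiv.swap_apply_left] at h2
        exact absurd (h1.trans hlt) (not_lt_of_gt h2)
      · rcases eq_or_ne t i.succ with rfl | ht'
        · rw [Equiv.swap_apply_right] at h2
          rw [Fin.lt_def] at h1 h2
          simp only [Fin.val_castSucc, Fin.val_succ] at h1 h2
          omega
        · rw [Equiv.swap_apply_of_ne_of_ne ht ht'] at h2
          exact absurd h2 (not_lt_of_gt h1)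
  · simp

lemma koszul_finRotate {n : ℕ} (e : Fin (n + 1) → ℤ) :
    koszul (finRotate (n + 1)) e = (e 0 * ∑ t : Fin n, e t.succ).negOnePow := by
  have h1 (t : Fin n) : finRotate (n + 1) t.castSucc = t.succ := by
    rw [finRotate_of_lt (by simp)]; rfl
  have h2 : finRotate (n + 1) (Fin.last n) = 0 := finRotate_last
  rw [koszul, Fin.prod_univ_castSucc]
  have h3 : ∏ t, (if Fin.last n < t ∧ finRotate (n + 1) t < finRotate (n + 1) (Fin.last n) then
      (e (finRotate (n + 1) (Fin.last n)) * e (finRotate (n + 1) t)).negOnePow else 1) = 1 :=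
    Finset.prod_eq_one fun t _ => if_neg fun h => absurd h.1 (not_lt_of_ge (Fin.le_last t))
  rw [h3, mul_one, Finset.mul_sum]
  have h4 : ∀ (s : Finset (Fin n)) (f : Fin n → ℤ), (∑ t ∈ s, f t).negOnePow = ∏ t ∈ s, (f t).negOnePow := by
    intro s f
    induction s using Finset.induction_on with
    | empty => simp
    | insert a s ha ih => rw [Finset.sum_insert ha, Finset.prod_insert ha, Int.negOnePow_add, ih]
  rw [h4]
  refine Finset.prod_congr rfl fun s _ => ?_
  rw [Fin.prod_univ_castSucc, Finset.prod_eq_one, one_mul, h1, h2, if_pos, mul_comm]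
  · exact ⟨Fin.castSucc_lt_last s, Fin.succ_pos s⟩
  · intro t _
    rw [if_neg]
    rintro ⟨h5, h6⟩
    rw [h1, h1, Fin.succ_lt_succ_iff] at h6
    exact absurd h6 (not_lt_of_gt (by simpa using h5))

end Koszul

variable {k A : Type u} [Field k] [Ring A] [Algebra k A] {𝒜 : ℤ → Submodule k A}

/-! ### Removing the last argument of a permutation -/

section LastPerm

/-- The permutation sending the last index to `i` and the others to the complement of `i` through `σ`. -/
def lastPerm {j : ℕ} (i : Fin (j + 1)) (σ : Equiv.Perm (Fin j)) : Equiv.Perm (Fin (j + 1)) :=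
  finSuccEquivLast.trans ((Equiv.optionCongr σ).trans (finSuccEquiv' i).symm)

@[simp] lemma lastPerm_last {j : ℕ} (i : Fin (j + 1)) (σ : Equiv.Perm (Fin j)) :
    lastPerm i σ (Fin.last j) = i := by simp [lastPerm]

@[simp] lemma lastPerm_castSucc {j : ℕ} (i : Fin (j + 1)) (σ : Equiv.Perm (Fin j)) (t : Fin j) :
    lastPerm i σ t.castSucc = i.succAbove (σ t) := by simp [lastPerm]

/-- `lastPerm` is injective in the pair (i, σ), and bijective by counting: (j+1)·j! = (j+1)!. -/
lemma sum_perm_succ {j : ℕ} {Y : Type*} [AddCommMonoid Y] (f : Equiv.Perm (Fin (j + 1)) → Y) :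
    ∑ π, f π = ∑ i, ∑ σ, f (lastPerm i σ) := by
  have hinj : Function.Injective (fun x : Fin (j + 1) × Equiv.Perm (Fin j) => lastPerm x.1 x.2) := by
    rintro ⟨i, σ⟩ ⟨i', σ'⟩ h
    have h1 : i = i' := by simpa using DFunLike.congr_fun h (Fin.last j)
    subst h1
    have h2 : σ = σ' := by
      ext t
      have := DFunLike.congr_fun h t.castSucc
      simp only [lastPerm_castSucc] at this
      rw [Fin.succAbove_right_injective this]
    rw [h2]
  have hbij := (Fintype.bijective_iff_injective_and_card _).2 ⟨hinj, by
    rw [Fintype.card_prod, Fintype.card_fin, Fintype.card_perm, Fintype.card_perm, Fintype.card_fin,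
      Fintype.card_fin, Nat.factorial_succ]⟩
  rw [← hbij.sum_comp, Fintype.sum_prod_type]

lemma negOnePow_sum {ι : Type*} (s : Finset ι) (f : ι → ℤ) :
    (∑ t ∈ s, f t).negOnePow = ∏ t ∈ s, (f t).negOnePow := by
  classical
  induction s using Finset.induction_on with
  | empty => simp
  | insert a s ha ih => rw [Finset.sum_insert ha, Finset.prod_insert ha, Int.negOnePow_add, ih]

lemma sum_filter_gt_succAbove {j : ℕ} (i : Fin (j + 1)) (e : Fin (j + 1) → ℤ) :
    ∑ t ∈ Finset.univ.filter (i < ·), e t =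
      ∑ t : Fin j, if i < i.succAbove t then e (i.succAbove t) else 0 := by
  rw [Finset.sum_filter, Fin.sum_univ_succAbove _ i]
  simp

lemma koszul_lastPerm {j : ℕ} (i : Fin (j + 1)) (σ : Equiv.Perm (Fin j)) (e : Fin (j + 1) → ℤ) :
    koszul (lastPerm i σ) e = (e i * ∑ t ∈ Finset.univ.filter (i < ·), e t).negOnePow *
      koszul σ (fun t => e (i.succAbove t)) := by
  rw [koszul, Fin.prod_univ_castSucc]
  have h3 : ∏ t, (if Fin.last j < t ∧ lastPerm i σ t < lastPerm i σ (Fin.last j) then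
      (e (lastPerm i σ (Fin.last j)) * e (lastPerm i σ t)).negOnePow else 1) = 1 :=
    Finset.prod_eq_one fun t _ => if_neg fun h => absurd h.1 (not_lt_of_ge (Fin.le_last t))
  rw [h3, mul_one]
  simp_rw [Fin.prod_univ_castSucc (n := j), Finset.prod_mul_distrib]
  rw [mul_comm]
  congr 1
  · simp only [Fin.castSucc_lt_last, lastPerm_last, lastPerm_castSucc, true_and]
    rw [Equiv.prod_comp σ (fun t => if i < i.succAbove t then (e (i.succAbove t) * e i).negOnePow else 1),
      sum_filter_gt_succAbove, Finset.mul_sum, negOnePow_sum]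
    refine Finset.prod_congr rfl fun t _ => ?_
    split_ifs <;> simp [mul_comm]
  · rw [koszul]
    refine Finset.prod_congr rfl fun s _ => Finset.prod_congr rfl fun t _ => ?_
    simp only [lastPerm_castSucc, Fin.castSucc_lt_castSucc_iff, Fin.succAbove_lt_succAbove_iff]

end LastPerm

variable [GradedAlgebra 𝒜] [IsGradedComm 𝒜]

/-- Groups the permutations by the argument `i` fed to the last factor. Iterated contraction obeys
the same recursion, `evF_mul_gen`. -/
lemma evalProd_succ {F : GMod 𝒜} {j : ℕ} (c e : Fin (j + 1) → ℤ) (φ : Fin (j + 1) → F.dual)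
    (x : Fin (j + 1) → F) :
    evalProd c e φ x = ∑ i, sg k (c (Fin.last j) * ∑ t, e (i.succAbove t) +
      e i * ∑ t ∈ Finset.univ.filter (i < ·), e t) •
        (evalProd (fun t => c t.castSucc) (fun t => e (i.succAbove t)) (fun t => φ t.castSucc)
          (fun t => x (i.succAbove t)) * evalDual (φ (Fin.last j)) (x i)) := by
  rw [evalProd, sum_perm_succ]
  refine Finset.sum_congr rfl fun i _ => ?_
  rw [evalProd, Finset.sum_mul, Finset.smul_sum]
  refine Finset.sum_congr rfl fun σ _ => ?_
  rw [List.ofFn_succ', List.concat_eq_append, List.prod_append, koszul_lastPerm]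
  simp only [lastPerm_castSucc, lastPerm_last, List.prod_cons, List.prod_nil, mul_one]
  rw [smul_mul_assoc, ← negOnePow_smul (k := k), smul_smul]
  congr 1
  rw [Int.negOnePow_add, Fin.prod_univ_castSucc]
  have h3 : ∏ t, (if Fin.last j < t then
      (c t * e (lastPerm i σ (Fin.last j))).negOnePow else 1) = 1 :=
    Finset.prod_eq_one fun t _ => if_neg fun h => absurd h (not_lt_of_ge (Fin.le_last t))
  rw [h3, mul_one]
  simp_rw [Fin.prod_univ_castSucc (n := j), Finset.prod_mul_distrib]
  simp only [Fin.castSucc_lt_last, lastPerm_castSucc, Fin.castSucc_lt_castSucc_iff, if_true]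
  rw [Equiv.prod_comp σ (fun t => (c (Fin.last j) * e (i.succAbove t)).negOnePow), ← negOnePow_sum,
    ← Finset.mul_sum]
  have key : ∀ a b c d : ℤˣ, a * b * (c * d) = d * a * (b * c) := fun a b c d => by
    rw [mul_comm c d, ← mul_assoc, mul_comm _ d, ← mul_assoc, ← mul_assoc]
  exact key _ _ _ _

/-! ### Evaluation functionals -/

section IsEval

open GSym

variable {F : GMod 𝒜}

/-- Iterated contractions of `P φ`. -/
lemma ctrN_mul_gen {x : ℕ → F} {e : ℕ → ℤ} (hx : ∀ t, x t ∈ F.gr (e t)) {c : ℤ} {φ : F.dual}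
    (hφ : φ ∈ F.dual.gr c) (P : GSym F.dual) (r : ℕ) :
    ctrN x e LinearMap.id r (Finset.range r) (P * gen _ φ) =
      sg k (c * ∑ t ∈ Finset.range r, e t) •
        (ctrN x e LinearMap.id r (Finset.range r) P * gen _ φ) +
      ∑ i ∈ Finset.range r, sg k (c * ∑ t ∈ Finset.range i, e t) •
        (ctrN x e LinearMap.id r ((Finset.range r).erase i) P *
          coeff _ (twA 𝒜 (∑ t ∈ Finset.range r with i < t, e t) (evalDual φ (x i)))) := by
  have hstep (r : ℕ) : ctrN x e (LinearMap.id (R := k) (M := GSym F.dual)) (r + 1) (Finset.range (r + 1)) =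
      ctr F (x r) ∘ₗ ctrN x e LinearMap.id r (Finset.range r) := foldN_range_succ r
  induction r with
  | zero => simp [sg_zero]
  | succ r ih =>
    rw [hstep, LinearMap.comp_apply, ih, map_add, map_smul, ctr_mul_gen (hx r) hφ, map_sum,
      Finset.sum_range_succ _ r, Finset.sum_range_succ, mul_add, sg_add]
    have h1 : ctrN x e (LinearMap.id (R := k) (M := GSym F.dual)) (r + 1) ((Finset.range (r + 1)).erase r) =
        ctrN x e LinearMap.id r (Finset.range r) := by
      rw [ctrN, foldN_succ_not_mem (by simp)]
      exact foldN_congr_set fun t ht => by simp; omega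
    have h2 : (Finset.range (r + 1)).filter (r < ·) = ∅ := by
      ext t; simp
      try omega
    rw [h1, h2, Finset.sum_empty, twA_zero]
    have h3 : ∀ i ∈ Finset.range r, ctr F (x r) (sg k (c * ∑ t ∈ Finset.range i, e t) •
        (ctrN x e LinearMap.id r ((Finset.range r).erase i) P *
          coeff _ (twA 𝒜 (∑ t ∈ Finset.range r with i < t, e t) (evalDual φ (x i))))) =
        sg k (c * ∑ t ∈ Finset.range i, e t) •
        (ctrN x e LinearMap.id (r + 1) ((Finset.range (r + 1)).erase i) P *
          coeff _ (twA 𝒜 (∑ t ∈ Finset.range (r + 1) with i < t, e t) (evalDual φ (x i)))) := by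
      intro i hi
      rw [Finset.mem_range] at hi
      have h4 : ctrN x e (LinearMap.id (R := k) (M := GSym F.dual)) (r + 1) ((Finset.range (r + 1)).erase i) =
          ctr F (x r) ∘ₗ ctrN x e LinearMap.id r ((Finset.range r).erase i) := by
        rw [ctrN, foldN_succ_mem (by simp; omega), foldN_congr_set (T' := (Finset.range r).erase i)
          (fun t ht => by simp; omega)]
        rfl
      have h5 : (Finset.range (r + 1)).filter (i < ·) = insert r ((Finset.range r).filter (i < ·)) := by
        ext t; simp; omega
      rw [map_smul, ctr_mul_coeff (hx r), twA_twA, h4, h5, Finset.sum_insert (by simp)]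
      rfl
    rw [Finset.sum_congr rfl h3, LinearMap.comp_apply, smul_add, smul_smul]
    rw [mul_comm (e r) c]
    abel

/-- The index map skipping `i`. -/
def skip (i t : ℕ) : ℕ := if t < i then t else t + 1

lemma foldN_erase {X Ω : Type u} [AddCommGroup X] [Module k X] [AddCommGroup Ω] [Module k Ω]
    {st : ℤ → ℤ → X →ₗ[k] Ω →ₗ[k] Ω} (x : ℕ → X) (e : ℕ → ℤ) (ω : Ω) {r i : ℕ} (hi : i < r + 1) :
    foldN st x e ω (r + 1) ((Finset.range (r + 1)).erase i) =
      foldN st (fun t => x (skip i t)) (fun t => e (skip i t)) ω r (Finset.range r) := by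
  refine foldN_enum (skip i) (fun s t hst ht => by simp only [skip]; split_ifs <;> omega) fun t => ?_
  simp only [Finset.mem_erase, Finset.mem_range]
  constructor
  · rintro ⟨⟨h1, h2⟩, -⟩
    rcases Nat.lt_or_ge t i with h | h
    · exact ⟨t, by omega, by simp [skip, h]⟩
    · exact ⟨t - 1, by omega, by simp only [skip]; split_ifs <;> omega⟩
  · rintro ⟨s, hs, rfl⟩
    simp only [skip]; split_ifs <;> omega

lemma extz_skip {X : Type*} [Zero X] {r : ℕ} (x : Fin (r + 1) → X) (i : Fin (r + 1)) {t : ℕ}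
    (ht : t < r) : extz x (skip i t) = extz (fun s => x (i.succAbove s)) t := by
  rw [extz_of_lt _ ht, extz_of_lt _ (by simp only [skip]; split_ifs <;> omega)]
  congr 1
  ext
  simp only [skip, Fin.succAbove, Fin.lt_def, Fin.val_castSucc]
  split_ifs <;> simp

lemma sum_range_extz {r : ℕ} (e : Fin r → ℤ) : ∑ t ∈ Finset.range r, extz e t = ∑ t, e t := by
  rw [Finset.sum_range]; simp

/-- Evaluation at `x₀ ⊙ ⋯ ⊙ x_{j-1}` on the symmetric algebra. -/
def evF {j : ℕ} (e : Fin j → ℤ) (x : Fin j → F) : GSym F.dual →ₗ[k] A :=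
  (aug F.dual).toLinearMap ∘ₗ ctrN (extz x) (extz e) LinearMap.id j (Finset.range j)

lemma extz_mem {j : ℕ} {e : Fin j → ℤ} {x : Fin j → F} (hx : ∀ t, x t ∈ F.gr (e t)) (t : ℕ) :
    extz x t ∈ F.gr (extz e t) := by
  by_cases h : t < j
  · rw [extz_of_lt _ h, extz_of_lt _ h]; exact hx _
  · simp [extz, h]

/-- After the augmentation only the terms in which φ has been contracted by some x_i survive. -/
lemma evF_mul_gen {j : ℕ} {e : Fin (j + 1) → ℤ} {x : Fin (j + 1) → F} (hx : ∀ t, x t ∈ F.gr (e t))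
    {c : ℤ} {φ : F.dual} (hφ : φ ∈ F.dual.gr c) (P : GSym F.dual) :
    evF e x (P * gen _ φ) = ∑ i, sg k (c * ∑ t, e (i.succAbove t) +
      e i * ∑ t ∈ Finset.univ.filter (i < ·), e t) •
        (evF (fun t => e (i.succAbove t)) (fun t => x (i.succAbove t)) P * evalDual φ (x i)) := by
  rw [evF, LinearMap.comp_apply, ctrN_mul_gen (extz_mem hx) hφ, map_add, map_smul]
  simp only [AlgHom.toLinearMap_apply, map_mul, aug_gen, mul_zero, smul_zero, zero_add, map_sum,
    map_smul, aug_coeff]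
  rw [Finset.sum_range]
  refine Finset.sum_congr rfl fun i _ => ?_
  have h1 : ctrN (extz x) (extz e) (LinearMap.id (R := k) (M := GSym F.dual)) (j + 1) ((Finset.range (j + 1)).erase i) =
      ctrN (extz fun t => x (i.succAbove t)) (extz fun t => e (i.succAbove t)) LinearMap.id j
        (Finset.range j) := by
    rw [ctrN, foldN_erase _ _ _ i.2]
    exact foldN_congr (fun t _ ht => extz_skip x i ht) (fun t _ ht => extz_skip e i ht)
  have h2 : ∑ t ∈ Finset.range (j + 1) with (i : ℕ) < t, extz e t =
      ∑ t ∈ Finset.univ.filter (i < ·), e t := by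
    rw [Finset.sum_filter, Finset.sum_range, Finset.sum_filter]
    exact Finset.sum_congr rfl fun t _ => by rw [extz_coe]; simp only [Fin.lt_def]
  have h3 : ∑ t ∈ Finset.range (i : ℕ), extz e t = ∑ t ∈ Finset.univ.filter (· < i), e t := by
    have : Finset.range (i : ℕ) = (Finset.range (j + 1)).filter (· < (i : ℕ)) := by
      ext t; simp; omega
    rw [this, Finset.sum_filter, Finset.sum_range, Finset.sum_filter]
    exact Finset.sum_congr rfl fun t _ => by rw [extz_coe]; simp only [Fin.lt_def]
  have h4 : ∑ t, e (i.succAbove t) = ∑ t ∈ Finset.univ.filter (· < i), e t +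
      ∑ t ∈ Finset.univ.filter (i < ·), e t := by
    rw [Finset.sum_filter, Finset.sum_filter, Fin.sum_univ_succAbove _ i, Fin.sum_univ_succAbove _ i]
    simp only [lt_irrefl, if_false, zero_add, ← Finset.sum_add_distrib]
    refine Finset.sum_congr rfl fun t _ => ?_
    rcases lt_or_gt_of_ne (Fin.succAbove_ne i t) with h | h
    · simp [h, not_lt_of_gt h]
    · simp [h, not_lt_of_gt h]
  rw [h1, h2, h3, extz_coe, twA_of_mem _ (evalDual_mem hφ (hx i)), mul_smul_comm, smul_smul, ← sg_add, h4]
  refine congrArg₂ _ (sg_congr (by push_cast; grind)) rfl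

/-- Identifies iterated contraction with the permutation formula of the statement, both being
determined by the recursion on the last factor. -/
lemma evF_monomial {j : ℕ} {c e : Fin j → ℤ} {x : Fin j → F} (hx : ∀ t, x t ∈ F.gr (e t))
    {φ : Fin j → F.dual} (hφ : ∀ t, φ t ∈ F.dual.gr (c t)) (a : A) :
    evF e x (monomial _ a φ) = a * evalProd c e φ x := by
  induction j with
  | zero =>
    rw [monomial_zero]
    simp [evF, evalProd, koszul]
  | succ j ih =>
    rw [monomial_succ, evF_mul_gen hx (hφ _), evalProd_succ (k := k), Finset.mul_sum,
      show Fin.init φ = fun t => φ t.castSucc from rfl]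
    refine Finset.sum_congr rfl fun i _ => ?_
    rw [ih (c := fun t => c t.castSucc) (fun t => hx _) (fun t => hφ t.castSucc), mul_smul_comm, mul_assoc]

lemma pr_ctrN_range {x : ℕ → F} {e : ℕ → ℤ} (hx : ∀ t, x t ∈ F.gr (e t)) (n r : ℕ) (P : GSym F.dual) :
    pr _ n (ctrN x e LinearMap.id r (Finset.range r) P) =
      ctrN x e LinearMap.id r (Finset.range r) (pr _ (n + r) P) := by
  have hstep (r : ℕ) : ctrN x e (LinearMap.id (R := k) (M := GSym F.dual)) (r + 1) (Finset.range (r + 1)) =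
      ctr F (x r) ∘ₗ ctrN x e LinearMap.id r (Finset.range r) := foldN_range_succ r
  induction r generalizing n with
  | zero => rfl
  | succ r ih =>
    rw [hstep, LinearMap.comp_apply, LinearMap.comp_apply, pr_ctr (hx r), ih, add_assoc, add_comm 1]

lemma evF_pr {j : ℕ} {e : Fin j → ℤ} {x : Fin j → F} (hx : ∀ t, x t ∈ F.gr (e t)) (P : GSym F.dual) :
    evF e x P = evF e x (pr _ j P) := by
  have h (X : GSym F.dual) : aug _ X = aug _ (pr _ 0 X) := by rw [pr_zero_eq, aug_coeff]
  rw [evF, LinearMap.comp_apply, AlgHom.toLinearMap_apply, h, pr_ctrN_range (extz_mem hx), zero_add]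
  rfl

lemma evF_of_wt {j i : ℕ} (hij : i ≠ j) {e : Fin j → ℤ} {x : Fin j → F} (hx : ∀ t, x t ∈ F.gr (e t))
    {P : GSym F.dual} (hP : P ∈ wt _ i) : evF e x P = 0 := by
  rw [evF_pr hx, pr_of_wt hP, if_neg hij.symm, map_zero]

lemma evF_of_fil {j m : ℕ} (hjm : j < m) {e : Fin j → ℤ} {x : Fin j → F} (hx : ∀ t, x t ∈ F.gr (e t))
    {P : GSym F.dual} (hP : P ∈ fil F.dual m) : evF e x P = 0 := by
  rw [evF_pr hx, mem_fil.1 hP j hjm, map_zero]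

/-- Compose `q` with a linear section of the projection; the hypothesis removes the dependence on
the section. -/
lemma TruncSym.exists_desc {V : GMod 𝒜} {Y : Type u} [AddCommGroup Y] [Module k Y] {m : ℕ}
    (q : GSym V →ₗ[k] Y) (hq : ∀ P ∈ fil V (m + 1), q P = 0) :
    ∃ Q : TruncSym V m →ₗ[k] Y, ∀ P, Q (TruncSym.proj V m P) = q P := by
  obtain ⟨s, hs⟩ := LinearMap.exists_rightInverse_of_surjective (TruncSym.proj V m).toLinearMap
    (LinearMap.range_eq_top.2 (TruncSym.proj_surjective V m))
  refine ⟨q ∘ₗ s, fun P => ?_⟩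
  rw [LinearMap.comp_apply, ← sub_eq_zero, ← map_sub]
  refine hq _ (TruncSym.proj_eq_iff.1 ?_)
  exact LinearMap.congr_fun hs _

lemma exists_isEval {j m : ℕ} (hjm : j ≤ m) {e : Fin j → ℤ} {x : Fin j → F}
    (hx : ∀ t, x t ∈ F.gr (e t)) : ∃ Q : TruncSym F.dual m →ₗ[k] A, IsEval m e x Q ∧
      ∀ P, Q (TruncSym.proj _ m P) = evF e x P := by
  obtain ⟨Q, hQ⟩ := TruncSym.exists_desc (evF e x) (m := m)
    (fun P hP => evF_of_fil (by omega) hx hP)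
  refine ⟨Q, ⟨fun a c φ hφ => ?_, fun i a φ hi => ?_⟩, hQ⟩
  · rw [TruncSym.monomial, hQ, evF_monomial hx hφ]
  · rw [TruncSym.monomial, hQ, evF_of_wt hi hx (Submodule.subset_span ⟨a, φ, rfl⟩)]

/-- Homogeneous monomials span, so a functional satisfying `IsEval` is necessarily iterated
contraction followed by the augmentation. The existential `Q` in `Dual` thus hides no choice. -/
lemma IsEval.proj_eq {j m : ℕ} {e : Fin j → ℤ} {x : Fin j → F}
    (hx : ∀ t, x t ∈ F.gr (e t)) {Q : TruncSym F.dual m →ₗ[k] A} (hQ : IsEval m e x Q)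
    (P : GSym F.dual) : Q (TruncSym.proj _ m P) = evF e x P := by
  have : Q ∘ₗ (TruncSym.proj _ m).toLinearMap = evF e x := lin_ext fun p P hP => by
    induction hP using Submodule.span_induction with
    | zero => simp
    | add x y _ _ h1 h2 => rw [map_add, map_add, h1, h2]
    | smul c x _ h => rw [map_smul, map_smul, h]
    | mem P hP =>
      obtain ⟨i, c, d, a, φ, ha, hφ, -, rfl⟩ := hP
      rw [LinearMap.comp_apply, AlgHom.toLinearMap_apply]
      by_cases hi : i = j
      · subst hi
        rw [evF_monomial hx hφ]
        exact hQ.same a d φ hφ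
      · rw [evF_of_wt hi hx (Submodule.subset_span ⟨a, φ, rfl⟩)]
        exact hQ.other i a φ hi
  exact LinearMap.congr_fun this P

end IsEval

end SHLR
end

/-! ### Graded symmetry and A-linearity of the iterated operations. -/

noncomputable section
namespace SHLR

section FoldSwap

variable {k F Ω : Type u} [Field k] [AddCommGroup F] [Module k F] [AddCommGroup Ω] [Module k Ω]

/-- Steps before `i` are untouched. Steps after `i + 1` are linear and see the earlier degrees only
through their sum, which the exchange preserves; so the scalar from the two exchanged steps passes
through. -/
lemma foldN_swap {st : ℤ → ℤ → F →ₗ[k] Ω →ₗ[k] Ω} {x x' : ℕ → F} {e e' : ℕ → ℤ} {ω : Ω} {i r : ℕ}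
    (hir : i + 1 < r) {c : k}
    (hst : ∀ E ω, st (e i) (E + e (i + 1)) (x i) (st (e (i + 1)) E (x (i + 1)) ω) =
      c • st (e (i + 1)) (E + e i) (x (i + 1)) (st (e i) E (x i) ω))
    (hx0 : x' i = x (i + 1)) (hx1 : x' (i + 1) = x i) (hx : ∀ t, t ≠ i → t ≠ i + 1 → x' t = x t)
    (he0 : e' i = e (i + 1)) (he1 : e' (i + 1) = e i) (he : ∀ t, t ≠ i → t ≠ i + 1 → e' t = e t) :
    foldN st x' e' ω r (Finset.range r) = c • foldN st x e ω r (Finset.range r) := by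
  obtain ⟨r, rfl⟩ : ∃ s, r = i + 2 + s := ⟨r - (i + 2), by omega⟩
  induction r with
  | zero =>
    have h1 : foldN st x' e' ω i (Finset.range i) = foldN st x e ω i (Finset.range i) :=
      foldN_congr (fun t _ ht => hx t (by omega) (by omega)) (fun t _ ht => he t (by omega) (by omega))
    have h2 : ∑ t ∈ Finset.range i, e' t = ∑ t ∈ Finset.range i, e t :=
      Finset.sum_congr rfl fun t ht => by
        rw [Finset.mem_range] at ht
        exact he t (by omega) (by omega)
    rw [add_zero, foldN_range_succ, foldN_range_succ, foldN_range_succ (r := i + 1), foldN_range_succ,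
      Finset.sum_range_succ, Finset.sum_range_succ, h1, h2, hx0, hx1, he0, he1, hst]
  | succ r ih =>
    have h2 : ∑ t ∈ Finset.range (i + 2 + r), e' t = ∑ t ∈ Finset.range (i + 2 + r), e t := by
      clear ih hir
      induction r with
      | zero =>
        rw [add_zero, Finset.sum_range_succ, Finset.sum_range_succ, Finset.sum_range_succ,
          Finset.sum_range_succ, he0, he1, Finset.sum_congr rfl fun t ht => ?_]
        · ring
        · rw [Finset.mem_range] at ht
          exact he t (by omega) (by omega)
      | succ r ih => rw [← add_assoc, Finset.sum_range_succ, ih, Finset.sum_range_succ,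
          he _ (by omega) (by omega)]
    rw [← add_assoc, foldN_range_succ, ih (by omega), h2, hx _ (by omega) (by omega),
      he _ (by omega) (by omega), map_smul, ← foldN_range_succ]

end FoldSwap

variable {k A : Type u} [Field k] [Ring A] [Algebra k A] {𝒜 : ℤ → Submodule k A}

section Extz

variable {X : Type*} [Zero X] {l : ℕ}

lemma extz_swap_left (y : Fin (l + 1) → X) (i : Fin l) :
    extz (fun t => y (Equiv.swap i.castSucc i.succ t)) (i : ℕ) = y i.succ := by
  have := extz_coe (fun t => y (Equiv.swap i.castSucc i.succ t)) i.castSucc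
  rwa [Equiv.swap_apply_left] at this

lemma extz_swap_right (y : Fin (l + 1) → X) (i : Fin l) :
    extz (fun t => y (Equiv.swap i.castSucc i.succ t)) (i + 1 : ℕ) = y i.castSucc := by
  have := extz_coe (fun t => y (Equiv.swap i.castSucc i.succ t)) i.succ
  rwa [Equiv.swap_apply_right] at this

lemma extz_swap_of_ne (y : Fin (l + 1) → X) {i : Fin l} (t : ℕ) (h1 : t ≠ i) (h2 : t ≠ i + 1) :
    extz (fun t => y (Equiv.swap i.castSucc i.succ t)) t = extz y t := by
  rw [extz, extz]
  split_ifs with ht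
  · rw [Equiv.swap_apply_of_ne_of_ne]
    · exact fun h => h1 (congrArg Fin.val h)
    · exact fun h => h2 (congrArg Fin.val h)
  · rfl

lemma extz_snoc_of_lt (a : Fin l → X) (b : X) {t : ℕ} (ht : t < l) :
    extz (Fin.snoc (α := fun _ => X) a b : Fin (l + 1) → X) t = extz a t := by
  rw [extz_of_lt _ (by omega), extz_of_lt _ ht]
  exact Fin.snoc_castSucc (α := fun _ => X) b a ⟨t, ht⟩

lemma extz_snoc_self (a : Fin l → X) (b : X) :
    extz (Fin.snoc (α := fun _ => X) a b : Fin (l + 1) → X) l = b := by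
  rw [extz_of_lt _ (by omega)]
  exact Fin.snoc_last (α := fun _ => X) b a

end Extz

/-- Adjacent transpositions generate the symmetric group and `koszul` satisfies a cocycle rule, so
symmetry has to be known for adjacent transpositions only. -/
lemma symm_of_swap {F : GMod 𝒜} {Y : Type u} [AddCommGroup Y] [Module k Y] {l : ℕ}
    (Ψ : (Fin (l + 1) → F) → Y)
    (h : ∀ (e : Fin (l + 1) → ℤ) (x : Fin (l + 1) → F), (∀ t, x t ∈ F.gr (e t)) → ∀ i : Fin l,
      Ψ (fun t => x (Equiv.swap i.castSucc i.succ t)) = sg k (e i.castSucc * e i.succ) • Ψ x)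
    {e : Fin (l + 1) → ℤ} {x : Fin (l + 1) → F} (hx : ∀ t, x t ∈ F.gr (e t))
    (π : Equiv.Perm (Fin (l + 1))) : Ψ (fun t => x (π t)) = koszul π e • Ψ x := by
  have hπ : π ∈ Submonoid.closure (Set.range fun i : Fin l => Equiv.swap i.castSucc i.succ) := by
    rw [Equiv.Perm.mclosure_swap_castSucc_succ]; trivial
  induction hπ using Submonoid.closure_induction generalizing e x with
  | mem π hπ =>
    obtain ⟨i, rfl⟩ := hπ
    rw [h e x hx i, koszul_swap, negOnePow_smul (k := k)]
  | one => rw [koszul_one, one_smul]; rfl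
  | mul π ρ _ _ h1 h2 =>
    rw [koszul_mul, mul_comm, mul_smul, ← h1 hx, ← h2 (fun t => hx (π t))]
    rfl

variable [GradedAlgebra 𝒜] [IsGradedComm 𝒜]

open GSym

lemma HBasis.ext_eval {F : GMod 𝒜} (B : HBasis F) {x y : F}
    (h : ∀ (c : ℤ) (φ : F.dual), φ ∈ F.dual.gr c → evalDual φ x = evalDual φ y) : x = y := by
  rw [B.expand x, B.expand y]
  exact Finset.sum_congr rfl fun s _ => by rw [h _ _ (B.β_mem s)]

/-! ### Iterated brackets of a derivation -/

section Br

variable {F G : GMod 𝒜} (h : GHom F G) (δ : GSym G.dual →ₗ[k] GSym F.dual)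

/-- The iterated brackets of `δ` with the contractions by `x₀, …, x_{l-1}`. -/
def brMul (l : ℕ) : MultilinearMap k (fun _ : Fin l => F) (GSym G.dual →ₗ[k] GSym F.dual) :=
  homMul fun e => foldMul (brStep h) e δ

variable {h δ}

lemma brMul_eq {l : ℕ} {e : Fin l → ℤ} {x : Fin l → F} (hx : ∀ t, x t ∈ F.gr (e t)) :
    brMul h δ l x = brN h (extz x) (extz e) δ l (Finset.range l) := by
  rw [brMul, homMul_apply _ e x hx, foldMul_apply]

lemma brMul_eq_nat {l : ℕ} {e : ℕ → ℤ} {x : ℕ → F} (hx : ∀ t, x t ∈ F.gr (e t)) :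
    brMul h δ l (fun t => x t) = brN h x e δ l (Finset.range l) := by
  rw [brMul, homMul_apply _ (fun t => e t) _ (fun t => hx t), foldMul_eq]

lemma brMul_isBr {n : ℤ} (hδ : IsBr h n 0 δ) {l : ℕ} {e : Fin l → ℤ} {x : Fin l → F}
    (hx : ∀ t, x t ∈ F.gr (e t)) : IsBr h n (∑ t, e t) (brMul h δ l x) := by
  rw [brMul_eq hx]
  have := hδ.brN (extz_mem hx) l (Finset.range l)
  rwa [Finset.filter_true_of_mem (fun t ht => Finset.mem_range.1 ht), sum_range_extz] at this

lemma brMul_symm {l : ℕ} {e : Fin l → ℤ} {x : Fin l → F} (hx : ∀ t, x t ∈ F.gr (e t))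
    (π : Equiv.Perm (Fin l)) : brMul h δ l (fun t => x (π t)) = koszul π e • brMul h δ l x := by
  cases l with
  | zero =>
    rw [Subsingleton.elim π 1, koszul_one, one_smul]; rfl
  | succ l =>
    refine symm_of_swap (brMul h δ (l + 1)) (fun e x hx i => ?_) hx π
    have hx' : ∀ t, x (Equiv.swap i.castSucc i.succ t) ∈ F.gr (e (Equiv.swap i.castSucc i.succ t)) :=
      fun t => hx _
    rw [brMul_eq hx, brMul_eq hx']
    have h0 := extz_coe x i.castSucc
    have h1 := extz_coe x i.succ
    have h0' := extz_coe e i.castSucc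
    have h1' := extz_coe e i.succ
    rw [Fin.val_castSucc] at h0 h0'
    rw [Fin.val_succ] at h1 h1'
    have hr := foldN_swap (k := k) (st := brStep h) (x := extz x) (e := extz e) (i := i) (r := l + 1) (ω := δ)
      (x' := extz (fun t => x (Equiv.swap i.castSucc i.succ t)))
      (e' := extz (fun t => e (Equiv.swap i.castSucc i.succ t))) (by omega)
      (c := sg k (e i.castSucc * e i.succ))
      (fun E ω => by
        rw [h0, h1, h0', h1', brStep_brStep (hx _) (hx _), mul_comm])
      (by rw [extz_swap_left, h1]) (by rw [extz_swap_right, h0])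
      (extz_swap_of_ne x) (by rw [extz_swap_left, h1']) (by rw [extz_swap_right, h0']) (extz_swap_of_ne e)
    exact hr

lemma brMul_snoc {l : ℕ} {e : Fin l → ℤ} {x : Fin l → F} (hx : ∀ t, x t ∈ F.gr (e t)) {c : ℤ} {y : F}
    (hy : y ∈ F.gr c) : brMul h δ (l + 1) (Fin.snoc (α := fun _ => F) x y) =
      brStep h c (∑ t, e t) y (brMul h δ l x) := by
  have hs : ∀ t, (Fin.snoc (α := fun _ => F) x y : Fin (l + 1) → F) t ∈
      F.gr ((Fin.snoc (α := fun _ => ℤ) e c : Fin (l + 1) → ℤ) t) := by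
    intro t
    refine Fin.lastCases ?_ (fun t => ?_) t
    · simpa using hy
    · simpa using hx t
  rw [brMul_eq hs, brMul_eq hx, brN, brN, foldN_range_succ, extz_snoc_self, extz_snoc_self, ← sum_range_extz]
  congr 1
  · congr 1
    rw [Finset.sum_congr rfl fun t ht => extz_snoc_of_lt e c (Finset.mem_range.1 ht)]
  · exact foldN_congr (fun t _ ht => extz_snoc_of_lt x y ht) (fun t _ ht => extz_snoc_of_lt e c ht)

end Br

/-- Contracting with `a x_i` in place of `x_i`. -/
lemma ctrN_smul {F : GMod 𝒜} {x x' : ℕ → F} {e e' : ℕ → ℤ} (hx : ∀ t, x t ∈ F.gr (e t)) {i r : ℕ} (hi : i < r)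
    {c : ℤ} {a : A} (ha : a ∈ 𝒜 c) (hxi : x' i = a • x i) (hx' : ∀ t, t ≠ i → x' t = x t) {p : ℤ}
    {P : GSym F.dual} (hP : P ∈ deg _ p) :
    ctrN x' e' LinearMap.id r (Finset.range r) P =
      sg k (c * (p + ∑ t ∈ Finset.range i, e t)) •
        (coeff _ a * ctrN x e LinearMap.id r (Finset.range r) P) := by
  have hstep (x : ℕ → F) (e : ℕ → ℤ) (r : ℕ) :
      ctrN x e (LinearMap.id (R := k) (M := GSym F.dual)) (r + 1) (Finset.range (r + 1)) =
      ctr F (x r) ∘ₗ ctrN x e LinearMap.id r (Finset.range r) := foldN_range_succ r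
  have hdeg (r : ℕ) : ctrN x e LinearMap.id r (Finset.range r) P ∈ deg F.dual (p + ∑ t ∈ Finset.range r, e t) := by
    induction r with
    | zero => simpa using hP
    | succ r ih =>
      rw [hstep, Finset.sum_range_succ, ← add_assoc]
      exact ctr_mem_deg (hx r) ih
  obtain ⟨r, rfl⟩ : ∃ s, r = i + 1 + s := ⟨r - (i + 1), by omega⟩
  clear hi
  induction r with
  | zero =>
    have h1 : ctrN x' e' (LinearMap.id (R := k) (M := GSym F.dual)) i (Finset.range i) =
        ctrN x e LinearMap.id i (Finset.range i) := by
      have h2 : ∀ j ≤ i, ctrN x' e' (LinearMap.id (R := k) (M := GSym F.dual)) j (Finset.range j) =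
        ctrN x e LinearMap.id j (Finset.range j) := by
        intro j hj
        induction j with
        | zero => rfl
        | succ j ih => rw [hstep, hstep, ih (by omega), hx' j (by omega)]
      exact h2 i le_rfl
    rw [add_zero, hstep, hstep, LinearMap.comp_apply, LinearMap.comp_apply, h1, hxi, ctr_smul ha (hx i),
      tw_of_mem _ (hdeg i), map_smul, mul_smul_comm]
  | succ r ih =>
    rw [← add_assoc, hstep, hstep, LinearMap.comp_apply, LinearMap.comp_apply, ih, map_smul, ctr_coeff_mul,
      hx' _ (by omega)]

end SHLR
end

/-! ### The multiderivation of a derivation between finite modules. -/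

noncomputable section
namespace SHLR

variable {k A : Type u} [Field k] [Ring A] [Algebra k A] {𝒜 : ℤ → Submodule k A}
  [GradedAlgebra 𝒜] [IsGradedComm 𝒜]

open GSym

lemma evalDual_neg {F : GMod 𝒜} (φ : F.dual) (x : F) : evalDual φ (-x) = -evalDual φ x :=
  map_neg (DualType.val F φ) x

lemma sum_range_extz_coe {l : ℕ} (e : Fin l → ℤ) (i : Fin l) :
    ∑ t ∈ Finset.range (i : ℕ), extz e t = ∑ t ∈ Finset.univ.filter (· < i), e t := by
  have : Finset.range (i : ℕ) = (Finset.range l).filter (· < (i : ℕ)) := by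
    ext t; simp; omega
  rw [this, Finset.sum_filter, Finset.sum_range, Finset.sum_filter]
  exact Finset.sum_congr rfl fun t _ => by rw [extz_coe]; simp only [Fin.lt_def]

lemma sum_succAbove_eq {j : ℕ} (e : Fin (j + 1) → ℤ) (i : Fin (j + 1)) :
    ∑ t, e (i.succAbove t) = ∑ t ∈ Finset.univ.filter (· < i), e t +
      ∑ t ∈ Finset.univ.filter (i < ·), e t := by
  rw [Finset.sum_filter, Finset.sum_filter, Fin.sum_univ_succAbove _ i, Fin.sum_univ_succAbove _ i]
  simp only [lt_irrefl, if_false, zero_add, ← Finset.sum_add_distrib]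
  refine Finset.sum_congr rfl fun t _ => ?_
  rcases lt_or_gt_of_ne (Fin.succAbove_ne i t) with h | h
  · simp [h, not_lt_of_gt h]
  · simp [h, not_lt_of_gt h]

/-- Degree `1` derivations `Sym(G^*) → Sym(F^*)` over `h^*` not lowering weights. -/
structure GDer {F G : GMod 𝒜} (h : GHom F G) where
  d : GSym G.dual →ₗ[k] GSym F.dual
  isBr : IsBr h 1 0 d
  aug_gen : ∀ ω, aug _ (d (gen _ ω)) = 0

namespace GDer

variable {F G : GMod 𝒜} {h : GHom F G} (D : GDer h)

/-- Iterated brackets, followed by the augmentation. -/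
def q (l : ℕ) : MultilinearMap k (fun _ : Fin l => F) (GSym G.dual →ₗ[k] A) :=
  (LinearMap.compRight k (aug F.dual).toLinearMap).compMultilinearMap (brMul h D.d l)

lemma q_apply {l : ℕ} (x : Fin l → F) (P : GSym G.dual) :
    D.q l x P = aug _ (brMul h D.d l x P) := rfl

/-- Augmented brackets are skew derivations into A, hence determined by their values on A and on
G^*: the former give the anchor, the latter the bracket. -/
lemma q_mul {l : ℕ} {e : Fin l → ℤ} {x : Fin l → F} (hx : ∀ t, x t ∈ F.gr (e t)) (P Q : GSym G.dual) :
    D.q l x (P * Q) = twA 𝒜 1 (aug _ P) * D.q l x Q + D.q l x P * twA 𝒜 (∑ t, e t) (aug _ Q) := by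
  rw [q_apply, (brMul_isBr D.isBr hx).mul, map_add, map_mul, map_mul, aug_tw, aug_tw, aug_map, aug_map]
  rfl

lemma q_mem {l : ℕ} {e : Fin l → ℤ} {x : Fin l → F} (hx : ∀ t, x t ∈ F.gr (e t)) {p : ℤ} {P : GSym G.dual}
    (hP : P ∈ deg _ p) : D.q l x P ∈ 𝒜 (p + 1 + ∑ t, e t) :=
  aug_mem ((brMul_isBr D.isBr hx).mem_deg hP)

lemma q_symm {l : ℕ} {e : Fin l → ℤ} {x : Fin l → F} (hx : ∀ t, x t ∈ F.gr (e t))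
    (π : Equiv.Perm (Fin l)) : D.q l (fun t => x (π t)) = koszul π e • D.q l x := by
  refine LinearMap.ext fun P => ?_
  rw [q_apply, brMul_symm hx, units_smul (k := k), units_smul (k := k), LinearMap.smul_apply, map_smul]
  rfl

lemma q_smul_gen {l : ℕ} {e : Fin l → ℤ} {x : Fin l → F} (hx : ∀ t, x t ∈ F.gr (e t)) (a : A) (ω : G.dual) :
    D.q l x (gen _ (a • ω)) = twA 𝒜 1 a * D.q l x (gen _ ω) := by
  rw [← coeff_mul_gen, q_mul D hx, GSym.aug_gen, map_zero, mul_zero, add_zero, aug_coeff]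

lemma q_snoc {l : ℕ} {e : Fin l → ℤ} {x : Fin l → F} (hx : ∀ t, x t ∈ F.gr (e t)) {c : ℤ} {y : F}
    (hy : y ∈ F.gr c) (P : GSym G.dual) : D.q (l + 1) (Fin.snoc (α := fun _ => F) x y) P =
      aug _ (ctr F y (brMul h D.d l x P)) - sg k (c * ∑ t, e t) • D.q l x (ctr G (h y) P) := by
  rw [q_apply, brMul_snoc hx hy, brStep_apply, map_sub, map_smul]
  rfl

lemma q_coeff {l : ℕ} {e : Fin l → ℤ} {x : Fin l → F} (hx : ∀ t, x t ∈ F.gr (e t)) (a : A) :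
    D.q l x (coeff _ a) = evF e x (D.d (coeff _ a)) := by
  rw [q_apply, brMul_eq hx, brN_coeff, ctrN_apply]
  rfl

/-- The anchors. -/
def anchor (l : ℕ) : MultilinearMap k (fun _ : Fin l => F) (A →ₗ[k] A) :=
  homMul fun e => ((LinearMap.lcomp k A (coeff G.dual ∘ₗ (twA 𝒜 (∑ t, e t)).toLinearMap)) ∘ₗ
    LinearMap.compRight k (aug F.dual).toLinearMap).compMultilinearMap (brMul h D.d l)

/-- The twist by the total degree of `x` absorbs the sign (-1)^{|a|Σ|x_i|} of the duality formula
for da. -/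
lemma anchor_apply {l : ℕ} {e : Fin l → ℤ} {x : Fin l → F} (hx : ∀ t, x t ∈ F.gr (e t)) (a : A) :
    D.anchor l x a = D.q l x (coeff _ (twA 𝒜 (∑ t, e t) a)) := by
  rw [anchor, homMul_apply _ e x hx]
  rfl

lemma q_coeff_eq {l : ℕ} {e : Fin l → ℤ} {x : Fin l → F} (hx : ∀ t, x t ∈ F.gr (e t)) {c : ℤ} {a : A}
    (ha : a ∈ 𝒜 c) : D.q l x (coeff _ a) = sg k (c * ∑ t, e t) • D.anchor l x a := by
  rw [anchor_apply D hx, twA_of_mem _ ha, map_smul, map_smul, mul_comm, sg_smul_smul]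

variable (B : HBasis G)

/-- The multilinear maps. -/
def bra (l : ℕ) : MultilinearMap k (fun _ : Fin l => F) G :=
  (-∑ s, ((LinearMap.toSpanSingleton A G (B.b s)).restrictScalars k ∘ₗ
    (sg k (B.d s) • (twA 𝒜 (B.d s)).toLinearMap)) ∘ₗ LinearMap.applyₗ (gen G.dual (B.β s)) :
      (GSym G.dual →ₗ[k] A) →ₗ[k] G).compMultilinearMap (D.q l)

lemma bra_apply {l : ℕ} (x : Fin l → F) : D.bra B l x =
    -∑ s, (sg k (B.d s) • twA 𝒜 (B.d s) (D.q l x (gen _ (B.β s)))) • B.b s := by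
  simp [bra]

/-- Expand ω in the dual basis. The augmented bracket is A-linear on generators up to a twist, and
`bra` was built from its values on the dual basis; the resulting formula characterises `bra` without
reference to the basis. -/
lemma q_gen_eq {l : ℕ} {e : Fin l → ℤ} {x : Fin l → F} (hx : ∀ t, x t ∈ F.gr (e t)) {c : ℤ} {ω : G.dual}
    (hω : ω ∈ G.dual.gr c) : D.q l x (gen _ ω) = -(sg k c • evalDual ω (D.bra B l x)) := by
  have h1 : D.q l x (gen _ ω) = ∑ s, twA 𝒜 1 (evalDual ω (B.b s)) * D.q l x (gen _ (B.β s)) := by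
    conv_lhs => rw [B.expand_dual ω]
    rw [map_sum, map_sum]
    exact Finset.sum_congr rfl fun s _ => D.q_smul_gen hx _ _
  rw [h1, bra_apply, evalDual_neg, evalDual_sum, smul_neg, neg_neg, Finset.smul_sum]
  refine Finset.sum_congr rfl fun s _ => ?_
  have h2 := evalDual_mem hω (B.b_mem s)
  have h3 := D.q_mem hx (gen_mem_deg (B.β_mem s))
  rw [evalDual_smul_tw hω, map_smul, twA_twA, smul_mul_assoc, ← mul_eq_twA_mul h2, twA_of_mem _ h2,
    smul_mul_assoc, smul_smul, ← sg_add, one_mul]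

lemma eval_bra {l : ℕ} {e : Fin l → ℤ} {x : Fin l → F} (hx : ∀ t, x t ∈ F.gr (e t)) {c : ℤ} {ω : G.dual}
    (hω : ω ∈ G.dual.gr c) : evalDual ω (D.bra B l x) = -(sg k c • D.q l x (gen _ ω)) := by
  rw [D.q_gen_eq B hx hω, smul_neg, sg_smul_smul, neg_neg]

lemma bra_mem {l : ℕ} {e : Fin l → ℤ} {x : Fin l → F} (hx : ∀ t, x t ∈ F.gr (e t)) :
    D.bra B l x ∈ G.gr (1 + ∑ t, e t) := by
  rw [bra_apply]
  refine neg_mem (sum_mem fun s _ => ?_)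
  have h1 := G.smul_mem (Submodule.smul_mem _ (sg k (B.d s))
    (twA_mem (B.d s) (D.q_mem hx (gen_mem_deg (B.β_mem s))))) (B.b_mem s)
  have h2 : -B.d s + 1 + ∑ t, e t + B.d s = 1 + ∑ t, e t := by ring
  rwa [h2] at h1

lemma bra_symm {l : ℕ} {e : Fin l → ℤ} {x : Fin l → F} (hx : ∀ t, x t ∈ F.gr (e t))
    (π : Equiv.Perm (Fin l)) : D.bra B l (fun t => x (π t)) = koszul π e • D.bra B l x := by
  rw [bra, LinearMap.compMultilinearMap_apply, D.q_symm hx, units_smul (k := k), map_smul,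
    ← units_smul]
  rfl

lemma anchor_mem {l : ℕ} {e : Fin l → ℤ} {x : Fin l → F} (hx : ∀ t, x t ∈ F.gr (e t)) {c : ℤ} {a : A}
    (ha : a ∈ 𝒜 c) : D.anchor l x a ∈ 𝒜 (1 + ∑ t, e t + c) := by
  have h1 := D.q_mem hx (coeff_mem_deg (V := G.dual) (twA_mem (∑ t, e t) ha))
  rw [anchor_apply D hx]
  have h2 : c + 1 + ∑ t, e t = 1 + ∑ t, e t + c := by ring
  rwa [h2] at h1

lemma anchor_mul {l : ℕ} {e : Fin l → ℤ} {x : Fin l → F} (hx : ∀ t, x t ∈ F.gr (e t)) (a b : A) :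
    D.anchor l x (a * b) = D.anchor l x a * b + twA 𝒜 (1 + ∑ t, e t) a * D.anchor l x b := by
  rw [anchor_apply D hx, anchor_apply D hx, anchor_apply D hx, map_mul, ← GSym.coeff_mul, D.q_mul hx,
    aug_coeff, aug_coeff, twA_twA, twA_self, add_comm]

lemma anchor_symm {l : ℕ} {e : Fin l → ℤ} {x : Fin l → F} (hx : ∀ t, x t ∈ F.gr (e t))
    (π : Equiv.Perm (Fin l)) : D.anchor l (fun t => x (π t)) = koszul π e • D.anchor l x := by
  refine LinearMap.ext fun a => ?_
  have hx' : ∀ t, x (π t) ∈ F.gr (e (π t)) := fun t => hx _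
  rw [anchor_apply D hx', Equiv.sum_comp π e, D.q_symm hx, units_smul (k := k), units_smul (k := k),
    LinearMap.smul_apply, LinearMap.smul_apply, anchor_apply D hx]

/-- On coefficients the bracket is a plain iterated contraction, so this is contraction by a·x_i, as
computed in `ctrN_smul`. -/
lemma anchor_smul {l : ℕ} {e : Fin l → ℤ} {x : Fin l → F} (hx : ∀ t, x t ∈ F.gr (e t)) (i : Fin l)
    {c : ℤ} {a : A} (ha : a ∈ 𝒜 c) (b : A) : D.anchor l (Function.update x i (a • x i)) b =
      sg k (c * (1 + ∑ t ∈ Finset.univ.filter (· < i), e t)) • (a * D.anchor l x b) := by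
  have key : D.anchor l (Function.update x i (a • x i)) =
      sg k (c * (1 + ∑ t ∈ Finset.univ.filter (· < i), e t)) • (LinearMap.mulLeft k a ∘ₗ D.anchor l x) := by
    refine lin_ext_alg 𝒜 fun p b hb => ?_
    have hx' : ∀ t, Function.update x i (a • x i) t ∈ F.gr (Function.update e i (c + e i) t) := by
      intro t
      rcases eq_or_ne t i with rfl | ht
      · simpa using F.smul_mem ha (hx t)
      · simpa [ht] using hx t
    have hsum : ∑ t, Function.update e i (c + e i) t = c + ∑ t, e t := by
      rw [Finset.sum_update_of_mem (Finset.mem_univ i), ← Finset.erase_eq, add_assoc,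
        Finset.add_sum_erase _ _ (Finset.mem_univ i)]
    have h1 : extz (Function.update x i (a • x i)) (i : ℕ) = a • extz x i := by
      rw [extz_coe, extz_coe, Function.update_self]
    have h2 : ∀ t, t ≠ (i : ℕ) → extz (Function.update x i (a • x i)) t = extz x t := by
      intro t ht
      rw [extz, extz]
      split_ifs with h
      · rw [Function.update_of_ne]
        exact fun h' => ht (congrArg Fin.val h')
      · rfl
    have h3 : ∑ t ∈ Finset.range (i : ℕ), extz e t = ∑ t ∈ Finset.univ.filter (· < i), e t :=
      sum_range_extz_coe e i
    rw [anchor_apply D hx', hsum, D.q_coeff hx', evF, LinearMap.comp_apply,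
      ctrN_smul (extz_mem hx) i.2 ha h1 h2 (D.isBr.mem_deg (coeff_mem_deg (twA_mem _ hb))), map_smul,
      AlgHom.toLinearMap_apply, map_mul, aug_coeff, h3, LinearMap.smul_apply, LinearMap.comp_apply,
      LinearMap.mulLeft_apply, anchor_apply D hx, D.q_coeff hx, twA_of_mem _ hb, twA_of_mem _ hb]
    simp only [map_smul, mul_smul_comm, smul_smul, ← sg_add]
    refine congrArg₂ _ (sg_congr (by push_cast; grind)) rfl
  rw [key]
  rfl

/-- Pair with ω and write out the last commutator, with a·y in the last slot. The half contracted
after the derivation is A-linear. The other half involves ω(h(a y)) = ±a ω(h y), and the product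
rule applied to this coefficient creates the anchor term. -/
lemma bra_leibniz {l : ℕ} {e : Fin l → ℤ} {x : Fin l → F} (hx : ∀ t, x t ∈ F.gr (e t))
    {c : ℤ} {a : A} (ha : a ∈ 𝒜 c) (y : F) :
    D.bra B (l + 1) (Fin.snoc (α := fun _ => F) x (a • y)) = D.anchor l x a • h y +
      sg k (c * (1 + ∑ t, e t)) • (a • D.bra B (l + 1) (Fin.snoc (α := fun _ => F) x y)) := by
  -- Linearity in the last argument allows `y` to be taken homogeneous.
  let L : F →ₗ[k] G := (D.bra B (l + 1)).toLinearMap (Fin.snoc (α := fun _ => F) x 0) (Fin.last l)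
  have hL (y : F) : L y = D.bra B (l + 1) (Fin.snoc (α := fun _ => F) x y) := by
    rw [MultilinearMap.toLinearMap_apply, Fin.update_snoc_last]
  have key : L ∘ₗ Algebra.lsmul k k F a = Algebra.lsmul k k G (D.anchor l x a) ∘ₗ h.lin +
        sg k (c * (1 + ∑ t, e t)) • (Algebra.lsmul k k G a ∘ₗ L) := by
    refine GMod.lin_ext fun p y hy => B.ext_eval fun n ω hω => ?_
    change evalDual ω (L (a • y)) = evalDual ω (D.anchor l x a • h y + sg k (c * (1 + ∑ t, e t)) • (a • L y))
    have hs {y : F} {p : ℤ} (hy : y ∈ F.gr p) (t : Fin (l + 1)) :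
        (Fin.snoc (α := fun _ => F) x y : Fin (l + 1) → F) t ∈
          F.gr ((Fin.snoc (α := fun _ => ℤ) e p : Fin (l + 1) → ℤ) t) := by
      refine Fin.lastCases ?_ (fun t => ?_) t
      · simpa using hy
      · simpa using hx t
    have hay := F.smul_mem ha hy
    have hlin : h (a • y) = a • h y := h.toLin.map_smul a y
    have hev := evalDual_mem hω (h.map_mem hy)
    have h1 : D.q l x (coeff _ (a * evalDual ω (h y))) = sg k c • (a * D.q l x (coeff _ (evalDual ω (h y)))) +
        sg k (c * ∑ t, e t + (∑ t, e t) * (n + p)) • (D.anchor l x a * evalDual ω (h y)) := by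
      rw [← GSym.coeff_mul, D.q_mul hx, aug_coeff, aug_coeff, D.q_coeff_eq hx ha, twA_of_mem _ ha,
        twA_of_mem _ hev, one_mul, smul_mul_assoc, smul_mul_assoc, mul_smul_comm, smul_smul, ← sg_add]
    rw [evalDual_add, evalDual_ksmul, evalDual_smul_right hω (D.anchor_mem hx ha), evalDual_smul_right hω ha,
      hL, hL, eval_bra D B (hs hy) hω, eval_bra D B (hs hay) hω, D.q_snoc hx hy, D.q_snoc hx hay,
      ctr_gen, ctr_gen, hlin, evalDual_smul_right hω ha, ctr_smul ha hy,
      tw_of_mem _ ((brMul_isBr D.isBr hx).mem_deg (gen_mem_deg hω)), map_smul, map_mul, aug_coeff, map_smul,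
      map_smul (coeff _), map_smul (D.q l x), h1]
    simp only [mul_smul_comm, smul_smul, ← sg_add, smul_sub, smul_add, mul_sub, mul_neg, smul_neg]
    rw [sg_congr (m := n + c * (n + 1 + ∑ t, e t)) (n := c * (1 + ∑ t, e t) + (n * c + n)) (by push_cast; grind),
      sg_congr (m := n + ((c + p) * ∑ t, e t + (n * c + c)))
        (n := c * (1 + ∑ t, e t) + (n * c + (n + p * ∑ t, e t))) (by push_cast; grind),
      sg_congr (m := n + ((c + p) * ∑ t, e t + (n * c + (c * ∑ t, e t + (∑ t, e t) * (n + p)))))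
        (n := n * (1 + ∑ t, e t + c)) (by push_cast; grind)]
    abel
  have := LinearMap.congr_fun key y
  rw [LinearMap.comp_apply, LinearMap.add_apply, LinearMap.smul_apply, LinearMap.comp_apply,
    LinearMap.comp_apply, hL] at this
  rw [← hL y]
  exact this

/-- The multiderivation dual to `D`. -/
def toMultiDer : MultiDer h := fun l =>
  { X := D.bra B (l + 1)
    anchor := D.anchor l
    X_mem := fun _ _ hx => D.bra_mem B hx
    X_symm := fun _ _ hx π => D.bra_symm B hx π
    anchor_der := fun e x hx =>
      ⟨fun _ _ ha => D.anchor_mem hx ha, fun p a b ha => by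
        rw [D.anchor_mul hx, twA_of_mem _ ha, negOnePow_smul (k := k), smul_mul_assoc]
        rfl⟩
    anchor_symm := fun _ _ hx π => D.anchor_symm hx π
    anchor_smul := fun _ _ hx i c a ha b => by
      rw [negOnePow_smul (k := k)]
      exact D.anchor_smul hx i ha b
    leibniz := fun _ _ hx c a ha y => by
      rw [negOnePow_smul (k := k)]
      exact D.bra_leibniz B hx ha y }

/-- The value of `d ω` in terms of the dual multiderivation. -/
lemma evF_gen {l : ℕ} {e : Fin (l + 1) → ℤ} {x : Fin (l + 1) → F} (hx : ∀ t, x t ∈ F.gr (e t)) {c : ℤ}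
    {ω : G.dual} (hω : ω ∈ G.dual.gr c) : evF e x (D.d (gen _ ω)) =
      (∑ i : Fin (l + 1), sg k (c * ∑ t : Fin l, e (i.succAbove t) +
        e i * ∑ t ∈ Finset.univ.filter (i < ·), e t) •
          D.anchor l (fun t => x (i.succAbove t)) (evalDual ω (h (x i)))) -
      sg k c • evalDual ω (D.bra B (l + 1) x) := by
  rw [evF, LinearMap.comp_apply, AlgHom.toLinearMap_apply, ← ctrN_apply, ctrN_gen (h := h), map_add,
    Finset.filter_true_of_mem (fun t ht => Finset.mem_range.1 ht), add_comm, sub_eq_add_neg,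
    ← D.q_gen_eq B hx hω, q_apply, brMul_eq hx]
  congr 1
  rw [map_sum, Finset.sum_range]
  refine Finset.sum_congr rfl fun i _ => ?_
  have hxi : ∀ t, x (i.succAbove t) ∈ F.gr (e (i.succAbove t)) := fun t => hx _
  have h1 : ctrN (extz x) (extz e) D.d (l + 1) ((Finset.range (l + 1)).erase i) =
      ctrN (extz fun t => x (i.succAbove t)) (extz fun t => e (i.succAbove t)) D.d l
        (Finset.range l) := by
    rw [ctrN, foldN_erase _ _ _ i.2]
    exact foldN_congr (fun t _ ht => extz_skip x i ht) (fun t _ ht => extz_skip e i ht)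
  have h2 : ∑ t ∈ Finset.range (l + 1) with t < (i : ℕ), extz e t =
      ∑ t ∈ Finset.univ.filter (· < i), e t := by
    rw [← sum_range_extz_coe]
    refine Finset.sum_congr ?_ fun _ _ => rfl
    ext t; simp; omega
  have h3 : D.anchor l (fun t => x (i.succAbove t)) (evalDual ω (h (x i))) =
      sg k ((c + e i) * ∑ t, e (i.succAbove t)) • D.q l (fun t => x (i.succAbove t))
        (coeff _ (evalDual ω (h (x i)))) := by
    rw [D.q_coeff_eq hxi (evalDual_mem hω (h.map_mem (hx i))), sg_smul_smul]
  rw [map_smul, h1, h2, extz_coe, extz_coe, h3, D.q_coeff hxi, smul_smul, ← sg_add, ctrN_apply,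
    sum_succAbove_eq]
  refine congrArg₂ _ (sg_congr (by push_cast; grind)) rfl

end GDer

end SHLR
end

/-! ### Vanishing modulo high weights, and functoriality of brackets. -/

noncomputable section
namespace SHLR

variable {k A : Type u} [Field k] [Ring A] [Algebra k A] {𝒜 : ℤ → Submodule k A}
  [GradedAlgebra 𝒜] [IsGradedComm 𝒜]

open GSym

/-! ### Words in a basis -/

section Word

variable {F : GMod 𝒜} (B : HBasis F)

/-- The tuple of basis elements spelled by a word. -/
def HBasis.word (w : List (Fin B.n)) (t : Fin w.length) : F := B.b (w.get t)

/-- The degrees of the letters of a word. -/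
def HBasis.wordDeg (w : List (Fin B.n)) (t : Fin w.length) : ℤ := B.d (w.get t)

lemma HBasis.word_mem (w : List (Fin B.n)) (t : Fin w.length) : B.word w t ∈ F.gr (B.wordDeg w t) :=
  B.b_mem _

lemma HBasis.sum_wordDeg (w : List (Fin B.n)) : ∑ t, B.wordDeg w t = B.wdeg w := by
  rw [HBasis.wdeg, ← List.sum_ofFn]
  congr 1
  refine List.ext_get (by simp) fun n h1 h2 => ?_
  simp [HBasis.wordDeg]

lemma HBasis.evW_eq_evF (w : List (Fin B.n)) : B.evW w = evF (B.wordDeg w) (B.word w) := by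
  refine LinearMap.ext fun P => ?_
  have : (fun t => (w.map B.b).getD t 0) = extz (B.word w) := by
    funext t
    by_cases h : t < w.length
    · rw [extz_of_lt _ h]
      simp [HBasis.word, h, List.getD_eq_getElem?_getD]
    · simp [extz, h, List.getD_eq_getElem?_getD]
  rw [B.evW_eq w (extz (B.wordDeg w)), this]
  rfl

/-- Converts symmetry under permutations into the exchange of adjacent letters required by
`HBasis.SymW`. -/
lemma word_swap {Y : Type u} [AddCommGroup Y] [Module k Y] (Ψ : ∀ l, (Fin l → F) → Y)
    (hΨ : ∀ (l : ℕ) (e : Fin l → ℤ) (x : Fin l → F), (∀ t, x t ∈ F.gr (e t)) → ∀ π : Equiv.Perm (Fin l),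
      Ψ l (fun t => x (π t)) = koszul π e • Ψ l x) (w₁ : List (Fin B.n)) (r s : Fin B.n)
    (w₂ : List (Fin B.n)) : Ψ _ (B.word (w₁ ++ r :: s :: w₂)) =
      sg k (B.d r * B.d s) • Ψ _ (B.word (w₁ ++ s :: r :: w₂)) := by
  have key (w : List (Fin B.n)) {l : ℕ} (h : w.length = l) :
      Ψ _ (B.word w) = Ψ l (fun t => B.b (w.get (t.cast h.symm))) := by
    subst h; rfl
  have h1 : (w₁ ++ r :: s :: w₂).length = (w₁.length + w₂.length + 1) + 1 := by simp; omega
  have h2 : (w₁ ++ s :: r :: w₂).length = (w₁.length + w₂.length + 1) + 1 := by simp; omega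
  let i : Fin (w₁.length + w₂.length + 1) := ⟨w₁.length, by omega⟩
  rw [key _ h1, key _ h2]
  have h3 := hΨ _ (fun t => B.d ((w₁ ++ s :: r :: w₂).get (t.cast h2.symm)))
    (fun t => B.b ((w₁ ++ s :: r :: w₂).get (t.cast h2.symm))) (fun t => B.b_mem _)
    (Equiv.swap i.castSucc i.succ)
  rw [koszul_swap, negOnePow_smul (k := k)] at h3
  have h4 : (w₁ ++ s :: r :: w₂).get (i.castSucc.cast h2.symm) = s := by simp [i]
  have h5 : (w₁ ++ s :: r :: w₂).get (i.succ.cast h2.symm) = r := by simp [i]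
  rw [h4, h5, mul_comm] at h3
  rw [← h3]
  congr 1
  funext t
  congr 1
  rcases eq_or_ne t i.castSucc with rfl | ht
  · rw [Equiv.swap_apply_left, h5]; simp [i]
  · rcases eq_or_ne t i.succ with rfl | ht'
    · rw [Equiv.swap_apply_right, h4]; simp [i]
    · rw [Equiv.swap_apply_of_ne_of_ne ht ht']
      have h6 : (t : ℕ) ≠ w₁.length := fun h => ht (Fin.ext h)
      have h7 : (t : ℕ) ≠ w₁.length + 1 := fun h => ht' (Fin.ext h)
      simp only [List.get_eq_getElem, Fin.val_cast]
      rcases Nat.lt_or_ge t w₁.length with h | h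
      · rw [List.getElem_append_left h, List.getElem_append_left h]
      · rw [List.getElem_append_right h, List.getElem_append_right h]
        obtain ⟨u, hu⟩ : ∃ u, (t : ℕ) - w₁.length = u + 2 := ⟨t - w₁.length - 2, by omega⟩
        simp [hu]

end Word

/-! ### Brackets and the weight filtration -/

section Fil

variable {F G : GMod 𝒜} {h : GHom F G} {δ : GSym G.dual →ₗ[k] GSym F.dual} {m : ℕ}

lemma aug_of_fil {V : GMod 𝒜} {P : GSym V} (hP : P ∈ fil V 1) : aug V P = 0 := by
  have := pr_zero_eq P
  rw [mem_fil.1 hP 0 (by omega)] at this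
  simpa using (congrArg (aug V) this).symm

lemma aug_brMul_of_fil (hδ : ∀ P, δ P ∈ fil F.dual (m + 1)) {l : ℕ} (hl : l ≤ m) {e : Fin l → ℤ}
    {x : Fin l → F} (hx : ∀ t, x t ∈ F.gr (e t)) (P : GSym G.dual) : aug _ (brMul h δ l x P) = 0 := by
  rw [brMul_eq hx]
  refine aug_of_fil (brN_fil (extz_mem hx) (fun P => fil_anti (by omega) (hδ P)) _ _)

/-- On a coefficient, brackets are contractions, so the hypothesis says that all evaluations on
short words vanish. -/
lemma fil_coeff_of_brMul [CharZero k] (B : HBasis F) {a : A}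
    (hc : ∀ w : List (Fin B.n), w.length ≤ m → aug _ (brMul h δ _ (B.word w) (coeff _ a)) = 0) :
    δ (coeff _ a) ∈ fil F.dual (m + 1) := by
  refine B.mem_fil_of_evW fun w hw => ?_
  have := hc w (by omega)
  rw [brMul_eq (B.word_mem w), brN_coeff, ctrN_apply] at this
  rw [B.evW_eq_evF]
  exact this

lemma evF_gen_eq {l : ℕ} {e : Fin (l + 1) → ℤ} {x : Fin (l + 1) → F} (hx : ∀ t, x t ∈ F.gr (e t))
    (ω : G.dual) : evF e x (δ (gen _ ω)) = aug _ (brMul h δ (l + 1) x (gen _ ω)) +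
      ∑ i : Fin (l + 1), sg k (e i * ∑ t ∈ Finset.univ.filter (· < i), e t) •
        evF (fun t => e (i.succAbove t)) (fun t => x (i.succAbove t)) (δ (coeff _ (evalDual ω (h (x i))))) := by
  rw [evF, LinearMap.comp_apply, AlgHom.toLinearMap_apply, ← ctrN_apply, ctrN_gen (h := h), map_add,
    Finset.filter_true_of_mem (fun t ht => Finset.mem_range.1 ht), brMul_eq hx]
  congr 1
  rw [map_sum, Finset.sum_range]
  refine Finset.sum_congr rfl fun i _ => ?_
  have h1 : ctrN (extz x) (extz e) δ (l + 1) ((Finset.range (l + 1)).erase i) =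
      ctrN (extz fun t => x (i.succAbove t)) (extz fun t => e (i.succAbove t)) δ l
        (Finset.range l) := by
    rw [ctrN, foldN_erase _ _ _ i.2]
    exact foldN_congr (fun t _ ht => extz_skip x i ht) (fun t _ ht => extz_skip e i ht)
  have h2 : ∑ t ∈ Finset.range (l + 1) with t < (i : ℕ), extz e t =
      ∑ t ∈ Finset.univ.filter (· < i), e t := by
    rw [← sum_range_extz_coe]
    refine Finset.sum_congr ?_ fun _ _ => rfl
    ext t; simp; omega
  rw [map_smul, h1, h2, extz_coe, extz_coe, ctrN_apply]
  rfl

/-- On a generator, evaluation and bracket differ by evaluations of δ on coefficients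
(`evF_gen_eq`), and these vanish by `hc`. -/
lemma fil_gen_of_brMul [CharZero k] (B : HBasis F) (hc : ∀ a, δ (coeff _ a) ∈ fil F.dual (m + 1))
    {ω : G.dual} (hg : ∀ w : List (Fin B.n), w.length ≤ m →
      aug _ (brMul h δ _ (B.word w) (gen _ ω)) = 0) :
    δ (gen _ ω) ∈ fil F.dual (m + 1) := by
  refine B.mem_fil_of_evW fun w hw => ?_
  rw [B.evW_eq_evF]
  have key : ∀ (l : ℕ) (e : Fin l → ℤ) (x : Fin l → F), (∀ t, x t ∈ F.gr (e t)) → l ≤ m →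
      aug _ (brMul h δ _ x (gen _ ω)) = 0 → evF e x (δ (gen _ ω)) = 0 := by
    intro l e x hx hl h0
    cases l with
    | zero =>
      rw [brMul_eq hx] at h0
      exact h0
    | succ l =>
      rw [evF_gen_eq (h := h) hx, h0, zero_add]
      refine Finset.sum_eq_zero fun i _ => ?_
      rw [evF_of_fil (by omega) (fun t => hx _) (hc _), smul_zero]
  exact key _ _ _ (B.word_mem w) (by omega) (hg w (by omega))

/-- Skewness is asked only after projection to the truncation, because a composite of two
derivations will be skew only modulo high weights. -/
lemma fil_of_skew {ρ₁ ρ₂ : GSym G.dual →ₐ[k] TruncSym F.dual m}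
    (hs : IsSkewDer ρ₁ ρ₂ ((TruncSym.proj F.dual m).toLinearMap ∘ₗ δ))
    (hc : ∀ a, δ (coeff _ a) ∈ fil F.dual (m + 1)) (hg : ∀ ω, δ (gen _ ω) ∈ fil F.dual (m + 1))
    (P : GSym G.dual) : δ P ∈ fil F.dual (m + 1) := by
  have : (TruncSym.proj F.dual m).toLinearMap ∘ₗ δ = 0 :=
    skewDer_ext hs (fun P Q => by simp) (fun a => TruncSym.proj_eq_zero_iff.2 (hc a))
      (fun ω => TruncSym.proj_eq_zero_iff.2 (hg ω))
  exact TruncSym.proj_eq_zero_iff.1 (LinearMap.congr_fun this P)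

end Fil

/-! ### Functoriality of brackets -/

section Functoriality

variable {F F' G G' : GMod 𝒜}

lemma brMul_comp_map {h : GHom F G} (δ : GSym G.dual →ₗ[k] GSym F.dual) (v : GHom G G') {l : ℕ}
    {e : Fin l → ℤ} {x : Fin l → F} (hx : ∀ t, x t ∈ F.gr (e t)) :
    brMul (v.comp h) (δ ∘ₗ (GSym.map v.dual).toLinearMap) l x =
      brMul h δ l x ∘ₗ (GSym.map v.dual).toLinearMap := by
  rw [brMul_eq hx, brMul_eq hx, brN, brN]
  have hx' := extz_mem hx
  generalize extz x = y at *
  generalize extz e = d at *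
  clear hx x e
  induction l with
  | zero => rfl
  | succ l ih =>
    rw [foldN_range_succ, ih, foldN_range_succ]
    refine LinearMap.ext fun P => ?_
    rw [brStep_apply, LinearMap.comp_apply, LinearMap.comp_apply, LinearMap.comp_apply, brStep_apply,
      AlgHom.toLinearMap_apply, AlgHom.toLinearMap_apply, ctr_map (h.map_mem (hx' l))]
    rfl

lemma brMul_map_comp {h : GHom F G} (δ : GSym G.dual →ₗ[k] GSym F.dual) (u : GHom F' F) {l : ℕ}
    {e : Fin l → ℤ} {x : Fin l → F'} (hx : ∀ t, x t ∈ F'.gr (e t)) :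
    brMul (h.comp u) ((GSym.map u.dual).toLinearMap ∘ₗ δ) l x =
      (GSym.map u.dual).toLinearMap ∘ₗ brMul h δ l (fun t => u (x t)) := by
  rw [brMul_eq hx, brMul_eq (fun t => u.map_mem (hx t))]
  have hx' := extz_mem hx
  have hu : extz (fun t => u (x t)) = fun t => u (extz x t) := by
    funext t
    rw [extz, extz]
    split_ifs
    · rfl
    · rw [map_zero]
  rw [hu, brN, brN]
  generalize extz x = y at *
  generalize extz e = d at *
  clear hx hu x e
  induction l with
  | zero => rfl
  | succ l ih =>
    rw [foldN_range_succ, ih, foldN_range_succ]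
    refine LinearMap.ext fun P => ?_
    rw [brStep_apply, LinearMap.comp_apply, LinearMap.comp_apply, LinearMap.comp_apply, brStep_apply,
      AlgHom.toLinearMap_apply, AlgHom.toLinearMap_apply, AlgHom.toLinearMap_apply, ctr_map (hx' l),
      map_sub, map_smul]
    rfl

end Functoriality

end SHLR
end

/-! ### Construction, transport and comparison of derivations between finite modules. -/

noncomputable section
namespace SHLR

variable {k A : Type u} [Field k] [Ring A] [Algebra k A] {𝒜 : ℤ → Submodule k A}

@[ext]
lemma GHom.ext {M N : GMod 𝒜} {f g : GHom M N} (h : ∀ x, f x = g x) : f = g := by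
  cases f; cases g
  congr 1
  exact LinearMap.ext h

variable [GradedAlgebra 𝒜] [IsGradedComm 𝒜]

open GSym

namespace GDer

variable {F F' G G' : GMod 𝒜}

/-- An instance of `exists_skewDer`. The two commutation relations are automatic: the values have
the right degrees and Sym(F^*) is graded commutative. Only the two product rules remain as
hypotheses. -/
lemma exists_of {h : GHom F G} (δ₀ : A →ₗ[k] GSym F.dual) (δ₁ : G.dual →ₗ[k] GSym F.dual)
    (hmul : ∀ a b, δ₀ (a * b) = coeff _ (twA 𝒜 1 a) * δ₀ b + δ₀ a * coeff _ b)
    (hsmul : ∀ (a : A) (ω : G.dual), δ₁ (a • ω) = coeff _ (twA 𝒜 1 a) * δ₁ ω + δ₀ a * gen _ (h.dual ω))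
    (hd₀ : ∀ (p : ℤ) (a : A), a ∈ 𝒜 p → δ₀ a ∈ deg F.dual (p + 1))
    (hd₁ : ∀ (p : ℤ) (ω : G.dual), ω ∈ G.dual.gr p → δ₁ ω ∈ deg F.dual (p + 1))
    (haug : ∀ ω, aug _ (δ₁ ω) = 0) :
    ∃ D : GDer h, (∀ a, D.d (coeff _ a) = δ₀ a) ∧ ∀ ω, D.d (gen _ ω) = δ₁ ω := by
  obtain ⟨D, hD, h0, h1⟩ := exists_skewDer ((tw F.dual 1).comp (GSym.map h.dual))
    ((tw F.dual 0).comp (GSym.map h.dual)) δ₀ δ₁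
    (fun a b => by simp [hmul, twA_zero])
    (fun a v => by simp only [AlgHom.comp_apply, map_coeff, map_gen, tw_coeff, hsmul, tw_zero])
    (fun i j a v ha hv => by
      have hv' := gen_mem_deg (h.dual.map_mem hv)
      simp only [AlgHom.comp_apply, map_coeff, map_gen, tw_coeff, tw_zero, twA_zero]
      rw [tw_of_mem _ hv', twA_of_mem _ ha, smul_mul_assoc, gcomm hv' (hd₀ _ _ ha),
        gcomm (hd₁ _ _ hv) (coeff_mem_deg ha), map_smul, smul_mul_assoc, smul_add, smul_smul, smul_smul,
        ← sg_add, ← sg_add, add_comm]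
      refine congrArg₂ _ (congrArg₂ _ (sg_congr (by push_cast; grind)) rfl)
        (congrArg₂ _ (sg_congr (by push_cast; grind)) rfl))
    (fun i j v w hv hw => by
      have hv' := gen_mem_deg (h.dual.map_mem hv)
      have hw' := gen_mem_deg (h.dual.map_mem hw)
      simp only [AlgHom.comp_apply, map_gen, tw_zero]
      rw [tw_of_mem _ hv', tw_of_mem _ hw', smul_mul_assoc, smul_mul_assoc, gcomm hv' (hd₁ _ _ hw),
        gcomm (hd₁ _ _ hv) hw', smul_add, smul_smul, smul_smul, ← sg_add, ← sg_add, add_comm]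
      refine congrArg₂ _ (congrArg₂ _ (sg_congr (by push_cast; grind)) rfl)
        (congrArg₂ _ (sg_congr (by push_cast; grind)) rfl))
  refine ⟨⟨D, ⟨hD, fun {p P} hP => ?_⟩, fun ω => by rw [h1, haug]⟩, h0, h1⟩
  rw [add_zero]
  refine deg_induction (C := fun p P => D P ∈ deg F.dual (p + 1)) (fun p a ha => ?_) (fun p q P v hP ih hv => ?_)
    (fun p => by simp) (fun p P Q h h' => by rw [map_add]; exact add_mem h h')
    (fun p r P h => by rw [map_smul]; exact Submodule.smul_mem _ _ h) hP
  · rw [h0]; exact hd₀ _ _ ha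
  · rw [hD]
    have e1 : p + q + 1 = p + (q + 1) := by ring
    have e2 : p + q + 1 = p + 1 + q := by ring
    refine add_mem ?_ ?_
    · rw [e1, h1, AlgHom.comp_apply, tw_of_mem _ (map_deg _ hP), smul_mul_assoc]
      exact Submodule.smul_mem _ _ (deg_mul (map_deg _ hP) (hd₁ _ _ hv))
    · rw [e2, AlgHom.comp_apply, tw_zero, map_gen]
      exact deg_mul ih (gen_mem_deg (h.dual.map_mem hv))

lemma _root_.SHLR.GSym.map_dual_comp {h : GHom F G} {v : GHom G G'} {h' : GHom F G'}
    (hv : ∀ x, v (h x) = h' x) (P : GSym G'.dual) :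
    GSym.map h.dual (GSym.map v.dual P) = GSym.map h'.dual P := by
  have : (GSym.map h.dual).comp (GSym.map v.dual) = GSym.map h'.dual :=
    GSym.hom_ext (fun a => by simp) (fun ω => by
      rw [AlgHom.comp_apply, map_gen, map_gen, map_gen, GHom.dual_dual_eq h v h' hv])
  exact DFunLike.congr_fun this P

/-- Restriction of a derivation along `v^* : Sym(G'^*) → Sym(G^*)`. -/
def push {h : GHom F G} (D : GDer h) (v : GHom G G') {h' : GHom F G'} (hv : ∀ x, v (h x) = h' x) :
    GDer h' where
  d := D.d ∘ₗ (GSym.map v.dual).toLinearMap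
  isBr :=
    { skew := fun P Q => by
        have := D.isBr.mul (GSym.map v.dual P) (GSym.map v.dual Q)
        rw [map_dual_comp hv, map_dual_comp hv] at this
        rw [LinearMap.comp_apply, AlgHom.toLinearMap_apply, map_mul, this]
        rfl
      mem_deg := fun hP => D.isBr.mem_deg (map_deg _ hP) }
  aug_gen := fun ω => by
    rw [LinearMap.comp_apply, AlgHom.toLinearMap_apply, map_gen]
    exact D.aug_gen _

/-- Composition of a derivation with `u^* : Sym(F^*) → Sym(F'^*)`. -/
def pull {h : GHom F G} (D : GDer h) (u : GHom F' F) {h' : GHom F' G} (hu : ∀ x, h (u x) = h' x) :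
    GDer h' where
  d := (GSym.map u.dual).toLinearMap ∘ₗ D.d
  isBr :=
    { skew := fun P Q => by
        rw [LinearMap.comp_apply, D.isBr.mul, AlgHom.toLinearMap_apply, map_add, map_mul, map_mul, map_tw,
          map_tw, map_dual_comp hu, map_dual_comp hu]
        rfl
      mem_deg := fun hP => map_deg _ (D.isBr.mem_deg hP) }
  aug_gen := fun ω => by
    rw [LinearMap.comp_apply, AlgHom.toLinearMap_apply, aug_map]
    exact D.aug_gen _

lemma q_push {h : GHom F G} (D : GDer h) (v : GHom G G') {h' : GHom F G'} (hv : ∀ x, v (h x) = h' x)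
    {l : ℕ} {e : Fin l → ℤ} {x : Fin l → F} (hx : ∀ t, x t ∈ F.gr (e t)) (P : GSym G'.dual) :
    (D.push v hv).q l x P = D.q l x (GSym.map v.dual P) := by
  obtain rfl : v.comp h = h' := GHom.ext hv
  rw [q_apply, q_apply]
  exact congrArg (aug _) (LinearMap.congr_fun (brMul_comp_map D.d v hx) P)

lemma q_pull {h : GHom F G} (D : GDer h) (u : GHom F' F) {h' : GHom F' G} (hu : ∀ x, h (u x) = h' x)
    {l : ℕ} {e : Fin l → ℤ} {x : Fin l → F'} (hx : ∀ t, x t ∈ F'.gr (e t)) (P : GSym G.dual) :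
    (D.pull u hu).q l x P = D.q l (fun t => u (x t)) P := by
  obtain rfl : h.comp u = h' := GHom.ext hu
  rw [q_apply, q_apply, ← aug_map u.dual]
  exact congrArg (aug _) (LinearMap.congr_fun (brMul_map_comp D.d u hx) P)

lemma anchor_push {h : GHom F G} (D : GDer h) (v : GHom G G') {h' : GHom F G'} (hv : ∀ x, v (h x) = h' x)
    {l : ℕ} {e : Fin l → ℤ} {x : Fin l → F} (hx : ∀ t, x t ∈ F.gr (e t)) :
    (D.push v hv).anchor l x = D.anchor l x := by
  refine LinearMap.ext fun a => ?_
  rw [anchor_apply _ hx, anchor_apply _ hx, q_push _ _ _ hx, map_coeff]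

lemma bra_push {h : GHom F G} (D : GDer h) (v : GHom G G') {h' : GHom F G'} (hv : ∀ x, v (h x) = h' x)
    (B : HBasis G) (B' : HBasis G')
    {l : ℕ} {e : Fin l → ℤ} {x : Fin l → F} (hx : ∀ t, x t ∈ F.gr (e t)) :
    (D.push v hv).bra B' l x = v (D.bra B l x) := by
  refine B'.ext_eval fun c ω hω => ?_
  rw [eval_bra _ B' hx hω, q_push _ _ _ hx, map_gen, ← evalDual_dual v, eval_bra _ B hx (v.dual.map_mem hω)]

lemma anchor_pull {h : GHom F G} (D : GDer h) (u : GHom F' F) {h' : GHom F' G} (hu : ∀ x, h (u x) = h' x)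
    {l : ℕ} {e : Fin l → ℤ} {x : Fin l → F'} (hx : ∀ t, x t ∈ F'.gr (e t)) :
    (D.pull u hu).anchor l x = D.anchor l (fun t => u (x t)) := by
  refine LinearMap.ext fun a => ?_
  rw [anchor_apply _ hx, anchor_apply _ (fun t => u.map_mem (hx t)), q_pull _ _ _ hx]

lemma bra_pull {h : GHom F G} (D : GDer h) (u : GHom F' F) {h' : GHom F' G} (hu : ∀ x, h (u x) = h' x)
    (B : HBasis G) {l : ℕ} {e : Fin l → ℤ} {x : Fin l → F'} (hx : ∀ t, x t ∈ F'.gr (e t)) :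
    (D.pull u hu).bra B l x = D.bra B l (fun t => u (x t)) := by
  refine B.ext_eval fun c ω hω => ?_
  rw [eval_bra _ B hx hω, q_pull _ _ _ hx, eval_bra _ B (fun t => u.map_mem (hx t)) hω]

lemma q_zero_gen {h : GHom F G} (D : GDer h) (x : Fin 0 → F) (ω : G.dual) : D.q 0 x (gen _ ω) = 0 := by
  rw [q_apply, brMul_eq (e := fun _ => 0) (fun t => t.elim0)]
  exact D.aug_gen ω

lemma bra_zero {h : GHom F G} (D : GDer h) (B : HBasis G) (x : Fin 0 → F) : D.bra B 0 x = 0 := by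
  rw [bra_apply]
  simp [q_zero_gen]

/-- `D` and `D'` agree modulo weights `> m`. -/
def Agree {h : GHom F G} (m : ℕ) (D D' : GDer h) : Prop := ∀ P, D.d P - D'.d P ∈ fil F.dual (m + 1)

lemma brMul_sub {h : GHom F G} (δ δ' : GSym G.dual →ₗ[k] GSym F.dual) {l : ℕ} {e : Fin l → ℤ}
    {x : Fin l → F} (hx : ∀ t, x t ∈ F.gr (e t)) :
    brMul h (δ - δ') l x = brMul h δ l x - brMul h δ' l x := by
  rw [brMul_eq hx, brMul_eq hx, brMul_eq hx, brN, foldN_sub]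

lemma Agree.q_eq {h : GHom F G} {m : ℕ} {D D' : GDer h} (H : Agree m D D') {l : ℕ} (hl : l ≤ m)
    {e : Fin l → ℤ} {x : Fin l → F} (hx : ∀ t, x t ∈ F.gr (e t)) (P : GSym G.dual) :
    D.q l x P = D'.q l x P := by
  have := aug_brMul_of_fil (h := h) (δ := D.d - D'.d) H hl hx P
  rwa [brMul_sub _ _ hx, LinearMap.sub_apply, map_sub, sub_eq_zero] at this

lemma Agree.anchor_eq {h : GHom F G} {m : ℕ} {D D' : GDer h} (H : Agree m D D') {l : ℕ} (hl : l ≤ m)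
    {e : Fin l → ℤ} {x : Fin l → F} (hx : ∀ t, x t ∈ F.gr (e t)) : D.anchor l x = D'.anchor l x :=
  LinearMap.ext fun a => by rw [anchor_apply _ hx, anchor_apply _ hx, H.q_eq hl hx]

lemma Agree.bra_eq {h : GHom F G} {m : ℕ} {D D' : GDer h} (H : Agree m D D') (B : HBasis G) {l : ℕ}
    (hl : l ≤ m) {e : Fin l → ℤ} {x : Fin l → F} (hx : ∀ t, x t ∈ F.gr (e t)) :
    D.bra B l x = D'.bra B l x :=
  B.ext_eval fun c ω hω => by rw [eval_bra _ B hx hω, eval_bra _ B hx hω, H.q_eq hl hx]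

lemma fil_of_coeff_gen {h : GHom F G} {m : ℕ} {D D' : GDer h}
    (hc : ∀ a, D.d (coeff _ a) - D'.d (coeff _ a) ∈ fil F.dual (m + 1))
    (hg : ∀ ω, D.d (gen _ ω) - D'.d (gen _ ω) ∈ fil F.dual (m + 1)) : Agree m D D' := by
  refine fil_of_skew (δ := D.d - D'.d)
    (ρ₁ := (TruncSym.proj F.dual m).comp ((tw F.dual 1).comp (GSym.map h.dual)))
    (ρ₂ := (TruncSym.proj F.dual m).comp ((tw F.dual 0).comp (GSym.map h.dual))) (fun P Q => ?_) hc hg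
  simp only [LinearMap.comp_apply, LinearMap.sub_apply, AlgHom.toLinearMap_apply, D.isBr.mul, D'.isBr.mul,
    map_sub, map_add, map_mul, AlgHom.comp_apply, mul_sub, sub_mul]
  abel

/-- Uniqueness at finite level: the anchors on words fix a derivation on coefficients modulo weights
> `m`, after which the brackets fix it on generators. -/
lemma agree_of_words [CharZero k] {h : GHom F G} {m : ℕ} {D D' : GDer h} (BF : HBasis F) (B : HBasis G)
    (ha : ∀ w : List (Fin BF.n), w.length ≤ m → D.anchor _ (BF.word w) = D'.anchor _ (BF.word w))
    (hb : ∀ w : List (Fin BF.n), w.length ≤ m → D.bra B _ (BF.word w) = D'.bra B _ (BF.word w)) :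
    Agree m D D' := by
  have hc : ∀ a, (D.d - D'.d) (coeff _ a) ∈ fil F.dual (m + 1) := fun a =>
    fil_coeff_of_brMul (h := h) (δ := D.d - D'.d) BF (fun w hw => by
      have h1 := LinearMap.congr_fun (ha w hw) (twA 𝒜 (∑ t, BF.wordDeg w t) a)
      rw [anchor_apply _ (BF.word_mem w), anchor_apply _ (BF.word_mem w), twA_self] at h1
      rwa [brMul_sub _ _ (BF.word_mem w), LinearMap.sub_apply, map_sub, sub_eq_zero])
  refine fil_of_coeff_gen hc fun ω => ?_
  -- Passing to the quotient by `fil` makes the claim linear in ω, so ω may be taken homogeneous.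
  have key : (fil F.dual (m + 1)).mkQ ∘ₗ (D.d - D'.d) ∘ₗ gen G.dual = 0 := by
    refine GMod.lin_ext fun c ω hω => ?_
    refine (Submodule.Quotient.mk_eq_zero _).2 ?_
    refine fil_gen_of_brMul (h := h) BF hc fun w hw => ?_
    have h1 := q_gen_eq D B (BF.word_mem w) hω
    rw [hb w hw, ← q_gen_eq D' B (BF.word_mem w) hω] at h1
    rwa [brMul_sub _ _ (BF.word_mem w), LinearMap.sub_apply, map_sub, sub_eq_zero]
  exact (Submodule.Quotient.mk_eq_zero _).1 (LinearMap.congr_fun key ω)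

end GDer

end SHLR
end

/-! ### From a multiderivation to a derivation, for finite modules. -/

noncomputable section
namespace SHLR

variable {k A : Type u} [Field k] [Ring A] [Algebra k A] {𝒜 : ℤ → Submodule k A}

/-! ### Extensionality of multiderivations -/

lemma multilinear_ext_hom {F : GMod 𝒜} {Y : Type u} [AddCommGroup Y] [Module k Y] {l : ℕ}
    {Φ Φ' : MultilinearMap k (fun _ : Fin l => F) Y}
    (h : ∀ (e : Fin l → ℤ) (x : Fin l → F), (∀ t, x t ∈ F.gr (e t)) → Φ x = Φ' x) : Φ = Φ' := by
  refine MultilinearMap.ext fun x => ?_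
  choose S hS using fun t => exists_sum_component F.isInternal (x t)
  have hx : x = fun t => ∑ p ∈ S t, component F.isInternal p (x t) :=
    funext fun t => (hS t _ subset_rfl).symm
  rw [hx, MultilinearMap.map_sum_finset, MultilinearMap.map_sum_finset]
  exact Finset.sum_congr rfl fun p _ => h p _ fun t => component_mem _ _ _

/-- Graded symmetry moves slot `i` to the end, where the Leibniz rule applies. With equal anchors
and equal values at `x`, the values after scaling one argument are equal too. -/
lemma MultiDerW.X_update {M N : GMod 𝒜} {f : GHom M N} {l : ℕ} {Z Z' : MultiDerW f l}
    (hanc : Z.anchor = Z'.anchor) {e : Fin (l + 1) → ℤ} {x : Fin (l + 1) → M} (hx : ∀ t, x t ∈ M.gr (e t))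
    (hX : Z.X x = Z'.X x) (i : Fin (l + 1)) {c : ℤ} {a : A} (ha : a ∈ 𝒜 c) :
    Z.X (Function.update x i (a • x i)) = Z'.X (Function.update x i (a • x i)) := by
  have hu : ∀ t, Function.update x i (a • x i) t ∈ M.gr (Function.update e i (c + e i) t) := by
    intro t
    rcases eq_or_ne t i with rfl | ht
    · simpa using M.smul_mem ha (hx t)
    · simpa [ht] using hx t
  let π := Equiv.swap i (Fin.last l)
  have h1 : (fun t => Function.update x i (a • x i) (π t)) =
      Fin.snoc (α := fun _ => M) (fun t => x (π t.castSucc)) (a • x i) := by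
    funext t
    refine Fin.lastCases ?_ (fun t => ?_) t
    · simp [π]
    · rw [Fin.snoc_castSucc, Function.update_of_ne]
      intro h
      have : t.castSucc = Fin.last l := by
        rw [← π.injective.eq_iff, h]; simp [π]
      exact absurd this (Fin.castSucc_lt_last t).ne
  have h2 : (fun t => x (π t)) = Fin.snoc (α := fun _ => M) (fun t => x (π t.castSucc)) (x i) := by
    funext t
    refine Fin.lastCases ?_ (fun t => ?_) t
    · simp [π]
    · rw [Fin.snoc_castSucc]
  have h3 := Z.X_symm _ _ hu π
  have h4 := Z'.X_symm _ _ hu π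
  have h5 := Z.X_symm _ _ hx π
  have h6 := Z'.X_symm _ _ hx π
  rw [h1, Z.leibniz (fun t => e (π t.castSucc)) _ (fun t => hx _) c a ha] at h3
  rw [h1, Z'.leibniz (fun t => e (π t.castSucc)) _ (fun t => hx _) c a ha] at h4
  rw [h2] at h5 h6
  have h7 := smul_left_cancel (koszul π (Function.update e i (c + e i)))
    (x := Z.X (Function.update x i (a • x i))) (y := Z'.X (Function.update x i (a • x i)))
  refine h7 ?_
  rw [← h3, ← h4, h5, h6, hX, hanc]

variable [GradedAlgebra 𝒜] [IsGradedComm 𝒜]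

open GSym

/-- Brackets are not A-multilinear, so coefficients cannot simply be pulled out of an expansion in
the basis. They are inserted one slot at a time, `hstep` transporting equality across each
insertion. -/
lemma multilinear_ext_basis {F : GMod 𝒜} (B : HBasis F) {Y : Type u} [AddCommGroup Y] [Module k Y] {l : ℕ}
    {Φ Φ' : MultilinearMap k (fun _ : Fin l => F) Y}
    (hstep : ∀ (e : Fin l → ℤ) (x : Fin l → F), (∀ t, x t ∈ F.gr (e t)) → Φ x = Φ' x → ∀ (i : Fin l) (c : ℤ)
      (a : A), a ∈ 𝒜 c → Φ (Function.update x i (a • x i)) = Φ' (Function.update x i (a • x i)))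
    (h : ∀ s : Fin l → Fin B.n, Φ (fun t => B.b (s t)) = Φ' (fun t => B.b (s t))) : Φ = Φ' := by
  refine multilinear_ext_hom fun e x hx => ?_
  have hx' : x = fun t => ∑ s, twA 𝒜 (B.d s) (evalDual (B.β s) (x t)) • B.b s := funext fun t => B.expand (x t)
  rw [hx', MultilinearMap.map_sum, MultilinearMap.map_sum]
  refine Finset.sum_congr rfl fun s _ => ?_
  have ha : ∀ t, twA 𝒜 (B.d (s t)) (evalDual (B.β (s t)) (x t)) ∈ 𝒜 (-B.d (s t) + e t) :=
    fun t => twA_mem _ (evalDual_mem (B.β_mem _) (hx t))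
  -- The first `j` slots already carry their coefficients; the others still hold bare basis
  -- elements.
  have key : ∀ j : ℕ, Φ (fun t : Fin l => if (t : ℕ) < j then twA 𝒜 (B.d (s t)) (evalDual (B.β (s t)) (x t)) • B.b (s t)
        else B.b (s t)) =
      Φ' (fun t : Fin l => if (t : ℕ) < j then twA 𝒜 (B.d (s t)) (evalDual (B.β (s t)) (x t)) • B.b (s t)
        else B.b (s t)) := by
    intro j
    induction j with
    | zero => simpa using h s
    | succ j ih =>
      by_cases hj : j < l
      · have h1 := hstep (fun t : Fin l => if (t : ℕ) < j then -B.d (s t) + e t + B.d (s t) else B.d (s t)) _ (fun t => by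
          split_ifs
          · exact F.smul_mem (ha t) (B.b_mem _)
          · exact B.b_mem _) ih ⟨j, hj⟩ _ _ (ha ⟨j, hj⟩)
        convert h1 using 2 <;>
        · funext t
          rcases eq_or_ne t ⟨j, hj⟩ with rfl | ht
          · simp
          · have : (t : ℕ) ≠ j := fun h => ht (Fin.ext h)
            rw [Function.update_of_ne ht]
            simp only [show (t : ℕ) < j + 1 ↔ (t : ℕ) < j by omega]
      · convert ih using 2 <;>
        · funext t
          simp only [show (t : ℕ) < j + 1 ↔ (t : ℕ) < j by omega]
  simpa using key l

lemma word_ofFn {F : GMod 𝒜} (B : HBasis F) {Y : Type*} (Ψ : ∀ l, (Fin l → F) → Y) {l : ℕ}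
    (s : Fin l → Fin B.n) : Ψ _ (B.word (List.ofFn s)) = Ψ l (fun t => B.b (s t)) := by
  have key (w : List (Fin B.n)) {l : ℕ} (h : w.length = l) :
      Ψ _ (B.word w) = Ψ l (fun t => B.b (w.get (t.cast h.symm))) := by
    subst h; rfl
  rw [key _ (List.length_ofFn)]
  simp

/-- The anchors of a multiderivation, on a basis. -/
lemma anchor_ext_words {F : GMod 𝒜} (B : HBasis F) {l : ℕ} {Φ Φ' : MultilinearMap k (fun _ : Fin l => F) (A →ₗ[k] A)}
    (hΦ : ∀ (e : Fin l → ℤ) (m : Fin l → F), (∀ t, m t ∈ F.gr (e t)) →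
      ∀ (i : Fin l) (c : ℤ) (a : A), a ∈ 𝒜 c → ∀ b : A, Φ (Function.update m i (a • m i)) b =
        (c * (1 + ∑ t ∈ Finset.univ.filter (· < i), e t)).negOnePow • (a * Φ m b))
    (hΦ' : ∀ (e : Fin l → ℤ) (m : Fin l → F), (∀ t, m t ∈ F.gr (e t)) →
      ∀ (i : Fin l) (c : ℤ) (a : A), a ∈ 𝒜 c → ∀ b : A, Φ' (Function.update m i (a • m i)) b =
        (c * (1 + ∑ t ∈ Finset.univ.filter (· < i), e t)).negOnePow • (a * Φ' m b))
    (h : ∀ s : Fin l → Fin B.n, Φ (fun t => B.b (s t)) = Φ' (fun t => B.b (s t))) : Φ = Φ' :=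
  multilinear_ext_basis B (fun e x hx hΦx i c a ha => LinearMap.ext fun b => by
    rw [hΦ e x hx i c a ha, hΦ' e x hx i c a ha, hΦx]) h

/-- Transport of a multiderivation along `u : F' → F` and `v : G → N`. -/
def MultiDerW.conj {F F' G N : GMod 𝒜} {h : GHom F G} {f' : GHom F' N} {l : ℕ} (Z : MultiDerW h l)
    (u : GHom F' F) (v : GHom G N) (hf : ∀ x, v (h (u x)) = f' x) : MultiDerW f' l where
  X := v.lin.compMultilinearMap (Z.X.compLinearMap fun _ => u.lin)
  anchor := Z.anchor.compLinearMap fun _ => u.lin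
  X_mem := fun e m hm => v.map_mem (Z.X_mem e _ fun t => u.map_mem (hm t))
  X_symm := fun e m hm π => by
    have := Z.X_symm e (fun t => u (m t)) (fun t => u.map_mem (hm t)) π
    have h2 := congrArg v.lin this
    rw [units_smul (k := k), map_smul, ← units_smul] at h2
    exact h2
  anchor_der := fun e m hm => Z.anchor_der e _ fun t => u.map_mem (hm t)
  anchor_symm := fun e m hm π => Z.anchor_symm e (fun t => u (m t)) (fun t => u.map_mem (hm t)) π
  anchor_smul := fun e m hm i c a ha b => by
    have := Z.anchor_smul e (fun t => u (m t)) (fun t => u.map_mem (hm t)) i c a ha b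
    have h2 : (fun t => u.lin (Function.update m i (a • m i) t)) =
        Function.update (fun t => u (m t)) i (a • u (m i)) := by
      funext t
      rcases eq_or_ne t i with rfl | ht
      · rw [Function.update_self, Function.update_self]; exact u.toLin.map_smul a (m t)
      · rw [Function.update_of_ne ht, Function.update_of_ne ht]; rfl
    rw [MultilinearMap.compLinearMap_apply, h2]
    exact this
  leibniz := fun e m hm c a ha x => by
    have := Z.leibniz e (fun t => u (m t)) (fun t => u.map_mem (hm t)) c a ha (u x)
    have h2 (y : F') : (fun t => u.lin ((Fin.snoc (α := fun _ => F') m y : Fin (l + 1) → F') t)) =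
        Fin.snoc (α := fun _ => F) (fun t => u (m t)) (u y) := by
      funext t
      refine Fin.lastCases ?_ (fun t => ?_) t
      · rw [Fin.snoc_last, Fin.snoc_last]; rfl
      · rw [Fin.snoc_castSucc, Fin.snoc_castSucc]; rfl
    have h3 : u (a • x) = a • u x := u.toLin.map_smul a x
    have h5 (y : F') : v.lin.compMultilinearMap (Z.X.compLinearMap fun _ => u.lin)
        (Fin.snoc (α := fun _ => F') m y) = v.lin (Z.X (Fin.snoc (α := fun _ => F) (fun t => u (m t)) (u y))) := by
      rw [LinearMap.compMultilinearMap_apply, MultilinearMap.compLinearMap_apply, h2 y]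
    have h4 (a : A) (y : G) : v.lin (a • y) = a • v.lin y := v.toLin.map_smul a y
    rw [h5, h5, h3, this, map_add, h4, negOnePow_smul (k := k), v.lin.map_smul, ← negOnePow_smul, h4, ← hf]
    rfl

end SHLR
end

noncomputable section
namespace SHLR

variable {k A : Type u} [Field k] [Ring A] [Algebra k A] {𝒜 : ℤ → Submodule k A}
  [GradedAlgebra 𝒜] [IsGradedComm 𝒜]

open GSym

/-! ### Derivations dual to a given multiderivation -/

namespace GDer

variable {F G N : GMod 𝒜} {h : GHom F G}

/-- The values on words determining the derivation of a coefficient. -/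
def ancW (B : HBasis F) {f' : GHom F N} (X : MultiDer f') (a : A) (w : List (Fin B.n)) : A :=
  (X w.length).anchor (B.word w) (twA 𝒜 (B.wdeg w) a)

lemma ancW_symm (B : HBasis F) {f' : GHom F N} (X : MultiDer f') (a : A) (j : ℕ) :
    B.SymW (ancW B X a) j := by
  intro w₁ r s w₂ _
  have h1 : B.wdeg (w₁ ++ r :: s :: w₂) = B.wdeg (w₁ ++ s :: r :: w₂) := by
    simp only [HBasis.wdeg, List.map_append, List.map_cons, List.sum_append, List.sum_cons]
    ring
  have h2 := word_swap B (fun l x => (X l).anchor x) (fun l e x hx π => (X l).anchor_symm e x hx π) w₁ r s w₂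
  rw [ancW, ancW, h1, h2]
  rfl

lemma ancW_mem (B : HBasis F) {f' : GHom F N} (X : MultiDer f') {p : ℤ} {a : A} (ha : a ∈ 𝒜 p)
    (w : List (Fin B.n)) : ancW B X a w ∈ 𝒜 (p + 1 + B.wdeg w) := by
  have := ((X w.length).anchor_der _ _ (B.word_mem w)).1 p _ (twA_mem (B.wdeg w) ha)
  rw [B.sum_wordDeg] at this
  rwa [show p + 1 + B.wdeg w = 1 + B.wdeg w + p by ring]

lemma ancW_mul (B : HBasis F) {f' : GHom F N} (X : MultiDer f') (a b : A) (w : List (Fin B.n)) :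
    ancW B X (a * b) w = twA 𝒜 1 a * ancW B X b w + ancW B X a w * twA 𝒜 (B.wdeg w) b := by
  have hd := ((X w.length).anchor_der _ _ (B.word_mem w)).2
  rw [B.sum_wordDeg] at hd
  have key : (X w.length).anchor (B.word w) ∘ₗ LinearMap.mulRight k (twA 𝒜 (B.wdeg w) b) =
      LinearMap.mulRight k ((X w.length).anchor (B.word w) (twA 𝒜 (B.wdeg w) b)) ∘ₗ
        (twA 𝒜 (1 + B.wdeg w)).toLinearMap +
      LinearMap.mulRight k (twA 𝒜 (B.wdeg w) b) ∘ₗ (X w.length).anchor (B.word w) := by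
    refine lin_ext_alg 𝒜 fun p x hx => ?_
    simp only [LinearMap.comp_apply, LinearMap.mulRight_apply, LinearMap.add_apply, AlgHom.toLinearMap_apply]
    rw [hd p _ _ hx, negOnePow_smul (k := k), twA_of_mem _ hx, smul_mul_assoc, add_comm]
    rfl
  have := LinearMap.congr_fun key (twA 𝒜 (B.wdeg w) a)
  simp only [LinearMap.comp_apply, LinearMap.mulRight_apply, LinearMap.add_apply, AlgHom.toLinearMap_apply] at this
  rw [ancW, map_mul, this, ← twA_twA 1, twA_self]
  rfl

/-- The derivation on coefficients dual to the anchors of weight at most `m`. -/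
def ancElt (B : HBasis F) {f' : GHom F N} (X : MultiDer f') (m : ℕ) : A →ₗ[k] GSym F.dual where
  toFun a := ∑ l ∈ Finset.range (m + 1), B.elt l (ancW B X a)
  map_add' a b := by
    rw [← Finset.sum_add_distrib]
    refine Finset.sum_congr rfl fun l _ => ?_
    rw [← B.elt_add]
    congr 1
    funext w
    simp [ancW]
  map_smul' c a := by
    rw [RingHom.id_apply, Finset.smul_sum]
    refine Finset.sum_congr rfl fun l _ => ?_
    rw [← B.elt_smul]
    congr 1
    funext w
    simp [ancW]

lemma ancElt_apply (B : HBasis F) {f' : GHom F N} (X : MultiDer f') (m : ℕ) (a : A) :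
    ancElt B X m a = ∑ l ∈ Finset.range (m + 1), B.elt l (ancW B X a) := rfl

/-- The product rule holds word by word for the anchors, and `elt` turns multiplication of values by
coefficients into multiplication in Sym(F^*). -/
lemma ancElt_mul (B : HBasis F) {f' : GHom F N} (X : MultiDer f') (m : ℕ) (a b : A) :
    ancElt B X m (a * b) = coeff _ (twA 𝒜 1 a) * ancElt B X m b + ancElt B X m a * coeff _ b := by
  simp only [ancElt_apply, Finset.mul_sum, Finset.sum_mul, ← Finset.sum_add_distrib]
  refine Finset.sum_congr rfl fun l _ => ?_
  rw [← B.elt_mul_left, ← B.elt_mul_right, ← B.elt_add]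
  congr 1
  funext w
  exact ancW_mul B X a b w

lemma ancElt_mem (B : HBasis F) {f' : GHom F N} (X : MultiDer f') (m : ℕ) {p : ℤ} {a : A} (ha : a ∈ 𝒜 p) :
    ancElt B X m a ∈ deg F.dual (p + 1) := by
  rw [ancElt_apply]
  exact sum_mem fun _ _ => B.elt_mem_deg fun w _ => ancW_mem B X ha w

lemma evW_ancElt [CharZero k] (B : HBasis F) {f' : GHom F N} (X : MultiDer f') {m : ℕ} (a : A)
    {w : List (Fin B.n)} (hw : w.length ≤ m) : B.evW w (ancElt B X m a) = ancW B X a w := by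
  rw [ancElt_apply, map_sum, Finset.sum_eq_single w.length]
  · rw [B.evW_elt (ancW_symm B X a _), if_pos rfl]
  · intro l _ hl
    rw [B.evW_elt (ancW_symm B X a _), if_neg hl.symm]
  · intro h; exact absurd (Finset.mem_range.2 (by omega)) h

/-- A derivation with prescribed dual anchors and brackets on basis tuples. -/
lemma exists_dual_words [CharZero k] (BF : HBasis F) (BG : HBasis G) (h : GHom F G) {f' : GHom F N}
    (X : MultiDer f') (m : ℕ) (y : List (Fin BF.n) → G)
    (hy : ∀ w, w ≠ [] → w.length ≤ m → y w ∈ G.gr (1 + BF.wdeg w))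
    (hsymm : ∀ w₁ r s w₂, (w₁ ++ r :: s :: w₂).length ≤ m →
      y (w₁ ++ r :: s :: w₂) = sg k (BF.d r * BF.d s) • y (w₁ ++ s :: r :: w₂)) :
    ∃ D : GDer h, (∀ w : List (Fin BF.n), w.length ≤ m →
        D.anchor _ (BF.word w) = (X w.length).anchor (BF.word w)) ∧
      ∀ w : List (Fin BF.n), w ≠ [] → w.length ≤ m → D.bra BG _ (BF.word w) = y w := by
  -- By `q_gen_eq`, the bracket on a word takes the value `y w` exactly when the augmented bracket
  -- of β_s on `w` is this quantity for every `s`.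
  let T (s : Fin BG.n) (w : List (Fin BF.n)) : A := -(sg k (BG.d s) • evalDual (BG.β s) (y w))
  -- Only weights 1 to `m` enter: the empty word is excluded, because generators must go to weight
  -- at least 1.
  let Θ (s : Fin BG.n) : GSym F.dual := ∑ l ∈ Finset.range m, BF.elt (l + 1) (T s)
  have hT (s) (l : ℕ) (hl : l < m) : BF.SymW (T s) (l + 1) := fun w₁ r s' w₂ hw => by
    simp only [T]
    rw [hsymm _ _ _ _ (by omega), evalDual_ksmul, smul_neg, smul_smul, smul_smul, mul_comm]
  -- The first sum is forced by the anchors: its evaluations are the terms σ(ω(h x_i)) of the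
  -- duality formula, and it accounts for the non-linear part of the product rule. The second sum is
  -- linear up to a twist and carries the brackets.
  let δ₁ : G.dual →ₗ[k] GSym F.dual :=
    { toFun := fun ω => ∑ r, ancElt BF X m (evalDual ω (h (BF.b r))) * gen _ (BF.β r) +
        ∑ s, coeff _ (twA 𝒜 1 (evalDual ω (BG.b s))) * Θ s
      map_add' := fun ω ω' => by
        have h1 (x : G) : evalDual (ω + ω') x = evalDual ω x + evalDual ω' x := rfl
        simp only [h1, map_add, add_mul, Finset.sum_add_distrib]
        abel
      map_smul' := fun c ω => by
        have h1 (x : G) : evalDual (c • ω) x = c • evalDual ω x := rfl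
        simp only [h1, map_smul, smul_mul_assoc, ← Finset.smul_sum, smul_add, RingHom.id_apply] }
  have hδ₁ (ω : G.dual) : δ₁ ω = ∑ r, ancElt BF X m (evalDual ω (h (BF.b r))) * gen _ (BF.β r) +
        ∑ s, coeff _ (twA 𝒜 1 (evalDual ω (BG.b s))) * Θ s := rfl
  have hΘaug (s) : aug _ (Θ s) = 0 := by
    rw [map_sum]
    exact Finset.sum_eq_zero fun l _ => aug_of_wt (by omega) (BF.elt_mem_wt _ _)
  have hΘdeg (s) : Θ s ∈ deg F.dual (-BG.d s + 1) := sum_mem fun l hl => BF.elt_mem_deg fun w hw => by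
    have hne : w ≠ [] := by rintro rfl; simp at hw
    have := evalDual_mem (BG.β_mem s) (hy w hne (by rw [hw]; exact Finset.mem_range.1 hl))
    rw [add_assoc]
    exact neg_mem (Submodule.smul_mem _ _ this)
  obtain ⟨D, hD0, hD1⟩ := exists_of (h := h) (ancElt BF X m) δ₁ (ancElt_mul BF X m)
    (fun a ω => by
      have h1 (x : G) : evalDual (a • ω) x = a * evalDual ω x := rfl
      have h2 : gen F.dual (h.dual ω) = ∑ r, coeff _ (evalDual ω (h (BF.b r))) * gen _ (BF.β r) := by
        conv_lhs => rw [BF.expand_dual (h.dual ω)]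
        rw [map_sum]
        exact Finset.sum_congr rfl fun r _ => by rw [← coeff_mul_gen, evalDual_dual]
      rw [hδ₁, hδ₁, h2]
      simp only [h1, ancElt_mul, add_mul, map_mul, mul_add, Finset.mul_sum, Finset.sum_add_distrib,
        ← GSym.coeff_mul, mul_assoc]
      abel)
    (fun p a ha => ancElt_mem BF X m ha)
    (fun p ω hω => by
      rw [hδ₁]
      refine add_mem (sum_mem fun r _ => ?_) (sum_mem fun s _ => ?_)
      · have := deg_mul (ancElt_mem BF X m (evalDual_mem hω (h.map_mem (BF.b_mem r)))) (gen_mem_deg (BF.β_mem r))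
        rwa [show p + BF.d r + 1 + -BF.d r = p + 1 by ring] at this
      · have := deg_mul (coeff_mem_deg (V := F.dual) (twA_mem 1 (evalDual_mem hω (BG.b_mem s)))) (hΘdeg s)
        rwa [show p + BG.d s + (-BG.d s + 1) = p + 1 by ring] at this)
    (fun ω => by
      rw [hδ₁, map_add, map_sum, map_sum]
      simp [hΘaug])
  have hanc : ∀ w : List (Fin BF.n), w.length ≤ m →
        D.anchor _ (BF.word w) = (X w.length).anchor (BF.word w) := fun w hw => LinearMap.ext fun a => by
    rw [anchor_apply _ (BF.word_mem w), q_coeff _ (BF.word_mem w), hD0, ← BF.evW_eq_evF, evW_ancElt BF X _ hw,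
      BF.sum_wordDeg, ancW, twA_self]
  refine ⟨D, hanc, fun w hne hw => ?_⟩
  rw [BG.expand (y w), BG.expand (D.bra BG _ (BF.word w))]
  refine Finset.sum_congr rfl fun s _ => ?_
  congr 2
  -- Evaluated on basis elements, the first sum of `δ₁` is the anchor part of `evF_gen`: for each
  -- removed argument x_i = b_r only the index r contributes.
  have key : ∀ (l : ℕ) (e : Fin l → ℤ) (x : Fin l → F), (∀ t, x t ∈ F.gr (e t)) →
      (∀ t, ∃ r, x t = BF.b r ∧ e t = BF.d r) → l ≠ 0 →
      evF e x (∑ r, ancElt BF X m (evalDual (BG.β s) (h (BF.b r))) * gen _ (BF.β r)) =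
      evF e x (D.d (gen _ (BG.β s))) + sg k (-BG.d s) • evalDual (BG.β s) (D.bra BG _ x) := by
    intro l e x hx hxb hl
    obtain ⟨l, rfl⟩ : ∃ l', l = l' + 1 := ⟨l - 1, by omega⟩
    rw [evF_gen D BG hx (BG.β_mem s), sub_add_cancel, map_sum]
    simp_rw [evF_mul_gen hx (BF.β_mem _)]
    rw [Finset.sum_comm]
    refine Finset.sum_congr rfl fun i _ => ?_
    obtain ⟨r, hr, hd⟩ := hxb i
    have hxi : ∀ t, x (i.succAbove t) ∈ F.gr (e (i.succAbove t)) := fun t => hx _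
    rw [Finset.sum_eq_single r, hr, BF.eval, if_pos rfl, mul_one, ← hD0, ← D.q_coeff hxi,
      D.q_coeff_eq hxi (evalDual_mem (BG.β_mem s) (h.map_mem (BF.b_mem r))), smul_smul, ← sg_add]
    · refine congrArg₂ _ (sg_congr ?_) rfl
      rw [← hd]; push_cast; grind
    · intro r' _ hr'
      rw [hr, BF.eval, if_neg hr', mul_zero, smul_zero]
    · simp
  have h1 := key _ _ _ (BF.word_mem w) (fun t => ⟨_, rfl, rfl⟩) (by simpa using hne)
  rw [hD1, hδ₁, map_add] at h1
  have h2 : ∀ s', evalDual (BG.β s) (BG.b s') = if s = s' then 1 else 0 := fun s' => BG.eval s s'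
  have h3 : ∑ s', coeff F.dual (twA 𝒜 1 (evalDual (BG.β s) (BG.b s'))) * Θ s' = Θ s := by
    rw [Finset.sum_eq_single s]
    · rw [h2, if_pos rfl, map_one, GSym.coeff_one, one_mul]
    · intro s' _ hs'
      rw [h2, if_neg hs'.symm, map_zero, map_zero, zero_mul]
    · simp
  have h4 : BF.evW w (Θ s) = T s w := by
    have hpos : 0 < w.length := List.length_pos_of_ne_nil hne
    rw [map_sum, Finset.sum_eq_single (w.length - 1)]
    · rw [BF.evW_elt (hT s _ (by omega)), if_pos (by omega)]
    · intro l hl hl'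
      rw [BF.evW_elt (hT s _ (Finset.mem_range.1 hl)), if_neg (by omega)]
    · intro h; exact absurd (Finset.mem_range.2 (by omega)) h
  rw [h3, ← BF.evW_eq_evF, h4, add_assoc, left_eq_add, sg_congr (n := BG.d s) (by push_cast; grind)] at h1
  have h5 : sg k (BG.d s) • (evalDual (BG.β s) (D.bra BG _ (BF.word w)) - evalDual (BG.β s) (y w)) = 0 := by
    rw [smul_sub, sub_eq_add_neg, add_comm]; exact h1
  rw [smul_eq_zero_iff_right (sg_ne_zero _), sub_eq_zero] at h5
  exact h5

end GDer

end SHLR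
end

/-! ### From finite modules to colimits: lifting, germs and induced truncations. -/

noncomputable section
namespace SHLR

variable {k A : Type u} [Field k] [Ring A] [Algebra k A] {𝒜 : ℤ → Submodule k A}

lemma GHom.component {M N : GMod 𝒜} (f : GHom M N) (p : ℤ) (x : M) :
    f (component M.isInternal p x) = component N.isInternal p (f x) := by
  have : f.lin ∘ₗ SHLR.component M.isInternal p = SHLR.component N.isInternal p ∘ₗ f.lin := by
    refine GMod.lin_ext fun q x hx => ?_
    have h2 := component_of_mem N.isInternal (f.map_mem hx) p
    rw [LinearMap.comp_apply, component_of_mem _ hx]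
    refine Eq.trans ?_ h2.symm
    split_ifs
    · rfl
    · exact map_zero _
  exact LinearMap.congr_fun this x

namespace Presentation

variable {M : GMod 𝒜} (P : Presentation M)

/-- Take any lift and project it to degree `e`; morphisms commute with the projections, so the image
is unchanged. -/
lemma exists_lift_one (i₀ : P.ι) {e : ℤ} {z : M} (hz : z ∈ M.gr e) :
    ∃ (i : P.ι) (_ : i₀ ≤ i) (x : P.F i), x ∈ (P.F i).gr e ∧ P.incl i x = z := by
  obtain ⟨j, x, hx⟩ := P.incl_surj z
  obtain ⟨i, h0, hj⟩ := exists_ge_ge i₀ j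
  refine ⟨i, h0, component (P.F i).isInternal e (P.t hj x), component_mem _ _ _, ?_⟩
  rw [GHom.component, P.incl_t, hx, component_of_mem _ hz, if_pos rfl]

lemma exists_lift {J : Type*} [Finite J] (i₀ : P.ι) (e : J → ℤ) (z : J → M) (hz : ∀ j, z j ∈ M.gr (e j)) :
    ∃ (i : P.ι) (_ : i₀ ≤ i) (x : J → P.F i), (∀ j, x j ∈ (P.F i).gr (e j)) ∧ ∀ j, P.incl i (x j) = z j := by
  choose i hi x hx hxz using fun j => P.exists_lift_one i₀ (hz j)
  obtain ⟨s, hs⟩ := Finite.exists_le i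
  obtain ⟨s', h0, hs'⟩ := exists_ge_ge i₀ s
  exact ⟨s', h0, fun j => P.t ((hs j).trans hs') (x j), fun j => (P.t _).map_mem (hx j),
    fun j => by rw [P.incl_t, hxz]⟩

lemma exists_kill {J : Type*} [Finite J] (i : P.ι) (x : J → P.F i) (hx : ∀ j, P.incl i (x j) = 0) :
    ∃ (i' : P.ι) (h : i ≤ i'), ∀ j, P.t h (x j) = 0 := by
  choose i' h hh using fun j => P.incl_eq_zero i (x j) (hx j)
  obtain ⟨s, hs⟩ := Finite.exists_le i'
  obtain ⟨s', h0, hs'⟩ := exists_ge_ge i s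
  exact ⟨s', h0, fun j => by rw [← P.t_comp (h j) ((hs j).trans hs'), hh, map_zero]⟩

lemma exists_eq {J : Type*} [Finite J] (i : P.ι) (x y : J → P.F i)
    (hx : ∀ j, P.incl i (x j) = P.incl i (y j)) :
    ∃ (i' : P.ι) (h : i ≤ i'), ∀ j, P.t h (x j) = P.t h (y j) := by
  obtain ⟨i', h, hh⟩ := P.exists_kill i (fun j => x j - y j) (fun j => by rw [map_sub, hx, sub_self])
  exact ⟨i', h, fun j => by rw [← sub_eq_zero, ← map_sub, hh]⟩

end Presentation

lemma Germ.of_eq_iff {X : InvSys k} {Z : Type u} [AddCommGroup Z] [Module k Z] {a b : X.ι}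
    {φ : X.obj a →ₗ[k] Z} {ψ : X.obj b →ₗ[k] Z} :
    Germ.of X a φ = Germ.of X b ψ ↔ ∃ (c : X.ι) (ha : a ≤ c) (hb : b ≤ c), φ ∘ₗ X.p ha = ψ ∘ₗ X.p hb := by
  classical
  constructor
  · intro h
    obtain ⟨c, ha, hb⟩ := exists_ge_ge a b
    rw [← Germ.of_p ha, ← Germ.of_p hb, ← sub_eq_zero, ← map_sub] at h
    have : DirectedSystem (fun a : X.ι => X.obj a →ₗ[k] Z)
        (fun _ _ h => LinearMap.lcomp k Z (X.p h)) :=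
      ⟨fun i φ => LinearMap.ext fun x => congrArg φ (X.p_refl i x),
        fun _ _ _ h h' φ => LinearMap.ext fun x => congrArg φ (X.p_comp h h' x)⟩
    obtain ⟨d, hd, h0⟩ := Module.DirectLimit.of.zero_exact h
    refine ⟨d, ha.trans hd, hb.trans hd, LinearMap.ext fun x => ?_⟩
    have := LinearMap.congr_fun h0 x
    simp only [LinearMap.lcomp_apply, LinearMap.sub_apply, LinearMap.comp_apply, LinearMap.zero_apply,
      sub_eq_zero, X.p_comp] at this
    exact this
  · rintro ⟨c, ha, hb, h⟩
    rw [← Germ.of_p ha, ← Germ.of_p hb, h]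

variable [GradedAlgebra 𝒜] [IsGradedComm 𝒜]

open GSym

lemma HBasis.hom_ext {F G : GMod 𝒜} (B : HBasis F) {f g : GHom F G} (h : ∀ r, f (B.b r) = g (B.b r)) :
    f = g := by
  refine GHom.ext fun x => ?_
  rw [B.expand x, map_sum, map_sum]
  exact Finset.sum_congr rfl fun r _ => by rw [map_smul, map_smul, h]

/-- The morphism with prescribed values on a basis. -/
def HBasis.desc {F G : GMod 𝒜} (B : HBasis F) (z : Fin B.n → G) (hz : ∀ r, z r ∈ G.gr (B.d r)) : GHom F G where
  toLin :=
    { toFun := fun x => ∑ r, twA 𝒜 (B.d r) (evalDual (B.β r) x) • z r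
      map_add' := fun x y => by
        simp only [evalDual_add, map_add, add_smul, Finset.sum_add_distrib]
      map_smul' := fun a x => by
        rw [RingHom.id_apply, Finset.smul_sum]
        refine Finset.sum_congr rfl fun r _ => ?_
        rw [evalDual_smul_tw (B.β_mem r), map_mul, twA_twA, smul_smul, add_neg_cancel, twA_zero] }
  map_mem := fun {n x} hx => by
    change ∑ r, twA 𝒜 (B.d r) (evalDual (B.β r) x) • z r ∈ G.gr n
    refine sum_mem fun r _ => ?_
    have := G.smul_mem (twA_mem (B.d r) (evalDual_mem (B.β_mem r) hx)) (hz r)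
    rwa [show -B.d r + n + B.d r = n by ring] at this

lemma HBasis.desc_b {F G : GMod 𝒜} (B : HBasis F) (z : Fin B.n → G) (hz : ∀ r, z r ∈ G.gr (B.d r))
    (r : Fin B.n) : B.desc z hz (B.b r) = z r := by
  change ∑ s, twA 𝒜 (B.d s) (evalDual (B.β s) (B.b r)) • z s = z r
  rw [Finset.sum_eq_single r]
  · rw [B.eval, if_pos rfl, map_one, one_smul]
  · intro s _ hs
    rw [B.eval, if_neg hs, map_zero, zero_smul]
  · simp

namespace GDer

variable {F G : GMod 𝒜} {h : GHom F G} (D : GDer h)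

lemma bra_indep (B B' : HBasis G) {l : ℕ} {e : Fin l → ℤ} {x : Fin l → F} (hx : ∀ t, x t ∈ F.gr (e t)) :
    D.bra B l x = D.bra B' l x :=
  B.ext_eval fun c ω hω => by rw [eval_bra _ B hx hω, eval_bra _ B' hx hω]

lemma gen_fil (ω : G.dual) : D.d (gen _ ω) ∈ fil F.dual 1 := mem_fil.2 fun j hj => by
  obtain rfl : j = 0 := by omega
  rw [pr_zero_eq, D.aug_gen, map_zero]

/-- Each generator goes to weight at least 1 and h^* preserves weights, so the product rule never
lowers the weight. -/
lemma wt_fil {i : ℕ} {P : GSym G.dual} (hP : P ∈ wt _ i) : D.d P ∈ fil F.dual i := by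
  induction hP using Submodule.span_induction with
  | zero => simp
  | add x y _ _ h1 h2 => rw [map_add]; exact add_mem h1 h2
  | smul c x _ h => rw [map_smul]; exact Submodule.smul_mem _ _ h
  | mem P hP =>
    obtain ⟨a, v, rfl⟩ := hP
    induction i with
    | zero => exact fil_zero _
    | succ i ih =>
      rw [monomial_succ, D.isBr.mul]
      refine add_mem ?_ ?_
      · exact fil_mul (tw_fil _ (map_fil _ (wt_le_fil le_rfl (Submodule.subset_span ⟨a, _, rfl⟩)))) (D.gen_fil _)
      · exact fil_mul (ih _) (tw_fil _ (map_fil _ (wt_le_fil le_rfl (gen_mem_wt _))))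

lemma fil_fil {i : ℕ} {P : GSym G.dual} (hP : P ∈ fil _ i) : D.d P ∈ fil F.dual i := by
  obtain ⟨N, hN⟩ := exists_sum_pr P
  rw [hN N le_rfl, map_sum]
  refine sum_mem fun j _ => ?_
  rcases Nat.lt_or_ge j i with hj | hj
  · rw [mem_fil.1 hP j hj, map_zero]; exact zero_mem _
  · exact fil_anti hj (D.wt_fil (pr_mem_wt _ _))

/-- The derivation induced on truncations. -/
def trunc (m : ℕ) : TruncSym G.dual m →ₗ[k] TruncSym F.dual m :=
  (TruncSym.exists_desc (m := m) ((TruncSym.proj F.dual m).toLinearMap ∘ₗ D.d)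
    (fun _ hP => TruncSym.proj_eq_zero_iff.2 (D.fil_fil hP))).choose

lemma trunc_proj (m : ℕ) (P : GSym G.dual) :
    D.trunc m (TruncSym.proj _ m P) = TruncSym.proj _ m (D.d P) :=
  (TruncSym.exists_desc (m := m) ((TruncSym.proj F.dual m).toLinearMap ∘ₗ D.d)
    (fun _ hP => TruncSym.proj_eq_zero_iff.2 (D.fil_fil hP))).choose_spec P

end GDer

lemma fil_proj_mem {V : GMod 𝒜} {m i : ℕ} {P : GSym V} (hP : P ∈ fil V i) :
    TruncSym.proj V m P ∈ ⨆ (j : ℕ) (_ : i ≤ j), TruncSym.wt V m j := by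
  obtain ⟨N, hN⟩ := exists_sum_pr P
  rw [hN N le_rfl, map_sum]
  refine sum_mem fun j _ => ?_
  rcases Nat.lt_or_ge j i with hj | hj
  · rw [mem_fil.1 hP j hj, map_zero]; exact zero_mem _
  · exact Submodule.mem_iSup_of_mem j (Submodule.mem_iSup_of_mem hj ⟨_, pr_mem_wt _ _, rfl⟩)

variable {M N : GMod 𝒜} {PM : Presentation M} {PN : Presentation N} {f : GHom M N}

/-- The representative given by a derivation of symmetric algebras. -/
def GDer.toLocal {α : PM.ι} {β : PN.ι} {h : GHom (PM.F α) (PN.F β)} (D : GDer h)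
    (hh : ∀ x, PN.incl β (h x) = f (PM.incl α x)) (m : ℕ) : LocalDer PM PN f α m where
  β := β
  n := m
  h := h
  incl_h := hh
  le := le_rfl
  d := D.trunc m
  isDer := by
    refine ⟨?_, ?_⟩
    · rintro p _ ⟨P, hP, rfl⟩
      refine ⟨D.d P, ?_, (D.trunc_proj m P).symm⟩
      have := D.isBr.mem_deg hP
      rwa [show p + 1 + 0 = 1 + p by ring] at this
    · rintro p _ y ⟨P, hP, rfl⟩
      obtain ⟨Q, rfl⟩ := TruncSym.proj_surjective _ _ y
      rw [AlgHom.toLinearMap_apply, ← map_mul, D.trunc_proj, D.trunc_proj, D.trunc_proj, TruncSym.map_proj,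
        TruncSym.map_proj, D.isBr.mul, tw_zero, tw_of_mem _ (map_deg _ hP), negOnePow_smul (k := k), map_add,
        map_mul, map_mul, map_smul, smul_mul_assoc, add_comm]
  nonneg := by
    rintro i _ ⟨P, hP, rfl⟩
    rw [AlgHom.toLinearMap_apply, D.trunc_proj]
    exact fil_proj_mem (D.wt_fil hP)

/-- The class of the truncation of `D`. -/
def GDer.germ {α : PM.ι} {β : PN.ι} {h : GHom (PM.F α) (PN.F β)} (D : GDer h) (m : ℕ) :
    Germ PN.symSys (PM.symSys.obj (PM.idx α m)) :=
  Germ.of PN.symSys (PN.idx β m) (D.trunc m)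

lemma GDer.germ_push {α : PM.ι} {β β' : PN.ι} {h : GHom (PM.F α) (PN.F β)} (D : GDer h) (hβ : β ≤ β')
    {h' : GHom (PM.F α) (PN.F β')} (hv : ∀ x, PN.t hβ (h x) = h' x) (m : ℕ) :
    (D.push (PN.t hβ) hv).germ (PM := PM) (PN := PN) m = D.germ m := by
  have hle : PN.idx β m ≤ PN.idx β' m := ⟨hβ, le_rfl⟩
  refine Eq.trans (congrArg _ ?_) (Germ.of_p (Z := PM.symSys.obj (PM.idx α m)) hle (D.trunc m))
  refine LinearMap.ext fun s => ?_
  obtain ⟨P, rfl⟩ := TruncSym.proj_surjective _ _ s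
  refine (GDer.trunc_proj _ m P).trans ?_
  refine Eq.trans ?_ (congrArg (D.trunc m) (TruncSym.map_proj (PN.t hβ).dual le_rfl P)).symm
  rw [D.trunc_proj]
  rfl

lemma GDer.Agree.germ_eq {α : PM.ι} {β : PN.ι} {h : GHom (PM.F α) (PN.F β)} {D D' : GDer h} {m : ℕ}
    (H : GDer.Agree m D D') : D.germ (PM := PM) (PN := PN) m = D'.germ m := by
  rw [GDer.germ, GDer.germ]
  congr 1
  refine LinearMap.ext fun s => ?_
  obtain ⟨P, rfl⟩ := TruncSym.proj_surjective _ _ s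
  exact (GDer.trunc_proj _ m P).trans ((TruncSym.proj_eq_iff.2 (H P)).trans (GDer.trunc_proj _ m P).symm)

end SHLR
end

/-! ### Representatives of a multiderivation at a finite index. -/

noncomputable section
namespace SHLR

variable {k A : Type u} [Field k] [Ring A] [Algebra k A] {𝒜 : ℤ → Submodule k A}
  [GradedAlgebra 𝒜] [IsGradedComm 𝒜]

open GSym

variable {M N : GMod 𝒜} {PM : Presentation M} {PN : Presentation N} {f : GHom M N}

/-- `D` represents the multiderivation `X`, up to weight `m`. -/
structure Rep (X : MultiDer f) {α : PM.ι} {β : PN.ι} (m : ℕ) {h : GHom (PM.F α) (PN.F β)} (D : GDer h) :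
    Prop where
  incl_h : ∀ x, PN.incl β (h x) = f (PM.incl α x)
  anchor : ∀ l ≤ m, ∀ (e : Fin l → ℤ) (x : Fin l → PM.F α), (∀ t, x t ∈ (PM.F α).gr (e t)) →
    D.anchor l x = (X l).anchor (fun t => PM.incl α (x t))
  bra : ∀ l, l + 1 ≤ m → ∀ (e : Fin (l + 1) → ℤ) (x : Fin (l + 1) → PM.F α),
    (∀ t, x t ∈ (PM.F α).gr (e t)) → ∀ B, PN.incl β (D.bra B (l + 1) x) = (X l).X (fun t => PM.incl α (x t))

lemma Rep.push {X : MultiDer f} {α : PM.ι} {β β' : PN.ι} {m : ℕ} {h : GHom (PM.F α) (PN.F β)} {D : GDer h}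
    (H : Rep X m D) (hβ : β ≤ β') {h' : GHom (PM.F α) (PN.F β')} (hv : ∀ x, PN.t hβ (h x) = h' x) :
    Rep X m (D.push (PN.t hβ) hv) where
  incl_h := fun x => by rw [← hv, PN.incl_t, H.incl_h]
  anchor := fun l hl e x hx => by rw [D.anchor_push _ _ hx, H.anchor l hl e x hx]
  bra := fun l hl e x hx B => by
    obtain ⟨B'⟩ := exists_hbasis (PN.finite β)
    rw [D.bra_push _ _ B' B hx, PN.incl_t, H.bra l hl e x hx]

lemma Rep.mono {X : MultiDer f} {α : PM.ι} {β : PN.ι} {m m' : ℕ} (hm : m' ≤ m) {h : GHom (PM.F α) (PN.F β)}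
    {D : GDer h} (H : Rep X m D) : Rep X m' D :=
  ⟨H.incl_h, fun l hl => H.anchor l (hl.trans hm), fun l hl => H.bra l (hl.trans hm)⟩

lemma Rep.pull {X : MultiDer f} {α α' : PM.ι} {β : PN.ι} {m : ℕ} {h : GHom (PM.F α) (PN.F β)} {D : GDer h}
    (H : Rep X m D) (hα : α' ≤ α) {h' : GHom (PM.F α') (PN.F β)} (hu : ∀ x, h (PM.t hα x) = h' x) :
    Rep X m (D.pull (PM.t hα) hu) where
  incl_h := fun x => by rw [← hu, H.incl_h, PM.incl_t]
  anchor := fun l hl e x hx => by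
    rw [D.anchor_pull _ _ hx, H.anchor l hl e _ (fun t => (PM.t hα).map_mem (hx t))]
    simp_rw [PM.incl_t]
  bra := fun l hl e x hx B => by
    rw [D.bra_pull _ _ B hx, H.bra l hl e _ (fun t => (PM.t hα).map_mem (hx t))]
    simp_rw [PM.incl_t]

/-- The values of the multiderivation of all weights. -/
def MultiDer.val (X : MultiDer f) : ∀ l : ℕ, (Fin l → M) → N
  | 0, _ => 0
  | l + 1, x => (X l).X x

lemma MultiDer.val_symm (X : MultiDer f) (l : ℕ) (e : Fin l → ℤ) (x : Fin l → M) (hx : ∀ t, x t ∈ M.gr (e t))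
    (π : Equiv.Perm (Fin l)) : X.val l (fun t => x (π t)) = koszul π e • X.val l x := by
  cases l with
  | zero => exact (smul_zero _).symm
  | succ l => exact (X l).X_symm e x hx π

lemma MultiDer.val_mem (X : MultiDer f) (l : ℕ) (e : Fin l → ℤ) (x : Fin l → M) (hx : ∀ t, x t ∈ M.gr (e t)) :
    X.val l x ∈ N.gr (1 + ∑ t, e t) := by
  cases l with
  | zero => exact zero_mem _
  | succ l => exact (X l).X_mem e x hx

instance finite_words (n m : ℕ) : Finite {w : List (Fin n) // w.length ≤ m} :=
  (List.finite_length_le (Fin n) m).to_subtype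

/-- Composed with the maps of the presentations, both sides become multiderivations over the same
morphism from the finite module to N. Equality on basis tuples then extends, for the anchors first
and for the brackets afterwards. -/
lemma Rep.of_words {X : MultiDer f} {α : PM.ι} {β : PN.ι} {m : ℕ} {h : GHom (PM.F α) (PN.F β)} {D : GDer h}
    (hh : ∀ x, PN.incl β (h x) = f (PM.incl α x)) (BF : HBasis (PM.F α)) (BG : HBasis (PN.F β))
    (ha : ∀ w : List (Fin BF.n), w.length ≤ m → D.anchor _ (BF.word w) =
      (X w.length).anchor (fun t => PM.incl α (BF.word w t)))
    (hb : ∀ w : List (Fin BF.n), w.length ≤ m → PN.incl β (D.bra BG _ (BF.word w)) =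
      X.val _ (fun t => PM.incl α (BF.word w t))) : Rep X m D := by
  have hf' : ∀ x, PN.incl β (h (GHom.id _ x)) = (f.comp (PM.incl α)) x := hh
  have hf : ∀ x, GHom.id N (f (PM.incl α x)) = (f.comp (PM.incl α)) x := fun x => rfl
  obtain ⟨Z, hZ⟩ : ∃ Z : MultiDer (f.comp (PM.incl α)), Z = fun l => (D.toMultiDer BG l).conj (GHom.id _) (PN.incl β) hf' :=
    ⟨_, rfl⟩
  obtain ⟨Z', hZ'⟩ : ∃ Z : MultiDer (f.comp (PM.incl α)), Z = fun l => (X l).conj (PM.incl α) (GHom.id _) hf :=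
    ⟨_, rfl⟩
  have hanc : ∀ l ≤ m, (Z l).anchor = (Z' l).anchor := fun l hl =>
    anchor_ext_words BF (Z l).anchor_smul (Z' l).anchor_smul fun s => by
      have h1 := word_ofFn BF (fun l x => D.anchor l x) s
      have h2 := word_ofFn BF (fun l x => (X l).anchor (fun t => PM.incl α (x t))) s
      rw [hZ, hZ']
      exact h1.symm.trans ((ha _ (by rwa [List.length_ofFn])).trans h2)
  have hbra : ∀ l, l + 1 ≤ m → (Z l).X = (Z' l).X := fun l hl =>
    multilinear_ext_basis BF (fun e x hx hX i c a h => MultiDerW.X_update (hanc l (by omega)) hx hX i h) fun s => by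
      have h1 := word_ofFn BF (fun l x => PN.incl β (D.bra BG l x)) s
      have h2 := word_ofFn BF (fun l x => X.val l (fun t => PM.incl α (x t))) s
      rw [hZ, hZ']
      exact h1.symm.trans ((hb _ (by rwa [List.length_ofFn])).trans h2)
  refine ⟨hh, fun l hl e x hx => ?_, fun l hl e x hx B => ?_⟩
  · have := congrArg (fun Φ => Φ x) (hanc l hl)
    rw [hZ, hZ'] at this
    exact this
  · have := congrArg (fun Φ => Φ x) (hbra l hl)
    rw [hZ, hZ'] at this
    rw [D.bra_indep B BG hx]
    exact this

/-- Only finitely many words matter at weight `m`. The images of the basis and the values on words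
lift to a common N_β, and after enlarging β the lifted values are graded symmetric as well, so
`GDer.exists_dual_words` applies. -/
lemma exists_rep [CharZero k] (X : MultiDer f) (α : PM.ι) (m : ℕ) :
    ∃ (β : PN.ι) (h : GHom (PM.F α) (PN.F β)) (D : GDer h), Rep X m D := by
  obtain ⟨BF⟩ := exists_hbasis (PM.finite α)
  have hword (w : List (Fin BF.n)) (t) : PM.incl α (BF.word w t) ∈ M.gr (BF.wordDeg w t) :=
    (PM.incl α).map_mem (BF.word_mem w t)
  obtain ⟨β₀, -, y₀, hy₀, hy₀'⟩ := PN.exists_lift (J := Fin BF.n ⊕ {w : List (Fin BF.n) // w.length ≤ m})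
    (Classical.arbitrary _) (Sum.elim BF.d fun w => 1 + BF.wdeg w)
    (Sum.elim (fun r => f (PM.incl α (BF.b r))) fun w => X.val _ (fun t => PM.incl α (BF.word w.1 t)))
    (by
      rintro (r | w)
      · exact f.map_mem ((PM.incl α).map_mem (BF.b_mem r))
      · have := X.val_mem _ _ _ (hword w.1)
        rwa [BF.sum_wordDeg] at this)
  -- Every true relation v = ±v' in N between values on words of length ≤ `m` is made to hold for
  -- the lifts. There are finitely many, and they include all exchanges of adjacent letters.
  obtain ⟨β, hβ, hβ'⟩ := PN.exists_eq
    (J := {p : ({w : List (Fin BF.n) // w.length ≤ m} × {w : List (Fin BF.n) // w.length ≤ m}) × ℤˣ //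
      X.val _ (fun t => PM.incl α (BF.word p.1.1.1 t)) = p.2 • X.val _ (fun t => PM.incl α (BF.word p.1.2.1 t))}) β₀
    (fun p => y₀ (Sum.inr p.1.1.1)) (fun p => p.1.2 • y₀ (Sum.inr p.1.1.2))
    (fun p => by
      rw [units_smul (k := k)]
      refine Eq.trans ?_ ((PN.incl β₀).lin.map_smul _ _).symm
      rw [← units_smul]
      exact (hy₀' _).trans (p.2.trans (congrArg (p.1.2 • ·) (hy₀' (Sum.inr p.1.1.2)).symm)))
  let h : GHom (PM.F α) (PN.F β) := BF.desc (fun r => PN.t hβ (y₀ (Sum.inl r)))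
    fun r => (PN.t hβ).map_mem (hy₀ (Sum.inl r))
  have hh : ∀ x, PN.incl β (h x) = f (PM.incl α x) := by
    have : (PN.incl β).comp h = f.comp (PM.incl α) := BF.hom_ext fun r => by
      change PN.incl β (h (BF.b r)) = f (PM.incl α (BF.b r))
      rw [BF.desc_b, PN.incl_t, hy₀']
      rfl
    exact fun x => congrArg (fun g : GHom _ _ => g x) this
  obtain ⟨BG⟩ := exists_hbasis (PN.finite β)
  -- The value 0 on longer words is never used.
  let y (w : List (Fin BF.n)) : PN.F β := if hw : w.length ≤ m then PN.t hβ (y₀ (Sum.inr ⟨w, hw⟩)) else 0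
  have hyw {w : List (Fin BF.n)} (hw : w.length ≤ m) : y w = PN.t hβ (y₀ (Sum.inr ⟨w, hw⟩)) := dif_pos hw
  have hf : ∀ x, GHom.id N (f (PM.incl α x)) = (f.comp (PM.incl α)) x := fun x => rfl
  obtain ⟨D, hD, hD'⟩ := GDer.exists_dual_words BF BG h (fun l => (X l).conj (PM.incl α) (GHom.id _) hf) m y
    (fun w _ hw => by rw [hyw hw]; exact (PN.t hβ).map_mem (hy₀ (Sum.inr ⟨w, hw⟩)))
    (fun w₁ r s w₂ hw => by
      have hw' : (w₁ ++ s :: r :: w₂).length ≤ m := by simpa using hw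
      have h1 := word_swap BF (fun l x => X.val l (fun t => PM.incl α (x t)))
        (fun l e x hx π => X.val_symm l e _ (fun t => (PM.incl α).map_mem (hx t)) π) w₁ r s w₂
      rw [← negOnePow_smul] at h1
      have h2 := hβ' ⟨⟨(⟨_, hw⟩, ⟨_, hw'⟩), _⟩, h1⟩
      rw [hyw hw, hyw hw', ← negOnePow_smul]
      refine h2.trans ?_
      rw [units_smul (k := k)]
      refine ((PN.t hβ).lin.map_smul _ _).trans ?_
      rw [← units_smul]
      rfl)
  refine ⟨β, h, D, Rep.of_words hh BF BG hD fun w hw => ?_⟩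
  by_cases hne : w = []
  · subst hne
    exact (congrArg (PN.incl β) (D.bra_zero BG _)).trans (map_zero _)
  · rw [hD' w hne hw, hyw hw, PN.incl_t, hy₀']
    rfl

/-- Two derivations become derivations over the same map after refinement. -/
lemma exists_common_hom {α : PM.ι} {β β' : PN.ι} {h : GHom (PM.F α) (PN.F β)} {h' : GHom (PM.F α) (PN.F β')}
    (hh : ∀ x, PN.incl β (h x) = PN.incl β' (h' x)) (γ : PN.ι) :
    ∃ (β'' : PN.ι) (hβ : β ≤ β'') (hβ' : β' ≤ β'') (_ : γ ≤ β''), ∀ x, PN.t hβ (h x) = PN.t hβ' (h' x) := by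
  obtain ⟨BF⟩ := exists_hbasis (PM.finite α)
  obtain ⟨β₀, h0, h0'⟩ := exists_ge_ge β β'
  obtain ⟨β₁, h1, h1'⟩ := exists_ge_ge β₀ γ
  obtain ⟨β₂, h2, h2'⟩ := PN.exists_eq (J := Fin BF.n) β₁ (fun r => PN.t (h0.trans h1) (h (BF.b r)))
    (fun r => PN.t (h0'.trans h1) (h' (BF.b r))) (fun r => by rw [PN.incl_t, PN.incl_t, hh])
  refine ⟨β₂, (h0.trans h1).trans h2, (h0'.trans h1).trans h2, h1'.trans h2, fun x => ?_⟩
  have : (PN.t ((h0.trans h1).trans h2)).comp h = (PN.t ((h0'.trans h1).trans h2)).comp h' :=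
    BF.hom_ext fun r => by
      have := h2' r
      rw [PN.t_comp, PN.t_comp] at this
      exact this
  exact congrArg (fun g : GHom _ _ => g x) this

/-- Representatives of a multiderivation agree after refinement. -/
lemma Rep.exists_agree [CharZero k] {X : MultiDer f} {α : PM.ι} {β β' : PN.ι} {m : ℕ}
    {h : GHom (PM.F α) (PN.F β)} {h' : GHom (PM.F α) (PN.F β')} {D : GDer h} {D' : GDer h'}
    (H : Rep X m D) (H' : Rep X m D') :
    ∃ (β'' : PN.ι) (hβ : β ≤ β'') (hβ' : β' ≤ β'') (h'' : GHom (PM.F α) (PN.F β''))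
      (e : ∀ x, PN.t hβ (h x) = h'' x) (e' : ∀ x, PN.t hβ' (h' x) = h'' x),
      GDer.Agree m (D.push _ e) (D'.push _ e') := by
  obtain ⟨BF⟩ := exists_hbasis (PM.finite α)
  obtain ⟨B⟩ := exists_hbasis (PN.finite β)
  obtain ⟨B'⟩ := exists_hbasis (PN.finite β')
  obtain ⟨β₁, h1, h1', -, heq⟩ := exists_common_hom (fun x => (H.incl_h x).trans (H'.incl_h x).symm) β
  have hval {β : PN.ι} {h : GHom (PM.F α) (PN.F β)} {D : GDer h} (H : Rep X m D) (B : HBasis (PN.F β))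
      (w : List (Fin BF.n)) (hw : w.length ≤ m) :
      PN.incl β (D.bra B _ (BF.word w)) = X.val _ (fun t => PM.incl α (BF.word w t)) := by
    have key : ∀ (l : ℕ) (e : Fin l → ℤ) (x : Fin l → PM.F α), l ≤ m → (∀ t, x t ∈ (PM.F α).gr (e t)) →
        PN.incl β (D.bra B l x) = X.val l (fun t => PM.incl α (x t)) := by
      intro l e x hl hx
      cases l with
      | zero => rw [D.bra_zero, map_zero]; rfl
      | succ l => exact H.bra l hl e x hx B
    exact key _ _ _ hw (BF.word_mem w)
  -- The two families of brackets have the same image in N, so finitely many of them become equal at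
  -- a later index. The anchors take values in A and already agree.
  obtain ⟨β₂, h2, h2'⟩ := PN.exists_eq (J := {w : List (Fin BF.n) // w.length ≤ m}) β₁
    (fun w => PN.t h1 (D.bra B _ (BF.word w.1))) (fun w => PN.t h1' (D'.bra B' _ (BF.word w.1)))
    (fun w => by rw [PN.incl_t, PN.incl_t, hval H B _ w.2, hval H' B' _ w.2])
  obtain ⟨B₂⟩ := exists_hbasis (PN.finite β₂)
  have e : ∀ x, PN.t (h1.trans h2) (h x) = ((PN.t (h1.trans h2)).comp h) x := fun x => rfl
  have e' : ∀ x, PN.t (h1'.trans h2) (h' x) = ((PN.t (h1.trans h2)).comp h) x := fun x => by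
    rw [← e, ← PN.t_comp h1 h2, ← PN.t_comp h1' h2, heq]
  refine ⟨β₂, h1.trans h2, h1'.trans h2, _, e, e', GDer.agree_of_words BF B₂ (fun w hw => ?_) fun w hw => ?_⟩
  · rw [D.anchor_push _ _ (BF.word_mem w), D'.anchor_push _ _ (BF.word_mem w), H.anchor _ hw _ _ (BF.word_mem w),
      H'.anchor _ hw _ _ (BF.word_mem w)]
  · rw [D.bra_push _ _ B _ (BF.word_mem w), D'.bra_push _ _ B' _ (BF.word_mem w), ← PN.t_comp h1 h2,
      ← PN.t_comp h1' h2, h2' ⟨w, hw⟩]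

lemma Rep.germ_eq [CharZero k] {X : MultiDer f} {α : PM.ι} {β β' : PN.ι} {m : ℕ}
    {h : GHom (PM.F α) (PN.F β)} {h' : GHom (PM.F α) (PN.F β')} {D : GDer h} {D' : GDer h'}
    (H : Rep X m D) (H' : Rep X m D') : D.germ (PM := PM) (PN := PN) m = D'.germ m := by
  obtain ⟨β'', hβ, hβ', h'', e, e', hag⟩ := H.exists_agree H'
  rw [← D.germ_push hβ e, hag.germ_eq, D'.germ_push hβ' e']

/-- Derivations with the same class agree after refinement. -/
lemma exists_agree_of_germ_eq {α : PM.ι} {β β' : PN.ι} {m : ℕ}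
    {h : GHom (PM.F α) (PN.F β)} {h' : GHom (PM.F α) (PN.F β')} (D : GDer h) (D' : GDer h')
    (hh : ∀ x, PN.incl β (h x) = PN.incl β' (h' x))
    (H : D.germ (PM := PM) (PN := PN) m = D'.germ m) :
    ∃ (β'' : PN.ι) (hβ : β ≤ β'') (hβ' : β' ≤ β'') (h'' : GHom (PM.F α) (PN.F β''))
      (e : ∀ x, PN.t hβ (h x) = h'' x) (e' : ∀ x, PN.t hβ' (h' x) = h'' x),
      GDer.Agree m (D.push _ e) (D'.push _ e') := by
  obtain ⟨c, ha, hb, hab⟩ := (Germ.of_eq_iff (X := PN.symSys)).1 H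
  let γ : PN.ι := Prod.fst (β := ℕ) c
  let n : ℕ := Prod.snd (α := PN.ι) c
  have ha1 : β ≤ γ := And.left ha
  have hb1 : β' ≤ γ := And.left hb
  -- Equality of classes is witnessed at the index `γ`, but the morphisms over which the derivations
  -- live need not agree there; hence a further refinement.
  obtain ⟨β₂, h2, h2', h3, heq⟩ := exists_common_hom hh γ
  refine ⟨β₂, h2, h2', (PN.t h2).comp h, fun x => rfl, fun x => (heq x).symm, fun P => ?_⟩
  have h4 := LinearMap.congr_fun hab (TruncSym.proj _ n (GSym.map (PN.t h3).dual P))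
  have h5 : TruncSym.proj _ m (D.d (GSym.map (PN.t ha1).dual (GSym.map (PN.t h3).dual P))) =
      TruncSym.proj _ m (D'.d (GSym.map (PN.t hb1).dual (GSym.map (PN.t h3).dual P))) := by
    refine (D.trunc_proj m _).symm.trans (Eq.trans ?_ (D'.trunc_proj m _))
    refine (congrArg (D.trunc m) (TruncSym.map_proj (PN.t ha1).dual (And.right ha) _).symm).trans
      (Eq.trans h4 (congrArg (D'.trunc m) (TruncSym.map_proj (PN.t hb1).dual (And.right hb) _)))
  rw [map_dual_comp (PN.t_comp ha1 h3), map_dual_comp (PN.t_comp hb1 h3), TruncSym.proj_eq_iff] at h5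
  exact h5

end SHLR
end

/-! ### Truncated representatives, and duality in terms of representing derivations. -/

noncomputable section
namespace SHLR

variable {k A : Type u} [Field k] [Ring A] [Algebra k A] {𝒜 : ℤ → Submodule k A}
  [GradedAlgebra 𝒜] [IsGradedComm 𝒜]

open GSym

/-! ### Truncating to low weights -/

namespace GSym

variable {V : GMod 𝒜}

/-- The part of weight `< n`. -/
def lo (V : GMod 𝒜) (n : ℕ) : GSym V →ₗ[k] GSym V := ∑ j ∈ Finset.range n, pr V j

lemma lo_apply (n : ℕ) (P : GSym V) : lo V n P = ∑ j ∈ Finset.range n, pr V j P := by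
  simp [lo]

lemma lo_sub_mem (n : ℕ) (P : GSym V) : lo V n P - P ∈ fil V n := mem_fil.2 fun j hj => by
  rw [map_sub, lo_apply, map_sum, Finset.sum_eq_single j, pr_pr, if_pos rfl, sub_self]
  · intro i _ hi
    rw [pr_pr, if_neg hi.symm]
  · intro h; exact absurd (Finset.mem_range.2 hj) h

lemma lo_eq_of_sub_mem {n : ℕ} {P Q : GSym V} (h : P - Q ∈ fil V n) : lo V n P = lo V n Q := by
  rw [← sub_eq_zero, ← map_sub, lo_apply]
  exact Finset.sum_eq_zero fun j hj => mem_fil.1 h j (Finset.mem_range.1 hj)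

lemma lo_coeff_mul (n : ℕ) (a : A) (P : GSym V) : lo V n (coeff V a * P) = coeff V a * lo V n P := by
  simp_rw [lo_apply, pr_coeff_mul, Finset.mul_sum]

lemma lo_mul_coeff (n : ℕ) (a : A) (P : GSym V) : lo V n (P * coeff V a) = lo V n P * coeff V a := by
  simp_rw [lo_apply, pr_mul_coeff, Finset.sum_mul]

lemma lo_succ_mul_gen (n : ℕ) (v : V) (P : GSym V) : lo V (n + 1) (P * gen V v) = lo V n P * gen V v := by
  rw [lo_apply, Finset.sum_range_succ', pr_zero_mul_gen, add_zero, lo_apply, Finset.sum_mul]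
  exact Finset.sum_congr rfl fun j _ => pr_succ_mul_gen j v P

lemma lo_mem_deg {n : ℕ} {p : ℤ} {P : GSym V} (hP : P ∈ deg V p) : lo V n P ∈ deg V p := by
  rw [lo_apply]
  exact sum_mem fun j _ => pr_mem_deg hP j

lemma aug_pr_succ (j : ℕ) (P : GSym V) : aug V (pr V (j + 1) P) = 0 := aug_of_wt (by omega) (pr_mem_wt _ _)

lemma aug_lo {n : ℕ} {P : GSym V} (hP : P ∈ fil V 1) : aug V (lo V n P) = 0 := by
  rw [lo_apply, map_sum]
  refine Finset.sum_eq_zero fun j _ => ?_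
  cases j with
  | zero => rw [mem_fil.1 hP 0 (by omega), map_zero]
  | succ j => exact aug_pr_succ j P

end GSym

lemma exists_fil_of_mem {V : GMod 𝒜} {m i : ℕ} {x : TruncSym V m}
    (hx : x ∈ ⨆ (j : ℕ) (_ : i ≤ j), TruncSym.wt V m j) : ∃ P ∈ fil V i, TruncSym.proj V m P = x := by
  have : (⨆ (j : ℕ) (_ : i ≤ j), TruncSym.wt V m j) ≤ (fil V i).map (TruncSym.proj V m).toLinearMap := by
    refine iSup_le fun j => iSup_le fun hj => ?_
    rintro _ ⟨P, hP, rfl⟩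
    exact ⟨P, wt_le_fil hj hP, rfl⟩
  exact this hx

variable {M N : GMod 𝒜} {PM : Presentation M} {PN : Presentation N} {f : GHom M N}

lemma LocalDer.skew {α : PM.ι} {m : ℕ} (r : LocalDer PM PN f α m) (P Q : GSym (PN.F r.β).dual) :
    r.d (TruncSym.proj _ r.n (P * Q)) =
      TruncSym.proj _ m (tw _ 1 (GSym.map r.h.dual P)) * r.d (TruncSym.proj _ r.n Q) +
        r.d (TruncSym.proj _ r.n P) * TruncSym.proj _ m (GSym.map r.h.dual Q) := by
  have key : r.d ∘ₗ (TruncSym.proj _ r.n).toLinearMap ∘ₗ LinearMap.mulRight k Q =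
      LinearMap.mulRight k (r.d (TruncSym.proj _ r.n Q)) ∘ₗ (TruncSym.proj _ m).toLinearMap ∘ₗ
        (tw _ 1).toLinearMap ∘ₗ (GSym.map r.h.dual).toLinearMap +
      LinearMap.mulRight k (TruncSym.proj _ m (GSym.map r.h.dual Q)) ∘ₗ r.d ∘ₗ
        (TruncSym.proj _ r.n).toLinearMap := by
    refine lin_ext fun p P hP => ?_
    have h1 := r.isDer.2 p (TruncSym.proj _ r.n P) (TruncSym.proj _ r.n Q) ⟨P, hP, rfl⟩
    simp only [LinearMap.comp_apply, LinearMap.mulRight_apply, LinearMap.add_apply, AlgHom.toLinearMap_apply]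
    rw [map_mul, h1, TruncSym.map_proj, TruncSym.map_proj, tw_of_mem _ (map_deg _ hP), map_smul,
      negOnePow_smul (k := k), smul_mul_assoc, add_comm]
  exact LinearMap.congr_fun key P

/-- A local derivation is induced by a derivation of symmetric algebras, one weight lower. -/
lemma LocalDer.exists_gder {α : PM.ι} {m : ℕ} (r : LocalDer PM PN f α (m + 1)) :
    ∃ D : GDer r.h, ∀ P Q, r.d (TruncSym.proj _ r.n P) = TruncSym.proj _ (m + 1) Q →
      D.d P - Q ∈ fil (PM.F α).dual (m + 1) := by
  obtain ⟨s, hs⟩ := LinearMap.exists_rightInverse_of_surjective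
    (TruncSym.proj (PM.F α).dual (m + 1)).toLinearMap
    (LinearMap.range_eq_top.2 (TruncSym.proj_surjective _ _))
  -- `S` is a merely linear lift of the truncated derivation; it satisfies the product rule modulo
  -- weights > m + 1.
  obtain ⟨S, hS⟩ : ∃ S : GSym (PN.F r.β).dual →ₗ[k] GSym (PM.F α).dual,
      ∀ P, TruncSym.proj _ (m + 1) (S P) = r.d (TruncSym.proj _ r.n P) :=
    ⟨s ∘ₗ r.d ∘ₗ (TruncSym.proj _ r.n).toLinearMap, fun P => LinearMap.congr_fun hs _⟩
  have hSm (P Q) : S (P * Q) - (tw _ 1 (GSym.map r.h.dual P) * S Q + S P * GSym.map r.h.dual Q) ∈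
      fil (PM.F α).dual (m + 2) := by
    rw [← TruncSym.proj_eq_iff, hS, r.skew, map_add, map_mul, map_mul, hS, hS]
  have hSeq {P} {Q} (h : r.d (TruncSym.proj _ r.n P) = TruncSym.proj _ (m + 1) Q) :
      S P - Q ∈ fil (PM.F α).dual (m + 2) := by
    rw [← TruncSym.proj_eq_iff, hS, h]
  have hlo {n : ℕ} (hn : n ≤ m + 2) {P Q : GSym (PM.F α).dual} (h : P - Q ∈ fil (PM.F α).dual (m + 2)) :
      lo _ n P = lo _ n Q := lo_eq_of_sub_mem (fil_anti hn h)
  have hSd {n : ℕ} (hn : n ≤ m + 2) {p : ℤ} {P} (hP : P ∈ deg (PN.F r.β).dual p) :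
      lo _ n (S P) ∈ deg (PM.F α).dual (p + 1) := by
    obtain ⟨Q, hQ, hPQ⟩ := r.isDer.1 p _ ⟨P, hP, rfl⟩
    rw [hlo hn (hSeq hPQ.symm), add_comm]
    exact lo_mem_deg hQ
  -- Values on coefficients are cut to weights ≤ m and values on generators to weights ≤ m + 1. As
  -- multiplication by a generator raises the weight by 1, these cut-offs turn the approximate
  -- product rules into exact ones. The weight m + 1 part on coefficients is thereby lost.
  obtain ⟨D, hD0, hD1⟩ := GDer.exists_of (h := r.h) (lo _ (m + 1) ∘ₗ S ∘ₗ coeff _) (lo _ (m + 2) ∘ₗ S ∘ₗ gen _)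
    (fun a b => by
      simp only [LinearMap.comp_apply]
      rw [← GSym.coeff_mul, hlo (by omega) (hSm _ _), map_add, map_coeff, map_coeff, tw_coeff, lo_coeff_mul,
        lo_mul_coeff])
    (fun a ω => by
      simp only [LinearMap.comp_apply]
      rw [← coeff_mul_gen, hlo (by omega) (hSm _ _), map_add, map_coeff, map_gen, tw_coeff, lo_coeff_mul,
        lo_succ_mul_gen])
    (fun p a ha => hSd (by omega) (coeff_mem_deg ha)) (fun p ω hω => hSd le_rfl (gen_mem_deg hω))
    (fun ω => by
      -- This is where not lowering weights is used: a generator goes to weight at least 1, so its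
      -- augmentation vanishes.
      obtain ⟨Q, hQ, hPQ⟩ := exists_fil_of_mem (r.nonneg 1 _ ⟨_, gen_mem_wt ω, rfl⟩)
      simp only [LinearMap.comp_apply]
      rw [hlo le_rfl (hSeq hPQ.symm)]
      exact aug_lo hQ)
  refine ⟨D, fun P Q hPQ => ?_⟩
  have h1 : D.d P - S P ∈ fil (PM.F α).dual (m + 1) := by
    refine fil_of_skew (δ := D.d - S)
      (ρ₁ := (TruncSym.proj _ m).comp ((tw _ 1).comp (GSym.map r.h.dual)))
      (ρ₂ := (TruncSym.proj _ m).comp (GSym.map r.h.dual)) (fun P Q => ?_) (fun a => ?_) (fun ω => ?_) P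
    · have h2 := TruncSym.proj_eq_iff.2 (fil_anti (show m + 1 ≤ m + 2 by omega) (hSm P Q))
      simp only [LinearMap.comp_apply, LinearMap.sub_apply, AlgHom.toLinearMap_apply, D.isBr.mul,
        map_sub, map_add, map_mul, AlgHom.comp_apply, mul_sub, sub_mul, h2, tw_zero]
      abel
    · rw [LinearMap.sub_apply, hD0]
      exact lo_sub_mem _ _
    · rw [LinearMap.sub_apply, hD1]
      exact fil_anti (by omega) (lo_sub_mem _ _)
  have h3 := add_mem h1 (fil_anti (show m + 1 ≤ m + 2 by omega) (hSeq hPQ))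
  rwa [sub_add_sub_cancel] at h3

lemma Presentation.map_t_refl (α : PM.ι) (P : GSym (PM.F α).dual) :
    GSym.map (PM.t (le_refl α)).dual P = P := by
  have : GSym.map (PM.t (le_refl α)).dual = AlgHom.id k (GSym (PM.F α).dual) := by
    refine GSym.hom_ext (fun a => by simp) (fun v => ?_)
    rw [GSym.map_gen, GHom.dual_eq_self _ (PM.t_refl α)]
    rfl
  rw [this]; rfl

lemma GDer.post_germ {α α' : PM.ι} {β : PN.ι} {m m' : ℕ} {h : GHom (PM.F α) (PN.F β)} (D : GDer h)
    (hα : α' ≤ α) (hm : m' ≤ m) {h' : GHom (PM.F α') (PN.F β)} (hu : ∀ x, h (PM.t hα x) = h' x)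
    (hle : PM.idx α' m' ≤ PM.idx α m) :
    Germ.post PN.symSys (PM.symSys.p hle) (D.germ (PM := PM) (PN := PN) m) =
      (D.pull (PM.t hα) hu).germ (PM := PM) (PN := PN) m' := by
  have hle' : PN.idx β m' ≤ PN.idx β m := ⟨le_rfl, hm⟩
  refine (Germ.post_of _ _ _).trans (Eq.trans (congrArg _ ?_) (Germ.of_p
    (Z := PM.symSys.obj (PM.idx α' m')) hle' ((D.pull (PM.t hα) hu).trunc m')))
  refine LinearMap.ext fun s => ?_
  obtain ⟨P, rfl⟩ := TruncSym.proj_surjective _ _ s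
  refine (congrArg (PM.symSys.p hle) (D.trunc_proj m P)).trans ?_
  refine (TruncSym.map_proj (PM.t hα).dual hm _).trans ?_
  refine Eq.trans ?_ (congrArg ((D.pull (PM.t hα) hu).trunc m')
    (TruncSym.map_proj (PN.t (le_refl β)).dual hm P)).symm
  refine Eq.trans ?_ ((GDer.trunc_proj _ m' _).trans
    (congrArg (fun R => TruncSym.proj (PM.F α').dual m' ((D.pull (PM.t hα) hu).d R))
      (Presentation.map_t_refl (PM := PN) β P))).symm
  rfl

/-- The weight lost in lifting is harmless: by compatibility of germs the class at (α, m) is the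
image of the class at (α, m + 1). -/
lemma LocalDer.exists_gder_germ (D : NonnegDer PM PN f) {α : PM.ι} {m : ℕ} (r : LocalDer PM PN f α (m + 1))
    (hr : r.germ = D.germ (PM.idx α (m + 1))) :
    ∃ Δ : GDer r.h, Δ.germ (PM := PM) (PN := PN) m = D.germ (PM.idx α m) ∧
      ∀ P Q, r.d (TruncSym.proj _ r.n P) = TruncSym.proj _ (m + 1) Q →
        Δ.d P - Q ∈ fil (PM.F α).dual (m + 1) := by
  obtain ⟨Δ, hΔ⟩ := r.exists_gder
  refine ⟨Δ, ?_, hΔ⟩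
  have hle : PM.idx α m ≤ PM.idx α (m + 1) := ⟨le_rfl, Nat.le_succ m⟩
  have hle' : PN.idx r.β m ≤ PN.idx r.β r.n := ⟨le_rfl, (Nat.le_succ m).trans r.le⟩
  rw [← D.compat hle, ← hr]
  refine Eq.trans (Germ.of_p (Z := PM.symSys.obj (PM.idx α m)) hle' (Δ.trunc m)).symm
    (Eq.trans (congrArg _ ?_) (Germ.post_of _ _ _).symm)
  refine LinearMap.ext fun s => ?_
  obtain ⟨P, rfl⟩ := TruncSym.proj_surjective _ _ s
  obtain ⟨Q, hQ⟩ := TruncSym.proj_surjective _ _ (r.d (TruncSym.proj _ r.n P))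
  refine (congrArg (Δ.trunc m) (TruncSym.map_proj (PN.t (le_refl r.β)).dual _ P)).trans ?_
  refine ((GDer.trunc_proj _ m _).trans
    (congrArg (fun R => TruncSym.proj (PM.F α).dual m (Δ.d R))
      (Presentation.map_t_refl (PM := PN) r.β P))).trans ?_
  refine (TruncSym.proj_eq_iff.2 (hΔ P Q hQ.symm)).trans ?_
  refine Eq.trans ?_ (congrArg (PM.symSys.p hle) hQ)
  refine Eq.trans ?_ (TruncSym.map_proj (PM.t (le_refl α)).dual (Nat.le_succ m) Q).symm
  exact congrArg (TruncSym.proj (PM.F α).dual m) (Presentation.map_t_refl (PM := PM) α Q).symm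

/-! ### Duality in terms of representing derivations -/

/-- Duality is used at weight `m + 1`, one weight being lost when the representative is lifted to a
derivation. The formula for da gives the anchors; in the formula for dω the anchor sums then agree,
leaving equality of ω(y) and ω of the bracket for every ω. -/
lemma Dual.exists_rep {X : MultiDer f} {D : NonnegDer PM PN f} (H : Dual PM PN f X D) (α : PM.ι) (m : ℕ) :
    ∃ (β : PN.ι) (h : GHom (PM.F α) (PN.F β)) (Δ : GDer h), Rep X m Δ ∧
      Δ.germ (PM := PM) (PN := PN) m = D.germ (PM.idx α m) := by
  obtain ⟨r, hr, h0, h1⟩ := H α (m + 1)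
  obtain ⟨Δ, hg, hΔ⟩ := r.exists_gder_germ D hr
  have hev {l : ℕ} (hl : l ≤ m) {e : Fin l → ℤ} {x : Fin l → PM.F α} (hx : ∀ t, x t ∈ (PM.F α).gr (e t))
      {Q : TruncSym (PM.F α).dual (m + 1) →ₗ[k] A} (hQ : IsEval (m + 1) e x Q) (P) :
      Q (r.d (TruncSym.proj _ r.n P)) = evF e x (Δ.d P) := by
    obtain ⟨R, hR⟩ := TruncSym.proj_surjective _ _ (r.d (TruncSym.proj _ r.n P))
    have h2 := evF_of_fil (show l < m + 1 by omega) hx (hΔ P R hR.symm)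
    rw [map_sub, sub_eq_zero] at h2
    rw [← hR, hQ.proj_eq hx, h2]
  have hanc : ∀ l ≤ m, ∀ (e : Fin l → ℤ) (x : Fin l → PM.F α), (∀ t, x t ∈ (PM.F α).gr (e t)) →
      Δ.anchor l x = (X l).anchor (fun t => PM.incl α (x t)) := fun l hl e x hx =>
    lin_ext_alg 𝒜 fun c a ha => by
      obtain ⟨Q, hQ, h2⟩ := h0 l (by omega) e x hx
      have h3 := h2 c a ha
      rw [TruncSym.coeff, hev hl hx hQ, ← Δ.q_coeff hx, Δ.q_coeff_eq hx ha, negOnePow_smul (k := k)] at h3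
      exact (smul_right_injective A (sg_ne_zero (k := k) _)) h3
  refine ⟨r.β, r.h, Δ, ⟨r.incl_h, hanc, fun l hl e x hx B => ?_⟩, hg⟩
  obtain ⟨Q, hQ, y, hy, h2⟩ := h1 l (by omega) e x hx
  rw [← hy]
  congr 1
  -- The given `y` is not only congruent to the bracket in N but equal to it at this index.
  refine B.ext_eval fun c ω hω => ?_
  have h3 := h2 c ω hω
  rw [TruncSym.gen, hev hl hx hQ, Δ.evF_gen B hx hω, negOnePow_smul (k := k)] at h3
  simp_rw [negOnePow_smul (k := k)] at h3
  rw [Finset.sum_congr rfl fun i _ => by rw [hanc l (by omega) _ _ (fun t => hx (i.succAbove t))],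
    sub_right_inj] at h3
  exact (smul_right_injective A (sg_ne_zero (k := k) _)) h3

lemma Dual.of_rep {X : MultiDer f} {D : NonnegDer PM PN f}
    (H : ∀ (α : PM.ι) (m : ℕ), ∃ (β : PN.ι) (h : GHom (PM.F α) (PN.F β)) (Δ : GDer h), Rep X m Δ ∧
      Δ.germ (PM := PM) (PN := PN) m = D.germ (PM.idx α m)) : Dual PM PN f X D := by
  intro α m
  obtain ⟨β, h, Δ, hΔ, hg⟩ := H α m
  refine ⟨Δ.toLocal hΔ.incl_h m, hg, fun l hl e x hx => ?_, fun l hl e x hx => ?_⟩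
  · obtain ⟨Q, hQ, hQ'⟩ := exists_isEval hl hx
    refine ⟨Q, hQ, fun c a ha => ?_⟩
    refine (congrArg Q (Δ.trunc_proj m (coeff _ a))).trans ?_
    rw [hQ', ← Δ.q_coeff hx, Δ.q_coeff_eq hx ha, hΔ.anchor l hl e x hx, negOnePow_smul (k := k)]
  · obtain ⟨Q, hQ, hQ'⟩ := exists_isEval hl hx
    obtain ⟨B⟩ := exists_hbasis (PN.finite β)
    refine ⟨Q, hQ, Δ.bra B (l + 1) x, hΔ.bra l hl e x hx B, fun c ω hω => ?_⟩
    refine (congrArg Q (Δ.trunc_proj m (gen _ ω))).trans ?_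
    rw [hQ', Δ.evF_gen B hx hω, negOnePow_smul (k := k)]
    simp_rw [negOnePow_smul (k := k)]
    rw [Finset.sum_congr rfl fun i _ => by rw [hΔ.anchor l (by omega) _ _ (fun t => hx (i.succAbove t))]]
    rfl

end SHLR
end

/-! ### Gluing along a presentation, and the bijection. -/

noncomputable section
namespace SHLR

variable {k A : Type u} [Field k] [Ring A] [Algebra k A] {𝒜 : ℤ → Submodule k A}

/-! ### Gluing multiderivations along a presentation -/

namespace Presentation

variable {M : GMod 𝒜} (P : Presentation M)

lemma exists_lift_all {J : Type*} [Finite J] (z : J → M) :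
    ∃ (i : P.ι) (x : J → P.F i), ∀ j, P.incl i (x j) = z j := by
  choose i x hx using fun j => P.incl_surj (z j)
  obtain ⟨s, hs⟩ := Finite.exists_le i
  exact ⟨s, fun j => P.t (hs j) (x j), fun j => by rw [P.incl_t, hx]⟩

/-- A tuple in M lifts to some index and two lifts agree at a later one, so the value is well
defined. Linearity in a slot involves finitely many elements, which can be lifted together. -/
lemma exists_multilinear {Y : Type u} [AddCommGroup Y] [Module k Y] {l : ℕ}
    (Z : ∀ α, MultilinearMap k (fun _ : Fin l => P.F α) Y)
    (hZ : ∀ {α α'} (h : α ≤ α') x, Z α' (fun t => P.t h (x t)) = Z α x) :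
    ∃ Φ : MultilinearMap k (fun _ : Fin l => M) Y, ∀ α x, Φ (fun t => P.incl α (x t)) = Z α x := by
  choose i x hx using fun z : Fin l → M => P.exists_lift_all z
  have key : ∀ α (y : Fin l → P.F α), Z (i fun t => P.incl α (y t)) (x fun t => P.incl α (y t)) = Z α y := by
    intro α y
    obtain ⟨β, h1, h2⟩ := exists_ge_ge (i fun t => P.incl α (y t)) α
    obtain ⟨γ, h3, h4⟩ := P.exists_eq β (fun t => P.t h1 (x (fun t => P.incl α (y t)) t))
      (fun t => P.t h2 (y t)) (fun t => by rw [P.incl_t, P.incl_t, hx])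
    rw [← hZ (h1.trans h3), ← hZ (h2.trans h3)]
    congr 1
    funext t
    rw [← P.t_comp h1 h3, ← P.t_comp h2 h3, h4]
  have hupd {α : P.ι} [DecidableEq (Fin l)] (y : Fin l → P.F α) (j : Fin l) (a : P.F α) :
      Function.update (fun t => P.incl α (y t)) j (P.incl α a) =
        fun t => P.incl α (Function.update y j a t) := by
    funext t
    rcases eq_or_ne t j with rfl | h
    · simp
    · simp [h]
  refine ⟨⟨fun z => Z (i z) (x z), fun z j a b => ?_, fun z j c a => ?_⟩, key⟩
  · obtain ⟨α, y, hy⟩ := P.exists_lift_all (Sum.elim z ![a, b])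
    obtain rfl : (fun t => P.incl α (y (Sum.inl t))) = z := funext fun t => hy _
    obtain rfl : P.incl α (y (Sum.inr 0)) = a := hy _
    obtain rfl : P.incl α (y (Sum.inr 1)) = b := hy _
    have h1 := hupd (fun t => y (Sum.inl t)) j
    rw [← map_add, h1, h1, h1]
    exact (key _ _).trans (((Z α).map_update_add _ _ _ _).trans (congrArg₂ _ (key _ _) (key _ _)).symm)
  · obtain ⟨α, y, hy⟩ := P.exists_lift_all (Sum.elim z ![a])
    obtain rfl : (fun t => P.incl α (y (Sum.inl t))) = z := funext fun t => hy _
    obtain rfl : P.incl α (y (Sum.inr 0)) = a := hy _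
    have : c • P.incl α (y (Sum.inr 0)) = P.incl α (c • y (Sum.inr 0)) :=
      ((P.incl α).lin.map_smul _ _).symm
    have h1 := hupd (fun t => y (Sum.inl t)) j
    rw [this, h1, h1]
    exact (key _ _).trans (((Z α).map_update_smul _ _ _ _).trans (congrArg _ (key _ _)).symm)

end Presentation

/-- Each axiom concerns finitely many homogeneous elements; these have homogeneous lifts to a single
index, where the axiom holds. -/
lemma MultiDerW.exists_glue {M N : GMod 𝒜} (PM : Presentation M) {f : GHom M N} {l : ℕ}
    (Z : ∀ α, MultiDerW (f.comp (PM.incl α)) l)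
    (hX : ∀ {α α'} (h : α ≤ α') x, (Z α').X (fun t => PM.t h (x t)) = (Z α).X x)
    (hanc : ∀ {α α'} (h : α ≤ α') x, (Z α').anchor (fun t => PM.t h (x t)) = (Z α).anchor x) :
    ∃ X : MultiDerW f l, (∀ α x, X.X (fun t => PM.incl α (x t)) = (Z α).X x) ∧
      ∀ α x, X.anchor (fun t => PM.incl α (x t)) = (Z α).anchor x := by
  obtain ⟨Φ, hΦ⟩ := PM.exists_multilinear (fun α => (Z α).X) hX
  obtain ⟨S, hS⟩ := PM.exists_multilinear (fun α => (Z α).anchor) hanc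
  have α₀ : PM.ι := Classical.arbitrary _
  refine ⟨⟨Φ, S, fun e m hm => ?_, fun e m hm π => ?_, fun e m hm => ?_, fun e m hm π => ?_,
    fun e m hm i c a ha b => ?_, fun e m hm c a ha x => ?_⟩, hΦ, hS⟩
  · obtain ⟨α, -, y, hy, hy'⟩ := PM.exists_lift α₀ e m hm
    obtain rfl : (fun t => PM.incl α (y t)) = m := funext hy'
    rw [hΦ]
    exact (Z α).X_mem e y hy
  · obtain ⟨α, -, y, hy, hy'⟩ := PM.exists_lift α₀ e m hm
    obtain rfl : (fun t => PM.incl α (y t)) = m := funext hy'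
    rw [hΦ α y, hΦ α (fun t => y (π t))]
    exact (Z α).X_symm e y hy π
  · obtain ⟨α, -, y, hy, hy'⟩ := PM.exists_lift α₀ e m hm
    obtain rfl : (fun t => PM.incl α (y t)) = m := funext hy'
    rw [hS]
    exact (Z α).anchor_der e y hy
  · obtain ⟨α, -, y, hy, hy'⟩ := PM.exists_lift α₀ e m hm
    obtain rfl : (fun t => PM.incl α (y t)) = m := funext hy'
    rw [hS α y, hS α (fun t => y (π t))]
    exact (Z α).anchor_symm e y hy π
  · obtain ⟨α, -, y, hy, hy'⟩ := PM.exists_lift α₀ e m hm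
    obtain rfl : (fun t => PM.incl α (y t)) = m := funext hy'
    have : Function.update (fun t => PM.incl α (y t)) i (a • PM.incl α (y i)) =
        fun t => PM.incl α (Function.update y i (a • y i) t) := by
      funext t
      rcases eq_or_ne t i with rfl | h
      · simp
      · simp [h]
    rw [this, hS, hS]
    exact (Z α).anchor_smul e y hy i c a ha b
  · obtain ⟨α₁, z₁, rfl⟩ := PM.incl_surj x
    obtain ⟨α, h1, y, hy, hy'⟩ := PM.exists_lift α₁ e m hm
    obtain rfl : (fun t => PM.incl α (y t)) = m := funext hy'
    rw [← PM.incl_t h1]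
    generalize PM.t h1 z₁ = z
    have (w : PM.F α) : Fin.snoc (α := fun _ => M) (fun t => PM.incl α (y t)) (PM.incl α w) =
        fun t => PM.incl α (Fin.snoc (α := fun _ => PM.F α) y w t) := by
      funext t
      refine Fin.lastCases ?_ (fun t => ?_) t
      · simp
      · simp
    rw [← map_smul, this, this, hS, hΦ, hΦ]
    exact (Z α).leibniz e y hy c a ha z

variable [GradedAlgebra 𝒜] [IsGradedComm 𝒜]

open GSym

variable {M N : GMod 𝒜} {PM : Presentation M} {PN : Presentation N} {f : GHom M N}

/-! ### The bijection -/

/-- A representative at a larger index restricts to one at a smaller index, and any two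
representatives of the same multiderivation have the same class; so the chosen classes are
compatible. -/
lemma Dual.exists_right [CharZero k] (PM : Presentation M) (PN : Presentation N) (X : MultiDer f) :
    ∃ D : NonnegDer PM PN f, Dual PM PN f X D := by
  choose β h Δ H using fun (α : PM.ι) (m : ℕ) => SHLR.exists_rep (PM := PM) (PN := PN) X α m
  refine ⟨⟨⟨fun c => (Δ (Prod.fst (β := ℕ) c) (Prod.snd (α := PM.ι) c)).germ _, fun {c c'} hc => ?_⟩,
    fun α m => ⟨(Δ α m).toLocal (H α m).incl_h m, rfl⟩⟩,
    Dual.of_rep fun α m => ⟨β α m, h α m, Δ α m, H α m, rfl⟩⟩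
  have h1 := And.left hc
  have h2 := And.right hc
  refine ((Δ c'.1 c'.2).post_germ (And.left hc) (And.right hc)
    (h' := (h c'.1 c'.2).comp (PM.t h1)) (fun x => rfl) hc).trans ?_
  exact Rep.germ_eq (((H c'.1 c'.2).mono h2).pull h1 _) (H c.1 c.2)

lemma Dual.right_unique [CharZero k] {X : MultiDer f} {D D' : NonnegDer PM PN f} (H : Dual PM PN f X D)
    (H' : Dual PM PN f X D') : D = D' := by
  refine NonnegDer.ext (funext fun c => ?_)
  obtain ⟨β, h, Δ, hΔ, hg⟩ := H.exists_rep (Prod.fst (β := ℕ) c) (Prod.snd (α := PM.ι) c)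
  obtain ⟨β', h', Δ', hΔ', hg'⟩ := H'.exists_rep (Prod.fst (β := ℕ) c) (Prod.snd (α := PM.ι) c)
  exact hg.symm.trans ((hΔ.germ_eq hΔ').trans hg')

/-- Representatives of a derivation induce the same anchors and brackets. -/
lemma NonnegDer.anchor_bra_eq (D : NonnegDer PM PN f) {α α' : PM.ι} {β β' : PN.ι} {m m' n : ℕ}
    {h : GHom (PM.F α) (PN.F β)} {h' : GHom (PM.F α') (PN.F β')} {Δ : GDer h} {Δ' : GDer h'}
    (hh : ∀ x, PN.incl β (h x) = f (PM.incl α x)) (hh' : ∀ x, PN.incl β' (h' x) = f (PM.incl α' x))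
    (hg : Δ.germ (PM := PM) (PN := PN) m = D.germ (PM.idx α m))
    (hg' : Δ'.germ (PM := PM) (PN := PN) m' = D.germ (PM.idx α' m'))
    (hα : α ≤ α') (hm : n ≤ m) (hm' : n ≤ m') {l : ℕ} (hl : l ≤ n) {e : Fin l → ℤ} {x : Fin l → PM.F α}
    (hx : ∀ t, x t ∈ (PM.F α).gr (e t)) :
    Δ.anchor l x = Δ'.anchor l (fun t => PM.t hα (x t)) ∧ ∀ B B',
      PN.incl β (Δ.bra B l x) = PN.incl β' (Δ'.bra B' l (fun t => PM.t hα (x t))) := by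
  have h1 : PM.idx α n ≤ PM.idx α m := ⟨le_rfl, hm⟩
  have h2 : PM.idx α n ≤ PM.idx α' m' := ⟨hα, hm'⟩
  have p1 := Δ.post_germ (PM := PM) (PN := PN) (le_refl α) hm (h' := h.comp (PM.t le_rfl)) (fun x => rfl) h1
  have p2 := Δ'.post_germ (PM := PM) (PN := PN) hα hm' (h' := h'.comp (PM.t hα)) (fun x => rfl) h2
  rw [hg, D.compat h1] at p1
  rw [hg', D.compat h2] at p2
  obtain ⟨γ, hβ, hβ', h'', e1, e2, hag⟩ := exists_agree_of_germ_eq (PM := PM) (PN := PN)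
    (Δ.pull (PM.t le_rfl) (h' := h.comp (PM.t le_rfl)) fun x => rfl)
    (Δ'.pull (PM.t hα) (h' := h'.comp (PM.t hα)) fun x => rfl)
    (fun x => by
      change PN.incl β (h (PM.t le_rfl x)) = PN.incl β' (h' (PM.t hα x))
      rw [hh, hh', PM.incl_t, PM.incl_t]) (p1.symm.trans p2)
  have hxr : (fun t => PM.t (le_refl α) (x t)) = x := funext fun t => PM.t_refl α _
  refine ⟨?_, fun B B' => ?_⟩
  · have := hag.anchor_eq hl hx
    rw [GDer.anchor_push _ _ _ hx, GDer.anchor_push _ _ _ hx] at this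
    refine Eq.trans ?_ (this.trans (Δ'.anchor_pull (PM.t hα) _ hx))
    refine Eq.trans ?_ (Δ.anchor_pull (PM.t le_rfl) _ hx).symm
    rw [hxr]
  · obtain ⟨C⟩ := exists_hbasis (PN.finite γ)
    have := congrArg (PN.incl γ) (hag.bra_eq C hl hx)
    rw [GDer.bra_push _ _ _ B C hx, GDer.bra_push _ _ _ B' C hx, PN.incl_t, PN.incl_t] at this
    refine Eq.trans ?_ (this.trans (congrArg _ (Δ'.bra_pull (PM.t hα) _ B' hx)))
    refine Eq.trans ?_ (congrArg _ (Δ.bra_pull (PM.t le_rfl) _ B hx)).symm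
    rw [hxr]

/-- The component of weight `l` takes l + 1 arguments, so it is read off from representatives at
weight l + 1, themselves lifted from weight l + 2. Independence of the representative gives the
compatibility needed for gluing. -/
lemma Dual.exists_left (D : NonnegDer PM PN f) : ∃ X : MultiDer f, Dual PM PN f X D := by
  choose r hr using fun (α : PM.ι) (m : ℕ) => D.isDer α (m + 1)
  choose Δ hΔ _ using fun (α : PM.ι) (m : ℕ) => (r α m).exists_gder_germ D (hr α m)
  have B (β : PN.ι) : HBasis (PN.F β) := Classical.choice (exists_hbasis (PN.finite β))
  have hglue (l : ℕ) := MultiDerW.exists_glue PM (f := f) (l := l) (fun α =>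
    ((Δ α (l + 1)).toMultiDer (B _) l).conj (f' := f.comp (PM.incl α)) (GHom.id _) (PN.incl _) (r α (l + 1)).incl_h)
    (fun {α α'} hα => fun x => by
      have := multilinear_ext_hom (Φ' := (((Δ α (l + 1)).toMultiDer (B _) l).conj (f' := f.comp (PM.incl α))
          (GHom.id _) (PN.incl _) (r α (l + 1)).incl_h).X)
        (Φ := (((Δ α' (l + 1)).toMultiDer (B _) l).conj (f' := f.comp (PM.incl α')) (GHom.id _) (PN.incl _)
          (r α' (l + 1)).incl_h).X.compLinearMap fun _ => (PM.t hα).lin) fun e x hx =>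
        ((D.anchor_bra_eq (r α (l + 1)).incl_h (r α' (l + 1)).incl_h (hΔ α (l + 1)) (hΔ α' (l + 1)) hα le_rfl le_rfl
          (l := l + 1) le_rfl hx).2 _ _).symm
      exact congrArg (fun Φ => Φ x) this)
    (fun {α α'} hα => fun x => by
      have := multilinear_ext_hom (Φ' := (((Δ α (l + 1)).toMultiDer (B _) l).conj (f' := f.comp (PM.incl α))
          (GHom.id _) (PN.incl _) (r α (l + 1)).incl_h).anchor)
        (Φ := (((Δ α' (l + 1)).toMultiDer (B _) l).conj (f' := f.comp (PM.incl α')) (GHom.id _) (PN.incl _)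
          (r α' (l + 1)).incl_h).anchor.compLinearMap fun _ => (PM.t hα).lin) fun e x hx =>
        ((D.anchor_bra_eq (r α (l + 1)).incl_h (r α' (l + 1)).incl_h (hΔ α (l + 1)) (hΔ α' (l + 1)) hα le_rfl le_rfl
          (l := l) (Nat.le_succ l) hx).1).symm
      exact congrArg (fun Φ => Φ x) this)
  choose X hX hXa using hglue
  refine ⟨X, Dual.of_rep fun α m => ⟨_, _, Δ α m, ⟨(r α m).incl_h, fun l hl e x hx => ?_,
    fun l hl e x hx C => ?_⟩, hΔ α m⟩⟩
  · have := (D.anchor_bra_eq (r α m).incl_h (r α (l + 1)).incl_h (hΔ α m) (hΔ α (l + 1)) le_rfl hl (Nat.le_succ l)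
      le_rfl hx).1
    rw [this, hXa]
    congr 1
    exact funext fun t => PM.t_refl α _
  · have := (D.anchor_bra_eq (r α m).incl_h (r α (l + 1)).incl_h (hΔ α m) (hΔ α (l + 1)) le_rfl hl le_rfl
      le_rfl hx).2 C (B _)
    rw [this, hX]
    refine congrArg (fun y => PN.incl _ ((Δ α (l + 1)).bra (B _) (l + 1) y)) ?_
    exact funext fun t => PM.t_refl α _

lemma Dual.left_unique {X X' : MultiDer f} {D : NonnegDer PM PN f} (H : Dual PM PN f X D)
    (H' : Dual PM PN f X' D) : X = X' := by
  have α₀ : PM.ι := Classical.arbitrary _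
  refine funext fun l => MultiDerW.ext ?_ ?_
  · refine multilinear_ext_hom fun e m hm => ?_
    obtain ⟨α, -, y, hy, hy'⟩ := PM.exists_lift α₀ e m hm
    obtain rfl : (fun t => PM.incl α (y t)) = m := funext hy'
    obtain ⟨β, h, Δ, hΔ, hg⟩ := H.exists_rep α (l + 1)
    obtain ⟨β', h', Δ', hΔ', hg'⟩ := H'.exists_rep α (l + 1)
    obtain ⟨B⟩ := exists_hbasis (PN.finite β)
    obtain ⟨B'⟩ := exists_hbasis (PN.finite β')
    have := (D.anchor_bra_eq hΔ.incl_h hΔ'.incl_h hg hg' le_rfl le_rfl le_rfl le_rfl hy).2 B B'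
    rw [hΔ.bra l le_rfl e y hy, hΔ'.bra l le_rfl e _ fun t => (PM.t le_rfl).map_mem (hy t)] at this
    simp_rw [PM.incl_t] at this
    exact this
  · refine multilinear_ext_hom fun e m hm => ?_
    obtain ⟨α, -, y, hy, hy'⟩ := PM.exists_lift α₀ e m hm
    obtain rfl : (fun t => PM.incl α (y t)) = m := funext hy'
    obtain ⟨β, h, Δ, hΔ, hg⟩ := H.exists_rep α l
    obtain ⟨β', h', Δ', hΔ', hg'⟩ := H'.exists_rep α l
    have := (D.anchor_bra_eq hΔ.incl_h hΔ'.incl_h hg hg' le_rfl le_rfl le_rfl le_rfl hy).1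
    rw [hΔ.anchor l le_rfl e y hy, hΔ'.anchor l le_rfl e _ fun t => (PM.t le_rfl).map_mem (hy t)] at this
    simp_rw [PM.incl_t] at this
    exact this

/-- Multiderivations correspond bijectively to derivations of the completed symmetric algebras. -/
theorem exists_dual_equiv [CharZero k] (PM : Presentation M) (PN : Presentation N) (f : GHom M N) :
    ∃ Φ : MultiDer f ≃ NonnegDer PM PN f, ∀ (X : MultiDer f) (D : NonnegDer PM PN f),
      Φ X = D ↔ Dual PM PN f X D := by
  choose Φ hΦ using fun X : MultiDer f => Dual.exists_right PM PN X
  have key : ∀ X D, Φ X = D ↔ Dual PM PN f X D := fun X D =>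
    ⟨fun h => h ▸ hΦ X, fun h => (hΦ X).right_unique h⟩
  refine ⟨Equiv.ofBijective Φ ⟨fun X X' h => (hΦ X).left_unique (h ▸ hΦ X'), fun D => ?_⟩, key⟩
  obtain ⟨X, hX⟩ := Dual.exists_left D
  exact ⟨X, (key X D).2 hX⟩

end SHLR
end

/-! ### Sums over unshuffles. -/

noncomputable section
namespace SHLR

/-! ### Sums over unshuffles as sums over subsets -/

/-- The increasing enumeration of a finite set. -/
def enum (T : Finset ℕ) (s : Fin T.card) : ℕ := T.orderEmbOfFin rfl s

lemma enum_mem (T : Finset ℕ) (s : Fin T.card) : enum T s ∈ T := T.orderEmbOfFin_mem rfl s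

lemma sum_enum {Y : Type*} [AddCommMonoid Y] (T : Finset ℕ) (f : ℕ → Y) : ∑ s, f (enum T s) = ∑ t ∈ T, f t := by
  conv_rhs => rw [← T.map_orderEmbOfFin_univ rfl, Finset.sum_map]
  rfl

/-- `Ψ` takes the length as an argument, so replacing p by `T.card` needs no casts. -/
lemma eq_enum {Y : Sort*} (Ψ : ∀ p : ℕ, (Fin p → ℕ) → Y) {p : ℕ} {a : Fin p → ℕ} (ha : StrictMono a) {T : Finset ℕ}
    (hT : T.card = p) (h : ∀ t, a t ∈ T) : Ψ p a = Ψ T.card (enum T) := by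
  subst hT
  rw [Finset.orderEmbOfFin_unique rfl h ha]
  rfl

lemma mem_unshuffles {p q : ℕ} {π : Equiv.Perm (Fin (p + q))} : π ∈ unshuffles p q ↔
    StrictMono (fun t : Fin p => π (Fin.castAdd q t)) ∧ StrictMono (fun t : Fin q => π (Fin.natAdd p t)) := by
  simp only [unshuffles, Finset.mem_filter, Finset.mem_univ, true_and]
  exact ⟨fun h => ⟨fun s t => h.1 s t, fun s t => h.2 s t⟩, fun h => ⟨fun s t => @h.1 s t, fun s t => @h.2 s t⟩⟩

lemma unshuffle_fst {p q : ℕ} {π : Equiv.Perm (Fin (p + q))} (hπ : π ∈ unshuffles p q) :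
    StrictMono (fun t : Fin p => (π (Fin.castAdd q t) : ℕ)) := fun _ _ h => (mem_unshuffles.1 hπ).1 h

lemma unshuffle_snd {p q : ℕ} {π : Equiv.Perm (Fin (p + q))} (hπ : π ∈ unshuffles p q) :
    StrictMono (fun t : Fin q => (π (Fin.natAdd p t) : ℕ)) := fun _ _ h => (mem_unshuffles.1 hπ).2 h

/-- The values of the first block. -/
def block {p q : ℕ} (π : Equiv.Perm (Fin (p + q))) : Finset ℕ :=
  Finset.univ.image fun t : Fin p => (π (Fin.castAdd q t) : ℕ)

lemma mem_block {p q : ℕ} (π : Equiv.Perm (Fin (p + q))) (t : Fin p) :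
    (π (Fin.castAdd q t) : ℕ) ∈ block π := Finset.mem_image_of_mem _ (Finset.mem_univ t)

lemma card_block {p q : ℕ} (π : Equiv.Perm (Fin (p + q))) : (block π).card = p := by
  rw [block, Finset.card_image_of_injective, Finset.card_univ, Fintype.card_fin]
  exact fun s t h => Fin.castAdd_injective _ _ (π.injective (Fin.ext h))

lemma block_subset {p q : ℕ} (π : Equiv.Perm (Fin (p + q))) : block π ⊆ Finset.range (p + q) := by
  intro t ht
  obtain ⟨s, -, rfl⟩ := Finset.mem_image.1 ht
  simp

lemma mem_sdiff_block {p q : ℕ} (π : Equiv.Perm (Fin (p + q))) (t : Fin q) :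
    (π (Fin.natAdd p t) : ℕ) ∈ Finset.range (p + q) \ block π := by
  refine Finset.mem_sdiff.2 ⟨by simp, fun h => ?_⟩
  obtain ⟨s, -, hs⟩ := Finset.mem_image.1 h
  have := congrArg Fin.val (π.injective (Fin.ext hs))
  simp at this
  omega

lemma card_sdiff_block {p q : ℕ} (π : Equiv.Perm (Fin (p + q))) : (Finset.range (p + q) \ block π).card = q := by
  rw [Finset.card_sdiff_of_subset (block_subset π), card_block, Finset.card_range]; omega

/-- An unshuffle is determined by the set of values of its first block, each block being increasing;
conversely the increasing enumerations of a set and its complement form an unshuffle. -/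
lemma sum_unshuffles {Y : Type*} [AddCommMonoid Y] (p q : ℕ)
    (Ψ : ∀ p : ℕ, (Fin p → ℕ) → ∀ q : ℕ, (Fin q → ℕ) → Y) :
    ∑ π ∈ unshuffles p q, Ψ p (fun t => π (Fin.castAdd q t)) q (fun t => π (Fin.natAdd p t)) =
      ∑ T ∈ (Finset.range (p + q)).powersetCard p, Ψ _ (enum T) _ (enum (Finset.range (p + q) \ T)) := by
  refine Finset.sum_bij (fun π _ => block π) (fun π _ => ?_) (fun π hπ π' hπ' h => ?_) (fun T hT => ?_)
    (fun π hπ => ?_)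
  · exact Finset.mem_powersetCard.2 ⟨block_subset π, card_block π⟩
  · have h1 := Finset.orderEmbOfFin_unique (card_block π) (mem_block π) (unshuffle_fst hπ)
    have h1' := Finset.orderEmbOfFin_unique (card_block π) (fun t => h ▸ mem_block π' t) (unshuffle_fst hπ')
    have h2 := Finset.orderEmbOfFin_unique (card_sdiff_block π) (mem_sdiff_block π) (unshuffle_snd hπ)
    have h2' := Finset.orderEmbOfFin_unique (card_sdiff_block π) (fun t => h ▸ mem_sdiff_block π' t)
      (unshuffle_snd hπ')
    refine Equiv.ext fun t => ?_
    refine Fin.addCases (fun t => Fin.ext ?_) (fun t => Fin.ext ?_) t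
    · exact congrFun (h1.trans h1'.symm) t
    · exact congrFun (h2.trans h2'.symm) t
  · obtain ⟨hT, hc⟩ := Finset.mem_powersetCard.1 hT
    let S : Finset (Fin (p + q)) := Finset.univ.filter fun t => (t : ℕ) ∈ T
    have hS : S.map Fin.valEmbedding = T := by
      ext t
      simp only [S, Finset.mem_map, Finset.mem_filter, Finset.mem_univ, true_and, Fin.valEmbedding_apply]
      exact ⟨fun ⟨s, hs, h⟩ => h ▸ hs, fun h => ⟨⟨t, Finset.mem_range.1 (hT h)⟩, h, rfl⟩⟩
    have hSc : S.card = p := by rw [← Finset.card_map Fin.valEmbedding, hS, hc]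
    have hSc' : Sᶜ.card = q := by rw [Finset.card_compl, Fintype.card_fin, hSc]; omega
    let π : Equiv.Perm (Fin (p + q)) := finSumFinEquiv.symm.trans (finSumEquivOfFinset hSc hSc')
    have h1 (t : Fin p) : π (Fin.castAdd q t) = S.orderEmbOfFin hSc t := by simp [π]
    have h2 (t : Fin q) : π (Fin.natAdd p t) = Sᶜ.orderEmbOfFin hSc' t := by simp [π]
    refine ⟨π, mem_unshuffles.2 ⟨?_, ?_⟩, ?_⟩
    · simp_rw [h1]; exact (S.orderEmbOfFin hSc).strictMono
    · simp_rw [h2]; exact (Sᶜ.orderEmbOfFin hSc').strictMono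
    · refine Finset.eq_of_subset_of_card_le (fun t ht => ?_) (by rw [card_block, hc])
      obtain ⟨s, -, rfl⟩ := Finset.mem_image.1 ht
      rw [h1, ← hS]
      exact Finset.mem_map_of_mem _ (S.orderEmbOfFin_mem hSc s)
  · rw [eq_enum (fun p' a => Ψ p' a q fun t => π (Fin.natAdd p t)) (unshuffle_fst hπ) (card_block π) (mem_block π)]
    exact eq_enum (fun q b => Ψ _ (enum (block π)) q b) (unshuffle_snd hπ) (card_sdiff_block π) (mem_sdiff_block π)

/-- The sum over all unshuffles of `r` letters, indexed by the first blocks. -/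
def sumSh {Y : Type*} [AddCommMonoid Y] (r : ℕ) (Ψ : ∀ p : ℕ, (Fin p → ℕ) → ∀ q : ℕ, (Fin q → ℕ) → Y) : Y :=
  ∑ T ∈ (Finset.range r).powerset, Ψ _ (enum T) _ (enum (Finset.range r \ T))

lemma sum_antidiagonal_unshuffles {Y : Type*} [AddCommMonoid Y] (r : ℕ)
    (Ψ : ∀ p : ℕ, (Fin p → ℕ) → ∀ q : ℕ, (Fin q → ℕ) → Y) :
    ∑ pq ∈ Finset.HasAntidiagonal.antidiagonal r, ∑ π ∈ unshuffles pq.1 pq.2,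
      Ψ pq.1 (fun t => π (Fin.castAdd pq.2 t)) pq.2 (fun t => π (Fin.natAdd pq.1 t)) = sumSh r Ψ := by
  rw [sumSh, Finset.sum_powerset, Finset.card_range, Finset.Nat.sum_antidiagonal_eq_sum_range_succ_mk]
  refine Finset.sum_congr rfl fun p hp => ?_
  obtain ⟨q, rfl⟩ := Nat.exists_eq_add_of_le (Nat.le_of_lt_succ (Finset.mem_range.1 hp))
  rw [Nat.add_sub_cancel_left]
  exact sum_unshuffles p q Ψ

/-- Reindexing by complements. The unwanted terms in `GDer.aug_comp_gen` cancel by this symmetry. -/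
lemma sumSh_swap {Y : Type*} [AddCommMonoid Y] (r : ℕ)
    (Ψ : ∀ p : ℕ, (Fin p → ℕ) → ∀ q : ℕ, (Fin q → ℕ) → Y) :
    sumSh r (fun p a q b => Ψ q b p a) = sumSh r Ψ := by
  have h : ∀ T ∈ (Finset.range r).powerset, Finset.range r \ (Finset.range r \ T) = T := fun T hT =>
    Finset.sdiff_sdiff_eq_self (Finset.mem_powerset.1 hT)
  refine Finset.sum_nbij' (fun T => Finset.range r \ T) (fun T => Finset.range r \ T) ?_ ?_ h h fun T hT => ?_
  · exact fun T _ => Finset.mem_powerset.2 Finset.sdiff_subset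
  · exact fun T _ => Finset.mem_powerset.2 Finset.sdiff_subset
  · rw [h T hT]

/-- The exponent of the Koszul sign of the unshuffle with given blocks. -/
def invs (e : ℕ → ℤ) {p q : ℕ} (a : Fin p → ℕ) (b : Fin q → ℕ) : ℤ :=
  ∑ s, ∑ t, if b t < a s then e (a s) * e (b t) else 0

/-- Within a block there are no inversions, so only pairs from different blocks contribute. -/
lemma koszul_unshuffle {p q : ℕ} {π : Equiv.Perm (Fin (p + q))} (hπ : π ∈ unshuffles p q) (e : ℕ → ℤ) :
    koszul π (fun t => e t) = (invs e (fun t : Fin p => (π (Fin.castAdd q t) : ℕ))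
      (fun t : Fin q => (π (Fin.natAdd p t) : ℕ))).negOnePow := by
  obtain ⟨h1, h2⟩ := mem_unshuffles.1 hπ
  have h3 : ∏ s : Fin q, ∏ t, (if Fin.natAdd p s < t ∧ π t < π (Fin.natAdd p s) then
      (e (π (Fin.natAdd p s)) * e (π t)).negOnePow else 1) = 1 := by
    refine Finset.prod_eq_one fun s _ => Finset.prod_eq_one fun t _ => if_neg ?_
    refine Fin.addCases (fun t => ?_) (fun t => ?_) t
    · rintro ⟨h, -⟩
      rw [Fin.lt_def] at h
      simp at h
      omega
    · rintro ⟨h, h'⟩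
      exact lt_asymm h' (h2 (by rw [Fin.lt_def] at h ⊢; simpa using h))
  rw [koszul, Fin.prod_univ_add, h3, mul_one, invs, negOnePow_sum]
  refine Finset.prod_congr rfl fun s _ => ?_
  rw [Fin.prod_univ_add, Finset.prod_eq_one, one_mul, negOnePow_sum]
  · refine Finset.prod_congr rfl fun t _ => ?_
    have : Fin.castAdd q s < Fin.natAdd p t := by rw [Fin.lt_def]; simp; omega
    simp only [this, true_and, Fin.lt_def]
    split_ifs <;> simp
  · refine fun t _ => if_neg ?_
    rintro ⟨h, h'⟩
    exact lt_asymm h' (h1 (by rw [Fin.lt_def] at h ⊢; simpa using h))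

/-- Each pair from the two blocks is inverted in exactly one of the two orders. Signs of exchanged
blocks are compared through this. -/
lemma invs_add_invs (e : ℕ → ℤ) {p q : ℕ} (a : Fin p → ℕ) (b : Fin q → ℕ) (hab : ∀ s t, a s ≠ b t) :
    invs e a b + invs e b a = (∑ s, e (a s)) * ∑ t, e (b t) := by
  rw [invs, invs, Finset.sum_comm (s := Finset.univ (α := Fin q)), Finset.sum_mul_sum, ← Finset.sum_add_distrib]
  refine Finset.sum_congr rfl fun s _ => ?_
  rw [← Finset.sum_add_distrib]
  refine Finset.sum_congr rfl fun t _ => ?_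
  rcases lt_or_gt_of_ne (hab s t) with h | h
  · rw [if_neg h.not_gt, if_pos h, zero_add, mul_comm]
  · rw [if_pos h, if_neg h.not_gt, add_zero]

lemma enum_ne (r : ℕ) (T : Finset ℕ) (s : Fin T.card) (t : Fin (Finset.range r \ T).card) :
    enum T s ≠ enum (Finset.range r \ T) t := fun h =>
  (Finset.mem_sdiff.1 (enum_mem _ t)).2 (h ▸ enum_mem T s)

end SHLR
end

/-! ### Commutators of composites. -/

noncomputable section
namespace SHLR

variable {k A : Type u} [Field k] [Ring A] [Algebra k A] {𝒜 : ℤ → Submodule k A}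
  [GradedAlgebra 𝒜] [IsGradedComm 𝒜]

open GSym

/-! ### Iterated brackets of composites -/

section Composite

variable {F G H : GMod 𝒜} {h : GHom F G} {h' : GHom G H}

/-- The commutator with a contraction satisfies the Leibniz rule for composition: insert and
subtract the term in which the contraction stands between δ and ε. -/
lemma brStep_comp (c a b : ℤ) (x : F) (δ : GSym G.dual →ₗ[k] GSym F.dual) (ε : GSym H.dual →ₗ[k] GSym G.dual) :
    brStep (h'.comp h) c (a + b) x (δ ∘ₗ ε) =
      brStep h c a x δ ∘ₗ ε + sg k (c * a) • (δ ∘ₗ brStep h' c b (h x) ε) := by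
  refine LinearMap.ext fun P => ?_
  have h1 : (h'.comp h) x = h' (h x) := rfl
  simp only [LinearMap.add_apply, LinearMap.comp_apply, LinearMap.smul_apply, brStep_apply, map_sub, map_smul,
    smul_sub, smul_smul, ← sg_add, h1]
  rw [mul_add]
  abel

/-- Each letter is bracketed either with δ or with ε; `T` is the set of those that go to δ. The sign
records each letter outside `T` passing the earlier letters of `T`. -/
lemma brN_comp (x : ℕ → F) (e : ℕ → ℤ) (δ : GSym G.dual →ₗ[k] GSym F.dual) (ε : GSym H.dual →ₗ[k] GSym G.dual)
    (r : ℕ) : brN (h'.comp h) x e (δ ∘ₗ ε) r (Finset.range r) = ∑ T ∈ (Finset.range r).powerset,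
      sg k (∑ u ∈ Finset.range r \ T, e u * ∑ t ∈ T with t < u, e t) •
        (brN h x e δ r T ∘ₗ brN h' (fun t => h (x t)) e ε r (Finset.range r \ T)) := by
  induction r with
  | zero => simp [sg_zero]
  | succ r ih =>
    rw [brN] at ih
    -- Subsets with and without the new letter `r` correspond to the two terms of `brStep_comp`.
    rw [brN, foldN_range_succ, ih, map_sum, Finset.range_add_one,
      Finset.sum_powerset_insert Finset.notMem_range_self, ← Finset.sum_add_distrib]
    refine Finset.sum_congr rfl fun T hT => ?_
    have hT := Finset.mem_powerset.1 hT
    have hr : r ∉ T := fun h => Finset.notMem_range_self (hT h)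
    have h1 : insert r (Finset.range r) \ T = insert r (Finset.range r \ T) :=
      Finset.insert_sdiff_of_notMem _ hr
    have h2 : insert r (Finset.range r) \ insert r T = Finset.range r \ T := by
      rw [Finset.insert_sdiff_insert]
      exact Finset.sdiff_insert_of_notMem Finset.notMem_range_self _
    have h3 : r ∉ Finset.range r \ T := fun h => Finset.notMem_range_self (Finset.mem_sdiff.1 h).1
    have hfT : T.filter (· < r) = T := Finset.filter_true_of_mem fun t ht => Finset.mem_range.1 (hT ht)
    have hfT' : (insert r T).filter (· < r) = T := by rw [Finset.filter_insert, if_neg (lt_irrefl r), hfT]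
    have hfU : (insert r (Finset.range r \ T)).filter (· < r) = Finset.range r \ T := by
      rw [Finset.filter_insert, if_neg (lt_irrefl r)]
      exact Finset.filter_true_of_mem fun t ht => Finset.mem_range.1 (Finset.mem_sdiff.1 ht).1
    have h4 : ∑ u ∈ Finset.range r \ T, e u * ∑ t ∈ insert r T with t < u, e t =
        ∑ u ∈ Finset.range r \ T, e u * ∑ t ∈ T with t < u, e t := by
      refine Finset.sum_congr rfl fun u hu => ?_
      rw [Finset.filter_insert, if_neg]
      exact (Finset.mem_range.1 (Finset.mem_sdiff.1 hu).1).not_gt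
    rw [h1, h2, h4, Finset.sum_insert h3, hfT, brN, brN, brN, brN, brN, brN, foldN_succ_not_mem hr,
      foldN_succ_mem (Finset.mem_insert_self _ _), foldN_succ_mem (Finset.mem_insert_self _ _),
      foldN_succ_not_mem h3, hfT', hfU,
      foldN_congr_set (T := insert r T) (T' := T) (fun t ht => by simp [ht.ne]),
      foldN_congr_set (T := insert r (Finset.range r \ T)) (T' := Finset.range r \ T) (fun t ht => by simp [ht.ne]),
      map_smul, ← Finset.sum_sdiff hT, add_comm (∑ t ∈ Finset.range r \ T, e t), brStep_comp, smul_add, smul_smul,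
      ← sg_add, add_comm, add_comm (_ * _)]

lemma brN_eq_enum {δ : GSym G.dual →ₗ[k] GSym F.dual} {x : ℕ → F} {e : ℕ → ℤ} (hx : ∀ t, x t ∈ F.gr (e t))
    {r : ℕ} {T : Finset ℕ} (hT : T ⊆ Finset.range r) :
    brN h x e δ r T = brMul h δ T.card (fun s => x (enum T s)) := by
  rw [brMul_eq (e := fun s => e (enum T s)) (fun s => hx _), brN, brN, foldN_enum (extz (enum T)) (p := T.card)]
  · refine foldN_congr (fun t _ ht => ?_) (fun t _ ht => ?_)
    · rw [extz_of_lt _ ht, extz_of_lt _ ht]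
    · rw [extz_of_lt _ ht, extz_of_lt _ ht]
  · intro s t hst ht
    rw [extz_of_lt _ (hst.trans ht), extz_of_lt _ ht]
    exact (T.orderEmbOfFin rfl).strictMono (by simpa using hst)
  · intro t
    constructor
    · rintro ⟨h1, -⟩
      rw [← T.image_orderEmbOfFin_univ rfl] at h1
      obtain ⟨s, -, hs⟩ := Finset.mem_image.1 h1
      exact ⟨s, s.2, by rw [extz_coe]; exact hs⟩
    · rintro ⟨s, hs, rfl⟩
      rw [extz_of_lt _ hs]
      exact ⟨enum_mem _ _, Finset.mem_range.1 (hT (enum_mem _ _))⟩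

/-- Iterated brackets of a composite, as a sum over unshuffles. -/
lemma aug_brN_comp {δ : GSym G.dual →ₗ[k] GSym F.dual} {ε : GSym H.dual →ₗ[k] GSym G.dual} {x : ℕ → F} {e : ℕ → ℤ}
    (hx : ∀ t, x t ∈ F.gr (e t)) (r : ℕ) (P : GSym H.dual) :
    aug _ (brMul (h'.comp h) (δ ∘ₗ ε) r (fun t => x t) P) = sumSh r fun p a q b => sg k (invs e b a) •
      aug _ (brMul h δ p (fun s => x (a s)) (brMul h' ε q (fun s => h (x (b s))) P)) := by
  rw [brMul_eq_nat hx, brN_comp, LinearMap.sum_apply, map_sum, sumSh]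
  refine Finset.sum_congr rfl fun T hT => ?_
  have hT := Finset.mem_powerset.1 hT
  rw [LinearMap.smul_apply, map_smul, LinearMap.comp_apply, brN_eq_enum hx hT,
    brN_eq_enum (fun t => h.map_mem (hx t)) Finset.sdiff_subset]
  congr 2
  rw [invs, sum_enum (f := fun u => ∑ s, if enum T s < u then e u * e (enum T s) else 0)]
  refine Finset.sum_congr rfl fun u _ => ?_
  rw [sum_enum (f := fun t => if t < u then e u * e t else 0), Finset.mul_sum, Finset.sum_filter]

end Composite

/-- Iterated commutators append their new argument at the end, whereas composites of
multiderivations put X(…) in front. -/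
lemma snoc_eq_cons {M : GMod 𝒜} {Y : Type u} [AddCommGroup Y] [Module k Y] {n : ℕ} {X : (Fin (n + 1) → M) → Y}
    (hX : ∀ (e : Fin (n + 1) → ℤ) (m : Fin (n + 1) → M), (∀ t, m t ∈ M.gr (e t)) →
      ∀ π : Equiv.Perm (Fin (n + 1)), X (fun t => m (π t)) = koszul π e • X m)
    {e : Fin n → ℤ} {y : Fin n → M} (hy : ∀ t, y t ∈ M.gr (e t)) {c : ℤ} {z : M} (hz : z ∈ M.gr c) :
    X (Fin.snoc (α := fun _ => M) y z) = sg k (c * ∑ t, e t) • X (Fin.cons (α := fun _ => M) z y) := by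
  have h1 (t : Fin n) : finRotate (n + 1) t.castSucc = t.succ := by
    rw [finRotate_of_lt (by simp)]; rfl
  have h2 : (fun t => (Fin.cons (α := fun _ => M) z y : Fin (n + 1) → M) (finRotate (n + 1) t)) =
      Fin.snoc (α := fun _ => M) y z := by
    funext t
    refine Fin.lastCases ?_ (fun t => ?_) t
    · rw [finRotate_last, Fin.cons_zero, Fin.snoc_last]
    · rw [h1, Fin.cons_succ, Fin.snoc_castSucc]
  have h3 := hX (Fin.cons (α := fun _ => ℤ) c e) (Fin.cons (α := fun _ => M) z y) (fun t => by
    refine Fin.cases ?_ (fun t => ?_) t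
    · simpa using hz
    · simpa using hy t) (finRotate (n + 1))
  rw [h2, koszul_finRotate, negOnePow_smul (k := k)] at h3
  simpa using h3

namespace GDer

variable {F G H : GMod 𝒜} {h : GHom F G} {h' : GHom G H} (D : GDer h) (E : GDer h') (B : HBasis G) (C : HBasis H)

/-- Both sides are skew derivations into A for the same twists. On coefficients the last term
vanishes, and on generators the identity is the definition of the bracket. So an augmented bracket
is its anchor part plus contraction by the vector X(x). -/
lemma q_eq_ctr {p : ℕ} {e : Fin p → ℤ} {x : Fin p → F} (hx : ∀ t, x t ∈ F.gr (e t)) (R : GSym G.dual) :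
    D.q p x R = D.q p x (coeff _ (aug _ R)) - aug _ (ctr G (D.bra B p x) (tw _ 1 R)) := by
  have hb := D.bra_mem B hx
  have key : D.q p x = D.q p x ∘ₗ coeff _ ∘ₗ (aug _).toLinearMap -
      (aug _).toLinearMap ∘ₗ ctr G (D.bra B p x) ∘ₗ (tw _ 1).toLinearMap := by
    refine skewDer_ext (ρ₁ := (twA 𝒜 1).comp (aug _)) (ρ₂ := (twA 𝒜 (∑ t, e t)).comp (aug _))
      (fun P Q => D.q_mul hx P Q) (fun P Q => ?_) (fun a => ?_) (fun ω => ?_)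
    · simp only [LinearMap.sub_apply, LinearMap.comp_apply, AlgHom.toLinearMap_apply, map_mul, ctr_mul hb,
        map_add, aug_tw, AlgHom.comp_apply, twA_twA]
      rw [← GSym.coeff_mul, D.q_mul hx, aug_coeff, aug_coeff,
        twA_congr (m := 1 + ∑ t, e t + 1) (n := ∑ t, e t) (by push_cast; grind)]
      simp only [mul_sub, sub_mul]
      abel
    · simp
    · refine LinearMap.congr_fun (f := D.q p x ∘ₗ gen _) (g := (D.q p x ∘ₗ coeff _ ∘ₗ (aug _).toLinearMap -
        (aug _).toLinearMap ∘ₗ ctr G (D.bra B p x) ∘ₗ (tw _ 1).toLinearMap) ∘ₗ gen _) ?_ ω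
      refine GMod.lin_ext fun c ω hω => ?_
      simp [D.q_gen_eq B hx hω, tw_of_mem 1 (gen_mem_deg hω)]
  exact LinearMap.congr_fun key R

variable {p q : ℕ} {e : Fin p → ℤ} {x : Fin p → F} {e' : Fin q → ℤ} {y : Fin q → G}

/-- Apply `q_eq_ctr` to the inner bracket. Contracting it by X(x) is the next commutator, with X(x)
as additional argument, up to a correction in which P itself is contracted. That correction vanishes
for coefficients and is an anchor term for generators. -/
lemma q_brMul (hx : ∀ t, x t ∈ F.gr (e t)) (hy : ∀ t, y t ∈ G.gr (e' t)) {c : ℤ} {P : GSym H.dual}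
    (hP : P ∈ deg _ c) : D.q p x (brMul h' E.d q y P) =
    D.q p x (coeff _ (E.q q y P)) - sg k (c + 1 + ∑ t, e' t) •
      (sg k ((1 + ∑ t, e t) * ∑ t, e' t) • (E.q (q + 1) (Fin.cons (α := fun _ => G) (D.bra B p x) y) P +
        E.q q y (ctr H (h' (D.bra B p x)) P))) := by
  have hb := D.bra_mem B hx
  have h1 := E.q_snoc hy hb P
  rw [snoc_eq_cons (k := k) (X := fun z => E.q (q + 1) z) (fun e m hm π => E.q_symm hm π) hy hb, eq_sub_iff_add_eq,
    LinearMap.smul_apply, ← smul_add] at h1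
  rw [D.q_eq_ctr B hx, tw_of_mem 1 ((brMul_isBr E.isBr hy).mem_deg hP), map_smul, map_smul, h1, one_mul]
  rfl

lemma q_brMul_coeff (hx : ∀ t, x t ∈ F.gr (e t)) (hy : ∀ t, y t ∈ G.gr (e' t)) {c : ℤ} {a : A}
    (ha : a ∈ 𝒜 c) : D.q p x (brMul h' E.d q y (coeff _ a)) =
    sg k (c * (∑ t, e t + ∑ t, e' t) + (∑ t, e t) * ∑ t, e' t) • (sg k (∑ t, e t) • D.anchor p x (E.anchor q y a) +
      E.anchor (q + 1) (Fin.cons (α := fun _ => G) (D.bra B p x) y) a) := by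
  have hc : ∀ t, (Fin.cons (α := fun _ => G) (D.bra B p x) y : Fin (q + 1) → G) t ∈
      G.gr ((Fin.cons (α := fun _ => ℤ) (1 + ∑ t, e t) e' : Fin (q + 1) → ℤ) t) := fun t => by
    refine Fin.cases ?_ (fun t => ?_) t
    · simpa using D.bra_mem B hx
    · simpa using hy t
  rw [q_brMul D E B hx hy (coeff_mem_deg ha), ctr_coeff, map_zero, add_zero, E.q_coeff_eq hy ha, map_smul, map_smul,
    D.q_coeff_eq hx (E.anchor_mem hy ha), E.q_coeff_eq hc ha, Fin.sum_univ_succ]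
  simp only [Fin.cons_zero, Fin.cons_succ, smul_smul, ← sg_add, smul_add, sub_eq_add_neg, ← neg_smul]
  rw [← neg_one_mul, ← sg_one, ← sg_add]
  refine congrArg₂ _ (congrArg₂ _ (sg_congr (by push_cast; grind)) rfl)
    (congrArg₂ _ (sg_congr (by push_cast; grind)) rfl)

lemma q_brMul_gen (hx : ∀ t, x t ∈ F.gr (e t)) (hy : ∀ t, y t ∈ G.gr (e' t)) {c : ℤ} {ω : H.dual}
    (hω : ω ∈ H.dual.gr c) : D.q p x (brMul h' E.d q y (gen _ ω)) =
    D.q p x (coeff _ (E.q q y (gen _ ω))) + sg k (c + (∑ t, e t) * ∑ t, e' t) •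
      E.q q y (coeff _ (evalDual ω (h' (D.bra B p x)))) - sg k ((∑ t, e t) * ∑ t, e' t) •
        evalDual ω (E.bra C (q + 1) (Fin.cons (α := fun _ => G) (D.bra B p x) y)) := by
  have hc : ∀ t, (Fin.cons (α := fun _ => G) (D.bra B p x) y : Fin (q + 1) → G) t ∈
      G.gr ((Fin.cons (α := fun _ => ℤ) (1 + ∑ t, e t) e' : Fin (q + 1) → ℤ) t) := fun t => by
    refine Fin.cases ?_ (fun t => ?_) t
    · simpa using D.bra_mem B hx
    · simpa using hy t
  rw [q_brMul D E B hx hy (gen_mem_deg hω), ctr_gen, E.q_gen_eq C hc hω]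
  simp only [smul_smul, ← sg_add, smul_add, smul_neg]
  rw [sg_congr (m := c + 1 + ∑ t, e' t + (1 + ∑ t, e t) * ∑ t, e' t) (n := 1 + (c + (∑ t, e t) * ∑ t, e' t))
    (by push_cast; grind), sg_congr (m := c + 1 + ∑ t, e' t + ((1 + ∑ t, e t) * ∑ t, e' t + c))
    (n := 1 + (∑ t, e t) * ∑ t, e' t) (by push_cast; grind), sg_add (m := 1), sg_add (m := 1), sg_one]
  module

end GDer

end SHLR
end

/-! ### The composite of two multiderivations at finite level. -/

noncomputable section
namespace SHLR

variable {k A : Type u} [Field k] [Ring A] [Algebra k A] {𝒜 : ℤ → Submodule k A}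
  [GradedAlgebra 𝒜] [IsGradedComm 𝒜]

open GSym

namespace GDer

section

variable {F G H : GMod 𝒜} {h : GHom F G} {h' : GHom G H} (D : GDer h) (E : GDer h') (B : HBasis G) (C : HBasis H)

/-- The brackets of the composite of the dual multiderivations. -/
def compBra (x : ℕ → F) (e : ℕ → ℤ) (r : ℕ) : H := sumSh r fun p a q b => sg k (invs e a b) •
  E.bra C (q + 1) (Fin.cons (α := fun _ => G) (D.bra B p fun s => x (a s)) fun t => h (x (b t)))

/-- The anchors of the composite of the dual multiderivations. -/
def compAnc (x : ℕ → F) (e : ℕ → ℤ) (r : ℕ) : A →ₗ[k] A :=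
  (sumSh r fun p a q b => sg k (invs e a b) • E.anchor (q + 1)
    (Fin.cons (α := fun _ => G) (D.bra B p fun s => x (a s)) fun t => h (x (b t)))) +
  sumSh r fun p a q b => sg k (invs e a b) • sg k (∑ s, e (a s)) •
    (D.anchor p (fun s => x (a s)) ∘ₗ E.anchor q (fun t => h (x (b t))))

variable {x : ℕ → F} {e : ℕ → ℤ}

/-- Sum of `q_brMul_coeff` over all unshuffles; the two kinds of terms are exactly those in the
anchor of the composite. -/
lemma aug_comp_coeff (hx : ∀ t, x t ∈ F.gr (e t)) (r : ℕ) {c : ℤ} {a : A} (ha : a ∈ 𝒜 c) :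
    aug _ (brMul (h'.comp h) (D.d ∘ₗ E.d) r (fun t => x t) (coeff _ a)) =
      sg k (c * ∑ t ∈ Finset.range r, e t) • D.compAnc E B x e r a := by
  rw [aug_brN_comp hx, compAnc, sumSh, sumSh, sumSh, ← Finset.sum_add_distrib, LinearMap.sum_apply,
    Finset.smul_sum]
  refine Finset.sum_congr rfl fun T hT => ?_
  have hT := Finset.mem_powerset.1 hT
  have h1 : ∑ s, e (enum T s) + ∑ t, e (enum (Finset.range r \ T) t) = ∑ t ∈ Finset.range r, e t := by
    rw [sum_enum, sum_enum, add_comm, Finset.sum_sdiff hT]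
  have h2 := invs_add_invs e _ _ (enum_ne r T)
  refine (congrArg (_ • ·) (q_brMul_coeff D E B (fun s => hx (enum T s))
    (fun t => h.map_mem (hx (enum (Finset.range r \ T) t))) ha)).trans ?_
  rw [h1, ← h2, add_comm (sg k _ • _)]
  simp only [LinearMap.add_apply, LinearMap.smul_apply, LinearMap.comp_apply, smul_add, smul_smul, ← sg_add]
  refine congrArg₂ _ (congrArg₂ _ (sg_congr (by push_cast; grind)) rfl)
    (congrArg₂ _ (sg_congr (by push_cast; grind)) rfl)

/-- `D ∘ h'^*` and `h^* ∘ E` agree modulo weights `> m`. -/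
def Inter (m : ℕ) : Prop := Agree m (D.push h' (h' := h'.comp h) fun _ => rfl) (E.pull h (h' := h'.comp h) fun _ => rfl)

variable {D E}

lemma Inter.q_eq {m : ℕ} (H : Inter D E m) {l : ℕ} (hl : l ≤ m) {e : Fin l → ℤ} {x : Fin l → F}
    (hx : ∀ t, x t ∈ F.gr (e t)) (P) : D.q l x (GSym.map h'.dual P) = E.q l (fun t => h (x t)) P := by
  rw [← D.q_push h' (h' := h'.comp h) (fun _ => rfl) hx, ← E.q_pull h (h' := h'.comp h) (fun _ => rfl) hx]
  exact Agree.q_eq H hl hx P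

lemma Inter.push {H' : GMod 𝒜} {m : ℕ} (HI : Inter D E m) (v : GHom H H') {h'' : GHom G H'}
    (hv : ∀ x, v (h' x) = h'' x) : Inter D (E.push v hv) m := fun P => by
  have := HI (GSym.map v.dual P)
  change D.d (GSym.map h'.dual (GSym.map v.dual P)) - _ ∈ _ at this
  rw [map_dual_comp hv] at this
  exact this

/-- Besides the bracket term, each subset contributes one anchor term from the inner evaluation and
one from the correction in `q_brMul`. Intertwining, available for at most `m` arguments, rewrites
both through `E`; they are then `Ψ` at the two orderings of the blocks with opposite signs, and
cancel in the sum. -/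
lemma aug_comp_gen (hx : ∀ t, x t ∈ F.gr (e t)) {r m : ℕ} (hr : r ≤ m) (HI : Inter D E m) {c : ℤ} {ω : H.dual}
    (hω : ω ∈ H.dual.gr c) :
    aug _ (brMul (h'.comp h) (D.d ∘ₗ E.d) r (fun t => x t) (gen _ ω)) = -evalDual ω (D.compBra E B C x e r) := by
  let Ψ : ∀ p : ℕ, (Fin p → ℕ) → ∀ q : ℕ, (Fin q → ℕ) → A := fun p a q b => sg k (invs e b a) •
    E.q p (fun s => h (x (a s))) (coeff _ (E.q q (fun t => h (x (b t))) (gen _ ω)))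
  have key : aug _ (brMul (h'.comp h) (D.d ∘ₗ E.d) r (fun t => x t) (gen _ ω)) =
      sumSh r Ψ - sumSh r (fun p a q b => Ψ q b p a) - evalDual ω (D.compBra E B C x e r) := by
    rw [aug_brN_comp hx, compBra, sumSh, sumSh, sumSh, sumSh, evalDual_sum, ← Finset.sum_sub_distrib,
      ← Finset.sum_sub_distrib]
    refine Finset.sum_congr rfl fun T hT => ?_
    have hT := Finset.mem_powerset.1 hT
    have h2 := invs_add_invs e _ _ (enum_ne r T)
    have hxT : ∀ s, x (enum T s) ∈ F.gr (e (enum T s)) := fun s => hx _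
    have hxU : ∀ t, x (enum (Finset.range r \ T) t) ∈ F.gr (e (enum (Finset.range r \ T) t)) := fun t => hx _
    have hTc : T.card ≤ m := by
      have := Finset.card_le_card hT
      rw [Finset.card_range] at this
      omega
    have hUc : (Finset.range r \ T).card ≤ m := by
      have := Finset.card_le_card (Finset.sdiff_subset (s := Finset.range r) (t := T))
      rw [Finset.card_range] at this
      omega
    have h3 : evalDual ω (h' (D.bra B T.card fun s => x (enum T s))) =
        -(sg k c • E.q T.card (fun s => h (x (enum T s))) (gen _ ω)) := by
      rw [← HI.q_eq hTc hxT, map_gen, D.q_gen_eq B hxT (h'.dual.map_mem hω), smul_neg, sg_smul_smul, neg_neg]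
      exact (evalDual_dual h' _ _).symm
    refine (congrArg (_ • ·) (q_brMul_gen D E B C hxT (fun t => h.map_mem (hxU t)) hω)).trans ?_
    have h4 (b : A) := HI.q_eq hTc hxT (coeff _ b)
    simp only [map_coeff] at h4
    rw [h3, h4, ← h2]
    simp only [Ψ, map_neg, map_smul, smul_sub, smul_add, smul_neg, smul_smul, ← sg_add, evalDual_ksmul]
    rw [sg_congr (m := invs e (enum (Finset.range r \ T)) (enum T) + (c + (invs e (enum T) (enum (Finset.range r \ T)) +
      invs e (enum (Finset.range r \ T)) (enum T)) + c)) (n := invs e (enum T) (enum (Finset.range r \ T)))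
      (by push_cast; grind), sg_congr (m := invs e (enum (Finset.range r \ T)) (enum T) +
      (invs e (enum T) (enum (Finset.range r \ T)) + invs e (enum (Finset.range r \ T)) (enum T)))
      (n := invs e (enum T) (enum (Finset.range r \ T))) (by push_cast; grind)]
    abel
  rw [key, sumSh_swap r Ψ, sub_self, zero_sub]

lemma compBra_push {H' : GMod 𝒜} (v : GHom H H') {h'' : GHom G H'} (hv : ∀ x, v (h' x) = h'' x) (C' : HBasis H')
    (hx : ∀ t, x t ∈ F.gr (e t)) (r : ℕ) :
    D.compBra (E.push v hv) B C' x e r = v (D.compBra E B C x e r) := by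
  rw [compBra, compBra, sumSh, sumSh, map_sum]
  refine Finset.sum_congr rfl fun T hT => ?_
  rw [E.bra_push v hv C C' (e := Fin.cons (α := fun _ => ℤ) (1 + ∑ s, e (enum T s))
    fun t => e (enum (Finset.range r \ T) t)) (fun t => ?_)]
  · exact (v.lin.map_smul _ _).symm
  · refine Fin.cases ?_ (fun t => ?_) t
    · exact D.bra_mem B fun s => hx _
    · exact h.map_mem (hx _)

/-- The composite of intertwined derivations is a skew derivation, modulo weights `> m`. -/
lemma Inter.skew {m : ℕ} (HI : Inter D E m) : IsSkewDer
    ((TruncSym.proj F.dual m).comp (GSym.map (h'.comp h).dual))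
    ((TruncSym.proj F.dual m).comp (GSym.map (h'.comp h).dual))
    ((TruncSym.proj F.dual m).toLinearMap ∘ₗ D.d ∘ₗ E.d) := fun P Q => by
  have hc (P : GSym H.dual) : TruncSym.proj F.dual m (D.d (GSym.map h'.dual P)) =
      TruncSym.proj F.dual m (GSym.map h.dual (E.d P)) := TruncSym.proj_eq_iff.2 (HI P)
  -- Both derivations are odd. Once D ∘ h'^* is replaced by h^* ∘ E, this sign makes the two cross
  -- terms of the product rule opposite.
  have h1 : tw _ 1 (E.d P) = -E.d (tw _ 1 P) := by
    rw [E.isBr.tw_comm, sg_congr (n := 1) (by push_cast; grind), sg_one, neg_one_smul]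
  have h2 (P : GSym H.dual) : GSym.map h.dual (GSym.map h'.dual P) = GSym.map (h'.comp h).dual P :=
    map_dual_comp (fun _ => rfl) P
  simp only [LinearMap.comp_apply, AlgHom.toLinearMap_apply, AlgHom.comp_apply, E.isBr.mul, D.isBr.mul, map_add,
    map_mul, tw_zero, ← map_tw, hc, h1, h2, map_neg, tw_tw]
  rw [show tw H.dual (1 + 1) P = P by
    rw [tw_congr (m := 1 + 1) (n := 0) (by push_cast; grind), tw_zero]]
  noncomm_ring

end

end GDer

end SHLR
end

/-! ### Vanishing of composites in the colimit. -/

noncomputable section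
namespace SHLR

variable {k A : Type u} [Field k] [Ring A] [Algebra k A] {𝒜 : ℤ → Submodule k A}
  [GradedAlgebra 𝒜] [IsGradedComm 𝒜]

open GSym

/-! ### Composites of multiderivations and of derivations -/

section CompRep

variable {L M N : GMod 𝒜} {PL : Presentation L} {PM : Presentation M} {PN : Presentation N}
  {f : GHom L M} {g : GHom M N} {X : MultiDer f} {Y : MultiDer g}
  {α : PL.ι} {β : PM.ι} {γ : PN.ι} {h : GHom (PL.F α) (PM.F β)} {h' : GHom (PM.F β) (PN.F γ)}
  {D : GDer h} {E : GDer h'} {m : ℕ}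

lemma bra_cons_mem (B : HBasis (PM.F β)) {p q : ℕ} {e : Fin p → ℤ} {x : Fin p → PL.F α}
    (hx : ∀ t, x t ∈ (PL.F α).gr (e t)) {e' : Fin q → ℤ} {y : Fin q → PL.F α} (hy : ∀ t, y t ∈ (PL.F α).gr (e' t))
    (t : Fin (q + 1)) : (Fin.cons (α := fun _ => PM.F β) (D.bra B p x) (fun t => h (y t)) : Fin (q + 1) → PM.F β) t ∈
      (PM.F β).gr ((Fin.cons (α := fun _ => ℤ) (1 + ∑ t, e t) e' : Fin (q + 1) → ℤ) t) := by
  refine Fin.cases ?_ (fun t => ?_) t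
  · exact D.bra_mem B hx
  · exact h.map_mem (hy t)

lemma Rep.incl_cons (HD : Rep X m D) (B : HBasis (PM.F β)) {p q : ℕ} (hp : p + 1 ≤ m) {e : Fin (p + 1) → ℤ}
    {x : Fin (p + 1) → PL.F α} (hx : ∀ t, x t ∈ (PL.F α).gr (e t)) (y : Fin q → PL.F α) :
    (fun t => PM.incl β ((Fin.cons (α := fun _ => PM.F β) (D.bra B (p + 1) x) (fun t => h (y t)) :
      Fin (q + 1) → PM.F β) t)) =
      Fin.cons (α := fun _ => M) ((X p).X fun t => PL.incl α (x t)) (fun t => f (PL.incl α (y t))) := by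
  funext t
  refine Fin.cases ?_ (fun t => ?_) t
  · exact HD.bra p hp e x hx B
  · exact HD.incl_h (y t)

lemma GDer.bra_cons_zero (B : HBasis (PM.F β)) (C : HBasis (PN.F γ)) {q : ℕ} (x : Fin 0 → PL.F α) (y : Fin q → PM.F β) :
    E.bra C (q + 1) (Fin.cons (α := fun _ => PM.F β) (D.bra B 0 x) y) = 0 :=
  (E.bra C (q + 1)).map_coord_zero 0 (by rw [Fin.cons_zero, D.bra_zero])

lemma GDer.anchor_cons_zero (B : HBasis (PM.F β)) {q : ℕ} (x : Fin 0 → PL.F α) (y : Fin q → PM.F β) :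
    E.anchor (q + 1) (Fin.cons (α := fun _ => PM.F β) (D.bra B 0 x) y) = 0 :=
  (E.anchor (q + 1)).map_coord_zero 0 (by rw [Fin.cons_zero, D.bra_zero])

lemma GDer.compBra_zero (B : HBasis (PM.F β)) (C : HBasis (PN.F γ)) (x : ℕ → PL.F α) (e : ℕ → ℤ) :
    D.compBra E B C x e 0 = 0 := by
  rw [GDer.compBra, ← sum_antidiagonal_unshuffles, Finset.Nat.antidiagonal_zero, Finset.sum_singleton]
  exact Finset.sum_eq_zero fun π _ => by rw [GDer.bra_cons_zero, smul_zero]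

/-- A first block of length j + 1 feeds the component of weight j of 𝕏. The empty block contributes
nothing, the bracket without arguments being zero, so w + 1 letters correspond to total weight w. -/
lemma Rep.incl_compBra (HD : Rep X m D) (HE : Rep Y m E) (B : HBasis (PM.F β)) (C : HBasis (PN.F γ)) {w : ℕ}
    (hw : w + 1 ≤ m) {x : ℕ → PL.F α} {e : ℕ → ℤ} (hx : ∀ t, x t ∈ (PL.F α).gr (e t)) :
    PN.incl γ (D.compBra E B C x e (w + 1)) = ∑ ij ∈ Finset.HasAntidiagonal.antidiagonal w,
      compX (Y ij.1) (X ij.2) e (fun t => PL.incl α (x t)) := by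
  rw [GDer.compBra, ← sum_antidiagonal_unshuffles, Finset.Nat.sum_antidiagonal_succ,
    Finset.sum_eq_zero fun π _ => by rw [GDer.bra_cons_zero, smul_zero], zero_add, map_sum,
    ← Finset.Nat.sum_antidiagonal_swap (n := w)]
  refine Finset.sum_congr rfl fun ij hij => ?_
  have hij := Finset.HasAntidiagonal.mem_antidiagonal.1 hij
  rw [compX, map_sum]
  refine Finset.sum_congr rfl fun π hπ => ?_
  have h1 := koszul_unshuffle hπ e
  refine ((PN.incl γ).lin.map_smul _ _).trans ?_
  rw [h1, negOnePow_smul (k := k)]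
  refine congrArg (_ • ·) ?_
  refine (HE.bra _ (by simp; omega) _ _ (bra_cons_mem (D := D) B (fun s => hx _) (fun t => hx _)) C).trans ?_
  rw [HD.incl_cons B (by simp; omega) (fun s => hx _)]
  rfl

/-- At finite level the anchor of 𝕏 is applied last, in the composite of the statement that of 𝕐.
Intertwining identifies the two anchors on the relevant arguments, so both orders give the same sum.
-/
lemma Rep.compAnc_eq (HD : Rep X m D) (HE : Rep Y m E) (hYX : Intertwined Y X) (B : HBasis (PM.F β)) {w : ℕ}
    (hw : w ≤ m) {x : ℕ → PL.F α} {e : ℕ → ℤ} (hx : ∀ t, x t ∈ (PL.F α).gr (e t)) :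
    D.compAnc E B x e w = ∑ ij ∈ Finset.HasAntidiagonal.antidiagonal w,
      (compAnchorX (X ij.2) e (fun t => PL.incl α (x t)) (Y ij.1) +
        compAnchors (Y ij.1) (X ij.2) e (fun t => PL.incl α (x t))) := by
  rw [GDer.compAnc, Finset.sum_add_distrib]
  congr 1
  · rw [← sum_antidiagonal_unshuffles]
    cases w with
    | zero =>
      rw [Finset.Nat.antidiagonal_zero, Finset.sum_singleton, Finset.sum_singleton]
      exact Finset.sum_eq_zero fun π _ => by rw [GDer.anchor_cons_zero, smul_zero]
    | succ w =>
      rw [Finset.Nat.sum_antidiagonal_succ, Finset.Nat.sum_antidiagonal_succ,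
        Finset.sum_eq_zero fun π _ => by rw [GDer.anchor_cons_zero, smul_zero], zero_add,
        ← Finset.Nat.sum_antidiagonal_swap (n := w)]
      refine Eq.trans ?_ (zero_add _).symm
      refine Finset.sum_congr rfl fun ij hij => ?_
      have hij := Finset.HasAntidiagonal.mem_antidiagonal.1 hij
      rw [compAnchorX]
      refine Finset.sum_congr rfl fun π hπ => ?_
      have h1 := koszul_unshuffle hπ e
      rw [h1, negOnePow_smul (k := k)]
      refine congrArg (_ • ·) ?_
      refine (HE.anchor _ (by simp; omega) _ _ (bra_cons_mem (D := D) B (fun s => hx _) (fun t => hx _))).trans ?_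
      rw [HD.incl_cons B (by simp; omega) (fun s => hx _)]
      rfl
  · rw [← sum_antidiagonal_unshuffles]
    refine Finset.sum_congr rfl fun ij hij => ?_
    have hij := Finset.HasAntidiagonal.mem_antidiagonal.1 hij
    rw [compAnchors]
    refine Finset.sum_congr rfl fun π hπ => ?_
    have h1 := koszul_unshuffle hπ e
    rw [h1, negOnePow_smul (k := k), negOnePow_smul (k := k), HD.anchor _ (by omega) _ _ fun s => hx _,
      HE.anchor _ (by omega) _ _ fun t => h.map_mem (hx _), (hYX _).2, (hYX _).2]
    simp_rw [HD.incl_h]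

/-- Both composites, of D with h'^* and of h^* with E, represent the multiderivation g ∘ 𝕏 = 𝕐 ∘ f,
hence agree modulo weights > `m` after enlarging γ. -/
lemma Rep.exists_inter [CharZero k] (HD : Rep X m D) (HE : Rep Y m E) (hYX : Intertwined Y X) :
    ∃ (γ' : PN.ι) (h'' : GHom (PM.F β) (PN.F γ')) (E' : GDer h''), Rep Y m E' ∧
      E'.germ (PM := PM) (PN := PN) m = E.germ m ∧ GDer.Inter D E' m := by
  let X' : MultiDer (g.comp f) := fun l => (X l).conj (GHom.id _) g (fun _ => rfl)
  have H1 : Rep (PM := PL) (PN := PN) X' m (D.push h' (h' := h'.comp h) fun _ => rfl) :=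
    { incl_h := fun x => by
        change PN.incl γ (h' (h x)) = g (f (PL.incl α x))
        rw [HE.incl_h, HD.incl_h]
      anchor := fun l hl e x hx => by
        refine (D.anchor_push h' (h' := h'.comp h) (fun _ => rfl) hx).trans ?_
        rw [HD.anchor l hl e x hx]
        rfl
      bra := fun l hl e x hx C => by
        obtain ⟨B⟩ := exists_hbasis (PM.finite β)
        refine (congrArg _ (D.bra_push h' (h' := h'.comp h) (fun _ => rfl) B C hx)).trans ?_
        rw [HE.incl_h, HD.bra l hl e x hx]
        rfl }
  have H2 : Rep (PM := PL) (PN := PN) X' m (E.pull h (h' := h'.comp h) fun _ => rfl) :=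
    { incl_h := H1.incl_h
      anchor := fun l hl e x hx => by
        refine (E.anchor_pull h (h' := h'.comp h) (fun _ => rfl) hx).trans ?_
        rw [HE.anchor l hl e _ fun t => h.map_mem (hx t)]
        simp_rw [HD.incl_h]
        exact ((hYX l).2 _).symm
      bra := fun l hl e x hx C => by
        refine (congrArg _ (E.bra_pull h (h' := h'.comp h) (fun _ => rfl) C hx)).trans ?_
        rw [HE.bra l hl e _ fun t => h.map_mem (hx t)]
        simp_rw [HD.incl_h]
        exact ((hYX l).1 _).symm }
  obtain ⟨γ', hγ, hγ', h'', e, e', hag⟩ := H1.exists_agree H2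
  refine ⟨γ', (PN.t hγ).comp h', E.push (PN.t hγ) fun _ => rfl, HE.push hγ _, E.germ_push hγ _ m, fun P => ?_⟩
  have := hag P
  change D.d (GSym.map h'.dual (GSym.map (PN.t hγ).dual P)) - _ ∈ _ at this
  rw [map_dual_comp (h' := (PN.t hγ).comp h') fun _ => rfl] at this
  exact this

end CompRep

section Main

variable {L M N : GMod 𝒜} {PL : Presentation L} {PM : Presentation M} {PN : Presentation N}
  {f : GHom L M} {g : GHom M N} {X : MultiDer f} {Y : MultiDer g}
  {D : NonnegDer PL PM f} {E : NonnegDer PM PN g}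

lemma comp_germ {α : PL.ι} {β : PM.ι} {γ : PN.ι} {h : GHom (PL.F α) (PM.F β)} {h' : GHom (PM.F β) (PN.F γ)}
    {D₀ : GDer h} {E₀ : GDer h'} {m : ℕ} (hD : D₀.germ (PM := PL) (PN := PM) m = D.germ (PL.idx α m))
    (hE : E₀.germ (PM := PM) (PN := PN) m = E.germ (PM.idx β m)) :
    (D.toProHom.comp E.toProHom).germ (PL.idx α m) =
      Germ.of PN.symSys (Z := PL.symSys.obj (PL.idx α m)) (PN.idx γ m) (D₀.trunc m ∘ₗ E₀.trunc m) := by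
  change E.toProHom.bind _ (D.germ (PL.idx α m)) = _
  rw [← hD]
  refine (ProHom.bind_of E.toProHom (Z := PL.symSys.obj (PL.idx α m)) (PM.idx β m) (D₀.trunc m)).trans ?_
  refine (congrArg (Germ.post PN.symSys _) hE.symm).trans ?_
  exact Germ.post_of _ _ _

lemma Dual.exists_reps [CharZero k] (HX : Dual PL PM f X D) (HY : Dual PM PN g Y E) (hYX : Intertwined Y X)
    (α : PL.ι) (m : ℕ) : ∃ (β : PM.ι) (γ : PN.ι) (h : GHom (PL.F α) (PM.F β)) (h' : GHom (PM.F β) (PN.F γ))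
      (D₀ : GDer h) (E₀ : GDer h'), Rep X m D₀ ∧ Rep Y m E₀ ∧ GDer.Inter D₀ E₀ m ∧
        (D.toProHom.comp E.toProHom).germ (PL.idx α m) =
          Germ.of PN.symSys (Z := PL.symSys.obj (PL.idx α m)) (PN.idx γ m) (D₀.trunc m ∘ₗ E₀.trunc m) := by
  obtain ⟨β, h, D₀, hD, hgD⟩ := HX.exists_rep α m
  obtain ⟨γ, h', E₀, hE, hgE⟩ := HY.exists_rep β m
  obtain ⟨γ', h'', E', hE', hg, hI⟩ := hD.exists_inter hE hYX
  exact ⟨β, γ', h, h'', D₀, E', hD, hE', hI, comp_germ hgD (hg.trans hgE)⟩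

/-- Composites read finitely many letters, so a sequence may be replaced by one extended by zero. -/
lemma compX_congr {i j : ℕ} (Y : MultiDerW g i) (X : MultiDerW f j) (e : ℕ → ℤ) {m m' : ℕ → L}
    (h : ∀ t < j + 1 + i, m t = m' t) : compX Y X e m = compX Y X e m' := by
  refine Finset.sum_congr rfl fun π _ => ?_
  have h1 (t : Fin (j + 1 + i)) : m (π t) = m' (π t) := h _ (π t).2
  simp_rw [h1]

lemma compAnchorX_congr {i j : ℕ} (Y : MultiDerW g i) (X : MultiDerW f j) (e : ℕ → ℤ) {m m' : ℕ → L}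
    (h : ∀ t < j + i, m t = m' t) : compAnchorX X e m Y = compAnchorX X e m' Y := by
  cases i with
  | zero => rfl
  | succ i =>
    refine Finset.sum_congr rfl fun π _ => ?_
    have h1 (t : Fin (j + 1 + i)) : m (π t) = m' (π t) := h _ (by have := (π t).2; omega)
    simp_rw [h1]

lemma compAnchors_congr {i j : ℕ} (Y : MultiDerW g i) (X : MultiDerW f j) (e : ℕ → ℤ) {m m' : ℕ → L}
    (h : ∀ t < i + j, m t = m' t) : compAnchors Y X e m = compAnchors Y X e m' := by
  refine Finset.sum_congr rfl fun π _ => ?_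
  have h1 (t : Fin (i + j)) : m (π t) = m' (π t) := h _ (π t).2
  simp_rw [h1]

lemma Rep.incl_compBra_eq_zero {α : PL.ι} {β : PM.ι} {γ : PN.ι} {h : GHom (PL.F α) (PM.F β)}
    {h' : GHom (PM.F β) (PN.F γ)} {D : GDer h} {E : GDer h'} {m : ℕ} (HD : Rep X m D) (HE : Rep Y m E)
    (H : CompEqZero Y X) (B : HBasis (PM.F β)) (C : HBasis (PN.F γ)) {l : ℕ} (hl : l ≤ m) {x : ℕ → PL.F α}
    {e : ℕ → ℤ} (hx : ∀ t, x t ∈ (PL.F α).gr (e t)) : PN.incl γ (D.compBra E B C x e l) = 0 := by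
  cases l with
  | zero => rw [GDer.compBra_zero, map_zero]
  | succ w =>
    rw [HD.incl_compBra HE B C hl hx]
    exact (H w e _ fun t => (PL.incl α).map_mem (hx t)).1

lemma word_eq_extz {F : GMod 𝒜} (B : HBasis F) (w : List (Fin B.n)) :
    B.word w = fun t : Fin w.length => extz (B.word w) t := funext fun t => (extz_coe _ t).symm

lemma Germ.of_trunc_comp_eq_zero {α : PL.ι} {β : PM.ι} {γ : PN.ι} {h : GHom (PL.F α) (PM.F β)}
    {h' : GHom (PM.F β) (PN.F γ)} {D : GDer h} {E : GDer h'} {m : ℕ} :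
    Germ.of PN.symSys (Z := PL.symSys.obj (PL.idx α m)) (PN.idx γ m) (D.trunc m ∘ₗ E.trunc m) = 0 ↔
      ∃ (γ' : PN.ι) (hγ : γ ≤ γ'), ∀ P, D.d (E.d (GSym.map (PN.t hγ).dual P)) ∈ fil (PL.F α).dual (m + 1) := by
  constructor
  · intro H
    obtain ⟨c, ha, hb, hab⟩ := (Germ.of_eq_iff (X := PN.symSys) (Z := PL.symSys.obj (PL.idx α m))
      (b := PN.idx γ m) (ψ := 0)).1 (H.trans (map_zero _).symm)
    let γ' : PN.ι := Prod.fst (β := ℕ) c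
    let n : ℕ := Prod.snd (α := PN.ι) c
    have ha1 : γ ≤ γ' := And.left ha
    refine ⟨γ', ha1, fun P => ?_⟩
    have h4 := LinearMap.congr_fun hab (TruncSym.proj _ n P)
    have h5 : D.trunc m (E.trunc m (TruncSym.proj _ m (GSym.map (PN.t ha1).dual P))) = 0 := by
      refine (congrArg (fun s => D.trunc m (E.trunc m s)) (TruncSym.map_proj (PN.t ha1).dual (And.right ha) P).symm).trans ?_
      exact h4
    rw [E.trunc_proj, D.trunc_proj] at h5
    exact TruncSym.proj_eq_zero_iff.1 h5
  · rintro ⟨γ', hγ, H⟩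
    have hle : PN.idx γ m ≤ PN.idx γ' m := ⟨hγ, le_rfl⟩
    refine (Germ.of_p (X := PN.symSys) (Z := PL.symSys.obj (PL.idx α m)) hle _).symm.trans ?_
    refine (congrArg _ ?_).trans (map_zero _)
    refine LinearMap.ext fun s => ?_
    obtain ⟨P, rfl⟩ := TruncSym.proj_surjective _ _ s
    refine (congrArg (fun s => D.trunc m (E.trunc m s)) (TruncSym.map_proj (PN.t hγ).dual le_rfl P)).trans ?_
    change D.trunc m (E.trunc m (TruncSym.proj _ m _)) = 0
    rw [E.trunc_proj, D.trunc_proj]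
    exact TruncSym.proj_eq_zero_iff.2 (H P)

/-- The composite brackets vanish in the colimit module; on the finitely many words of length ≤ m
they therefore vanish at a later index. There the composite kills coefficients and generators modulo
weights > m and, being skew by intertwining, it kills everything. -/
lemma comp_eq_zero_of_compEqZero [CharZero k] (HX : Dual PL PM f X D) (HY : Dual PM PN g Y E)
    (hYX : Intertwined Y X) (H : CompEqZero Y X) : D.toProHom.comp E.toProHom = 0 := by
  have key : ∀ (α : PL.ι) (m : ℕ), (D.toProHom.comp E.toProHom).germ (PL.idx α m) = 0 := by
    intro α m
    obtain ⟨β, γ, h, h', D₀, E₀, hD, hE, hI, hg⟩ := HX.exists_reps HY hYX α m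
    obtain ⟨BF⟩ := exists_hbasis (PL.finite α)
    obtain ⟨B⟩ := exists_hbasis (PM.finite β)
    obtain ⟨C⟩ := exists_hbasis (PN.finite γ)
    have hword (w : List (Fin BF.n)) := extz_mem (BF.word_mem w)
    -- Only the brackets need this enlargement; anchors take values in A and vanish already.
    obtain ⟨γ₂, hγ, hkill⟩ := PN.exists_kill (J := {w : List (Fin BF.n) // w.length ≤ m}) γ
      (fun w => D₀.compBra E₀ B C (extz (BF.word w.1)) (extz (BF.wordDeg w.1)) w.1.length)
      (fun w => hD.incl_compBra_eq_zero hE H B C w.2 (hword w.1))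
    obtain ⟨C₂⟩ := exists_hbasis (PN.finite γ₂)
    obtain ⟨E₂, hE₂⟩ : ∃ E₂ : GDer ((PN.t hγ).comp h'), E₂ = E₀.push (PN.t hγ) fun _ => rfl := ⟨_, rfl⟩
    have hI₂ : GDer.Inter D₀ E₂ m := hE₂ ▸ hI.push (PN.t hγ) _
    have hR₂ : Rep Y m E₂ := hE₂ ▸ hE.push hγ _
    rw [hg, Germ.of_trunc_comp_eq_zero]
    refine ⟨γ₂, hγ, fun P => ?_⟩
    have hcoeff (w : List (Fin BF.n)) (hw : w.length ≤ m) (a : A) :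
        aug _ (brMul (((PN.t hγ).comp h').comp h) (D₀.d ∘ₗ E₂.d) _ (BF.word w) (coeff _ a)) = 0 := by
      rw [word_eq_extz]
      refine LinearMap.congr_fun (f := (aug _).toLinearMap ∘ₗ brMul (((PN.t hγ).comp h').comp h) (D₀.d ∘ₗ E₂.d) _
        (fun t : Fin w.length => extz (BF.word w) t) ∘ₗ coeff _) (g := 0) (lin_ext_alg 𝒜 fun c a ha => ?_) a
      refine (D₀.aug_comp_coeff E₂ B (hword w) w.length ha).trans ?_
      rw [hD.compAnc_eq hR₂ hYX B hw (hword w),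
        (H w.length _ _ fun t => (PL.incl α).map_mem (hword w t)).2, LinearMap.zero_apply, smul_zero]
    have hgen (w : List (Fin BF.n)) (hw : w.length ≤ m) (ω : (PN.F γ₂).dual) :
        aug _ (brMul (((PN.t hγ).comp h').comp h) (D₀.d ∘ₗ E₂.d) _ (BF.word w) (gen _ ω)) = 0 := by
      rw [word_eq_extz]
      refine LinearMap.congr_fun (f := (aug _).toLinearMap ∘ₗ brMul (((PN.t hγ).comp h').comp h) (D₀.d ∘ₗ E₂.d) _
        (fun t : Fin w.length => extz (BF.word w) t) ∘ₗ gen _) (g := 0) (GMod.lin_ext fun c ω hω => ?_) ω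
      refine (GDer.aug_comp_gen B C₂ (hword w) hw hI₂ hω).trans ?_
      have := hkill ⟨w, hw⟩
      rw [← GDer.compBra_push B C (PN.t hγ) (h'' := (PN.t hγ).comp h') (fun _ => rfl) C₂ (hword w), ← hE₂] at this
      rw [this, evalDual_zero, neg_zero]
      rfl
    have hc := fun a => fil_coeff_of_brMul (h := ((PN.t hγ).comp h').comp h) (δ := D₀.d ∘ₗ E₂.d) (m := m) BF
      (a := a) fun w hw => hcoeff w hw a
    have := fil_of_skew (δ := D₀.d ∘ₗ E₂.d) hI₂.skew hc (fun ω => fil_gen_of_brMul (h := ((PN.t hγ).comp h').comp h) BF hc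
      fun w hw => hgen w hw ω) P
    rw [hE₂] at this
    exact this
  have : (D.toProHom.comp E.toProHom).germ = (0 : ProHom PN.symSys PL.symSys).germ := funext fun c => key _ _
  generalize D.toProHom.comp E.toProHom = Z at this
  cases Z
  change _ = ProHom.mk _ _
  congr

/-- Lift the arguments to a finite index and read the composite bracket and anchor off the brackets
of a composite derivation that is zero modulo high weights. -/
lemma compEqZero_of_comp_eq_zero [CharZero k] (HX : Dual PL PM f X D) (HY : Dual PM PN g Y E)
    (hYX : Intertwined Y X) (H : D.toProHom.comp E.toProHom = 0) : CompEqZero Y X := by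
  intro w e z hz
  obtain ⟨α, -, y, hy, hy'⟩ := PL.exists_lift (J := Fin (w + 1)) (Classical.arbitrary _) (fun t => e t)
    (fun t => z t) (fun t => hz t)
  have hx : ∀ t, extz y t ∈ (PL.F α).gr (e t) := fun t => by
    by_cases ht : t < w + 1
    · rw [extz_of_lt _ ht]; exact hy ⟨t, ht⟩
    · simp [extz, ht]
  have hxz : ∀ t < w + 1, z t = PL.incl α (extz y t) := fun t ht => by
    rw [extz_of_lt _ ht]; exact (hy' ⟨t, ht⟩).symm
  -- Total weight w has brackets in w + 1 arguments, so the representatives must be exact up to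
  -- weight w + 1.
  obtain ⟨β, γ, h, h', D₀, E₀, hD, hE, hI, hg⟩ := HX.exists_reps HY hYX α (w + 1)
  rw [H] at hg
  obtain ⟨γ₂, hγ, hfil⟩ := Germ.of_trunc_comp_eq_zero.1 hg.symm
  obtain ⟨E₂, hE₂⟩ : ∃ E₂ : GDer ((PN.t hγ).comp h'), E₂ = E₀.push (PN.t hγ) fun _ => rfl := ⟨_, rfl⟩
  have hI₂ : GDer.Inter D₀ E₂ (w + 1) := hE₂ ▸ hI.push (PN.t hγ) _
  have hR₂ : Rep Y (w + 1) E₂ := hE₂ ▸ hE.push hγ _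
  have hfil₂ : ∀ P, (D₀.d ∘ₗ E₂.d) P ∈ fil (PL.F α).dual (w + 1 + 1) := by rw [hE₂]; exact hfil
  obtain ⟨B⟩ := exists_hbasis (PM.finite β)
  obtain ⟨C⟩ := exists_hbasis (PN.finite γ₂)
  have hij {ij : ℕ × ℕ} (h : ij ∈ Finset.HasAntidiagonal.antidiagonal w) : ij.1 + ij.2 = w :=
    Finset.HasAntidiagonal.mem_antidiagonal.1 h
  constructor
  · rw [Finset.sum_congr rfl fun ij h => compX_congr (Y ij.1) (X ij.2) e (fun t ht => hxz t (by have := hij h; omega)),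
      ← hD.incl_compBra hR₂ B C le_rfl hx]
    have : D₀.compBra E₂ B C (extz y) e (w + 1) = 0 := C.ext_eval fun c ω hω => by
      have h1 := GDer.aug_comp_gen B C hx le_rfl hI₂ hω
      rw [aug_brMul_of_fil hfil₂ le_rfl (e := fun t => e t) (fun t => hx t), zero_eq_neg] at h1
      rw [h1, evalDual_zero]
    rw [this, map_zero]
  · rw [Finset.sum_congr rfl fun ij h => congrArg₂ (· + ·)
      (compAnchorX_congr (Y ij.1) (X ij.2) e (fun t ht => hxz t (by have := hij h; omega)))
      (compAnchors_congr (Y ij.1) (X ij.2) e (fun t ht => hxz t (by have := hij h; omega))),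
      ← hD.compAnc_eq hR₂ hYX B (Nat.le_succ w) hx]
    refine lin_ext_alg 𝒜 fun c a ha => ?_
    have h1 := D₀.aug_comp_coeff E₂ B hx w ha
    rw [aug_brMul_of_fil hfil₂ (Nat.le_succ w) (e := fun t => e t) (fun t => hx t)] at h1
    exact (smul_right_injective A (sg_ne_zero (k := k) _)) (h1.symm.trans (smul_zero _).symm)

end Main

end SHLR
end

/-! ### Lazard's theorem for graded modules. -/

noncomputable section
namespace SHLR

variable {k A : Type u} [Field k] [Ring A] [Algebra k A] {𝒜 : ℤ → Submodule k A}
  [GradedAlgebra 𝒜] [IsGradedComm 𝒜]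

/-! ### Kernels and free modules -/

/-- The base algebra as a graded module over itself. -/
def GMod.self (𝒜 : ℤ → Submodule k A) [GradedAlgebra 𝒜] : GMod 𝒜 where
  carrier := A
  gr := 𝒜
  isInternal := isInternal_alg 𝒜
  smul_mem := fun ha hx => SetLike.mul_mem_graded ha hx

lemma iSupIndep_of_injective_maps {I X : Type*} [AddCommGroup X] [Module k X]
    (gr : ℤ → Submodule k X) {Y : I → Type*} [∀ i, AddCommGroup (Y i)] [∀ i, Module k (Y i)]
    (φ : ∀ i, X →ₗ[k] Y i) (hφ : ∀ x, (∀ i, φ i x = 0) → x = 0)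
    (gr' : ∀ i, ℤ → Submodule k (Y i)) (h : ∀ i, iSupIndep (gr' i))
    (hm : ∀ i p x, x ∈ gr p → φ i x ∈ gr' i p) : iSupIndep gr := by
  rw [iSupIndep_iff_finsetSum_eq_zero_imp_eq_zero]
  intro s v h1 h2 p hp
  refine hφ _ fun i => ?_
  refine ((iSupIndep_iff_finsetSum_eq_zero_imp_eq_zero _).1 (h i)) s (fun p => φ i (v p))
    (fun p hp => hm i p _ (h1 p hp)) ?_ p hp
  rw [← map_sum, h2, map_zero]

/-- The kernel of a morphism. -/
def GHom.ker {M N : GMod 𝒜} (f : GHom M N) : GMod 𝒜 where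
  carrier := LinearMap.ker f.toLin
  gr := fun p => (M.gr p).comap ((LinearMap.ker f.toLin).subtype.restrictScalars k)
  isInternal := by
    refine DirectSum.isInternal_submodule_of_iSupIndep_of_iSup_eq_top ?_ ?_
    · exact iSupIndep_of_injective_maps (I := Unit) _
        (fun _ => (LinearMap.ker f.toLin).subtype.restrictScalars k)
        (fun x hx => Subtype.ext (hx ())) (fun _ => M.gr)
        (fun _ => M.isInternal.submodule_iSupIndep) (fun _ _ _ hx => hx)
    · rw [eq_top_iff]
      rintro ⟨x, hx⟩ -
      obtain ⟨s, hs⟩ := exists_sum_component M.isInternal x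
      have hc : ∀ p, SHLR.component M.isInternal p x ∈ LinearMap.ker f.toLin := fun p => by
        rw [LinearMap.mem_ker]
        exact (f.component p x).trans (by rw [show f x = 0 from hx, map_zero])
      have : (⟨x, hx⟩ : LinearMap.ker f.toLin) = ∑ p ∈ s, ⟨_, hc p⟩ := by
        refine Subtype.ext ?_
        rw [AddSubmonoidClass.coe_finsetSum, hs s subset_rfl]
      rw [this]
      exact Submodule.sum_mem _ fun p _ => Submodule.mem_iSup_of_mem p (component_mem M.isInternal p x)
  smul_mem := fun ha hx => M.smul_mem ha hx

/-- The inclusion of the kernel. -/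
def GHom.kerIncl {M N : GMod 𝒜} (f : GHom M N) : GHom f.ker M where
  toLin := (LinearMap.ker f.toLin).subtype
  map_mem := fun hx => hx

lemma GHom.exact_kerIncl {M N : GMod 𝒜} (f : GHom M N) : Function.Exact f.kerIncl f :=
  fun y => ⟨fun h => ⟨⟨y, h⟩, rfl⟩, by rintro ⟨x, rfl⟩; exact x.2⟩

variable {n : ℕ}

/-- The free graded module on homogeneous generators of degrees `e i`. -/
def freeMod (𝒜 : ℤ → Submodule k A) [GradedAlgebra 𝒜] (e : Fin n → ℤ) : GMod 𝒜 where
  carrier := Fin n → A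
  gr := fun p => Submodule.pi Set.univ fun i => 𝒜 (p - e i)
  isInternal := by
    refine DirectSum.isInternal_submodule_of_iSupIndep_of_iSup_eq_top ?_ ?_
    · refine iSupIndep_of_injective_maps _ (fun i => LinearMap.proj i) (fun x hx => funext hx)
        (fun i p => 𝒜 (p - e i)) (fun i => ?_) (fun i p x hx => hx i trivial)
      exact (isInternal_alg 𝒜).submodule_iSupIndep.comp (sub_left_injective)
    · rw [eq_top_iff]
      rintro x -
      rw [← Finset.univ_sum_single x]
      refine Submodule.sum_mem _ fun i _ => ?_
      generalize x i = a
      induction a using DirectSum.Decomposition.inductionOn 𝒜 with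
      | zero => simp
      | @homogeneous p a =>
        refine Submodule.mem_iSup_of_mem (p + e i) fun j _ => ?_
        by_cases h : j = i
        · subst h; simp
        · simp [h]
      | add a b h1 h2 => rw [Pi.single_add]; exact add_mem h1 h2
  smul_mem := fun {p q a x} ha hx i hi => by
    change a * x i ∈ 𝒜 (p + q - e i)
    rw [add_sub_assoc]
    exact SetLike.mul_mem_graded ha (hx i hi)

section FreeMod

variable {e : Fin n → ℤ}

/-- The generators of a free module. -/
def freeMod.basis (i : Fin n) : freeMod 𝒜 e := Pi.single (M := fun _ => A) i 1

lemma freeMod.basis_mem (i : Fin n) : (freeMod.basis i : freeMod 𝒜 e) ∈ (freeMod 𝒜 e).gr (e i) := by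
  intro j _
  by_cases h : j = i
  · subst h; simpa [freeMod.basis] using SetLike.one_mem_graded 𝒜
  · simp [freeMod.basis, h]

lemma freeMod_isFinite : (freeMod 𝒜 e).IsFinite := by
  refine ⟨n, Pi.basisFun A (Fin n), e, fun i j _ => ?_⟩
  refine (congrArg (fun v : Fin n → A => v j ∈ 𝒜 (e i - e j)) (Pi.basisFun_apply A (Fin n) i)).mpr ?_
  exact freeMod.basis_mem i j trivial

lemma freeMod.expand (x : freeMod 𝒜 e) : x = ∑ i, (show Fin n → A from x) i • freeMod.basis (𝒜 := 𝒜) i := by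
  refine (pi_eq_sum_univ' (show Fin n → A from x)).trans ?_
  refine Finset.sum_congr rfl fun i _ => ?_
  refine congrArg _ (funext fun j => ?_)
  simp [freeMod.basis, Pi.single_apply, eq_comm]

/-- The morphism with prescribed values on the generators. -/
def freeMod.desc {G : GMod 𝒜} (z : Fin n → G) (hz : ∀ i, z i ∈ G.gr (e i)) :
    GHom (freeMod 𝒜 e) G where
  toLin := Fintype.linearCombination A z
  map_mem := fun {p x} hx => by
    refine (congrArg (· ∈ G.gr p) (Fintype.linearCombination_apply A z x)).mpr ?_
    refine Submodule.sum_mem _ fun i _ => ?_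
    have := G.smul_mem (hx i trivial) (hz i)
    rwa [sub_add_cancel] at this

lemma freeMod.desc_apply {G : GMod 𝒜} (z : Fin n → G) (hz : ∀ i, z i ∈ G.gr (e i))
    (x : freeMod 𝒜 e) : freeMod.desc z hz x = ∑ i, (show Fin n → A from x) i • z i := rfl

@[simp] lemma freeMod.desc_basis {G : GMod 𝒜} (z : Fin n → G) (hz : ∀ i, z i ∈ G.gr (e i))
    (i : Fin n) : freeMod.desc z hz (freeMod.basis i) = z i := by
  rw [freeMod.desc_apply, Finset.sum_eq_single i]
  · simp [freeMod.basis]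
  · intro j _ hj; simp [freeMod.basis, hj]
  · simp

lemma freeMod.ext_apply {G : GMod 𝒜} {f g : GHom (freeMod 𝒜 e) G}
    (h : ∀ i, f (freeMod.basis i) = g (freeMod.basis i)) (x : freeMod 𝒜 e) : f x = g x := by
  rw [freeMod.expand x, map_sum, map_sum]
  exact Finset.sum_congr rfl fun r _ => by rw [map_smul, map_smul, h]

end FreeMod

end SHLR
end

noncomputable section
namespace SHLR

variable {k A : Type u} [Field k] [Ring A] [Algebra k A] {𝒜 : ℤ → Submodule k A}
  [GradedAlgebra 𝒜] [IsGradedComm 𝒜]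

/-! ### The equational criterion for flatness -/

lemma exists_sum_homogeneous_tmul {L M : GMod 𝒜} (s : L ⊗[k] M) :
    ∃ (m : ℕ) (g f : Fin m → ℤ) (κ : Fin m → L) (y : Fin m → M), (∀ j, κ j ∈ L.gr (g j)) ∧
      (∀ j, y j ∈ M.gr (f j)) ∧ s = ∑ j, κ j ⊗ₜ[k] y j := by
  have hs : s ∈ Submodule.span k
      {t : L ⊗[k] M | ∃ (p q : ℤ) (x : L) (y : M), x ∈ L.gr p ∧ y ∈ M.gr q ∧ x ⊗ₜ[k] y = t} := by
    induction s with
    | zero => exact zero_mem _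
    | add x y hx hy => exact add_mem hx hy
    | tmul x y =>
      have hx : x ∈ (⨆ i, L.gr i) := by rw [L.isInternal.submodule_iSup_eq_top]; trivial
      have hy : y ∈ (⨆ i, M.gr i) := by rw [M.isInternal.submodule_iSup_eq_top]; trivial
      induction hx using Submodule.iSup_induction' with
      | zero => rw [TensorProduct.zero_tmul]; exact zero_mem _
      | add x x' _ _ h1 h2 => rw [TensorProduct.add_tmul]; exact add_mem h1 h2
      | mem p x hx =>
        induction hy using Submodule.iSup_induction' with
        | zero => rw [TensorProduct.tmul_zero]; exact zero_mem _
        | add y y' _ _ h1 h2 => rw [TensorProduct.tmul_add]; exact add_mem h1 h2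
        | mem q y hy => exact Submodule.subset_span ⟨p, q, x, y, hx, hy, rfl⟩
  obtain ⟨m, c, t, rfl⟩ := Submodule.mem_span_set'.1 hs
  choose g f κ y hκ hy h using fun j => (t j).2
  exact ⟨m, g, f, fun j => c j • κ j, y, fun j => Submodule.smul_mem _ _ (hκ j), hy,
    Finset.sum_congr rfl fun j _ => by
      dsimp only
      rw [← TensorProduct.smul_tmul', h]⟩

variable {n : ℕ} {e : Fin n → ℤ}

/-- The `i`-th coordinate `F ⊗_A M → M` of the tensor product with a free module. -/
def freeMod.tensorCoord (𝒜 : ℤ → Submodule k A) [GradedAlgebra 𝒜] [IsGradedComm 𝒜]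
    (e : Fin n → ℤ) (M : GMod 𝒜) (i : Fin n) : GTensor (freeMod 𝒜 e) M →ₗ[k] M :=
  (tensorRel (freeMod 𝒜 e) M).liftQ
    (TensorProduct.lift ((Algebra.lsmul k k M).toLinearMap ∘ₗ (twA 𝒜 (e i)).toLinearMap ∘ₗ
      (LinearMap.proj i : (Fin n → A) →ₗ[k] A)))
    (by
      refine Submodule.span_le.2 ?_
      rintro _ ⟨p, q, a, l, m, ha, hl, rfl⟩
      rw [SetLike.mem_coe, LinearMap.mem_ker, map_sub, sub_eq_zero, negOnePow_smul (k := k), map_smul,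
        TensorProduct.lift.tmul, TensorProduct.lift.tmul]
      change sg k (p * q) • (twA 𝒜 (e i) (a * l i) • m) = twA 𝒜 (e i) (l i) • a • m
      have hli : l i ∈ 𝒜 (q - e i) := hl i trivial
      rw [map_mul, smul_smul, twA_of_mem _ ha, twA_of_mem _ hli,
        ← smul_assoc, smul_mul_assoc, mul_smul_comm, smul_mul_assoc, IsGradedComm.comm hli ha,
        negOnePow_smul (k := k)]
      simp only [smul_smul, ← sg_add]
      rw [sg_congr]
      push_cast
      grind)

lemma freeMod.tensorCoord_mk (M : GMod 𝒜) (i : Fin n) (x : freeMod 𝒜 e) (m : M) :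
    freeMod.tensorCoord 𝒜 e M i (Submodule.Quotient.mk (x ⊗ₜ[k] m)) =
      twA 𝒜 (e i) ((show Fin n → A from x) i) • m := rfl

lemma tensor_smul_one {M : GMod 𝒜} {p : ℤ} {a : A} (ha : a ∈ 𝒜 p) (x : M) :
    (Submodule.Quotient.mk ((show GMod.self 𝒜 from a) ⊗ₜ[k] x) : GTensor (GMod.self 𝒜) M) =
      Submodule.Quotient.mk ((show GMod.self 𝒜 from (1 : A)) ⊗ₜ[k] (a • x)) := by
  rw [Submodule.Quotient.eq]
  refine Submodule.subset_span ⟨p, 0, a, (1 : A), x, ha, SetLike.one_mem_graded 𝒜, ?_⟩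
  rw [mul_zero, Int.negOnePow_zero, one_smul]
  congr 2
  exact (mul_one a).symm

/-- Relations in a flat module come from relations in the base algebra. -/
lemma GMod.Flat.exists_eq_sum {M : GMod 𝒜} (hM : M.Flat) (e : Fin n → ℤ) (d : ℤ) (x : Fin n → M)
    (hx : ∀ i, x i ∈ M.gr (e i)) (a : Fin n → A) (ha : ∀ i, a i ∈ 𝒜 (d - e i))
    (h : ∑ i, a i • x i = 0) :
    ∃ (m : ℕ) (f : Fin m → ℤ) (y : Fin m → M) (b : Fin n → Fin m → A),
      (∀ j, y j ∈ M.gr (f j)) ∧ (∀ i j, b i j ∈ 𝒜 (e i - f j)) ∧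
      (∀ i, x i = ∑ j, b i j • y j) ∧ ∀ j, ∑ i, a i * b i j = 0 := by
  -- ψ sends generators of degrees d - e_i to a_i. The relation says that Σ (generator i) ⊗ x_i dies
  -- under ψ ⊗ M, so by flatness it comes from (ker ψ) ⊗ M.
  let ψ : GHom (freeMod 𝒜 fun i => d - e i) (GMod.self 𝒜) := freeMod.desc (fun i => (a i : A)) ha
  have hex := hM _ _ _ ψ.kerIncl ψ ψ.exact_kerIncl
  let t : GTensor (freeMod 𝒜 fun i => d - e i) M :=
    ∑ i, Submodule.Quotient.mk (freeMod.basis i ⊗ₜ[k] x i)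
  have ht : tensorMap ψ M t = 0 := by
    rw [map_sum]
    have : ∀ i, tensorMap ψ M (Submodule.Quotient.mk (freeMod.basis i ⊗ₜ[k] x i)) =
        Submodule.Quotient.mk ((show GMod.self 𝒜 from (1 : A)) ⊗ₜ[k] (a i • x i)) := fun i => by
      rw [← tensor_smul_one (ha i)]
      refine congrArg (fun z : GMod.self 𝒜 => (Submodule.Quotient.mk (z ⊗ₜ[k] x i) :
        GTensor (GMod.self 𝒜) M)) ?_
      exact freeMod.desc_basis _ ha i
    rw [Finset.sum_congr rfl fun i _ => this i]
    refine (map_sum ((Submodule.mkQ (tensorRel (GMod.self 𝒜) M)) ∘ₗ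
      (TensorProduct.mk k (GMod.self 𝒜) M (1 : A))) (fun i => a i • x i) Finset.univ).symm.trans ?_
    rw [h, map_zero]
  obtain ⟨s, hs⟩ := (hex t).1 ht
  obtain ⟨s, rfl⟩ := Submodule.Quotient.mk_surjective _ s
  obtain ⟨m, g, f, κ, y, hκ, hy, rfl⟩ := exists_sum_homogeneous_tmul s
  have hκi : ∀ j i, (κ j).1 i ∈ 𝒜 (g j - (d - e i)) := fun j i => hκ j i trivial
  have hψ : ∀ j, ∑ i, (κ j).1 i * a i = 0 := fun j => (κ j).2
  -- Comparing coordinates writes each x_i in terms of the y_j, with coefficients taken from the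
  -- kernel elements κ_j; that κ_j lies in ker ψ is the required relation among the coefficients.
  have hcoord : ∀ i, x i = ∑ j, twA 𝒜 (d - e i) ((κ j).1 i) • y j := fun i => by
    have h1 := congrArg (freeMod.tensorCoord 𝒜 (fun i => d - e i) M i) hs
    rw [map_sum, Finset.sum_eq_single i] at h1
    · rw [freeMod.tensorCoord_mk] at h1
      have h2 : (show Fin n → A from (freeMod.basis i : freeMod 𝒜 fun i => d - e i)) i = 1 :=
        Pi.single_eq_same i 1
      rw [h2, map_one, one_smul] at h1
      rw [← h1]
      refine (map_sum (freeMod.tensorCoord 𝒜 (fun i => d - e i) M i ∘ₗ tensorMap ψ.kerIncl M ∘ₗ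
        Submodule.mkQ (tensorRel ψ.ker M)) (fun j => κ j ⊗ₜ[k] y j) Finset.univ).trans ?_
      rfl
    · intro j _ hj
      rw [freeMod.tensorCoord_mk]
      have h2 : (show Fin n → A from (freeMod.basis j : freeMod 𝒜 fun i => d - e i)) i = 0 :=
        Pi.single_eq_of_ne hj.symm 1
      rw [h2, map_zero, zero_smul]
    · simp
  -- Summands of total degree other than d are discarded. Projecting x_i to its degree e_i shows
  -- that they contribute nothing, and the remaining coefficients have the right degrees.
  refine ⟨m, f, y, fun i j => if g j + f j = d then twA 𝒜 (d - e i) ((κ j).1 i) else 0, hy,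
    fun i j => ?_, fun i => ?_, fun j => ?_⟩
  · dsimp only
    split_ifs with hj
    · have := twA_mem (d - e i) (hκi j i)
      rwa [show g j - (d - e i) = e i - f j by lia] at this
    · exact zero_mem _
  · have h1 := congrArg (component M.isInternal (e i)) (hcoord i)
    rw [component_of_mem M.isInternal (hx i), if_pos rfl, map_sum] at h1
    rw [h1]
    refine Finset.sum_congr rfl fun j _ => ?_
    rw [component_of_mem M.isInternal (M.smul_mem (twA_mem (d - e i) (hκi j i)) (hy j))]
    dsimp only
    by_cases hj : g j + f j = d
    · rw [if_pos hj, if_pos (by lia)]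
    · rw [if_neg hj, if_neg (by lia), zero_smul]
  · dsimp only
    split_ifs with hj
    · rw [← hψ j]
      refine Finset.sum_congr rfl fun i _ => ?_
      rw [mul_eq_twA_mul (ha i), twA_self]
    · simp

end SHLR
end

noncomputable section
namespace SHLR

variable {k A : Type u} [Field k] [Ring A] [Algebra k A] {𝒜 : ℤ → Submodule k A}
  [GradedAlgebra 𝒜] [IsGradedComm 𝒜]

/-! ### Flat modules are directed colimits of finite modules -/

open CategoryTheory

/-- A finite free module over `M`, given by a finite family of homogeneous elements of `M`. -/
structure FreeOver (M : GMod 𝒜) where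
  n : ℕ
  e : Fin n → ℤ
  y : Fin n → M
  mem : ∀ i, y i ∈ M.gr (e i)

namespace FreeOver

variable {M : GMod 𝒜}

/-- The underlying free module. -/
def obj (X : FreeOver M) : GMod 𝒜 := freeMod 𝒜 X.e

/-- The structure map to `M`. -/
def π (X : FreeOver M) : GHom X.obj M := freeMod.desc X.y X.mem

/-- The generators. -/
def basis (X : FreeOver M) (i : Fin X.n) : X.obj := freeMod.basis i

lemma basis_mem (X : FreeOver M) (i : Fin X.n) : X.basis i ∈ X.obj.gr (X.e i) :=
  freeMod.basis_mem i

lemma π_basis (X : FreeOver M) (i : Fin X.n) : X.π (X.basis i) = X.y i :=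
  freeMod.desc_basis _ X.mem i

/-- Morphisms over `M`. -/
@[ext] structure Hom (X Y : FreeOver M) where
  toHom : GHom X.obj Y.obj
  π_apply : ∀ x, Y.π (toHom x) = X.π x

instance : SmallCategory (FreeOver M) where
  Hom := Hom
  id X := ⟨GHom.id _, fun _ => rfl⟩
  comp f g := ⟨g.toHom.comp f.toHom, fun x => (g.π_apply _).trans (f.π_apply x)⟩

/-- The morphism of free modules underlying an arrow. -/
def map {X Y : FreeOver M} (w : X ⟶ Y) : GHom X.obj Y.obj := Hom.toHom w

lemma π_map {X Y : FreeOver M} (w : X ⟶ Y) (x : X.obj) : Y.π (map w x) = X.π x := Hom.π_apply w x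

lemma map_comp {X Y Z : FreeOver M} (v : X ⟶ Y) (w : Y ⟶ Z) (x : X.obj) :
    map (v ≫ w) x = map w (map v x) := rfl

/-- The arrow with prescribed values on generators. -/
def desc {X Y : FreeOver M} (z : Fin X.n → Y.obj) (hz : ∀ i, z i ∈ Y.obj.gr (X.e i))
    (h : ∀ i, Y.π (z i) = X.y i) : X ⟶ Y where
  toHom := freeMod.desc z hz
  π_apply := fun x => by
    refine freeMod.ext_apply (f := Y.π.comp (freeMod.desc z hz)) (g := X.π) (fun i => ?_) x
    refine (congrArg Y.π (freeMod.desc_basis z hz i)).trans ((h i).trans (X.π_basis i).symm)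

lemma map_desc_apply {X Y : FreeOver M} (z : Fin X.n → Y.obj) (hz : ∀ i, z i ∈ Y.obj.gr (X.e i))
    (h : ∀ i, Y.π (z i) = X.y i) (x : X.obj) :
    map (desc z hz h) x = ∑ i, (show Fin X.n → A from x) i • z i := rfl

/-- The equational criterion read as a morphism over M: the matrix `b` maps the old generators to
combinations of the new ones and kills the given relation. -/
lemma exists_map_eq_zero_of_mem (hM : M.Flat) (X : FreeOver M) {d : ℤ} (x : X.obj)
    (hx : x ∈ X.obj.gr d) (h : X.π x = 0) : ∃ (Y : FreeOver M) (w : X ⟶ Y), map w x = 0 := by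
  obtain ⟨m, f, y, b, hy, hb, hxy, hab⟩ := hM.exists_eq_sum X.e d X.y X.mem
    (show Fin X.n → A from x) (fun i => hx i trivial) h
  refine ⟨⟨m, f, y, hy⟩, desc (fun i => b i) (fun i j _ => hb i j) (fun i => (hxy i).symm), ?_⟩
  refine (map_desc_apply _ _ _ x).trans (funext fun j => Eq.trans ?_ (hab j))
  exact Finset.sum_apply j _ _

lemma exists_map_eq_zero_finset (hM : M.Flat) (X : FreeOver M) {J : Type*} (s : Finset J)
    (d : J → ℤ) (x : J → X.obj) (hx : ∀ j, x j ∈ X.obj.gr (d j)) (h : ∀ j, X.π (x j) = 0) :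
    ∃ (Y : FreeOver M) (w : X ⟶ Y), ∀ j ∈ s, map w (x j) = 0 := by
  classical
  induction s using Finset.induction_on with
  | empty => exact ⟨X, 𝟙 X, by simp⟩
  | insert j s _ ih =>
    obtain ⟨Y, v, hv⟩ := ih
    obtain ⟨Z, w, hw⟩ := exists_map_eq_zero_of_mem hM Y (map v (x j)) ((map v).map_mem (hx j))
      (by rw [π_map, h])
    refine ⟨Z, v ≫ w, fun i hi => ?_⟩
    rw [map_comp]
    rcases Finset.mem_insert.1 hi with rfl | hi
    · exact hw
    · rw [hv i hi, map_zero]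

lemma exists_map_eq_zero (hM : M.Flat) (X : FreeOver M) (x : X.obj) (h : X.π x = 0) :
    ∃ (Y : FreeOver M) (w : X ⟶ Y), map w x = 0 := by
  obtain ⟨s, hs⟩ := exists_sum_component X.obj.isInternal x
  obtain ⟨Y, w, hw⟩ := exists_map_eq_zero_finset hM X s id
    (fun p => component X.obj.isInternal p x) (fun p => component_mem _ p x)
    (fun p => by rw [X.π.component p x, h, map_zero])
  refine ⟨Y, w, ?_⟩
  rw [← hs s subset_rfl, map_sum]
  exact Finset.sum_eq_zero hw

lemma exists_π_eq (m : M) : ∃ (X : FreeOver M) (x : X.obj), X.π x = m := by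
  obtain ⟨s, hs⟩ := exists_sum_component M.isInternal m
  let ε := s.equivFin
  let X : FreeOver M := ⟨s.card, fun i => (ε.symm i).1,
    fun i => component M.isInternal (ε.symm i).1 m, fun i => component_mem _ _ m⟩
  refine ⟨X, ∑ i, X.basis i, ?_⟩
  rw [map_sum, Finset.sum_congr rfl fun i _ => X.π_basis i]
  refine (Equiv.sum_comp ε.symm fun p : s => component M.isInternal p.1 m).trans ?_
  rw [Finset.sum_coe_sort s fun p => component M.isInternal p m, hs s subset_rfl]

/-- Concatenating families gives upper bounds. Two parallel arrows differ on generators by finitely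
many homogeneous elements mapping to zero in M, and these can be killed further on. -/
lemma isFiltered (hM : M.Flat) : IsFiltered (FreeOver M) where
  cocone_objs X Y := by
    let Z : FreeOver M := ⟨X.n + Y.n, Fin.append X.e Y.e, Fin.append X.y Y.y,
      fun i => by induction i using Fin.addCases <;> simp [X.mem, Y.mem]⟩
    refine ⟨Z, desc (fun i => Z.basis (Fin.castAdd Y.n i)) (fun i => ?_) (fun i => ?_),
      desc (fun i => Z.basis (Fin.natAdd X.n i)) (fun i => ?_) (fun i => ?_), trivial⟩
    · exact Fin.append_left X.e Y.e i ▸ Z.basis_mem (Fin.castAdd Y.n i)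
    · simpa [Z] using Z.π_basis (Fin.castAdd Y.n i)
    · exact Fin.append_right X.e Y.e i ▸ Z.basis_mem (Fin.natAdd X.n i)
    · simpa [Z] using Z.π_basis (Fin.natAdd X.n i)
  cocone_maps X Y v w := by
    obtain ⟨Z, t, ht⟩ := exists_map_eq_zero_finset hM Y Finset.univ X.e
      (fun i => map v (X.basis i) - map w (X.basis i))
      (fun i => sub_mem ((map v).map_mem (X.basis_mem i)) ((map w).map_mem (X.basis_mem i)))
      (fun i => by rw [map_sub, sub_eq_zero, π_map, π_map])
    refine ⟨Z, t, Hom.ext (GHom.ext fun x => ?_)⟩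
    refine freeMod.ext_apply (f := (map (v ≫ t))) (g := map (w ≫ t)) (fun i => ?_) x
    have := ht i (Finset.mem_univ i)
    rwa [map_sub, sub_eq_zero] at this
  nonempty := ⟨⟨0, Fin.elim0, Fin.elim0, fun i => i.elim0⟩⟩

end FreeOver

/-- Flat graded modules are directed colimits of finite modules. -/
theorem GMod.Flat.nonempty_presentation {M : GMod 𝒜} (hM : M.Flat) : Nonempty (Presentation M) := by
  have := FreeOver.isFiltered hM
  -- A small filtered category admits a final functor from a directed poset, so the colimit may be
  -- taken over the latter.
  obtain ⟨α, _, _, _, D, _⟩ := IsFiltered.exists_directed (FreeOver M)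
  have : IsDirectedOrder α := ‹_›
  have hD := (Functor.final_iff_of_isFiltered D).1 inferInstance
  refine ⟨{
    ι := α
    F := fun i => (D.obj i).obj
    finite := fun i => freeMod_isFinite
    t := fun h => FreeOver.map (D.map (homOfLE h))
    t_refl := fun i x => ?_
    t_comp := fun hij hjl x => ?_
    incl := fun i => (D.obj i).π
    incl_t := fun h x => FreeOver.π_map _ x
    incl_surj := fun m => ?_
    incl_eq_zero := fun i x hx => ?_ }⟩
  · exact congrArg (fun u => FreeOver.map u x) (D.map_id i)
  · rw [← FreeOver.map_comp, ← D.map_comp, homOfLE_comp]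
  · obtain ⟨X, x, rfl⟩ := FreeOver.exists_π_eq m
    obtain ⟨i, ⟨w⟩⟩ := hD.1 X
    exact ⟨i, FreeOver.map w x, FreeOver.π_map w x⟩
  · obtain ⟨Y, v, hv⟩ := FreeOver.exists_map_eq_zero hM _ x hx
    obtain ⟨j, ⟨w⟩⟩ := hD.1 Y
    obtain ⟨l, hil, hjl⟩ := exists_ge_ge i j
    -- The arrow killing `x` is not itself a transition map of the system. Finality makes it equal
    -- to one after going further along the poset.
    obtain ⟨m, t, ht⟩ := hD.2 (D.map (homOfLE hil)) ((v ≫ w) ≫ D.map (homOfLE hjl))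
    refine ⟨m, hil.trans (leOfHom t), ?_⟩
    have h1 := congrArg (fun u => FreeOver.map u x) ht
    simp only [FreeOver.map_comp, hv, map_zero] at h1
    rw [← h1, ← FreeOver.map_comp, ← D.map_comp]
    rfl

end SHLR
end

theorem mainTheorem2 {k A : Type u} [Field k] [CharZero k] [Ring A] [Algebra k A]
    (𝒜 : ℤ → Submodule k A) [GradedAlgebra 𝒜] [SHLR.IsGradedComm 𝒜]
    (hA : SHLR.IsNonpositivelyGraded 𝒜)
    (M N : SHLR.GMod 𝒜) (hM : M.Flat) (hN : N.Flat) (f : SHLR.GHom M N) :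
    Nonempty (SHLR.Presentation M) ∧ Nonempty (SHLR.Presentation N) ∧
    ∀ (PM : SHLR.Presentation M) (PN : SHLR.Presentation N),
      (∃ Φ : SHLR.MultiDer f ≃ SHLR.NonnegDer PM PN f,
        ∀ (X : SHLR.MultiDer f) (D : SHLR.NonnegDer PM PN f),
          Φ X = D ↔ SHLR.Dual PM PN f X D) ∧
      (∀ (X : SHLR.MultiDer (SHLR.GHom.id M)) (D : SHLR.NonnegDer PM PM (SHLR.GHom.id M)),
        SHLR.Dual PM PM (SHLR.GHom.id M) X D →
          (SHLR.SquareZero X ↔ D.toProHom.comp D.toProHom = 0)) ∧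
      (∀ (P : SHLR.GMod 𝒜) (_ : P.Flat) (PP : SHLR.Presentation P) (g : SHLR.GHom N P)
        (X : SHLR.MultiDer f) (Y : SHLR.MultiDer g)
        (D : SHLR.NonnegDer PM PN f) (E : SHLR.NonnegDer PN PP g),
        SHLR.Dual PM PN f X D → SHLR.Dual PN PP g Y E → SHLR.Intertwined Y X →
          (SHLR.CompEqZero Y X ↔ D.toProHom.comp E.toProHom = 0)) := by
  refine ⟨hM.nonempty_presentation, hN.nonempty_presentation, fun PM PN =>
    ⟨SHLR.exists_dual_equiv PM PN f, fun X D HX => ?_, fun P _ PP g X Y D E HX HY hYX => ?_⟩⟩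
  -- Over the identity the intertwining condition is empty, so the statement on squares is an
  -- instance of the one on composites.
  · have hX : SHLR.Intertwined X X := fun l => ⟨fun _ => rfl, fun _ => rfl⟩
    exact ⟨SHLR.comp_eq_zero_of_compEqZero HX HX hX, SHLR.compEqZero_of_comp_eq_zero HX HX hX⟩
  · exact ⟨SHLR.comp_eq_zero_of_compEqZero HX HY hYX, SHLR.compEqZero_of_comp_eq_zero HX HY hYX⟩
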